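/- Let $p\ge q\ge 1$, let $\mathrm O(p,q)$ be the isometry group of $(w,w')_{p,q}=\sum_{j=1}^p x_jx_j'-\sum_{j=1}^q y_jy_j'$ on $\mathbb R^{p+q}=\mathbb R^p\oplus\mathbb R^q$, $w=(x,y)$, $w'=(x',y')$, and let $X^0=\{w\neq 0:(w,w)_{p,q}=0\}$ be the light cone. For $a\in\mathbb C$ let $S^a(X^0)$ be the space of smooth functions $f:X^0\to\mathbb C$ with $f(tw)=t^af(w)$ for all $t>0$, with its $C^\infty$ topology and the action $(\rho(g)f)(w)=f(g^{-1}w)$ of $\mathrm O(p,q)$. A constituent of $S^a(X^0)$ is a subquotient $V_1/V_0$, where $V_0\subsetneq V_1$ are closed invariant subspaces such that no closed invariant subspace lies strictly between them. A subquotient is Hermitian if it carries a nonzero continuous $\mathrm O(p,q)$-invariant Hermitian form, and unitary if it carries a positive definite one. The unitary axis is the line $\operatorname{Re}a=-\frac{p+q}2+1$. 1. If $S^a(X^0)$ has a Hermitian constituent, then $a$ is on the unitary axis or $a$ is real. 2. If $a$ is on the unitary axis, then $S^a(X^0)$ is unitary. 3. If $a$ is real, then every constituent of $S^a(X^0)$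 is Hermitian. More precisely, let $\mathcal H^m(\mathbb R^p)$ be the space of harmonic homogeneous polynomials of degree $m$ with complex coefficients, and let the $K$-type $(m,n)$ be the span in $S^a(X^0)$ of the functions $h_1(x)h_2(y)|x|^{a-m-n}$ with $h_1\in\mathcal H^m(\mathbb R^p)$, $h_2\in\mathcal H^n(\mathbb R^q)$. Say that $(m,n)$ occurs in $V_1/V_0$ if this span is contained in $V_1$ but not in $V_0$. Put $\langle f,h\rangle=\int_{\mathbb S^{p-1}\times\mathbb S^{q-1}}f\,\overline h$, the integral being with respect to the rotation-invariant probability measure, and $$A^{++}(m,n)=a-m-n,\qquad A^{+-}(m,n)=a-m+n+q-2,$$ $$A^{-+}(m,n)=a+m-n+p-2,\qquad A^{--}(m,n)=a+m+n+p+q-4.$$ Then every constituent $V_1/V_0$ carries a nondegenerate continuous invariant Hermitian form for which distinct $K$-types are orthogonal and which on each $K$-type $(m,n)$ that occurs in $V_1/V_0$ equals $c_{m,n}\langle\cdot,\cdot\rangle$, where the $c_{m,n}$ are nonzero real numbers such that $$A^{++}(m,n)\,c_{m+1,n+1}+\overline{A^{--}(m+1,n+1)}\,c_{m,n}=0,$$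 $$A^{+-}(m,n)\,c_{m+1,n-1}+\overline{A^{-+}(m+1,n-1)}\,c_{m,n}=0,$$ each equation being required whenever both $K$-types in it occur in $V_1/V_0$. -/

import Mathlib

open scoped ContDiff ComplexConjugate

noncomputable section

namespace LightCone

/-- The space `ℝ^{p+q} = ℝ^p ⊕ ℝ^q` of pairs `w = (x, y)`. -/
abbrev Amb (p q : ℕ) : Type := EuclideanSpace ℝ (Fin p) × EuclideanSpace ℝ (Fin q)

/-- The indefinite inner product `(w, w')_{p,q} = (x, x')_p - (y, y')_q`. -/
def bil {p q : ℕ} (w w' : Amb p q) : ℝ := inner ℝ w.1 w'.1 - inner ℝ w.2 w'.2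

/-- The group `O(p,q)` of linear automorphisms of `ℝ^{p+q}` preserving `(·,·)_{p,q}`. -/
def indefOrthogonal (p q : ℕ) : Subgroup (Amb p q ≃L[ℝ] Amb p q) where
  carrier := {g | ∀ w w', bil (g w) (g w') = bil w w'}
  one_mem' := fun _ _ => rfl
  mul_mem' := by
    intro g h hg hh w w'
    change bil (g (h w)) (g (h w')) = _
    rw [hg, hh]
  inv_mem' := by
    intro g hg w w'
    have h := hg (g⁻¹ w) (g⁻¹ w')
    have e : ∀ v, g (g⁻¹ v) = v := fun v => g.apply_symm_apply v
    rw [e, e] at h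
    exact h.symm

/-- The light cone `X⁰ = {w ≠ 0 | (w, w)_{p,q} = 0}`. -/
def cone (p q : ℕ) : Set (Amb p q) := {w | w ≠ 0 ∧ bil w w = 0}

theorem mem_cone_iff {p q : ℕ} {w : Amb p q} :
    w ∈ cone p q ↔ w.1 ≠ 0 ∧ w.2 ≠ 0 ∧ ‖w.1‖ = ‖w.2‖ := by
  obtain ⟨x, y⟩ := w
  simp only [cone, bil, Set.mem_ofPred_eq, real_inner_self_eq_norm_sq, ne_eq, Prod.mk_eq_zero]
  constructor
  · rintro ⟨h0, h⟩
    have h1 : ‖x‖ = ‖y‖ :=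
      (sq_eq_sq₀ (norm_nonneg _) (norm_nonneg _)).1 (by linarith)
    refine ⟨fun hx => h0 ⟨hx, ?_⟩, fun hy => h0 ⟨?_, hy⟩, h1⟩
    · rw [hx, norm_zero] at h1
      exact norm_eq_zero.1 h1.symm
    · rw [hy, norm_zero] at h1
      exact norm_eq_zero.1 h1
  · rintro ⟨hx, _, h⟩
    exact ⟨fun h' => hx h'.1, by rw [h]; ring⟩

/-- The action of `O(p,q)` on the light cone. -/
def coneAct {p q : ℕ} (g : indefOrthogonal p q) (w : cone p q) : cone p q :=
  ⟨g.1 w.1, by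
    refine ⟨fun h => w.2.1 ?_, ?_⟩
    · exact (map_eq_zero_iff g.1 g.1.injective).1 h
    · rw [g.2]
      exact w.2.2⟩

/-- A function on the cone is smooth if it is the restriction of a function that is smooth on an
open neighbourhood of the cone in `ℝ^{p+q}`. -/
def IsSmooth {p q : ℕ} (f : cone p q → ℂ) : Prop :=
  ∃ (U : Set (Amb p q)) (F : Amb p q → ℂ), IsOpen U ∧ cone p q ⊆ U ∧ ContDiffOn ℝ ∞ F U ∧
    ∀ w : cone p q, F w = f w

/-- `f (t w) = t ^ a f (w)` for all `w` in the cone and all `t > 0`. -/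
def IsHomogeneous {p q : ℕ} (a : ℂ) (f : cone p q → ℂ) : Prop :=
  ∀ (t : ℝ) (w w' : cone p q), 0 < t → (w' : Amb p q) = t • (w : Amb p q) →
    f w' = (t : ℂ) ^ a * f w

/-- The smooth homogeneous functions of degree `a`, as a subspace of all functions. -/
def homSubmodule (p q : ℕ) (a : ℂ) : Submodule ℂ (cone p q → ℂ) where
  carrier := {f | IsSmooth f ∧ IsHomogeneous a f}
  zero_mem' := ⟨⟨Set.univ, 0, isOpen_univ, Set.subset_univ _, contDiffOn_const, fun _ => rfl⟩,
    fun t w w' _ _ => by simp⟩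
  add_mem' := by
    rintro f h ⟨⟨U, F, hU, hXU, hF, hFf⟩, hf⟩ ⟨⟨U', F', hU', hXU', hF', hFf'⟩, hh⟩
    refine ⟨⟨U ∩ U', fun w => F w + F' w, hU.inter hU', Set.subset_inter hXU hXU',
      (hF.mono Set.inter_subset_left).add (hF'.mono Set.inter_subset_right),
      fun w => by simp [hFf, hFf']⟩, fun t w w' ht hw => ?_⟩
    simp only [Pi.add_apply, hf t w w' ht hw, hh t w w' ht hw, mul_add]
  smul_mem' := by
    rintro c f ⟨⟨U, F, hU, hXU, hF, hFf⟩, hf⟩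
    refine ⟨⟨U, fun w => c * F w, hU, hXU, contDiffOn_const.mul hF,
      fun w => by simp [hFf]⟩, fun t w w' ht hw => ?_⟩
    simp only [Pi.smul_apply, smul_eq_mul, hf t w w' ht hw]
    ring

/-- The space `S^a(X⁰)` of smooth functions on the light cone that are homogeneous of degree `a`
under positive dilations. -/
def S (p q : ℕ) (a : ℂ) : Type := homSubmodule p q a

instance (p q : ℕ) (a : ℂ) : AddCommGroup (S p q a) :=
  inferInstanceAs (AddCommGroup (homSubmodule p q a))

instance (p q : ℕ) (a : ℂ) : Module ℂ (S p q a) :=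
  inferInstanceAs (Module ℂ (homSubmodule p q a))

/-- An element of `S^a(X⁰)` as a function on the cone. -/
def S.toFun {p q : ℕ} {a : ℂ} (f : S p q a) : cone p q → ℂ := f.1

/-- The smooth retraction `(x, y) ↦ (x, ‖x‖ y / ‖y‖)` of the open set `{x ≠ 0, y ≠ 0}` onto the
light cone. -/
def retraction {p q : ℕ} (w : Amb p q) : Amb p q := (w.1, (‖w.1‖ / ‖w.2‖) • w.2)

/-- The pullback of a function on the cone along the retraction. For a smooth function on the
cone it is smooth on the open set `{x ≠ 0, y ≠ 0}` (the values elsewhere are never used). -/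
def pullback {p q : ℕ} (f : cone p q → ℂ) (w : Amb p q) : ℂ :=
  Function.extend ((↑) : cone p q → Amb p q) f 0 (retraction w)

/-- The product of unit spheres `𝕊^{p-1} × 𝕊^{q-1}`, a compact subset of the cone that meets
every ray of the cone once. -/
abbrev Spheres (p q : ℕ) : Type :=
  Metric.sphere (0 : EuclideanSpace ℝ (Fin p)) 1 × Metric.sphere (0 : EuclideanSpace ℝ (Fin q)) 1

theorem spheres_mem_cone {p q : ℕ} (z : Spheres p q) :
    ((z.1 : EuclideanSpace ℝ (Fin p)), (z.2 : EuclideanSpace ℝ (Fin q))) ∈ cone p q := by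
  have h1 : ‖(z.1 : EuclideanSpace ℝ (Fin p))‖ = 1 := by simp
  have h2 : ‖(z.2 : EuclideanSpace ℝ (Fin q))‖ = 1 := by simp
  refine mem_cone_iff.2 ⟨fun h => ?_, fun h => ?_, h1.trans h2.symm⟩
  · simp only at h
    rw [h, norm_zero] at h1
    exact zero_ne_one h1
  · simp only at h
    rw [h, norm_zero] at h2
    exact zero_ne_one h2

/-- The inclusion of `𝕊^{p-1} × 𝕊^{q-1}` into the cone. -/
def sphereIncl {p q : ℕ} (z : Spheres p q) : cone p q := ⟨(z.1.1, z.2.1), spheres_mem_cone z⟩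

/-- The `C^∞` topology on `S^a(X⁰)`: uniform convergence of the derivatives of every order (of the
pullbacks to an open neighbourhood of the cone) on `𝕊^{p-1} × 𝕊^{q-1}`. By homogeneity this is the
same as uniform convergence of all derivatives on all compact subsets of the cone. -/
instance (p q : ℕ) (a : ℂ) : TopologicalSpace (S p q a) :=
  TopologicalSpace.induced
    (fun (f : S p q a) (k : ℕ) => UniformFun.ofFun (fun z : Spheres p q =>
      iteratedFDeriv ℝ k (pullback f.toFun) (sphereIncl z : Amb p q)))
    inferInstance

/-- The representation `(ρ(g) f)(w) = f (g⁻¹ w)` of `O(p,q)` on `S^a(X⁰)`. -/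
def rho (p q : ℕ) (a : ℂ) : Representation ℂ (indefOrthogonal p q) (S p q a) where
  toFun g :=
    { toFun := fun f => ⟨fun w => f.toFun (coneAct g⁻¹ w), by
        obtain ⟨f, ⟨U, F, hU, hXU, hF, hFf⟩, hf⟩ := f
        refine ⟨⟨(g⁻¹).1 ⁻¹' U, fun w => F ((g⁻¹).1 w), hU.preimage (g⁻¹).1.continuous,
          fun w hw => hXU (coneAct g⁻¹ ⟨w, hw⟩).2,
          hF.comp (g⁻¹).1.contDiff.contDiffOn (fun w hw => hw),
          fun w => hFf (coneAct g⁻¹ w)⟩, fun t w w' ht hw => ?_⟩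
        refine hf t (coneAct g⁻¹ w) (coneAct g⁻¹ w') ht ?_
        change (g⁻¹).1 w'.1 = t • (g⁻¹).1 w.1
        rw [hw, map_smul]⟩
      map_add' := fun _ _ => rfl
      map_smul' := fun _ _ => rfl }
  map_one' := by
    ext f
    refine Subtype.ext (funext fun w => ?_)
    change f.toFun (coneAct (1 : indefOrthogonal p q)⁻¹ w) = f.toFun w
    rw [inv_one]
    rfl
  map_mul' g h := by
    ext f
    refine Subtype.ext (funext fun w => ?_)
    change f.toFun (coneAct (g * h)⁻¹ w) = f.toFun (coneAct h⁻¹ (coneAct g⁻¹ w))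
    rw [mul_inv_rev]
    rfl

section Constituents

variable {p q : ℕ} {a : ℂ}

/-- A closed `O(p,q)`-invariant subspace of `S^a(X⁰)`. -/
def IsClosedInvariant (W : Submodule ℂ (S p q a)) : Prop :=
  IsClosed (W : Set (S p q a)) ∧ ∀ (g : indefOrthogonal p q), ∀ f ∈ W, rho p q a g f ∈ W

/-- `V₁ / V₀` is a constituent of `S^a(X⁰)`: an irreducible subquotient. Here `V₀ ⊂ V₁` are closed
invariant subspaces, and the quotient is nonzero and has no closed invariant subspaces other than
zero and itself. -/
def IsConstituent (V₀ V₁ : Submodule ℂ (S p q a)) : Prop :=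
  IsClosedInvariant V₀ ∧ IsClosedInvariant V₁ ∧ V₀ < V₁ ∧
    ∀ W : Submodule ℂ (S p q a), IsClosedInvariant W → V₀ ≤ W → W ≤ V₁ → W = V₀ ∨ W = V₁

/-- `B` is an invariant (continuous) Hermitian form on the subquotient `V₁ / V₀`, given as a form
on `V₁` that vanishes on `V₀`. It is linear in the first variable. -/
structure IsInvariantHermitianForm (V₀ V₁ : Submodule ℂ (S p q a))
    (B : V₁ →ₗ[ℂ] V₁ →ₗ⋆[ℂ] ℂ) : Prop where
  descends : ∀ f h : V₁, (f : S p q a) ∈ V₀ → B f h = 0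
  hermitian : ∀ f h : V₁, B h f = conj (B f h)
  continuous : Continuous fun x : V₁ × V₁ => B x.1 x.2
  invariant : ∀ (g : indefOrthogonal p q) (f h f' h' : V₁),
    (f' : S p q a) = rho p q a g f → (h' : S p q a) = rho p q a g h → B f' h' = B f h

/-- The subquotient `V₁ / V₀` is Hermitian: it carries a nonzero invariant Hermitian form. -/
def IsHermitian (V₀ V₁ : Submodule ℂ (S p q a)) : Prop :=
  ∃ B : V₁ →ₗ[ℂ] V₁ →ₗ⋆[ℂ] ℂ, IsInvariantHermitianForm V₀ V₁ B ∧ B ≠ 0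

/-- The subquotient `V₁ / V₀` is unitary: it carries a positive definite invariant Hermitian
form. -/
def IsUnitary (V₀ V₁ : Submodule ℂ (S p q a)) : Prop :=
  ∃ B : V₁ →ₗ[ℂ] V₁ →ₗ⋆[ℂ] ℂ, IsInvariantHermitianForm V₀ V₁ B ∧
    ∀ f : V₁, (f : S p q a) ∉ V₀ → 0 < (B f f).re

end Constituents

/-- The unitary axis `Re a = -(p+q)/2 + 1`. -/
def OnUnitaryAxis (p q : ℕ) (a : ℂ) : Prop := a.re = -((p + q : ℝ) / 2) + 1

section KTypes

/-- The space `ℋ^m(ℝ^p)` of harmonic polynomials, homogeneous of degree `m`, with complex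
coefficients. -/
def IsHarmonic (p m : ℕ) (P : MvPolynomial (Fin p) ℂ) : Prop :=
  P.IsHomogeneous m ∧ ∑ i, MvPolynomial.pderiv i (MvPolynomial.pderiv i P) = 0

/-- The value of a polynomial with complex coefficients at a real vector. -/
def polyVal {p : ℕ} (P : MvPolynomial (Fin p) ℂ) (x : EuclideanSpace ℝ (Fin p)) : ℂ :=
  MvPolynomial.eval (fun i => (x i : ℂ)) P

/-- The function `j_a(h₁ ⊗ h₂)(x, y) = h₁(x) h₂(y) r_p²(x)^b` on the cone, where
`m + n + 2 b = a`; that is, `r_p²(x)^b = ‖x‖ ^ (a - m - n)`. -/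
def jFun {p q : ℕ} (a : ℂ) (m n : ℕ) (h₁ : MvPolynomial (Fin p) ℂ) (h₂ : MvPolynomial (Fin q) ℂ)
    (w : cone p q) : ℂ :=
  polyVal h₁ (w : Amb p q).1 * polyVal h₂ (w : Amb p q).2 *
    ((‖(w : Amb p q).1‖ : ℝ) : ℂ) ^ (a - m - n)

theorem contDiff_polyVal {p : ℕ} (P : MvPolynomial (Fin p) ℂ) : ContDiff ℝ ∞ (polyVal P) := by
  unfold polyVal
  induction P using MvPolynomial.induction_on with
  | C c => simpa using contDiff_const
  | add P Q hP hQ => simpa using hP.add hQ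
  | mul_X P i hP =>
    have hi : ContDiff ℝ ∞ (fun x : EuclideanSpace ℝ (Fin p) => ((x i : ℝ) : ℂ)) :=
      Complex.ofRealCLM.contDiff.comp (EuclideanSpace.proj (𝕜 := ℝ) i).contDiff
    simpa using hP.mul hi

theorem polyVal_smul {p m : ℕ} {P : MvPolynomial (Fin p) ℂ} (hP : P.IsHomogeneous m) (t : ℝ)
    (x : EuclideanSpace ℝ (Fin p)) : polyVal P (t • x) = (t : ℂ) ^ m * polyVal P x := by
  unfold polyVal
  have h : (fun i => (((t • x) i : ℝ) : ℂ)) = (t : ℂ) • fun i => ((x i : ℝ) : ℂ) := by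
    funext i
    simp
  rw [h]
  simp only [MvPolynomial.eval_eq, Finset.mul_sum]
  refine Finset.sum_congr rfl fun d hd => ?_
  have hdeg : ∑ i, d i = m := by
    have := hP (MvPolynomial.mem_support_iff.1 hd)
    simpa [Finsupp.weight_apply, Finsupp.sum_fintype] using this
  have : (∏ i ∈ d.support, ((t : ℂ) • fun i => ((x i : ℝ) : ℂ)) i ^ d i)
      = (t : ℂ) ^ m * ∏ i ∈ d.support, ((x i : ℝ) : ℂ) ^ d i := by
    simp only [Pi.smul_apply, smul_eq_mul, mul_pow, Finset.prod_mul_distrib]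
    congr 1
    rw [Finset.prod_pow_eq_pow_sum]
    congr 1
    rw [← hdeg]
    exact Finset.sum_subset (Finset.subset_univ _) fun i _ hi => by simpa using hi
  rw [this]
  ring

theorem jFun_mem {p q : ℕ} (a : ℂ) {m n : ℕ} {h₁ : MvPolynomial (Fin p) ℂ}
    {h₂ : MvPolynomial (Fin q) ℂ} (H₁ : IsHarmonic p m h₁) (H₂ : IsHarmonic q n h₂) :
    jFun a m n h₁ h₂ ∈ homSubmodule p q a := by
  constructor
  · refine ⟨{w | w.1 ≠ 0}, fun w => polyVal h₁ w.1 * polyVal h₂ w.2 *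
      Complex.exp ((Real.log ‖w.1‖ : ℝ) * (a - m - n)),
      isOpen_ne.preimage continuous_fst, fun w hw => (mem_cone_iff.1 hw).1, ?_, fun w => ?_⟩
    · refine ContDiffOn.mul ?_ ?_
      · exact (((contDiff_polyVal h₁).comp contDiff_fst).mul
          ((contDiff_polyVal h₂).comp contDiff_snd)).contDiffOn
      · refine ContDiffOn.cexp (ContDiffOn.mul ?_ contDiffOn_const)
        refine Complex.ofRealCLM.contDiff.comp_contDiffOn (ContDiffOn.log ?_ ?_)
        · exact ContDiffOn.norm ℝ contDiff_fst.contDiffOn fun w hw => hw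
        · exact fun w hw => norm_ne_zero_iff.2 hw
    · have h : ‖(w : Amb p q).1‖ ≠ 0 := norm_ne_zero_iff.2 (mem_cone_iff.1 w.2).1
      simp only [jFun]
      rw [Complex.cpow_def_of_ne_zero (by exact_mod_cast h), Complex.ofReal_log (norm_nonneg _)]
  · intro t w w' ht hw
    have hp : 0 < ‖(w : Amb p q).1‖ := norm_pos_iff.2 (mem_cone_iff.1 w.2).1
    have ht' : (t : ℂ) ≠ 0 := by exact_mod_cast ht.ne'
    simp only [jFun, hw, Prod.smul_fst, Prod.smul_snd, polyVal_smul H₁.1, polyVal_smul H₂.1,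
      norm_smul, Real.norm_eq_abs, abs_of_pos ht]
    rw [Complex.ofReal_mul, Complex.mul_cpow_ofReal_nonneg ht.le hp.le, Complex.cpow_sub _ _ ht',
      Complex.cpow_sub _ _ ht', Complex.cpow_natCast, Complex.cpow_natCast]
    field_simp

/-- The `K`-type `j_a(ℋ^m(ℝ^p) ⊗ ℋ^n(ℝ^q))` of `S^a(X⁰)`, for `K = O(p) × O(q)`. -/
def kType (p q : ℕ) (a : ℂ) (m n : ℕ) : Submodule ℂ (S p q a) :=
  Submodule.span ℂ {f | ∃ (h₁ : MvPolynomial (Fin p) ℂ) (h₂ : MvPolynomial (Fin q) ℂ)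
    (H₁ : IsHarmonic p m h₁) (H₂ : IsHarmonic q n h₂), f = ⟨jFun a m n h₁ h₂, jFun_mem a H₁ H₂⟩}

/-- The rotation-invariant probability measure on the unit sphere `𝕊^{p-1}`. -/
def sphereProb (p : ℕ) : MeasureTheory.Measure (Metric.sphere (0 : EuclideanSpace ℝ (Fin p)) 1) :=
  ((MeasureTheory.volume : MeasureTheory.Measure (EuclideanSpace ℝ (Fin p))).toSphere Set.univ)⁻¹ •
    (MeasureTheory.volume : MeasureTheory.Measure (EuclideanSpace ℝ (Fin p))).toSphere

/-- Integration over `𝕊^{p-1} × 𝕊^{q-1}` against the invariant probability measure. Since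
`j_a φ = φ` on `𝕊^{p-1} × 𝕊^{q-1}`, on every `K`-type this is the push-forward by `j_a` of the
inner product `⟨φ₁, φ₂⟩_{m,n} = ∫ φ₁ conj φ₂` on `ℋ^m(ℝ^p) ⊗ ℋ^n(ℝ^q)`. -/
def stdInner {p q : ℕ} {a : ℂ} (f h : S p q a) : ℂ :=
  ∫ z : Spheres p q, f.toFun (sphereIncl z) * conj (h.toFun (sphereIncl z))
    ∂((sphereProb p).prod (sphereProb q))

/-- The `K`-type `(m, n)` occurs in the subquotient `V₁ / V₀`. -/
def HasKType {p q : ℕ} {a : ℂ} (V₀ V₁ : Submodule ℂ (S p q a)) (m n : ℕ) : Prop :=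
  kType p q a m n ≤ V₁ ∧ ¬ kType p q a m n ≤ V₀

/-- The transition coefficient `A^{++}(m,n)`. -/
def App (a : ℂ) (m n : ℕ) : ℂ := a - m - n

/-- The transition coefficient `A^{+-}(m,n)`. -/
def Apm (q : ℕ) (a : ℂ) (m n : ℕ) : ℂ := a - m + n + q - 2

/-- The transition coefficient `A^{-+}(m,n)`. -/
def Amp (p : ℕ) (a : ℂ) (m n : ℕ) : ℂ := a + m - n + p - 2

/-- The transition coefficient `A^{--}(m,n)`. -/
def Amm (p q : ℕ) (a : ℂ) (m n : ℕ) : ℂ := a + m + n + p + q - 4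

/-- The constants `c_{m,n}` satisfy the recursion
`A^{++}(m,n) c_{m+1,n+1} + conj (A^{--}(m+1,n+1)) c_{m,n} = 0` and
`A^{+-}(m,n) c_{m+1,n-1} + conj (A^{-+}(m+1,n-1)) c_{m,n} = 0`
whenever both `K`-types involved occur in `V₁ / V₀`. -/
def SolvesRecursion {p q : ℕ} {a : ℂ} (V₀ V₁ : Submodule ℂ (S p q a)) (c : ℕ → ℕ → ℝ) : Prop :=
  (∀ m n, HasKType V₀ V₁ m n → HasKType V₀ V₁ (m + 1) (n + 1) →
    App a m n * c (m + 1) (n + 1) + conj (Amm p q a (m + 1) (n + 1)) * c m n = 0) ∧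
  (∀ m n, HasKType V₀ V₁ m (n + 1) → HasKType V₀ V₁ (m + 1) n →
    Apm q a m (n + 1) * c (m + 1) n + conj (Amp p a (m + 1) n) * c m (n + 1) = 0)

/-- The form `B` on `V₁ / V₀` is the one built from the constants `c_{m,n}`: distinct `K`-types are
orthogonal, and on the `K`-type `(m, n)` of `V₁ / V₀` it is `c_{m,n}` times the standard inner
product. -/
def IsBuiltFrom {p q : ℕ} {a : ℂ} (V₀ V₁ : Submodule ℂ (S p q a))
    (B : V₁ →ₗ[ℂ] V₁ →ₗ⋆[ℂ] ℂ) (c : ℕ → ℕ → ℝ) : Prop :=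
  (∀ m n m' n', (m, n) ≠ (m', n') → ∀ f h : V₁, (f : S p q a) ∈ kType p q a m n →
    (h : S p q a) ∈ kType p q a m' n' → B f h = 0) ∧
  (∀ m n, HasKType V₀ V₁ m n → ∀ f h : V₁, (f : S p q a) ∈ kType p q a m n →
    (h : S p q a) ∈ kType p q a m n → B f h = c m n * stdInner (f : S p q a) (h : S p q a))

end KTypes

end LightCone

end

open scoped ContDiff ComplexConjugate

noncomputable section

namespace LightCone

section

/-! ### Calculus of homogeneous functions on the cone -/

section Functions

variable {p q : ℕ} {a b c : ℂ}

/-! Restriction to 𝕊^{p-1} × 𝕊^{q-1} identifies elements of S^a with smooth functions on a compact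
manifold, on which K = O(p) × O(q) acts by rotations. All dependence on a sits in the boosts X_{jk},
the infinitesimal generators that mix x_j and y_k. With u = x_j y_k / |x|² and C the Laplacian of
the product of spheres, `D_boost_eq` reads X_{jk} f = ½[C, u] f + (a + (p+q-2)/2) u f. Since C is
scalar on every K-type, the part of X_{jk} from the K-type σ to the K-type τ is a number, `trans p q
a σ τ`, times the part of multiplication by u. Multiplication by u links only neighbouring K-types,
and for the four kinds of neighbours the number is one of the coefficients A^{±±}.

Two bridges lead from this algebra to closed subspaces and to the group. First, a closed K-stable
subspace is determined by the K-types it contains (`typeSpan_typesOf`). This rests on Schur's lemma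
(`schur_same`, `schur_ne`), obtained from zonal functions, and on a Sobolev estimate
(`exists_jetNorm_le`) comparing the C^∞ topology with the L² norms of powers of 1 - C. Second,
K-finite functions are analytic vectors for the boosts (`exists_norm_pow_D_boost_le`), so
`eq_zero_of_jets` turns an infinitesimal statement into one about one-parameter groups, and
`mem_of_generators` extends it to O(p,q). Thus closed invariant subspaces correspond to sets of
K-types that no boost leaves.

Unitary axis: in degree 2 - p - q the integral over the spheres is O(p,q)-invariant (`integ_act`).
The function f · conj h has degree a + conj a, which on the axis is 2 - p - q, so the L² product is
invariant.

Necessity: by Schur, an invariant Hermitian form is c_σ⟨·,·⟩ with c_σ real on each K-type of V₁ and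
pairs distinct ones to zero. Take σ with c_σ ≠ 0 and some τ to which multiplication by some u leads.
If τ lies in V₁, invariance gives c_τ trans(σ,τ) = -c_σ conj(trans(τ,σ)); imaginary parts force a to
be real or c_τ = c_σ, and then real parts put a on the axis. If τ is not in V₁, then trans(σ,τ) = 0,
and its imaginary part is Im a.

Real a: each coefficient depends only on the value of m + n or of m - n, so a zero between two
neighbouring K-types is a wall across the whole lattice, and a wall would cut a constituent in two.
Hence no coefficient vanishes between neighbouring K-types that occur in a constituent
(`trans_ne_zero`). For the same reason c_{m,n} = φ(m+n) ψ(m-n) solves both recursions without any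
compatibility condition (`exists_constants`). The one-variable recursions have solutions of
polynomial growth, so the form Σ c_σ⟨f_σ, h⟩ converges and is continuous on smooth functions;
extending c by zero off the K-types that occur makes it descend to V₁/V₀, and `specForm_act` gives
its invariance. -/

instance : CoeFun (S p q a) fun _ => cone p q → ℂ := ⟨S.toFun⟩

theorem S.ext {f g : S p q a} (h : ∀ w, f w = g w) : f = g := Subtype.ext (funext h)

theorem S.smooth (f : S p q a) : IsSmooth f.toFun := f.2.1

theorem S.homog (f : S p q a) : IsHomogeneous a f.toFun := f.2.2

/-- The function `f` on the cone as an element of `S^a(X⁰)`. -/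
def S.mk (f : cone p q → ℂ) (h : f ∈ homSubmodule p q a) : S p q a := ⟨f, h⟩

@[simp] theorem S.add_apply (f g : S p q a) (w : cone p q) : (f + g) w = f w + g w := rfl

@[simp] theorem S.mk_apply (f : cone p q → ℂ) (h : f ∈ homSubmodule p q a) (w : cone p q) :
    S.mk f h w = f w := rfl

@[simp] theorem S.sub_apply (f g : S p q a) (w : cone p q) : (f - g) w = f w - g w := rfl

@[simp] theorem S.zero_apply (w : cone p q) : (0 : S p q a) w = 0 := rfl

@[simp] theorem S.smul_apply (c : ℂ) (f : S p q a) (w : cone p q) : (c • f) w = c * f w := rfl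

theorem S.sum_apply {ι : Type*} (s : Finset ι) (f : ι → S p q a) (w : cone p q) :
    (∑ i ∈ s, f i) w = ∑ i ∈ s, f i w := by
  classical
  induction s using Finset.induction_on with
  | empty => simp
  | insert i s hi ih => rw [Finset.sum_insert hi, Finset.sum_insert hi, S.add_apply, ih]

/-- The open set of pairs `(x, y)` with `x ≠ 0` and `y ≠ 0`. -/
def dom (p q : ℕ) : Set (Amb p q) := {w | w.1 ≠ 0 ∧ w.2 ≠ 0}

theorem isOpen_dom : IsOpen (dom p q) :=
  (isOpen_ne.preimage continuous_fst).inter (isOpen_ne.preimage continuous_snd)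

theorem cone_subset_dom : cone p q ⊆ dom p q := fun _ hw =>
  ⟨(mem_cone_iff.1 hw).1, (mem_cone_iff.1 hw).2.1⟩

theorem mem_dom (w : cone p q) : (w : Amb p q) ∈ dom p q := cone_subset_dom w.2

theorem retraction_mem {w : Amb p q} (hw : w ∈ dom p q) : retraction w ∈ cone p q := by
  have h1 : 0 < ‖w.1‖ := norm_pos_iff.2 hw.1
  have h2 : 0 < ‖w.2‖ := norm_pos_iff.2 hw.2
  refine mem_cone_iff.2 ⟨hw.1, smul_ne_zero (div_pos h1 h2).ne' hw.2, ?_⟩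
  simp only [retraction, norm_smul, Real.norm_eq_abs, abs_of_pos (div_pos h1 h2)]
  field_simp

theorem retraction_eq {w : Amb p q} (hw : w ∈ cone p q) : retraction w = w := by
  obtain ⟨h1, h2, h3⟩ := mem_cone_iff.1 hw
  simp only [retraction, h3]
  rw [div_self (norm_ne_zero_iff.2 h2), one_smul]

theorem pullback_apply (f : cone p q → ℂ) {w : Amb p q} (hw : w ∈ dom p q) :
    pullback f w = f ⟨retraction w, retraction_mem hw⟩ :=
  Subtype.val_injective.extend_apply f 0 ⟨retraction w, retraction_mem hw⟩

theorem pullback_coe (f : cone p q → ℂ) (w : cone p q) : pullback f w = f w := by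
  rw [pullback_apply f (mem_dom w)]
  congr 1
  exact Subtype.ext (retraction_eq w.2)

theorem contDiffOn_retraction : ContDiffOn ℝ ∞ (retraction (p := p) (q := q)) (dom p q) := by
  have h1 : ContDiffOn ℝ ∞ (fun w : Amb p q => ‖w.1‖) (dom p q) :=
    ContDiffOn.norm ℝ contDiff_fst.contDiffOn fun w hw => hw.1
  have h2 : ContDiffOn ℝ ∞ (fun w : Amb p q => ‖w.2‖) (dom p q) :=
    ContDiffOn.norm ℝ contDiff_snd.contDiffOn fun w hw => hw.2
  exact contDiff_fst.contDiffOn.prodMk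
    ((h1.div h2 fun w hw => norm_ne_zero_iff.2 hw.2).smul contDiff_snd.contDiffOn)

theorem contDiffOn_pullback (f : S p q a) : ContDiffOn ℝ ∞ (pullback f.toFun) (dom p q) := by
  obtain ⟨U, F, hU, hXU, hF, hFf⟩ := f.smooth
  refine (hF.comp contDiffOn_retraction fun w hw => hXU (retraction_mem hw)).congr fun w hw => ?_
  rw [pullback_apply _ hw, ← hFf]
  rfl

theorem differentiableAt_pullback (f : S p q a) {w : Amb p q} (hw : w ∈ dom p q) :
    DifferentiableAt ℝ (pullback f.toFun) w :=
  ((contDiffOn_pullback f).contDiffAt (isOpen_dom.mem_nhds hw)).differentiableAt (by simp)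

theorem isSmooth_of_contDiffOn {f : cone p q → ℂ} {F : Amb p q → ℂ}
    (hF : ContDiffOn ℝ ∞ F (dom p q)) (h : ∀ w : cone p q, F w = f w) : IsSmooth f :=
  ⟨dom p q, F, isOpen_dom, cone_subset_dom, hF, h⟩

theorem smul_mem_dom {s t : ℝ} (hs : 0 < s) (ht : 0 < t) {w : Amb p q} (hw : w ∈ dom p q) :
    (s • w.1, t • w.2) ∈ dom p q :=
  ⟨smul_ne_zero hs.ne' hw.1, smul_ne_zero ht.ne' hw.2⟩

/-- The retraction uses y only through its direction, so the pullback has degree a in x and degree 0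
in y separately. Both Euler identities below come from this. -/
theorem pullback_smul (f : S p q a) {s t : ℝ} (hs : 0 < s) (ht : 0 < t) {w : Amb p q}
    (hw : w ∈ dom p q) :
    pullback f.toFun (s • w.1, t • w.2) = (s : ℂ) ^ a * pullback f.toFun w := by
  rw [pullback_apply _ hw, pullback_apply _ (smul_mem_dom hs ht hw)]
  refine f.homog s _ _ hs ?_
  have h2 : ‖w.2‖ ≠ 0 := norm_ne_zero_iff.2 hw.2
  simp only [retraction, norm_smul, Real.norm_eq_abs, abs_of_pos hs, abs_of_pos ht, Prod.smul_mk,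
    smul_smul]
  congr 2
  field_simp

/-- Chain rule for `pullback_smul`. The case s = t gives the homogeneity of `D J f`; the case s = 1
gives `pullback_D_rot`. -/
theorem fderiv_pullback_smul (f : S p q a) {s t : ℝ} (hs : 0 < s) (ht : 0 < t) {w : Amb p q}
    (hw : w ∈ dom p q) (v : Amb p q) :
    fderiv ℝ (pullback f.toFun) (s • w.1, t • w.2) (s • v.1, t • v.2) =
      (s : ℂ) ^ a * fderiv ℝ (pullback f.toFun) w v := by
  let σ : Amb p q →L[ℝ] Amb p q :=
    (s • ContinuousLinearMap.id ℝ _).prodMap (t • ContinuousLinearMap.id ℝ _)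
  have h1 : HasFDerivAt (fun v => pullback f.toFun (σ v))
      ((fderiv ℝ (pullback f.toFun) (σ w)).comp σ) w :=
    HasFDerivAt.comp (g := pullback f.toFun) w
      (differentiableAt_pullback f (smul_mem_dom hs ht hw)).hasFDerivAt σ.hasFDerivAt
  have h2 : HasFDerivAt (fun v => pullback f.toFun (σ v))
      ((s : ℂ) ^ a • fderiv ℝ (pullback f.toFun) w) w := by
    refine ((differentiableAt_pullback f hw).hasFDerivAt.const_smul ((s : ℂ) ^ a)).congr_of_eventuallyEq ?_
    filter_upwards [isOpen_dom.mem_nhds hw] with v hv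
    exact pullback_smul f hs ht hv
  exact congrArg (fun L => L v) (h1.unique h2)

theorem pullback_add (f g : S p q a) :
    pullback (f + g).toFun = pullback f.toFun + pullback g.toFun := by
  classical
  funext w
  simp only [pullback, Function.extend_def, Pi.add_apply]
  split_ifs <;> simp

theorem pullback_smul_const (c : ℂ) (f : S p q a) :
    pullback (c • f).toFun = c • pullback f.toFun := by
  classical
  funext w
  simp only [pullback, Function.extend_def, Pi.smul_apply]
  split_ifs <;> simp

/-- The derivative of `f ∈ S^a(X⁰)` along the linear vector field `w ↦ J w`. -/
def D (J : Amb p q →L[ℝ] Amb p q) : S p q a →ₗ[ℂ] S p q a where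
  toFun f := S.mk (fun w => fderiv ℝ (pullback f.toFun) w (J w)) <| by
    constructor
    · refine isSmooth_of_contDiffOn (F := fun w => fderiv ℝ (pullback f.toFun) w (J w)) ?_
        fun _ => rfl
      exact ((contDiffOn_pullback f).fderiv_of_isOpen isOpen_dom (m := ∞) (by simp)).clm_apply
        J.contDiff.contDiffOn
    · intro t w w' ht hw
      have h := fderiv_pullback_smul f ht ht (mem_dom w) (J w)
      simp only [← Prod.smul_def] at h
      beta_reduce
      rw [hw, map_smul]
      exact h
  map_add' f g := S.ext fun w => by
    change fderiv ℝ (pullback (f + g).toFun) w (J w) =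
      fderiv ℝ (pullback f.toFun) w (J w) + fderiv ℝ (pullback g.toFun) w (J w)
    rw [pullback_add, fderiv_add (differentiableAt_pullback f (mem_dom w))
      (differentiableAt_pullback g (mem_dom w))]
    rfl
  map_smul' c f := S.ext fun w => by
    change fderiv ℝ (pullback (c • f).toFun) w (J w) = c * fderiv ℝ (pullback f.toFun) w (J w)
    rw [pullback_smul_const, fderiv_const_smul (differentiableAt_pullback f (mem_dom w))]
    rfl

theorem D_apply (J : Amb p q →L[ℝ] Amb p q) (f : S p q a) (w : cone p q) :
    D J f w = fderiv ℝ (pullback f.toFun) w (J w) := rfl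

theorem hasDerivAt_comp_curve (f : S p q a) {γ : ℝ → cone p q} {v : Amb p q} {t : ℝ}
    (hγ : HasDerivAt (fun s => (γ s : Amb p q)) v t) :
    HasDerivAt (fun s => f (γ s)) (fderiv ℝ (pullback f.toFun) (γ t) v) t := by
  have h := (differentiableAt_pullback f (mem_dom (γ t))).hasFDerivAt.comp_hasDerivAt t hγ
  refine h.congr_of_eventuallyEq (Filter.Eventually.of_forall fun s => ?_)
  exact (pullback_coe f.toFun (γ s)).symm

theorem continuous_S (f : S p q a) : Continuous f.toFun := by
  have h := (contDiffOn_pullback f).continuousOn.comp_continuous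
    (f := ((↑) : cone p q → Amb p q)) continuous_subtype_val mem_dom
  exact h.congr (pullback_coe f.toFun)

/-- The product of homogeneous functions. -/
def S.mul (h : a + b = c) (f : S p q a) (g : S p q b) : S p q c :=
  S.mk (fun w => f w * g w) <| by
    constructor
    · exact isSmooth_of_contDiffOn ((contDiffOn_pullback f).mul (contDiffOn_pullback g))
        fun w => by rw [pullback_coe, pullback_coe]
    · intro t w w' ht hw
      have h0 : (t : ℂ) ≠ 0 := by exact_mod_cast ht.ne'
      simp only [f.homog t w w' ht hw, g.homog t w w' ht hw, ← h, Complex.cpow_add _ _ h0]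
      ring

@[simp] theorem S.mul_apply (h : a + b = c) (f : S p q a) (g : S p q b) (w : cone p q) :
    S.mul h f g w = f w * g w := rfl

theorem pullback_mul (h : a + b = c) (f : S p q a) (g : S p q b) :
    pullback (S.mul h f g).toFun = pullback f.toFun * pullback g.toFun := by
  classical
  funext w
  simp only [pullback, Function.extend_def, Pi.mul_apply]
  split_ifs <;> simp

theorem D_mul (h : a + b = c) (J : Amb p q →L[ℝ] Amb p q) (f : S p q a) (g : S p q b) :
    D J (S.mul h f g) = S.mul h (D J f) g + S.mul h f (D J g) := by
  refine S.ext fun w => ?_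
  simp only [D_apply, S.add_apply, S.mul_apply]
  rw [pullback_mul, fderiv_mul (differentiableAt_pullback f (mem_dom w))
      (differentiableAt_pullback g (mem_dom w))]
  simp only [add_apply, smul_apply, pullback_coe,
    smul_eq_mul]
  ring

/-- The complex conjugate of a homogeneous function. -/
def S.conj (f : S p q a) : S p q (conj a) :=
  S.mk (fun w => conj (f w)) <| by
    constructor
    · exact isSmooth_of_contDiffOn
        (Complex.conjCLE.contDiff.comp_contDiffOn (contDiffOn_pullback f))
        fun w => by simp [pullback_coe]
    · intro t w w' ht hw
      have h0 : (t : ℂ).arg ≠ Real.pi := by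
        rw [Complex.arg_ofReal_of_nonneg ht.le]
        exact Real.pi_pos.ne
      beta_reduce
      rw [f.homog t w w' ht hw, map_mul, Complex.cpow_conj _ _ h0, Complex.conj_ofReal]

@[simp] theorem S.conj_apply (f : S p q a) (w : cone p q) : S.conj f w = conj (f w) := rfl

/-- Multiplication by a function of degree `0`. -/
def mulOp (u : S p q 0) : S p q a →ₗ[ℂ] S p q a where
  toFun f := S.mul (zero_add a) u f
  map_add' f g := S.ext fun w => by simp [mul_add]
  map_smul' c f := S.ext fun w => by simp [mul_left_comm]

@[simp] theorem mulOp_apply (u : S p q 0) (f : S p q a) (w : cone p q) :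
    mulOp u f w = u w * f w := rfl

theorem D_mulOp (J : Amb p q →L[ℝ] Amb p q) (u : S p q 0) (f : S p q a) :
    D J (mulOp u f) = mulOp (D J u) f + mulOp u (D J f) := D_mul (zero_add a) J u f

/-- Composition with an element of `O(p,q)`. -/
def act (g : indefOrthogonal p q) : S p q a →ₗ[ℂ] S p q a := rho p q a g⁻¹

theorem rho_eq_act (g : indefOrthogonal p q) : rho p q a g = act g⁻¹ := by
  rw [act, inv_inv]

theorem act_apply (g : indefOrthogonal p q) (f : S p q a) (w : cone p q) :
    act g f w = f (coneAct g w) := by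
  change f (coneAct g⁻¹⁻¹ w) = _
  rw [inv_inv]

@[simp] theorem coneAct_coe (g : indefOrthogonal p q) (w : cone p q) :
    (coneAct g w : Amb p q) = g.1 w := rfl

/-- Precomposition is contravariant, hence the reversed order. -/
theorem act_mul (g h : indefOrthogonal p q) (f : S p q a) : act (g * h) f = act h (act g f) :=
  S.ext fun w => by
    simp only [act_apply]
    rfl

@[simp] theorem act_one (f : S p q a) : act 1 f = f := S.ext fun w => by
  simp only [act_apply]
  rfl

@[simp] theorem act_inv_act (g : indefOrthogonal p q) (f : S p q a) : act g⁻¹ (act g f) = f := by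
  rw [← act_mul, mul_inv_cancel, act_one]

@[simp] theorem act_act_inv (g : indefOrthogonal p q) (f : S p q a) : act g (act g⁻¹ f) = f := by
  rw [← act_mul, inv_mul_cancel, act_one]

theorem act_S_mul (g : indefOrthogonal p q) (h : a + b = c) (f : S p q a) (f' : S p q b) :
    act g (S.mul h f f') = S.mul h (act g f) (act g f') :=
  S.ext fun w => by simp only [act_apply, S.mul_apply]

theorem act_conj (g : indefOrthogonal p q) (f : S p q a) :
    act g (S.conj f) = S.conj (act g f) :=
  S.ext fun w => by simp only [act_apply, S.conj_apply]

/-- A one-parameter subgroup of `O(p,q)` with infinitesimal generator `J`. -/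
structure IsFlow (J : Amb p q →L[ℝ] Amb p q) (g : ℝ → indefOrthogonal p q) : Prop where
  deriv : ∀ w t, HasDerivAt (fun t => (g t).1 w) (J ((g t).1 w)) t
  cont : Continuous fun x : ℝ × Amb p q => (g x.1).1 x.2
  zero : g 0 = 1
  add : ∀ s t, g (s + t) = g s * g t

theorem IsFlow.neg {J : Amb p q →L[ℝ] Amb p q} {g : ℝ → indefOrthogonal p q} (h : IsFlow J g)
    (t : ℝ) : g (-t) = (g t)⁻¹ := by
  refine eq_inv_of_mul_eq_one_left ?_
  rw [← h.add, neg_add_cancel, h.zero]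

theorem IsFlow.hasDerivAt {J : Amb p q →L[ℝ] Amb p q} {g : ℝ → indefOrthogonal p q}
    (h : IsFlow J g) (f : S p q a) (w : cone p q) (t : ℝ) :
    HasDerivAt (fun t => f (coneAct (g t) w)) (D J f (coneAct (g t) w)) t :=
  hasDerivAt_comp_curve f (γ := fun t => coneAct (g t) w) (h.deriv w t)

theorem IsFlow.continuous_coneAct {J : Amb p q →L[ℝ] Amb p q} {g : ℝ → indefOrthogonal p q}
    (h : IsFlow J g) : Continuous fun x : ℝ × cone p q => coneAct (g x.1) x.2 :=
  Continuous.subtype_mk (h.cont.comp (continuous_fst.prodMk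
    (continuous_subtype_val.comp continuous_snd))) _

/-- The function `|x| ^ e` on the cone. -/
def radial (e : ℂ) : S p q e :=
  S.mk (jFun e 0 0 1 1) (jFun_mem e ⟨MvPolynomial.isHomogeneous_one _ _, by simp⟩
    ⟨MvPolynomial.isHomogeneous_one _ _, by simp⟩)

theorem radial_apply (e : ℂ) (w : cone p q) :
    radial e w = ((‖(w : Amb p q).1‖ : ℝ) : ℂ) ^ e := by
  simp [radial, jFun, polyVal]

end Functions


end

section

open MeasureTheory
open scoped Pointwise

/-! ### Invariant measure on the spheres and integration -/

section Measure

variable {p q : ℕ} {a b c : ℂ}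

/-- The unit sphere `𝕊^{p-1}`. -/
abbrev Sph (p : ℕ) : Type := Metric.sphere (0 : EuclideanSpace ℝ (Fin p)) 1

instance [NeZero p] : IsProbabilityMeasure (sphereProb p) := by
  constructor
  simp only [sphereProb, Measure.smul_apply, smul_eq_mul]
  refine ENNReal.inv_mul_cancel ?_ (measure_ne_top _ _)
  rw [Ne, Measure.measure_univ_eq_zero]
  exact Measure.toSphere_ne_zero _

instance [NeZero p] : (sphereProb p).IsOpenPosMeasure :=
  Measure.isOpenPosMeasure_smul _ (ENNReal.inv_ne_zero.2 (measure_ne_top _ _))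

/-- The action of an orthogonal transformation on the sphere. -/
def sphMap (A : EuclideanSpace ℝ (Fin p) ≃ₗᵢ[ℝ] EuclideanSpace ℝ (Fin p)) (z : Sph p) : Sph p :=
  ⟨A z, by simp⟩

theorem continuous_sphMap (A : EuclideanSpace ℝ (Fin p) ≃ₗᵢ[ℝ] EuclideanSpace ℝ (Fin p)) :
    Continuous (sphMap A) :=
  Continuous.subtype_mk (A.continuous.comp continuous_subtype_val) _

theorem measurePreserving_sphMap
    (A : EuclideanSpace ℝ (Fin p) ≃ₗᵢ[ℝ] EuclideanSpace ℝ (Fin p)) :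
    MeasurePreserving (sphMap A) (sphereProb p) (sphereProb p) := by
  have hm : Measurable (sphMap A) := (continuous_sphMap A).measurable
  -- The sphere measure of a set is a multiple of the volume of the cone over it; a linear isometry
  -- carries cones to cones and preserves volume.
  have key : Measure.map (sphMap A)
      ((volume : Measure (EuclideanSpace ℝ (Fin p))).toSphere) =
      (volume : Measure (EuclideanSpace ℝ (Fin p))).toSphere := by
    ext s hs
    rw [Measure.map_apply hm hs, Measure.toSphere_apply' _ hs, Measure.toSphere_apply' _ (hm hs)]
    congr 1
    rw [← A.measurePreserving.measure_preimage_emb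
      A.toHomeomorph.measurableEmbedding (Set.Ioo (0 : ℝ) 1 • (Subtype.val '' s))]
    congr 1
    ext x
    simp only [Set.mem_smul, Set.mem_image, Set.mem_preimage, Subtype.exists, exists_and_right,
      exists_eq_right]
    constructor
    · rintro ⟨r, hr, y, ⟨hy, hys⟩, rfl⟩
      exact ⟨r, hr, A y, ⟨(sphMap A ⟨y, hy⟩).2, hys⟩, by simp⟩
    · rintro ⟨r, hr, y, ⟨hy, hys⟩, h⟩
      refine ⟨r, hr, A.symm y, ⟨by simpa using hy, ?_⟩, ?_⟩
      · simpa [sphMap] using hys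
      · rw [← map_smul, h, A.symm_apply_apply]
  refine ⟨hm, ?_⟩
  rw [sphereProb, Measure.map_smul, key]

/-- The rotation-invariant probability measure on `𝕊^{p-1} × 𝕊^{q-1}`. -/
abbrev mu (p q : ℕ) : Measure (Spheres p q) := (sphereProb p).prod (sphereProb q)

/-- The element of `O(p) × O(q)` with the given components. -/
def kElt (A : EuclideanSpace ℝ (Fin p) ≃ₗᵢ[ℝ] EuclideanSpace ℝ (Fin p))
    (B : EuclideanSpace ℝ (Fin q) ≃ₗᵢ[ℝ] EuclideanSpace ℝ (Fin q)) : indefOrthogonal p q :=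
  ⟨A.toContinuousLinearEquiv.prodCongr B.toContinuousLinearEquiv, fun w w' => by
    change inner ℝ (A w.1) (A w'.1) - inner ℝ (B w.2) (B w'.2) = _
    rw [A.inner_map_map, B.inner_map_map]
    rfl⟩

@[simp] theorem kElt_apply (A : EuclideanSpace ℝ (Fin p) ≃ₗᵢ[ℝ] EuclideanSpace ℝ (Fin p))
    (B : EuclideanSpace ℝ (Fin q) ≃ₗᵢ[ℝ] EuclideanSpace ℝ (Fin q)) (w : Amb p q) :
    (kElt A B).1 w = (A w.1, B w.2) := rfl

theorem kElt_inv (A : EuclideanSpace ℝ (Fin p) ≃ₗᵢ[ℝ] EuclideanSpace ℝ (Fin p))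
    (B : EuclideanSpace ℝ (Fin q) ≃ₗᵢ[ℝ] EuclideanSpace ℝ (Fin q)) :
    (kElt A B)⁻¹ = kElt A.symm B.symm := by
  rw [inv_eq_iff_mul_eq_one]
  refine Subtype.ext (ContinuousLinearEquiv.ext (funext fun w => ?_))
  change (kElt A B).1 ((kElt A.symm B.symm).1 w) = w
  simp

theorem coneAct_kElt (A : EuclideanSpace ℝ (Fin p) ≃ₗᵢ[ℝ] EuclideanSpace ℝ (Fin p))
    (B : EuclideanSpace ℝ (Fin q) ≃ₗᵢ[ℝ] EuclideanSpace ℝ (Fin q)) (z : Spheres p q) :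
    coneAct (kElt A B) (sphereIncl z) = sphereIncl (sphMap A z.1, sphMap B z.2) := rfl

theorem continuous_sphereIncl : Continuous (sphereIncl (p := p) (q := q)) :=
  Continuous.subtype_mk ((continuous_subtype_val.comp continuous_fst).prodMk
    (continuous_subtype_val.comp continuous_snd)) _

/-- The restriction of an element of `S^a(X⁰)` to `𝕊^{p-1} × 𝕊^{q-1}`. -/
def res : S p q a →ₗ[ℂ] C(Spheres p q, ℂ) where
  toFun f := ⟨fun z => f (sphereIncl z), (continuous_S f).comp continuous_sphereIncl⟩
  map_add' _ _ := rfl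
  map_smul' _ _ := rfl

@[simp] theorem res_apply (f : S p q a) (z : Spheres p q) : res f z = f (sphereIncl z) := rfl

theorem exists_sphere (w : cone p q) : ∃ z : Spheres p q,
    (w : Amb p q) = ‖(w : Amb p q).1‖ • (sphereIncl z : Amb p q) := by
  obtain ⟨h1, h2, h3⟩ := mem_cone_iff.1 w.2
  have h1' : ‖(w : Amb p q).1‖ ≠ 0 := norm_ne_zero_iff.2 h1
  have h2' : ‖(w : Amb p q).2‖ ≠ 0 := norm_ne_zero_iff.2 h2
  refine ⟨(⟨‖(w : Amb p q).1‖⁻¹ • (w : Amb p q).1, ?_⟩,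
    ⟨‖(w : Amb p q).2‖⁻¹ • (w : Amb p q).2, ?_⟩), ?_⟩
  · simp [norm_smul, h1']
  · simp [norm_smul, h2']
  · change (w : Amb p q) = ‖(w : Amb p q).1‖ • ((‖(w : Amb p q).1‖⁻¹ • (w : Amb p q).1,
      ‖(w : Amb p q).2‖⁻¹ • (w : Amb p q).2) : Amb p q)
    rw [Prod.smul_mk, smul_smul, smul_smul, h3, mul_inv_cancel₀ h2', one_smul, one_smul]

theorem S.ext_sphere {f g : S p q a} (h : ∀ z, f (sphereIncl z) = g (sphereIncl z)) : f = g := by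
  refine S.ext fun w => ?_
  obtain ⟨z, hz⟩ := exists_sphere w
  have hp : 0 < ‖(w : Amb p q).1‖ := norm_pos_iff.2 (mem_cone_iff.1 w.2).1
  rw [f.homog _ _ _ hp hz, g.homog _ _ _ hp hz, h]

theorem res_injective : Function.Injective (res (p := p) (q := q) (a := a)) := fun _ _ h =>
  S.ext_sphere fun z => congrArg (fun u : C(Spheres p q, ℂ) => u z) h

theorem norm_fst_sphereIncl (z : Spheres p q) : ‖(sphereIncl z : Amb p q).1‖ = 1 := by
  simp [sphereIncl]

theorem norm_snd_sphereIncl (z : Spheres p q) : ‖(sphereIncl z : Amb p q).2‖ = 1 := by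
  simp [sphereIncl]

variable [NeZero p] [NeZero q]

theorem integrable_cont {E : Type*} [NormedAddCommGroup E] {u : Spheres p q → E}
    (hu : Continuous u) : Integrable u (mu p q) := by
  have : HasCompactSupport u := HasCompactSupport.of_compactSpace u
  exact hu.integrable_of_hasCompactSupport this

/-- The integral over `𝕊^{p-1} × 𝕊^{q-1}`. -/
def integ : S p q a →ₗ[ℂ] ℂ where
  toFun f := ∫ z, f (sphereIncl z) ∂(mu p q)
  map_add' f g := integral_add (integrable_cont (res f).continuous)
    (integrable_cont (res g).continuous)
  map_smul' c f := by
    simp only [S.smul_apply, RingHom.id_apply, smul_eq_mul]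
    exact integral_const_mul c _

theorem integ_apply (f : S p q a) : integ f = ∫ z, f (sphereIncl z) ∂(mu p q) := rfl

theorem integral_sphMap {E : Type*} [NormedAddCommGroup E] [NormedSpace ℝ E]
    (A : EuclideanSpace ℝ (Fin p) ≃ₗᵢ[ℝ] EuclideanSpace ℝ (Fin p))
    (B : EuclideanSpace ℝ (Fin q) ≃ₗᵢ[ℝ] EuclideanSpace ℝ (Fin q)) (u : C(Spheres p q, E)) :
    ∫ z, u (sphMap A z.1, sphMap B z.2) ∂(mu p q) = ∫ z, u z ∂(mu p q) := by
  have h := (measurePreserving_sphMap A).prod (measurePreserving_sphMap B)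
  have h' := integral_map (μ := mu p q) (f := u) h.measurable.aemeasurable
    u.continuous.aestronglyMeasurable
  rw [h.map_eq] at h'
  exact h'.symm

theorem integ_act_kElt (A : EuclideanSpace ℝ (Fin p) ≃ₗᵢ[ℝ] EuclideanSpace ℝ (Fin p))
    (B : EuclideanSpace ℝ (Fin q) ≃ₗᵢ[ℝ] EuclideanSpace ℝ (Fin q)) (f : S p q a) :
    integ (act (kElt A B) f) = integ f := by
  simp only [integ_apply, act_apply, coneAct_kElt]
  exact integral_sphMap A B (res f)

theorem IsFlow.hasDerivAt_integ {J : Amb p q →L[ℝ] Amb p q} {g : ℝ → indefOrthogonal p q}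
    (h : IsFlow J g) (f : S p q a) (t : ℝ) :
    HasDerivAt (fun t => integ (act (g t) f)) (integ (act (g t) (D J f))) t := by
  have hc : ∀ f : S p q a, Continuous fun x : ℝ × Spheres p q =>
      act (g x.1) f (sphereIncl x.2) := fun f => by
    simp only [act_apply]
    exact (continuous_S f).comp (h.continuous_coneAct.comp
      (continuous_fst.prodMk (continuous_sphereIncl.comp continuous_snd)))
  have hcomp : IsCompact (Set.Icc (t - 1) (t + 1) ×ˢ (Set.univ : Set (Spheres p q))) :=
    isCompact_Icc.prod isCompact_univ
  -- Compactness of [t-1, t+1] times the spheres supplies a constant dominating function.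
  obtain ⟨C, hC⟩ := hcomp.exists_bound_of_continuousOn (hc (D J f)).continuousOn
  refine (hasDerivAt_integral_of_dominated_loc_of_deriv_le
    (F := fun t z => act (g t) f (sphereIncl z))
    (F' := fun t z => act (g t) (D J f) (sphereIncl z)) (μ := mu p q) (bound := fun _ => C)
    (s := Set.Icc (t - 1) (t + 1)) (Icc_mem_nhds (by linarith) (by linarith)) ?_ ?_ ?_ ?_ ?_ ?_).2
  · exact Filter.Eventually.of_forall fun s => (res (act (g s) f)).continuous.aestronglyMeasurable
  · exact integrable_cont (res (act (g t) f)).continuous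
  · exact (res (act (g t) (D J f))).continuous.aestronglyMeasurable
  · exact Filter.Eventually.of_forall fun z s hs => hC (s, z) ⟨hs, trivial⟩
  · exact integrable_const _
  · refine Filter.Eventually.of_forall fun z s _ => ?_
    simp only [act_apply]
    exact h.hasDerivAt f _ s

end Measure

/-! ### One-parameter groups of rotations and boosts -/

section Flows

variable {E : Type*} [NormedAddCommGroup E] [NormedSpace ℝ E] [CompleteSpace E]

theorem hasDerivAt_exp_apply (J : E →L[ℝ] E) (w : E) (t : ℝ) :
    HasDerivAt (fun t : ℝ => NormedSpace.exp (t • J) w) (J (NormedSpace.exp (t • J) w)) t := by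
  simpa using (hasDerivAt_exp_smul_const' J t).clm_apply (hasDerivAt_const t w)

theorem exp_add_apply (J : E →L[ℝ] E) (s t : ℝ) (w : E) :
    NormedSpace.exp ((s + t) • J) w = NormedSpace.exp (s • J) (NormedSpace.exp (t • J) w) := by
  have h : Commute (s • J) (t • J) := ((Commute.refl J).smul_left s).smul_right t
  let _ : NormedAlgebra ℚ (E →L[ℝ] E) := NormedAlgebra.restrictScalars ℚ ℝ _
  rw [add_smul, NormedSpace.exp_add_of_commute h]
  rfl

theorem exp_zero_apply {E : Type*} [NormedAddCommGroup E] [NormedSpace ℝ E]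
    (J : E →L[ℝ] E) (w : E) : NormedSpace.exp ((0 : ℝ) • J) w = w := by
  rw [zero_smul, NormedSpace.exp_zero]
  rfl

/-- The one-parameter group `exp (t J)`. -/
def expEquiv (J : E →L[ℝ] E) (t : ℝ) : E ≃L[ℝ] E :=
  ContinuousLinearEquiv.equivOfInverse (NormedSpace.exp (t • J)) (NormedSpace.exp ((-t) • J))
    (fun w => by rw [← exp_add_apply, neg_add_cancel, exp_zero_apply])
    (fun w => by rw [← exp_add_apply, add_neg_cancel, exp_zero_apply])

theorem hasDerivAt_expEquiv (J : E →L[ℝ] E) (w : E) (t : ℝ) :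
    HasDerivAt (fun t : ℝ => expEquiv J t w) (J (expEquiv J t w)) t := hasDerivAt_exp_apply J w t

theorem continuous_expEquiv (J : E →L[ℝ] E) :
    Continuous fun x : ℝ × E => expEquiv J x.1 x.2 := by
  have h : Continuous fun t : ℝ => NormedSpace.exp (t • J) :=
    continuous_iff_continuousAt.2 fun t => (hasDerivAt_exp_smul_const' J t).continuousAt
  exact (h.comp continuous_fst).clm_apply continuous_snd

theorem expEquiv_add (J : E →L[ℝ] E) (s t : ℝ) (w : E) :
    expEquiv J (s + t) w = expEquiv J s (expEquiv J t w) := exp_add_apply J s t w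

theorem expEquiv_zero (J : E →L[ℝ] E) (w : E) : expEquiv J 0 w = w := exp_zero_apply J w

theorem eq_of_hasDerivAt_zero {φ : ℝ → ℝ} (h : ∀ t, HasDerivAt φ 0 t) (t : ℝ) : φ t = φ 0 :=
  is_const_of_deriv_eq_zero (fun t => (h t).differentiableAt) (fun t => (h t).deriv) t 0

variable {p q : ℕ}

/-- The infinitesimal rotation `x ↦ x_i e_l - x_l e_i`. -/
def rotGen (i l : Fin p) : EuclideanSpace ℝ (Fin p) →L[ℝ] EuclideanSpace ℝ (Fin p) :=
  (EuclideanSpace.proj (𝕜 := ℝ) i).smulRight (EuclideanSpace.single l (1 : ℝ)) -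
    (EuclideanSpace.proj (𝕜 := ℝ) l).smulRight (EuclideanSpace.single i (1 : ℝ))

theorem rotGen_apply (i l : Fin p) (x : EuclideanSpace ℝ (Fin p)) :
    rotGen i l x = x i • EuclideanSpace.single l (1 : ℝ) -
      x l • EuclideanSpace.single i (1 : ℝ) := rfl

/-- Skewness makes the norm constant along the exponential flow, which therefore consists of
isometries. -/
theorem rotGen_skew (i l : Fin p) (x : EuclideanSpace ℝ (Fin p)) :
    inner ℝ x (rotGen i l x) = 0 := by
  simp only [rotGen_apply, inner_sub_right, inner_smul_right, EuclideanSpace.inner_single_right]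
  simp
  ring

/-- The one-parameter group of rotations generated by `rotGen i l`. -/
def rotIso (i l : Fin p) (t : ℝ) : EuclideanSpace ℝ (Fin p) ≃ₗᵢ[ℝ] EuclideanSpace ℝ (Fin p) :=
  ⟨(expEquiv (rotGen i l) t).toLinearEquiv, fun x => by
    have h : ∀ t, HasDerivAt (fun t => inner ℝ (expEquiv (rotGen i l) t x)
        (expEquiv (rotGen i l) t x)) 0 t := fun t => by
      have h1 := hasDerivAt_expEquiv (rotGen i l) x t
      have h2 := h1.inner ℝ h1
      rwa [real_inner_comm (expEquiv (rotGen i l) t x), rotGen_skew, add_zero] at h2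
    have h3 := eq_of_hasDerivAt_zero h t
    rw [expEquiv_zero, real_inner_self_eq_norm_sq, real_inner_self_eq_norm_sq] at h3
    exact (sq_eq_sq₀ (norm_nonneg _) (norm_nonneg _)).1 h3⟩

/-- The index set of the generators of `O(p) × O(q)`. -/
abbrev RotIdx (p q : ℕ) : Type := (Fin p × Fin p) ⊕ (Fin q × Fin q)

/-- The generators of `O(p) × O(q)`. -/
def rot : RotIdx p q → Amb p q →L[ℝ] Amb p q
  | Sum.inl i => ((rotGen i.1 i.2).comp (ContinuousLinearMap.fst ℝ _ _)).prod 0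
  | Sum.inr i => (0 : Amb p q →L[ℝ] _).prod
      ((rotGen i.1 i.2).comp (ContinuousLinearMap.snd ℝ _ _))

/-- The one-parameter groups of rotations. -/
def rotFlow : RotIdx p q → ℝ → indefOrthogonal p q
  | Sum.inl i => fun t => kElt (rotIso i.1 i.2 t) (LinearIsometryEquiv.refl ℝ _)
  | Sum.inr i => fun t => kElt (LinearIsometryEquiv.refl ℝ _) (rotIso i.1 i.2 t)

theorem exists_rotFlow (i : RotIdx p q) (t : ℝ) : ∃ A B, rotFlow i t = kElt A B := by
  cases i <;> exact ⟨_, _, rfl⟩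

theorem isFlow_rot (i : RotIdx p q) : IsFlow (rot i) (rotFlow i) := by
  rcases i with i | i
  · refine ⟨fun w t => (hasDerivAt_expEquiv _ w.1 t).prodMk (hasDerivAt_const t w.2), ?_, ?_, ?_⟩
    · exact ((continuous_expEquiv (rotGen i.1 i.2)).comp (continuous_fst.prodMk
        (continuous_fst.comp continuous_snd))).prodMk (continuous_snd.comp continuous_snd)
    · exact Subtype.ext (ContinuousLinearEquiv.ext (funext fun w =>
        Prod.ext (expEquiv_zero _ w.1) rfl))
    · exact fun s t => Subtype.ext (ContinuousLinearEquiv.ext (funext fun w =>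
        Prod.ext (expEquiv_add _ s t w.1) rfl))
  · refine ⟨fun w t => (hasDerivAt_const t w.1).prodMk (hasDerivAt_expEquiv _ w.2 t), ?_, ?_, ?_⟩
    · exact (continuous_fst.comp continuous_snd).prodMk
        ((continuous_expEquiv (rotGen i.1 i.2)).comp (continuous_fst.prodMk
        (continuous_snd.comp continuous_snd)))
    · exact Subtype.ext (ContinuousLinearEquiv.ext (funext fun w =>
        Prod.ext rfl (expEquiv_zero _ w.2)))
    · exact fun s t => Subtype.ext (ContinuousLinearEquiv.ext (funext fun w =>
        Prod.ext rfl (expEquiv_add _ s t w.2)))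

/-- The infinitesimal boost `(x, y) ↦ (y_k e_j, x_j e_k)`. -/
def boost (j : Fin p) (k : Fin q) : Amb p q →L[ℝ] Amb p q :=
  (((EuclideanSpace.proj (𝕜 := ℝ) k).comp (ContinuousLinearMap.snd ℝ _ _)).smulRight
    (EuclideanSpace.single j (1 : ℝ))).prod
  (((EuclideanSpace.proj (𝕜 := ℝ) j).comp (ContinuousLinearMap.fst ℝ _ _)).smulRight
    (EuclideanSpace.single k (1 : ℝ)))

theorem boost_apply (j : Fin p) (k : Fin q) (w : Amb p q) :
    boost j k w = (w.2 k • EuclideanSpace.single j (1 : ℝ),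
      w.1 j • EuclideanSpace.single k (1 : ℝ)) := rfl

/-- This places the boost in the Lie algebra of O(p,q): the form of two flow lines is constant in
time. -/
theorem boost_skew (j : Fin p) (k : Fin q) (w w' : Amb p q) :
    bil (boost j k w) w' + bil w (boost j k w') = 0 := by
  simp only [bil, boost_apply, inner_smul_left, inner_smul_right,
    EuclideanSpace.inner_single_left, EuclideanSpace.inner_single_right]
  simp
  ring

theorem hasDerivAt_bil {γ δ : ℝ → Amb p q} {v v' : Amb p q} {t : ℝ} (hγ : HasDerivAt γ v t)
    (hδ : HasDerivAt δ v' t) :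
    HasDerivAt (fun t => bil (γ t) (δ t)) (bil v (δ t) + bil (γ t) v') t := by
  have h1 := hγ.hasFDerivAt.fst.hasDerivAt.inner ℝ hδ.hasFDerivAt.fst.hasDerivAt
  have h2 := hγ.hasFDerivAt.snd.hasDerivAt.inner ℝ hδ.hasFDerivAt.snd.hasDerivAt
  refine (h1.sub h2).congr_deriv ?_
  simp [bil]
  ring

/-- The one-parameter group generated by `boost j k`. -/
def boostFlow (j : Fin p) (k : Fin q) (t : ℝ) : indefOrthogonal p q :=
  ⟨expEquiv (boost j k) t, fun w w' => by
    have h : ∀ t, HasDerivAt (fun t => bil (expEquiv (boost j k) t w)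
        (expEquiv (boost j k) t w')) 0 t := fun t => by
      have h2 := hasDerivAt_bil (hasDerivAt_expEquiv (boost j k) w t)
        (hasDerivAt_expEquiv (boost j k) w' t)
      rwa [boost_skew] at h2
    simpa only [expEquiv_zero] using eq_of_hasDerivAt_zero h t⟩

theorem isFlow_boost (j : Fin p) (k : Fin q) : IsFlow (boost j k) (boostFlow j k) :=
  ⟨fun w t => hasDerivAt_expEquiv _ w t, continuous_expEquiv _,
    Subtype.ext (ContinuousLinearEquiv.ext (funext fun w => expEquiv_zero _ w)),
    fun s t => Subtype.ext (ContinuousLinearEquiv.ext (funext fun w => expEquiv_add _ s t w))⟩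

/-- The integral of a rotated function does not depend on the angle; differentiate at angle zero.
All integrations by parts on the spheres reduce to this. -/
theorem integ_D_rot [NeZero p] [NeZero q] {a : ℂ} (i : RotIdx p q) (f : S p q a) :
    integ (D (rot i) f) = 0 := by
  have h := (isFlow_rot i).hasDerivAt_integ f 0
  have h2 : (fun t => integ (act (rotFlow i t) f)) = fun _ => integ f := funext fun t => by
    obtain ⟨A, B, hAB⟩ := exists_rotFlow i t
    rw [hAB, integ_act_kElt]
  rw [h2, (isFlow_rot i).zero, act_one] at h
  exact h.unique (hasDerivAt_const _ _)

end Flows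


end

section

open MeasureTheory
open MvPolynomial (X C pderiv)

/-! ### Harmonic polynomials -/

section Polynomials

variable {p m : ℕ}

theorem polyVal_add (P Q : MvPolynomial (Fin p) ℂ) (x : EuclideanSpace ℝ (Fin p)) :
    polyVal (P + Q) x = polyVal P x + polyVal Q x := map_add _ _ _

theorem polyVal_sub (P Q : MvPolynomial (Fin p) ℂ) (x : EuclideanSpace ℝ (Fin p)) :
    polyVal (P - Q) x = polyVal P x - polyVal Q x := map_sub _ _ _

theorem polyVal_mul (P Q : MvPolynomial (Fin p) ℂ) (x : EuclideanSpace ℝ (Fin p)) :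
    polyVal (P * Q) x = polyVal P x * polyVal Q x := map_mul _ _ _

@[simp] theorem polyVal_X (i : Fin p) (x : EuclideanSpace ℝ (Fin p)) :
    polyVal (X i) x = x i := MvPolynomial.eval_X _

@[simp] theorem polyVal_C (c : ℂ) (x : EuclideanSpace ℝ (Fin p)) :
    polyVal (C c) x = c := MvPolynomial.eval_C _

@[simp] theorem polyVal_one (x : EuclideanSpace ℝ (Fin p)) :
    polyVal 1 x = 1 := map_one _

theorem polyVal_smul_const (c : ℂ) (P : MvPolynomial (Fin p) ℂ) (x : EuclideanSpace ℝ (Fin p)) :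
    polyVal (c • P) x = c * polyVal P x := by
  rw [MvPolynomial.smul_eq_C_mul, polyVal_mul, polyVal_C]

theorem polyVal_sum {ι : Type*} (s : Finset ι) (P : ι → MvPolynomial (Fin p) ℂ)
    (x : EuclideanSpace ℝ (Fin p)) : polyVal (∑ i ∈ s, P i) x = ∑ i ∈ s, polyVal (P i) x :=
  map_sum _ _ _

theorem hasFDerivAt_polyVal (P : MvPolynomial (Fin p) ℂ) (x : EuclideanSpace ℝ (Fin p)) :
    HasFDerivAt (polyVal P) (∑ i, (EuclideanSpace.proj (𝕜 := ℝ) i :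
      EuclideanSpace ℝ (Fin p) →L[ℝ] ℝ).smulRight (polyVal (pderiv i P) x)) x := by
  induction P using MvPolynomial.induction_on with
  | C c =>
    simp only [MvPolynomial.pderiv_C]
    have : (polyVal (C c) : EuclideanSpace ℝ (Fin p) → ℂ) = fun _ => c := funext (polyVal_C c)
    rw [this]
    refine (hasFDerivAt_const c x).congr_fderiv ?_
    ext v
    simp [polyVal]
  | add P Q hP hQ =>
    have : (polyVal (P + Q) : EuclideanSpace ℝ (Fin p) → ℂ) =
      polyVal P + polyVal Q := funext (polyVal_add P Q)
    rw [this]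
    refine (hP.add hQ).congr_fderiv ?_
    ext v
    simp [polyVal_add, mul_add, Finset.sum_add_distrib]
  | mul_X P j hP =>
    have : (polyVal (P * X j) : EuclideanSpace ℝ (Fin p) → ℂ) =
      polyVal P * fun x => ((x j : ℝ) : ℂ) := funext fun x => by simp [polyVal_mul]
    rw [this]
    have hj : HasFDerivAt (fun x : EuclideanSpace ℝ (Fin p) => ((x j : ℝ) : ℂ))
        (Complex.ofRealCLM.comp (EuclideanSpace.proj (𝕜 := ℝ) j)) x :=
      (Complex.ofRealCLM.comp (EuclideanSpace.proj (𝕜 := ℝ) j)).hasFDerivAt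
    refine (hP.mul hj).congr_fderiv ?_
    ext v
    have hs : ∑ i, (v i : ℂ) * (polyVal P x * polyVal (pderiv i (X j)) x) =
        polyVal P x * v j := by
      rw [Finset.sum_eq_single j
        (fun i _ hi => by rw [MvPolynomial.pderiv_X_of_ne hi.symm]; simp [polyVal]) (by simp)]
      simp [mul_comm]
    have hR : ∑ i, (v i : ℂ) * polyVal (pderiv i (P * X j)) x =
        polyVal P x * v j + x j * ∑ i, (v i : ℂ) * polyVal (pderiv i P) x := by
      rw [← hs, Finset.mul_sum, ← Finset.sum_add_distrib]
      refine Finset.sum_congr rfl fun i _ => ?_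
      rw [MvPolynomial.pderiv_mul, polyVal_add, polyVal_mul, polyVal_mul, polyVal_X]
      ring
    simpa using hR.symm

theorem fderiv_polyVal (P : MvPolynomial (Fin p) ℂ) (x v : EuclideanSpace ℝ (Fin p)) :
    fderiv ℝ (polyVal P) x v = ∑ i, (v i : ℂ) * polyVal (pderiv i P) x := by
  rw [(hasFDerivAt_polyVal P x).fderiv]
  simp

theorem pderiv_comm (i j : Fin p) (P : MvPolynomial (Fin p) ℂ) :
    pderiv i (pderiv j P) = pderiv j (pderiv i P) := by
  induction P using MvPolynomial.induction_on with
  | C c => simp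
  | add P Q hP hQ => simp [hP, hQ]
  | mul_X P k hP =>
    have h : ∀ i j : Fin p, pderiv i (pderiv j (X k : MvPolynomial (Fin p) ℂ)) = 0 := fun i j => by
      rw [MvPolynomial.pderiv_X, Pi.single_apply]
      split_ifs <;> simp
    simp only [MvPolynomial.pderiv_mul, map_add, hP, h]
    ring

/-- The Laplacian on polynomials. -/
def lap : MvPolynomial (Fin p) ℂ →ₗ[ℂ] MvPolynomial (Fin p) ℂ :=
  ∑ i, (pderiv i).toLinearMap ∘ₗ (pderiv i).toLinearMap

theorem lap_apply (P : MvPolynomial (Fin p) ℂ) : lap P = ∑ i, pderiv i (pderiv i P) := by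
  simp [lap]

theorem IsHarmonic.lap_eq {P : MvPolynomial (Fin p) ℂ} (h : IsHarmonic p m P) : lap P = 0 := by
  rw [lap_apply, h.2]

theorem isHarmonic_iff {P : MvPolynomial (Fin p) ℂ} :
    IsHarmonic p m P ↔ P.IsHomogeneous m ∧ lap P = 0 := by
  rw [lap_apply]
  rfl

theorem lap_pderiv (i : Fin p) (P : MvPolynomial (Fin p) ℂ) : lap (pderiv i P) = pderiv i (lap P) := by
  simp only [lap_apply, map_sum]
  exact Finset.sum_congr rfl fun j _ => by rw [pderiv_comm j i P, pderiv_comm j i]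

theorem lap_mul (P Q : MvPolynomial (Fin p) ℂ) :
    lap (P * Q) = lap P * Q + 2 * ∑ i, pderiv i P * pderiv i Q + P * lap Q := by
  simp only [lap_apply, Finset.mul_sum, Finset.sum_mul, ← Finset.sum_add_distrib]
  refine Finset.sum_congr rfl fun i _ => ?_
  simp only [MvPolynomial.pderiv_mul, map_add]
  ring

theorem lap_X_mul (j : Fin p) (P : MvPolynomial (Fin p) ℂ) :
    lap (X j * P) = 2 * pderiv j P + X j * lap P := by
  rw [lap_mul]
  have h : lap (X j : MvPolynomial (Fin p) ℂ) = 0 := by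
    rw [lap_apply]
    refine Finset.sum_eq_zero fun i _ => ?_
    rw [MvPolynomial.pderiv_X, Pi.single_apply]
    split_ifs <;> simp
  simp [h, MvPolynomial.pderiv_X, Pi.single_apply]

/-- The polynomial `|x|²`. -/
def rsq (p : ℕ) : MvPolynomial (Fin p) ℂ := ∑ i, X i ^ 2

theorem rsq_isHomogeneous : (rsq p).IsHomogeneous 2 :=
  MvPolynomial.IsHomogeneous.sum _ _ _ fun i _ => MvPolynomial.isHomogeneous_X_pow i 2

theorem polyVal_rsq (x : EuclideanSpace ℝ (Fin p)) : polyVal (rsq p) x = ((‖x‖ ^ 2 : ℝ) : ℂ) := by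
  rw [EuclideanSpace.norm_sq_eq]
  simp [rsq, polyVal]

theorem pderiv_rsq (i : Fin p) : pderiv i (rsq p) = C 2 * X i := by
  simp [rsq, MvPolynomial.pderiv_X, Pi.single_apply, map_ofNat]

/-- Leibniz with Δ|x|² = 2p; the gradient term is evaluated by Euler's identity x·∇P = mP. -/
theorem lap_rsq_mul {P : MvPolynomial (Fin p) ℂ} (hP : P.IsHomogeneous m) :
    lap (rsq p * P) = C (2 * p + 4 * m : ℂ) * P + rsq p * lap P := by
  have h1 : lap (rsq p) = C (2 * p : ℂ) := by
    rw [lap_apply]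
    simp [pderiv_rsq, MvPolynomial.pderiv_C_mul, mul_comm]
  have h2 : ∑ i, pderiv i (rsq p) * pderiv i P = C (2 * m : ℂ) * P := by
    simp only [pderiv_rsq, mul_assoc, ← Finset.mul_sum, hP.sum_X_mul_pderiv]
    simp [mul_assoc]
  rw [lap_mul, h1, h2]
  simp only [map_add, map_mul, map_natCast, map_ofNat]
  ring

theorem pderiv_of_isHomogeneous_zero {P : MvPolynomial (Fin p) ℂ} (hP : P.IsHomogeneous 0)
    (i : Fin p) : pderiv i P = 0 := by
  rw [MvPolynomial.totalDegree_eq_zero_iff_eq_C.1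
    ((MvPolynomial.totalDegree_zero_iff_isHomogeneous (p := P)).2 hP), MvPolynomial.pderiv_C]

theorem IsHarmonic.pderiv_succ {P : MvPolynomial (Fin p) ℂ} (hP : IsHarmonic p (m + 1) P)
    (i : Fin p) : IsHarmonic p m (pderiv i P) :=
  isHarmonic_iff.2 ⟨by simpa using hP.1.pderiv (i := i), by rw [lap_pderiv, hP.lap_eq, map_zero]⟩

theorem isHarmonic_zero : IsHarmonic p m 0 :=
  isHarmonic_iff.2 ⟨MvPolynomial.isHomogeneous_zero _ _ _, map_zero _⟩

theorem isHarmonic_one : IsHarmonic p 0 1 :=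
  ⟨MvPolynomial.isHomogeneous_one _ _, by simp⟩

theorem isHarmonic_X (i : Fin p) : IsHarmonic p 1 (X i) := by
  refine isHarmonic_iff.2 ⟨MvPolynomial.isHomogeneous_X _ _, ?_⟩
  have h := lap_X_mul i (1 : MvPolynomial (Fin p) ℂ)
  simpa [isHarmonic_one.lap_eq] using h

theorem IsHarmonic.add {P Q : MvPolynomial (Fin p) ℂ} (hP : IsHarmonic p m P)
    (hQ : IsHarmonic p m Q) : IsHarmonic p m (P + Q) :=
  isHarmonic_iff.2 ⟨hP.1.add hQ.1, by rw [map_add, hP.lap_eq, hQ.lap_eq, add_zero]⟩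

theorem IsHarmonic.smul {P : MvPolynomial (Fin p) ℂ} (hP : IsHarmonic p m P) (c : ℂ) :
    IsHarmonic p m (c • P) :=
  isHarmonic_iff.2 ⟨by rw [MvPolynomial.smul_eq_C_mul]; exact hP.1.C_mul c,
    by rw [map_smul, hP.lap_eq, smul_zero]⟩

/-- Multiplication of a harmonic polynomial by a coordinate. -/
theorem IsHarmonic.X_mul {P : MvPolynomial (Fin p) ℂ} (hP : IsHarmonic p m P) (j : Fin p) :
    ∃ (P₁ P₂ : MvPolynomial (Fin p) ℂ) (m' : ℕ), IsHarmonic p (m + 1) P₁ ∧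
      IsHarmonic p m' P₂ ∧ (P₂ = 0 ∨ m = m' + 1) ∧ X j * P = P₁ + rsq p * P₂ := by
  rcases m with _ | m
  · refine ⟨X j * P, 0, 0, isHarmonic_iff.2 ⟨?_, ?_⟩, isHarmonic_zero, Or.inl rfl, by simp⟩
    · rw [add_comm]
      exact (MvPolynomial.isHomogeneous_X ℂ j).mul hP.1
    · rw [lap_X_mul, hP.lap_eq, pderiv_of_isHomogeneous_zero hP.1]
      simp
  -- Δ(x_j P) = 2 ∂_j P while Δ(|x|² Q) = (2p + 4m) Q for Q harmonic of degree m. This fixes the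
  -- multiple of |x|² ∂_j P to subtract.
  · have hp : (2 * p + 4 * m : ℂ) ≠ 0 := by
      have := j.pos
      exact_mod_cast (by omega : 2 * p + 4 * m ≠ 0)
    have hd := hP.pderiv_succ j
    have h2 := hd.smul (2 / (2 * p + 4 * m : ℂ))
    refine ⟨X j * P - rsq p * ((2 / (2 * p + 4 * m : ℂ)) • pderiv j P),
      (2 / (2 * p + 4 * m : ℂ)) • pderiv j P, m, isHarmonic_iff.2 ⟨?_, ?_⟩, h2, Or.inr rfl,
      by ring⟩
    · refine MvPolynomial.IsHomogeneous.sub ?_ ?_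
      · rw [add_comm]
        exact (MvPolynomial.isHomogeneous_X ℂ j).mul hP.1
      · rw [show m + 1 + 1 = 2 + m by ring]
        exact rsq_isHomogeneous.mul h2.1
    · rw [map_sub, lap_X_mul, lap_rsq_mul h2.1, hP.lap_eq, h2.lap_eq, MvPolynomial.smul_eq_C_mul,
        ← mul_assoc, ← map_mul, mul_div_cancel₀ _ hp, map_ofNat]
      simp

/-- The rotation operator `x_i ∂_l - x_l ∂_i`. -/
def rotPoly (i l : Fin p) (P : MvPolynomial (Fin p) ℂ) : MvPolynomial (Fin p) ℂ :=
  X i * pderiv l P - X l * pderiv i P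

theorem fderiv_polyVal_rotGen (i l : Fin p) (P : MvPolynomial (Fin p) ℂ)
    (x : EuclideanSpace ℝ (Fin p)) :
    fderiv ℝ (polyVal P) x (rotGen i l x) = polyVal (rotPoly i l P) x := by
  have h : ∀ l : Fin p, fderiv ℝ (polyVal P) x (EuclideanSpace.single l (1 : ℝ)) =
      polyVal (pderiv l P) x := fun l => by
    rw [fderiv_polyVal, Finset.sum_eq_single l (fun i _ hi => by simp [hi]) (by simp)]
    simp
  rw [rotGen_apply, map_sub, map_smul, map_smul, h, h, rotPoly, polyVal_sub, polyVal_mul,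
    polyVal_mul, polyVal_X, polyVal_X]
  simp

theorem IsHarmonic.rotPoly {P : MvPolynomial (Fin p) ℂ} (hP : IsHarmonic p m P) (i l : Fin p) :
    IsHarmonic p m (rotPoly i l P) := by
  rcases m with _ | m
  · rw [LightCone.rotPoly, pderiv_of_isHomogeneous_zero hP.1, pderiv_of_isHomogeneous_zero hP.1]
    simpa using isHarmonic_zero
  · refine isHarmonic_iff.2 ⟨?_, ?_⟩
    · rw [add_comm]
      exact ((MvPolynomial.isHomogeneous_X ℂ i).mul (hP.pderiv_succ l).1).sub
        ((MvPolynomial.isHomogeneous_X ℂ l).mul (hP.pderiv_succ i).1)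
    · rw [LightCone.rotPoly, map_sub, lap_X_mul, lap_X_mul, (hP.pderiv_succ l).lap_eq,
        (hP.pderiv_succ i).lap_eq, pderiv_comm]
      ring

/-- The eigenvalue of minus the spherical Laplacian on harmonics of degree `m`. -/
def lam (p m : ℕ) : ℝ := m * (m + p - 2)

/-- The sum over all (i, l) counts every plane twice, whence the factor 2. Euler's identity for P
and for its partial derivatives removes all first-order terms, and harmonicity removes |x|² Δ. -/
theorem IsHarmonic.sum_rotPoly {P : MvPolynomial (Fin p) ℂ} (hP : IsHarmonic p m P) :
    ∑ i, ∑ l, LightCone.rotPoly i l (LightCone.rotPoly i l P) = C (-2 * (lam p m : ℂ)) * P := by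
  have hE : ∑ i, X i * pderiv i P = C (m : ℂ) * P := by
    rw [hP.1.sum_X_mul_pderiv]
    simp
  have hE2 : ∀ i, ∑ l, X l * pderiv l (pderiv i P) = C (m - 1 : ℂ) * pderiv i P := fun i => by
    have h := congrArg (pderiv i) hE
    simp only [map_sum, MvPolynomial.pderiv_mul, MvPolynomial.pderiv_C_mul,
      Finset.sum_add_distrib] at h
    rw [Finset.sum_eq_single i (fun l _ hl => by simp [MvPolynomial.pderiv_X, hl]) (by simp)] at h
    simp only [MvPolynomial.pderiv_X_self, one_mul, pderiv_comm i, MvPolynomial.pderiv_C,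
      zero_mul, zero_add] at h
    rw [map_sub, sub_mul, ← h]
    simp
  have hlap := hP.2
  -- The square of a rotation operator splits as A i l + A l i, so by symmetry one double sum
  -- suffices.
  let A : Fin p → Fin p → MvPolynomial (Fin p) ℂ := fun i l =>
    X i * (if l = i then pderiv i P else 0) + X i ^ 2 * pderiv l (pderiv l P) -
      X i * pderiv i P - X i * (X l * pderiv l (pderiv i P))
  have h1 : ∀ i l, LightCone.rotPoly i l (LightCone.rotPoly i l P) = A i l + A l i := by
    intro i l
    simp only [LightCone.rotPoly, A, map_sub, MvPolynomial.pderiv_mul, MvPolynomial.pderiv_X_self,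
      pderiv_comm i l]
    by_cases h : l = i
    · subst h
      simp
      ring
    · simp only [MvPolynomial.pderiv_X_of_ne (Ne.symm h), MvPolynomial.pderiv_X_of_ne h, h,
        Ne.symm h, if_false]
      ring
  have h2 : ∑ i, ∑ l, A i l = C (-(lam p m : ℂ)) * P := by
    have h3 : ∀ i, ∑ l, A i l = X i * pderiv i P - C (p : ℂ) * (X i * pderiv i P) -
        C (m - 1 : ℂ) * (X i * pderiv i P) := fun i => by
      have e : ∑ l, A i l = X i * (∑ l, if l = i then pderiv i P else 0) +
          X i ^ 2 * ∑ l, pderiv l (pderiv l P) - ∑ _l : Fin p, X i * pderiv i P -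
          X i * ∑ l, X l * pderiv l (pderiv i P) := by
        simp only [A, Finset.sum_add_distrib, Finset.sum_sub_distrib, Finset.mul_sum]
      rw [e, hlap, hE2, Finset.sum_ite_eq' Finset.univ i, if_pos (Finset.mem_univ i),
        Finset.sum_const, Finset.card_univ, Fintype.card_fin, nsmul_eq_mul, map_natCast]
      ring
    simp only [h3, Finset.sum_sub_distrib, ← Finset.mul_sum, hE]
    simp only [lam, Complex.ofReal_mul, Complex.ofReal_sub, Complex.ofReal_add,
      Complex.ofReal_natCast, Complex.ofReal_ofNat, map_sub, map_mul, map_neg, map_add,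
      map_natCast, map_ofNat, map_one]
    ring
  simp only [h1, Finset.sum_add_distrib]
  rw [Finset.sum_comm (f := fun i l => A l i), h2]
  simp only [map_mul, map_neg, map_ofNat]
  ring

/-- Composition of a polynomial with an orthogonal transformation. -/
def compIso (A : EuclideanSpace ℝ (Fin p) ≃ₗᵢ[ℝ] EuclideanSpace ℝ (Fin p)) :
    MvPolynomial (Fin p) ℂ →ₐ[ℂ] MvPolynomial (Fin p) ℂ :=
  MvPolynomial.aeval fun i => ∑ k, C ((A.symm (EuclideanSpace.single i 1) k : ℝ) : ℂ) * X k

theorem isometry_apply (A : EuclideanSpace ℝ (Fin p) ≃ₗᵢ[ℝ] EuclideanSpace ℝ (Fin p))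
    (x : EuclideanSpace ℝ (Fin p)) (i : Fin p) :
    A x i = ∑ k, A.symm (EuclideanSpace.single i 1) k * x k := by
  have h : A x i = inner ℝ (EuclideanSpace.single i (1 : ℝ)) (A x) := by
    simp [EuclideanSpace.inner_single_left]
  rw [h, ← A.symm.inner_map_map, A.symm_apply_apply, PiLp.inner_apply]
  exact Finset.sum_congr rfl fun k _ => by simp [mul_comm]

theorem polyVal_compIso (A : EuclideanSpace ℝ (Fin p) ≃ₗᵢ[ℝ] EuclideanSpace ℝ (Fin p))
    (P : MvPolynomial (Fin p) ℂ) (x : EuclideanSpace ℝ (Fin p)) :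
    polyVal (compIso A P) x = polyVal P (A x) := by
  induction P using MvPolynomial.induction_on with
  | C c => simp [compIso]
  | add P Q hP hQ => rw [map_add, polyVal_add, polyVal_add, hP, hQ]
  | mul_X P i hP =>
    rw [map_mul, polyVal_mul, polyVal_mul, hP, polyVal_X, isometry_apply]
    congr 1
    simp [compIso, polyVal_sum, polyVal_mul]

theorem pderiv_compIso (A : EuclideanSpace ℝ (Fin p) ≃ₗᵢ[ℝ] EuclideanSpace ℝ (Fin p))
    (P : MvPolynomial (Fin p) ℂ) (k : Fin p) :
    pderiv k (compIso A P) = ∑ i, C ((A.symm (EuclideanSpace.single i 1) k : ℝ) : ℂ) *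
      compIso A (pderiv i P) := by
  induction P using MvPolynomial.induction_on with
  | C c => simp [compIso]
  | add P Q hP hQ => simp only [map_add, hP, hQ, mul_add, Finset.sum_add_distrib]
  | mul_X P j hP =>
    have h : pderiv k (compIso A (X j)) =
        C ((A.symm (EuclideanSpace.single j 1) k : ℝ) : ℂ) := by
      simp [compIso, MvPolynomial.pderiv_X, Pi.single_apply]
    have h2 : ∑ i, C ((A.symm (EuclideanSpace.single i 1) k : ℝ) : ℂ) *
        (compIso A P * compIso A (pderiv i (X j))) =
        compIso A P * C ((A.symm (EuclideanSpace.single j 1) k : ℝ) : ℂ) := by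
      rw [Finset.sum_eq_single j (fun i _ hi => by simp [MvPolynomial.pderiv_X, hi.symm])
        (by simp)]
      simp [mul_comm]
    rw [map_mul, MvPolynomial.pderiv_mul, hP, h, ← h2, Finset.sum_mul, ← Finset.sum_add_distrib]
    refine Finset.sum_congr rfl fun i _ => ?_
    rw [MvPolynomial.pderiv_mul, map_add, map_mul, map_mul]
    ring

theorem IsHarmonic.compIso {P : MvPolynomial (Fin p) ℂ} (hP : IsHarmonic p m P)
    (A : EuclideanSpace ℝ (Fin p) ≃ₗᵢ[ℝ] EuclideanSpace ℝ (Fin p)) :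
    IsHarmonic p m (compIso A P) := by
  refine isHarmonic_iff.2 ⟨?_, ?_⟩
  · have h := hP.1.aeval (φ := P) (n := 1)
      (fun i => ∑ k, C ((A.symm (EuclideanSpace.single i 1) k : ℝ) : ℂ) * X k)
      (fun i => MvPolynomial.IsHomogeneous.sum _ _ _ fun k _ => MvPolynomial.isHomogeneous_C_mul_X _ k)
    rw [one_mul] at h
    exact h
  -- The vectors A⁻¹e_i are orthonormal, so only the diagonal second derivatives survive the chain
  -- rule.
  · have hδ : ∀ i l : Fin p, ∑ k, C ((A.symm (EuclideanSpace.single i 1) k : ℝ) : ℂ) *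
        C ((A.symm (EuclideanSpace.single l 1) k : ℝ) : ℂ) =
        if i = l then (1 : MvPolynomial (Fin p) ℂ) else 0 := fun i l => by
      have h : ∑ k, (A.symm (EuclideanSpace.single i 1) k) * (A.symm (EuclideanSpace.single l 1) k) =
          if i = l then (1 : ℝ) else 0 := by
        have h := A.symm.inner_map_map (EuclideanSpace.single i (1 : ℝ))
          (EuclideanSpace.single l (1 : ℝ))
        rw [PiLp.inner_apply, EuclideanSpace.inner_single_left] at h
        simp only [map_one, one_mul, PiLp.single_apply] at h
        rw [← h]
        exact Finset.sum_congr rfl fun k _ => by simp [mul_comm]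
      simp only [← map_mul, ← Complex.ofReal_mul, ← map_sum, ← Complex.ofReal_sum, h]
      split_ifs <;> simp
    have h0 := hP.2
    have h3 : ∀ k, pderiv k (pderiv k (LightCone.compIso A P)) = ∑ i, ∑ l,
        (C ((A.symm (EuclideanSpace.single i 1) k : ℝ) : ℂ) *
          C ((A.symm (EuclideanSpace.single l 1) k : ℝ) : ℂ)) *
          LightCone.compIso A (pderiv l (pderiv i P)) := fun k => by
      rw [pderiv_compIso, map_sum]
      refine Finset.sum_congr rfl fun i _ => ?_
      rw [MvPolynomial.pderiv_C_mul, pderiv_compIso, Finset.mul_sum]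
      exact Finset.sum_congr rfl fun l _ => by ring
    have h4 : lap (LightCone.compIso A P) = ∑ i, ∑ l, (if i = l then 1 else 0) *
        LightCone.compIso A (pderiv l (pderiv i P)) := by
      rw [lap_apply, Finset.sum_congr rfl fun k _ => h3 k, Finset.sum_comm]
      refine Finset.sum_congr rfl fun i _ => ?_
      rw [Finset.sum_comm]
      refine Finset.sum_congr rfl fun l _ => ?_
      rw [← hδ, Finset.sum_mul]
    rw [h4]
    simp only [ite_mul, one_mul, zero_mul, Finset.sum_ite_eq, Finset.mem_univ, if_true]
    rw [← map_sum, h0, map_zero]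

end Polynomials


end

section

open MeasureTheory
open MvPolynomial (X C pderiv)

/-! ### K-types, spherical Laplacians and the boost formula -/

section KTypes

variable {p q : ℕ} {a : ℂ} {m n : ℕ}

/-- The element `j_a(h₁ ⊗ h₂)` of `S^a(X⁰)`. -/
def jS (a : ℂ) {h₁ : MvPolynomial (Fin p) ℂ} {h₂ : MvPolynomial (Fin q) ℂ}
    (H₁ : IsHarmonic p m h₁) (H₂ : IsHarmonic q n h₂) : S p q a :=
  S.mk (jFun a m n h₁ h₂) (jFun_mem a H₁ H₂)

theorem jS_apply {h₁ : MvPolynomial (Fin p) ℂ} {h₂ : MvPolynomial (Fin q) ℂ}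
    (H₁ : IsHarmonic p m h₁) (H₂ : IsHarmonic q n h₂) (w : cone p q) :
    jS a H₁ H₂ w = polyVal h₁ (w : Amb p q).1 * polyVal h₂ (w : Amb p q).2 *
    ((‖(w : Amb p q).1‖ : ℝ) : ℂ) ^ (a - m - n) := rfl

theorem jS_sphere {h₁ : MvPolynomial (Fin p) ℂ} {h₂ : MvPolynomial (Fin q) ℂ}
    (H₁ : IsHarmonic p m h₁) (H₂ : IsHarmonic q n h₂) (z : Spheres p q) :
    jS a H₁ H₂ (sphereIncl z) = polyVal h₁ z.1 * polyVal h₂ z.2 := by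
  rw [jS_apply, norm_fst_sphereIncl]
  simp [sphereIncl]

theorem jS_mem {h₁ : MvPolynomial (Fin p) ℂ} {h₂ : MvPolynomial (Fin q) ℂ}
    (H₁ : IsHarmonic p m h₁) (H₂ : IsHarmonic q n h₂) : jS a H₁ H₂ ∈ kType p q a m n :=
  Submodule.subset_span ⟨h₁, h₂, H₁, H₂, rfl⟩

theorem kType_le {W : Submodule ℂ (S p q a)}
    (h : ∀ (h₁ : MvPolynomial (Fin p) ℂ) (h₂ : MvPolynomial (Fin q) ℂ)
      (H₁ : IsHarmonic p m h₁) (H₂ : IsHarmonic q n h₂), jS a H₁ H₂ ∈ W) : kType p q a m n ≤ W := by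
  refine Submodule.span_le.2 ?_
  rintro _ ⟨h₁, h₂, H₁, H₂, rfl⟩
  exact h h₁ h₂ H₁ H₂

theorem kType_map_mem {W : Submodule ℂ (S p q a)} {b : ℂ} {T : S p q b →ₗ[ℂ] S p q a}
    (h : ∀ (h₁ : MvPolynomial (Fin p) ℂ) (h₂ : MvPolynomial (Fin q) ℂ)
      (H₁ : IsHarmonic p m h₁) (H₂ : IsHarmonic q n h₂), T (jS b H₁ H₂) ∈ W) {f : S p q b}
    (hf : f ∈ kType p q b m n) : T f ∈ W :=
  kType_le (W := W.comap T) h hf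

theorem kType_map_eq {M : Type*} [AddCommGroup M] [Module ℂ M] {T T' : S p q a →ₗ[ℂ] M}
    (h : ∀ (h₁ : MvPolynomial (Fin p) ℂ) (h₂ : MvPolynomial (Fin q) ℂ)
      (H₁ : IsHarmonic p m h₁) (H₂ : IsHarmonic q n h₂), T (jS a H₁ H₂) = T' (jS a H₁ H₂))
    {f : S p q a} (hf : f ∈ kType p q a m n) : T f = T' f :=
  kType_le (W := LinearMap.eqLocus T T') h hf

theorem act_kElt_jS {h₁ : MvPolynomial (Fin p) ℂ} {h₂ : MvPolynomial (Fin q) ℂ}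
    (H₁ : IsHarmonic p m h₁) (H₂ : IsHarmonic q n h₂)
    (A : EuclideanSpace ℝ (Fin p) ≃ₗᵢ[ℝ] EuclideanSpace ℝ (Fin p))
    (B : EuclideanSpace ℝ (Fin q) ≃ₗᵢ[ℝ] EuclideanSpace ℝ (Fin q)) :
    act (kElt A B) (jS a H₁ H₂) = jS a (H₁.compIso A) (H₂.compIso B) :=
  S.ext fun w => by
    simp only [act_apply, jS_apply, coneAct_coe, kElt_apply, polyVal_compIso,
      LinearIsometryEquiv.norm_map]

theorem act_kElt_mem {f : S p q a} (hf : f ∈ kType p q a m n)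
    (A : EuclideanSpace ℝ (Fin p) ≃ₗᵢ[ℝ] EuclideanSpace ℝ (Fin p))
    (B : EuclideanSpace ℝ (Fin q) ≃ₗᵢ[ℝ] EuclideanSpace ℝ (Fin q)) :
    act (kElt A B) f ∈ kType p q a m n :=
  kType_map_mem (fun h₁ h₂ H₁ H₂ => by rw [act_kElt_jS]; exact jS_mem _ _) hf

theorem D_rot_inl_jS {h₁ : MvPolynomial (Fin p) ℂ} {h₂ : MvPolynomial (Fin q) ℂ}
    (H₁ : IsHarmonic p m h₁) (H₂ : IsHarmonic q n h₂) (i : Fin p × Fin p) :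
    D (rot (Sum.inl i)) (jS a H₁ H₂) = jS a (H₁.rotPoly i.1 i.2) H₂ := by
  refine S.ext fun w => ?_
  have h := (isFlow_rot (q := q) (Sum.inl i)).hasDerivAt (jS a H₁ H₂) w 0
  have h1 := HasFDerivAt.comp_hasDerivAt (0 : ℝ)
    (((contDiff_polyVal h₁).differentiable (by simp) _).hasFDerivAt)
    (hasDerivAt_expEquiv (rotGen i.1 i.2) (w : Amb p q).1 0)
  have h2 := (h1.mul_const (polyVal h₂ (w : Amb p q).2)).mul_const
    (((‖(w : Amb p q).1‖ : ℝ) : ℂ) ^ (a - m - n))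
  rw [(isFlow_rot (q := q) (Sum.inl i)).zero] at h
  refine (h.unique (h2.congr_of_eventuallyEq (Filter.Eventually.of_forall fun t => ?_))).trans ?_
  · beta_reduce
    rw [jS_apply]
    simp only [coneAct_coe, rotFlow, kElt_apply, LinearIsometryEquiv.norm_map]
    rfl
  · rw [expEquiv_zero, fderiv_polyVal_rotGen]
    rfl

theorem D_rot_inr_jS {h₁ : MvPolynomial (Fin p) ℂ} {h₂ : MvPolynomial (Fin q) ℂ}
    (H₁ : IsHarmonic p m h₁) (H₂ : IsHarmonic q n h₂) (i : Fin q × Fin q) :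
    D (rot (Sum.inr i)) (jS a H₁ H₂) = jS a H₁ (H₂.rotPoly i.1 i.2) := by
  refine S.ext fun w => ?_
  have h := (isFlow_rot (p := p) (Sum.inr i)).hasDerivAt (jS a H₁ H₂) w 0
  have h1 := HasFDerivAt.comp_hasDerivAt (0 : ℝ)
    (((contDiff_polyVal h₂).differentiable (by simp) _).hasFDerivAt)
    (hasDerivAt_expEquiv (rotGen i.1 i.2) (w : Amb p q).2 0)
  have h2 := (h1.const_mul (polyVal h₁ (w : Amb p q).1)).mul_const
    (((‖(w : Amb p q).1‖ : ℝ) : ℂ) ^ (a - m - n))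
  rw [(isFlow_rot (p := p) (Sum.inr i)).zero] at h
  refine (h.unique (h2.congr_of_eventuallyEq (Filter.Eventually.of_forall fun t => ?_))).trans ?_
  · beta_reduce
    rw [jS_apply]
    simp only [coneAct_coe, rotFlow, kElt_apply]
    rfl
  · rw [expEquiv_zero, fderiv_polyVal_rotGen]
    rfl

theorem D_rot_mem {f : S p q a} (hf : f ∈ kType p q a m n) (i : RotIdx p q) :
    D (rot i) f ∈ kType p q a m n := by
  refine kType_map_mem (fun h₁ h₂ H₁ H₂ => ?_) hf
  rcases i with i | i
  · rw [D_rot_inl_jS]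
    exact jS_mem _ _
  · rw [D_rot_inr_jS]
    exact jS_mem _ _

/-- The Laplacian of the sphere `𝕊^{p-1}`. -/
def casL : S p q a →ₗ[ℂ] S p q a :=
  (1 / 2 : ℂ) • ∑ i, D (rot (Sum.inl i)) ∘ₗ D (rot (Sum.inl i))

/-- The Laplacian of the sphere `𝕊^{q-1}`. -/
def casR : S p q a →ₗ[ℂ] S p q a :=
  (1 / 2 : ℂ) • ∑ i, D (rot (Sum.inr i)) ∘ₗ D (rot (Sum.inr i))

/-- The Laplacian of `𝕊^{p-1} × 𝕊^{q-1}`. -/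
def cas : S p q a →ₗ[ℂ] S p q a := (1 / 2 : ℂ) • ∑ i, D (rot i) ∘ₗ D (rot i)

theorem cas_eq (f : S p q a) : cas f = casL f + casR f := by
  simp [cas, casL, casR, Fintype.sum_sum_type]

theorem cas_apply (f : S p q a) : cas f = (1 / 2 : ℂ) • ∑ i, D (rot i) (D (rot i) f) := by
  simp [cas]

theorem casL_apply (f : S p q a) :
    casL f = (1 / 2 : ℂ) • ∑ i, D (rot (Sum.inl i)) (D (rot (Sum.inl i)) f) := by
  simp [casL]

theorem casR_apply (f : S p q a) :
    casR f = (1 / 2 : ℂ) • ∑ i, D (rot (Sum.inr i)) (D (rot (Sum.inr i)) f) := by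
  simp [casR]

/-- The factor ½ in `casL` undoes the double counting in `IsHarmonic.sum_rotPoly`. -/
theorem casL_kType {f : S p q a} (hf : f ∈ kType p q a m n) : casL f = (-(lam p m) : ℂ) • f := by
  refine kType_map_eq (T' := (-(lam p m) : ℂ) • LinearMap.id) (fun h₁ h₂ H₁ H₂ => ?_) hf
  refine S.ext_sphere fun z => ?_
  have h := congrArg (fun P => polyVal P (z.1 : EuclideanSpace ℝ (Fin p))) H₁.sum_rotPoly
  simp only [polyVal_sum, polyVal_mul, polyVal_C] at h
  rw [casL_apply]
  simp only [S.smul_apply, S.sum_apply, D_rot_inl_jS, jS_sphere, LinearMap.smul_apply,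
    LinearMap.id_apply, ← Finset.sum_mul, Fintype.sum_prod_type, h]
  ring

theorem casR_kType {f : S p q a} (hf : f ∈ kType p q a m n) : casR f = (-(lam q n) : ℂ) • f := by
  refine kType_map_eq (T' := (-(lam q n) : ℂ) • LinearMap.id) (fun h₁ h₂ H₁ H₂ => ?_) hf
  refine S.ext_sphere fun z => ?_
  have h := congrArg (fun P => polyVal P (z.2 : EuclideanSpace ℝ (Fin q))) H₂.sum_rotPoly
  simp only [polyVal_sum, polyVal_mul, polyVal_C] at h
  rw [casR_apply]
  simp only [S.smul_apply, S.sum_apply, D_rot_inr_jS, jS_sphere, LinearMap.smul_apply,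
    LinearMap.id_apply, ← Finset.mul_sum, Fintype.sum_prod_type, h]
  ring

theorem cas_kType {f : S p q a} (hf : f ∈ kType p q a m n) :
    cas f = (-(lam p m + lam q n) : ℂ) • f := by
  rw [cas_eq, casL_kType hf, casR_kType hf, ← add_smul]
  congr 1
  ring

/-- The function `x_j / |x|`. -/
def uL (j : Fin p) : S p q 0 := jS 0 (isHarmonic_X j) isHarmonic_one

/-- The function `y_k / |x|`. -/
def uR (k : Fin q) : S p q 0 := jS 0 isHarmonic_one (isHarmonic_X k)

/-- The function `x_j y_k / |x|²`. -/
def uLR (j : Fin p) (k : Fin q) : S p q 0 := jS 0 (isHarmonic_X j) (isHarmonic_X k)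

theorem uL_sphere (j : Fin p) (z : Spheres p q) :
    uL j (sphereIncl z) = ((z.1 : EuclideanSpace ℝ (Fin p)) j : ℂ) := by
  simp [uL, jS_sphere]

theorem uR_sphere (k : Fin q) (z : Spheres p q) :
    uR k (sphereIncl z) = ((z.2 : EuclideanSpace ℝ (Fin q)) k : ℂ) := by
  simp [uR, jS_sphere]

theorem uLR_sphere (j : Fin p) (k : Fin q) (z : Spheres p q) :
    uLR j k (sphereIncl z) = ((z.1 : EuclideanSpace ℝ (Fin p)) j : ℂ) *
      ((z.2 : EuclideanSpace ℝ (Fin q)) k : ℂ) := by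
  simp [uLR, jS_sphere]

theorem mulOp_uLR (j : Fin p) (k : Fin q) (f : S p q a) :
    mulOp (uLR j k) f = mulOp (uL j) (mulOp (uR k) f) :=
  S.ext_sphere fun z => by simp [uLR_sphere, uL_sphere, uR_sphere, mul_assoc]

/-- Neighbouring degrees. -/
def nbr (m m' : ℕ) : Prop := m' = m + 1 ∨ m = m' + 1

theorem nbr.symm {m m' : ℕ} (h : nbr m m') : nbr m' m := Or.symm h

theorem polyVal_rsq_sphere (z : Sph p) : polyVal (rsq p) (z : EuclideanSpace ℝ (Fin p)) = 1 := by
  rw [polyVal_rsq]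
  simp

/-- On the unit sphere the factor |x|² in `IsHarmonic.X_mul` is 1, so both summands are genuine
K-type elements, of degrees m + 1 and m - 1. -/
theorem mulOp_uL_mem {f : S p q a} (hf : f ∈ kType p q a m n) (j : Fin p) :
    mulOp (uL j) f ∈ ⨆ (m' : ℕ) (_ : nbr m m'), kType p q a m' n := by
  refine kType_map_mem (fun h₁ h₂ H₁ H₂ => ?_) hf
  obtain ⟨P₁, P₂, m', hP₁, hP₂, hm, h⟩ := H₁.X_mul j
  have e : mulOp (uL j) (jS a H₁ H₂) = jS a hP₁ H₂ + jS a hP₂ H₂ := S.ext_sphere fun z => by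
    have h' := congrArg (fun P => polyVal P (z.1 : EuclideanSpace ℝ (Fin p))) h
    simp only [polyVal_add, polyVal_mul, polyVal_X, polyVal_rsq_sphere] at h'
    simp only [mulOp_apply, S.add_apply, jS_sphere, uL_sphere, ← mul_assoc, h']
    ring
  rw [e]
  refine Submodule.add_mem _ ?_ ?_
  · exact Submodule.mem_iSup_of_mem (m + 1) (Submodule.mem_iSup_of_mem (Or.inl rfl) (jS_mem _ _))
  · rcases hm with rfl | hm
    · convert Submodule.zero_mem _
      exact S.ext_sphere fun z => by simp [jS_sphere, polyVal]
    · exact Submodule.mem_iSup_of_mem m' (Submodule.mem_iSup_of_mem (Or.inr hm) (jS_mem _ _))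

theorem mulOp_uR_mem {f : S p q a} (hf : f ∈ kType p q a m n) (k : Fin q) :
    mulOp (uR k) f ∈ ⨆ (n' : ℕ) (_ : nbr n n'), kType p q a m n' := by
  refine kType_map_mem (fun h₁ h₂ H₁ H₂ => ?_) hf
  obtain ⟨P₁, P₂, n', hP₁, hP₂, hn, h⟩ := H₂.X_mul k
  have e : mulOp (uR k) (jS a H₁ H₂) = jS a H₁ hP₁ + jS a H₁ hP₂ := S.ext_sphere fun z => by
    have h' := congrArg (fun P => polyVal P (z.2 : EuclideanSpace ℝ (Fin q))) h
    simp only [polyVal_add, polyVal_mul, polyVal_X, polyVal_rsq_sphere] at h'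
    simp only [mulOp_apply, S.add_apply, jS_sphere, uR_sphere, mul_left_comm _ (polyVal h₁ _), h']
    ring
  rw [e]
  refine Submodule.add_mem _ ?_ ?_
  · exact Submodule.mem_iSup_of_mem (n + 1) (Submodule.mem_iSup_of_mem (Or.inl rfl) (jS_mem _ _))
  · rcases hn with rfl | hn
    · convert Submodule.zero_mem _
      exact S.ext_sphere fun z => by simp [jS_sphere, polyVal]
    · exact Submodule.mem_iSup_of_mem n' (Submodule.mem_iSup_of_mem (Or.inr hn) (jS_mem _ _))

/-- The sum of the `K`-types neighbouring `(m, n)`. -/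
def nbrSum (p q : ℕ) (a : ℂ) (m n : ℕ) : Submodule ℂ (S p q a) :=
  ⨆ (σ : ℕ × ℕ) (_ : nbr m σ.1 ∧ nbr n σ.2), kType p q a σ.1 σ.2

theorem mulOp_uLR_mem {f : S p q a} (hf : f ∈ kType p q a m n) (j : Fin p) (k : Fin q) :
    mulOp (uLR j k) f ∈ nbrSum p q a m n := by
  rw [mulOp_uLR]
  have h : (⨆ (n' : ℕ) (_ : nbr n n'), kType p q a m n') ≤
      (nbrSum p q a m n).comap (mulOp (uL j)) := by
    refine iSup₂_le fun n' hn' g hg => ?_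
    have h2 : (⨆ (m' : ℕ) (_ : nbr m m'), kType p q a m' n') ≤ nbrSum p q a m n :=
      iSup₂_le fun m' hm' => le_iSup₂_of_le (f := fun (σ : ℕ × ℕ)
        (_ : nbr m σ.1 ∧ nbr n σ.2) => kType p q a σ.1 σ.2) (m', n') ⟨hm', hn'⟩ le_rfl
    exact h2 (mulOp_uL_mem hg j)
  exact h (mulOp_uR_mem hf k)

/-- The bilinear gradient pairing of `u` and `f`. -/
def Gam (u : S p q 0) (f : S p q a) : S p q a :=
  (1 / 2 : ℂ) • ∑ i, mulOp (D (rot i) u) (D (rot i) f)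

/-- Leibniz for a second-order operator without constant term; `Gam` is its carré du champ. -/
theorem cas_mulOp (u : S p q 0) (f : S p q a) :
    cas (mulOp u f) = mulOp (cas u) f + mulOp u (cas f) + (2 : ℂ) • Gam u f := by
  refine S.ext fun w => ?_
  simp only [cas_apply, Gam, D_mulOp, map_add, S.add_apply, S.smul_apply, S.sum_apply,
    mulOp_apply, Finset.sum_add_distrib, mul_add]
  simp only [Finset.mul_sum, Finset.sum_mul, ← Finset.sum_add_distrib]
  refine Finset.sum_congr rfl fun i _ => ?_
  ring

theorem cas_uLR (j : Fin p) (k : Fin q) : cas (uLR j k) = (-(p + q - 2) : ℂ) • uLR j k := by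
  rw [uLR, cas_kType (jS_mem _ _)]
  congr 1
  simp [lam]
  ring

theorem hasDerivAt_ofReal_cpow_one (a : ℂ) : HasDerivAt (fun s : ℝ => (s : ℂ) ^ a) a 1 := by
  have h := (((hasDerivAt_id (1 : ℂ)).cpow_const (c := a) (by simp)).comp_ofReal (z := 1))
  simpa using h

/-- Euler's identity in x alone. Its companion in y has eigenvalue zero, since the pullback has
degree 0 in y. -/
theorem fderiv_pullback_fst (f : S p q a) {w : Amb p q} (hw : w ∈ dom p q) :
    fderiv ℝ (pullback f.toFun) w (w.1, 0) = a * pullback f.toFun w := by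
  have h1 : HasDerivAt (fun s : ℝ => ((s • w.1, (1 : ℝ) • w.2) : Amb p q)) (w.1, 0) 1 := by
    simpa using ((hasDerivAt_id (1 : ℝ)).smul_const w.1).prodMk (hasDerivAt_const (1 : ℝ) ((1 : ℝ) • w.2))
  have e : (((1 : ℝ) • w.1, (1 : ℝ) • w.2) : Amb p q) = w := by simp
  have h2 : HasFDerivAt (pullback f.toFun) (fderiv ℝ (pullback f.toFun) w)
      ((1 : ℝ) • w.1, (1 : ℝ) • w.2) := by
    rw [e]
    exact (differentiableAt_pullback f hw).hasFDerivAt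
  have h3 := HasFDerivAt.comp_hasDerivAt (1 : ℝ) h2 h1
  refine h3.unique (((hasDerivAt_ofReal_cpow_one a).mul_const _).congr_of_eventuallyEq ?_)
  filter_upwards [lt_mem_nhds (zero_lt_one (α := ℝ))] with s hs
  exact pullback_smul f hs one_pos hw

theorem fderiv_pullback_snd (f : S p q a) {w : Amb p q} (hw : w ∈ dom p q) :
    fderiv ℝ (pullback f.toFun) w (0, w.2) = 0 := by
  have h1 : HasDerivAt (fun s : ℝ => (((1 : ℝ) • w.1, s • w.2) : Amb p q)) (0, w.2) 1 := by
    simpa using (hasDerivAt_const (1 : ℝ) ((1 : ℝ) • w.1)).prodMk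
      ((hasDerivAt_id (1 : ℝ)).smul_const w.2)
  have e : (((1 : ℝ) • w.1, (1 : ℝ) • w.2) : Amb p q) = w := by simp
  have h2 : HasFDerivAt (pullback f.toFun) (fderiv ℝ (pullback f.toFun) w)
      ((1 : ℝ) • w.1, (1 : ℝ) • w.2) := by
    rw [e]
    exact (differentiableAt_pullback f hw).hasFDerivAt
  have h3 := HasFDerivAt.comp_hasDerivAt (1 : ℝ) h2 h1
  refine h3.unique ((hasDerivAt_const (1 : ℝ) (pullback f.toFun w)).congr_of_eventuallyEq ?_)
  filter_upwards [lt_mem_nhds (zero_lt_one (α := ℝ))] with s hs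
  simpa using pullback_smul f one_pos hs hw

/-- Contracting the rotation fields with x recovers the tangential part of e_l. With the Euler
identities for the radial directions, rotations then determine the whole gradient (`grad_fst`,
`grad_snd`). -/
theorem sum_smul_rotGen (x : EuclideanSpace ℝ (Fin p)) (l : Fin p) :
    ∑ i, x i • rotGen i l x = ‖x‖ ^ 2 • EuclideanSpace.single l (1 : ℝ) - x l • x := by
  have hn : ‖x‖ ^ 2 = ∑ i, x i ^ 2 := by
    rw [EuclideanSpace.norm_sq_eq]
    simp
  rw [hn]
  ext k
  simp [rotGen_apply, Finset.sum_sub_distrib, mul_sub,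
    Pi.single_apply, pow_two]
  ring

theorem grad_fst (f : S p q a) {w : Amb p q} (hw : w ∈ dom p q) (l : Fin p) :
    ∑ i, (w.1 i : ℂ) * fderiv ℝ (pullback f.toFun) w (rot (Sum.inl (i, l)) w) =
      ((‖w.1‖ ^ 2 : ℝ) : ℂ) * fderiv ℝ (pullback f.toFun) w (EuclideanSpace.single l (1 : ℝ), 0) -
        (w.1 l : ℂ) * (a * pullback f.toFun w) := by
  have h : ∑ i, w.1 i • rot (Sum.inl (i, l)) w = ‖w.1‖ ^ 2 •
      ((EuclideanSpace.single l (1 : ℝ), 0) : Amb p q) - w.1 l • ((w.1, 0) : Amb p q) := by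
    refine Prod.ext ?_ ?_
    · rw [Prod.fst_sum]
      exact sum_smul_rotGen w.1 l
    · rw [Prod.snd_sum]
      simp [rot]
  have h2 := congrArg (fderiv ℝ (pullback f.toFun) w) h
  rw [map_sub, map_smul, map_smul, fderiv_pullback_fst f hw, map_sum] at h2
  simpa [map_smul] using h2

theorem grad_snd (f : S p q a) {w : Amb p q} (hw : w ∈ dom p q) (l : Fin q) :
    ∑ i, (w.2 i : ℂ) * fderiv ℝ (pullback f.toFun) w (rot (Sum.inr (i, l)) w) =
      ((‖w.2‖ ^ 2 : ℝ) : ℂ) *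
        fderiv ℝ (pullback f.toFun) w (0, EuclideanSpace.single l (1 : ℝ)) := by
  have h : ∑ i, w.2 i • rot (Sum.inr (i, l)) w = ‖w.2‖ ^ 2 •
      ((0, EuclideanSpace.single l (1 : ℝ)) : Amb p q) - w.2 l • ((0, w.2) : Amb p q) := by
    refine Prod.ext ?_ ?_
    · rw [Prod.fst_sum]
      simp [rot]
    · rw [Prod.snd_sum]
      exact sum_smul_rotGen w.2 l
  have h2 := congrArg (fderiv ℝ (pullback f.toFun) w) h
  rw [map_sub, map_smul, map_smul, fderiv_pullback_snd f hw, map_sum] at h2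
  simpa [map_smul] using h2

theorem rotGen_swap (i l : Fin p) : rotGen l i = -rotGen i l := by
  simp [rotGen]

theorem D_rot_inl_swap (f : S p q a) (i l : Fin p) (w : cone p q) :
    D (rot (Sum.inl (l, i))) f w = -D (rot (Sum.inl (i, l))) f w := by
  rw [D_apply, D_apply, ← map_neg]
  congr 1
  refine Prod.ext ?_ (by simp [rot])
  simp [rot, rotGen_swap i l]

theorem D_rot_inr_swap (f : S p q a) (i l : Fin q) (w : cone p q) :
    D (rot (Sum.inr (l, i))) f w = -D (rot (Sum.inr (i, l))) f w := by
  rw [D_apply, D_apply, ← map_neg]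
  congr 1
  refine Prod.ext (by simp [rot]) ?_
  simp [rot, rotGen_swap i l]

theorem polyVal_rotPoly_X (i l j : Fin p) (x : EuclideanSpace ℝ (Fin p)) :
    polyVal (rotPoly i l (X j)) x =
      (if l = j then (x i : ℂ) else 0) - (if i = j then (x l : ℂ) else 0) := by
  simp only [rotPoly, polyVal_sub, polyVal_mul, polyVal_X, MvPolynomial.pderiv_X, Pi.single_apply,
    eq_comm (a := j)]
  split_ifs <;> simp [polyVal]

/-- The boost operators in terms of spherical gradients. -/
theorem D_boost_eq_Gam (j : Fin p) (k : Fin q) (f : S p q a) :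
    D (boost j k) f = Gam (uLR j k) f + a • mulOp (uLR j k) f := by
  refine S.ext_sphere fun z => ?_
  have hw := mem_dom (sphereIncl z)
  have h1 := grad_fst f hw j
  have h2 := grad_snd f hw k
  rw [norm_fst_sphereIncl, pullback_coe] at h1
  rw [norm_snd_sphereIncl] at h2
  simp only [one_pow, Complex.ofReal_one, one_mul] at h1 h2
  -- Antisymmetry in the two indices makes both halves of the sum equal; the resulting 2 cancels the
  -- ½ in `Gam`.
  have hx : ∑ i : Fin p × Fin p, polyVal (rotPoly i.1 i.2 (X j)) (z.1 : EuclideanSpace ℝ (Fin p)) *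
      D (rot (Sum.inl i)) f (sphereIncl z) = 2 * ∑ i,
      ((z.1 : EuclideanSpace ℝ (Fin p)) i : ℂ) * D (rot (Sum.inl (i, j))) f (sphereIncl z) := by
    simp only [polyVal_rotPoly_X, sub_mul, Finset.sum_sub_distrib, Fintype.sum_prod_type, ite_mul,
      zero_mul, Finset.sum_ite_eq', Finset.mem_univ, if_true]
    rw [Finset.sum_comm (f := fun x y => if x = j then _ else _)]
    simp only [Finset.sum_ite_eq', Finset.mem_univ, if_true]
    rw [two_mul, sub_eq_add_neg, ← Finset.sum_neg_distrib]
    congr 1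
    exact Finset.sum_congr rfl fun i _ => by rw [D_rot_inl_swap]; ring
  have hy : ∑ i : Fin q × Fin q, polyVal (rotPoly i.1 i.2 (X k)) (z.2 : EuclideanSpace ℝ (Fin q)) *
      D (rot (Sum.inr i)) f (sphereIncl z) = 2 * ∑ i,
      ((z.2 : EuclideanSpace ℝ (Fin q)) i : ℂ) * D (rot (Sum.inr (i, k))) f (sphereIncl z) := by
    simp only [polyVal_rotPoly_X, sub_mul, Finset.sum_sub_distrib, Fintype.sum_prod_type, ite_mul,
      zero_mul, Finset.sum_ite_eq', Finset.mem_univ, if_true]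
    rw [Finset.sum_comm (f := fun x y => if x = k then _ else _)]
    simp only [Finset.sum_ite_eq', Finset.mem_univ, if_true]
    rw [two_mul, sub_eq_add_neg, ← Finset.sum_neg_distrib]
    congr 1
    exact Finset.sum_congr rfl fun i _ => by rw [D_rot_inr_swap]; ring
  have hb : D (boost j k) f (sphereIncl z) =
      ((z.2 : EuclideanSpace ℝ (Fin q)) k : ℂ) *
        fderiv ℝ (pullback f.toFun) (sphereIncl z) (EuclideanSpace.single j (1 : ℝ), 0) +
      ((z.1 : EuclideanSpace ℝ (Fin p)) j : ℂ) *
        fderiv ℝ (pullback f.toFun) (sphereIncl z) (0, EuclideanSpace.single k (1 : ℝ)) := by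
    have e : boost j k (sphereIncl z : Amb p q) =
      (z.2 : EuclideanSpace ℝ (Fin q)) k • ((EuclideanSpace.single j (1 : ℝ), 0) : Amb p q) +
      (z.1 : EuclideanSpace ℝ (Fin p)) j • ((0, EuclideanSpace.single k (1 : ℝ)) : Amb p q) := by
      rw [boost_apply]
      simp [sphereIncl]
    rw [D_apply, e, map_add, map_smul, map_smul]
    simp
  have hG : Gam (uLR j k) f (sphereIncl z) =
      ((z.2 : EuclideanSpace ℝ (Fin q)) k : ℂ) * ∑ i,
      ((z.1 : EuclideanSpace ℝ (Fin p)) i : ℂ) * D (rot (Sum.inl (i, j))) f (sphereIncl z) +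
      ((z.1 : EuclideanSpace ℝ (Fin p)) j : ℂ) * ∑ i,
      ((z.2 : EuclideanSpace ℝ (Fin q)) i : ℂ) * D (rot (Sum.inr (i, k))) f (sphereIncl z) := by
    have e1 : ∀ i, polyVal (rotPoly i.1 i.2 (X j)) (z.1 : EuclideanSpace ℝ (Fin p)) *
        ((z.2 : EuclideanSpace ℝ (Fin q)) k : ℂ) * D (rot (Sum.inl i)) f (sphereIncl z) =
        ((z.2 : EuclideanSpace ℝ (Fin q)) k : ℂ) *
        (polyVal (rotPoly i.1 i.2 (X j)) (z.1 : EuclideanSpace ℝ (Fin p)) *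
          D (rot (Sum.inl i)) f (sphereIncl z)) := fun i => by ring
    simp only [Gam, uLR, S.smul_apply, S.sum_apply, mulOp_apply, Fintype.sum_sum_type,
      S.add_apply, D_rot_inl_jS, D_rot_inr_jS, jS_sphere, polyVal_X, e1, mul_assoc (((z.1 : EuclideanSpace ℝ (Fin p)) j : ℂ))]
    rw [← Finset.mul_sum, ← Finset.mul_sum, hx, hy]
    ring
  simp only [D_apply] at hG
  rw [hb, S.add_apply, S.smul_apply, mulOp_apply, uLR_sphere, hG]
  change ∑ i, ((z.1 : EuclideanSpace ℝ (Fin p)) i : ℂ) * _ = _ - ((z.1 : EuclideanSpace ℝ (Fin p)) j : ℂ) * _ at h1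
  change ∑ i, ((z.2 : EuclideanSpace ℝ (Fin q)) i : ℂ) * _ = _ at h2
  rw [h1, h2]
  ring

/-- The boost operators in terms of the Laplacian and multiplication operators. -/
theorem D_boost_eq (j : Fin p) (k : Fin q) (f : S p q a) :
    D (boost j k) f = (1 / 2 : ℂ) • (cas (mulOp (uLR j k) f) - mulOp (uLR j k) (cas f)) +
      (a + (p + q - 2) / 2) • mulOp (uLR j k) f := by
  -- Solving `cas_mulOp` for `Gam` turns the eigenvalue -(p+q-2) of `uLR j k` into the shift
  -- (p+q-2)/2.
  rw [D_boost_eq_Gam, cas_mulOp, cas_uLR]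
  refine S.ext fun w => ?_
  simp only [S.add_apply, S.smul_apply, S.sub_apply, mulOp_apply]
  ring

end KTypes


end

section

open MeasureTheory
open MvPolynomial (X C pderiv)

/-! ### The L² inner product, orthogonality of K-types, the invariant integral -/

section Inner

variable {p q : ℕ} {a b c : ℂ} {m n m' n' : ℕ}

theorem D_conj (J : Amb p q →L[ℝ] Amb p q) (f : S p q a) :
    D J (S.conj f) = S.conj (D J f) := by
  refine S.ext fun w => ?_
  have e : pullback (S.conj f).toFun = fun w => conj (pullback f.toFun w) := by
    classical
    funext w
    simp only [pullback, Function.extend_def]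
    split_ifs <;> simp
  have h := (Complex.conjCLE.toContinuousLinearMap.hasFDerivAt).comp (w : Amb p q)
    (differentiableAt_pullback f (mem_dom w)).hasFDerivAt
  rw [D_apply, e, S.conj_apply, D_apply]
  exact congrArg (fun L => L (J w)) h.fderiv

variable [NeZero p] [NeZero q]

/-- The Hilbert space `L²(𝕊^{p-1} × 𝕊^{q-1})`. -/
abbrev L2 (p q : ℕ) : Type := Lp ℂ 2 (mu p q)

/-- The restriction of an element of `S^a(X⁰)` as a square-integrable function. -/
def iota : S p q a →ₗ[ℂ] L2 p q := (ContinuousMap.toLp 2 (mu p q) ℂ).toLinearMap ∘ₗ res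

theorem iota_apply (f : S p q a) : iota f = ContinuousMap.toLp 2 (mu p q) ℂ (res f) := rfl

theorem iota_injective : Function.Injective (iota (p := p) (q := q) (a := a)) :=
  (ContinuousMap.toLp_injective (mu p q)).comp res_injective

theorem stdInner_eq_inner (f h : S p q a) : stdInner f h = inner ℂ (iota h) (iota f) := by
  rw [iota_apply, iota_apply, ContinuousMap.inner_toLp]
  rfl

theorem stdInner_eq_integ (f h : S p q a) : stdInner f h = integ (S.mul rfl f (S.conj h)) := rfl

theorem stdInner_conj (f h : S p q a) : conj (stdInner f h) = stdInner h f := by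
  rw [stdInner_eq_inner, stdInner_eq_inner, inner_conj_symm]

theorem stdInner_add_left (f g h : S p q a) :
    stdInner (f + g) h = stdInner f h + stdInner g h := by
  simp only [stdInner_eq_inner, map_add, inner_add_right]

theorem stdInner_add_right (f g h : S p q a) :
    stdInner f (g + h) = stdInner f g + stdInner f h := by
  simp only [stdInner_eq_inner, map_add, inner_add_left]

theorem stdInner_sub_left (f g h : S p q a) :
    stdInner (f - g) h = stdInner f h - stdInner g h := by
  simp only [stdInner_eq_inner, map_sub, inner_sub_right]

theorem stdInner_sub_right (f g h : S p q a) :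
    stdInner f (g - h) = stdInner f g - stdInner f h := by
  simp only [stdInner_eq_inner, map_sub, inner_sub_left]

theorem stdInner_smul_left (c : ℂ) (f h : S p q a) :
    stdInner (c • f) h = c * stdInner f h := by
  simp only [stdInner_eq_inner, map_smul, inner_smul_right]

theorem stdInner_smul_right (c : ℂ) (f h : S p q a) :
    stdInner f (c • h) = conj c * stdInner f h := by
  simp only [stdInner_eq_inner, map_smul, inner_smul_left]

@[simp] theorem stdInner_zero_left (h : S p q a) : stdInner 0 h = 0 := by
  simp [stdInner_eq_inner]

@[simp] theorem stdInner_zero_right (h : S p q a) : stdInner h 0 = 0 := by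
  simp [stdInner_eq_inner]

theorem stdInner_sum_left {ι : Type*} (s : Finset ι) (f : ι → S p q a) (h : S p q a) :
    stdInner (∑ i ∈ s, f i) h = ∑ i ∈ s, stdInner (f i) h := by
  simp only [stdInner_eq_inner, map_sum, inner_sum]

theorem stdInner_sum_right {ι : Type*} (s : Finset ι) (f : ι → S p q a) (h : S p q a) :
    stdInner h (∑ i ∈ s, f i) = ∑ i ∈ s, stdInner h (f i) := by
  simp only [stdInner_eq_inner, map_sum, sum_inner]

/-- The inner product against a fixed function. -/
def stdL (h : S p q a) : S p q a →ₗ[ℂ] ℂ where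
  toFun f := stdInner f h
  map_add' f g := stdInner_add_left f g h
  map_smul' c f := stdInner_smul_left c f h

theorem stdInner_self (f : S p q a) : stdInner f f = ((‖iota f‖ ^ 2 : ℝ) : ℂ) := by
  rw [stdInner_eq_inner, inner_self_eq_norm_sq_to_K]
  simp

theorem stdInner_self_eq_zero {f : S p q a} : stdInner f f = 0 ↔ f = 0 := by
  rw [stdInner_eq_inner, inner_self_eq_zero, map_eq_zero_iff _ iota_injective]

theorem norm_stdInner_le (f h : S p q a) : ‖stdInner f h‖ ≤ ‖iota f‖ * ‖iota h‖ := by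
  rw [stdInner_eq_inner, mul_comm]
  exact norm_inner_le_norm _ _

theorem norm_iota_sq (f : S p q a) : ‖iota f‖ ^ 2 = ∫ z, ‖f (sphereIncl z)‖ ^ 2 ∂(mu p q) := by
  have h : ((‖iota f‖ ^ 2 : ℝ) : ℂ) = ((∫ z, ‖f (sphereIncl z)‖ ^ 2 ∂(mu p q) : ℝ) : ℂ) := by
    rw [← stdInner_self, stdInner]
    refine Eq.trans (integral_congr_ae (Filter.Eventually.of_forall fun z => ?_)) integral_ofReal
    simp only [Complex.mul_conj, Complex.normSq_eq_norm_sq]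
    rfl
  exact_mod_cast h

/-- Integration by parts: the derivative of f · conj h along a rotation integrates to zero. -/
theorem stdInner_D_rot (i : RotIdx p q) (f h : S p q a) :
    stdInner (D (rot i) f) h = -stdInner f (D (rot i) h) := by
  have e := integ_D_rot i (S.mul rfl f (S.conj h))
  rw [D_mul, map_add, D_conj] at e
  exact eq_neg_of_add_eq_zero_left e

theorem stdInner_casL (f h : S p q a) : stdInner (casL f) h = stdInner f (casL h) := by
  simp only [casL_apply, stdInner_smul_left, stdInner_smul_right, stdInner_sum_left,
    stdInner_sum_right, stdInner_D_rot, neg_neg]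
  simp [Complex.conj_ofNat]

theorem stdInner_casR (f h : S p q a) : stdInner (casR f) h = stdInner f (casR h) := by
  simp only [casR_apply, stdInner_smul_left, stdInner_smul_right, stdInner_sum_left,
    stdInner_sum_right, stdInner_D_rot, neg_neg]
  simp [Complex.conj_ofNat]

theorem stdInner_cas (f h : S p q a) : stdInner (cas f) h = stdInner f (cas h) := by
  rw [cas_eq, cas_eq, stdInner_add_left, stdInner_add_right, stdInner_casL, stdInner_casR]

theorem stdInner_mulOp_uLR (j : Fin p) (k : Fin q) (f h : S p q a) :
    stdInner (mulOp (uLR j k) f) h = stdInner f (mulOp (uLR j k) h) := by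
  refine integral_congr_ae (Filter.Eventually.of_forall fun z => ?_)
  simp only [mulOp_apply, uLR_sphere, map_mul, Complex.conj_ofReal]
  ring

theorem stdInner_act_kElt (A : EuclideanSpace ℝ (Fin p) ≃ₗᵢ[ℝ] EuclideanSpace ℝ (Fin p))
    (B : EuclideanSpace ℝ (Fin q) ≃ₗᵢ[ℝ] EuclideanSpace ℝ (Fin q)) (f h : S p q a) :
    stdInner (act (kElt A B) f) (act (kElt A B) h) = stdInner f h := by
  rw [stdInner_eq_integ, stdInner_eq_integ, ← act_conj, ← act_S_mul, integ_act_kElt]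

/-- The eigenvalue is quadratic in the degree, so two degrees collide only when symmetric about (2 -
p)/2. For p ≥ 1 this leaves just the degrees 0 and 1 on 𝕊⁰. -/
theorem lam_injOn {m m' : ℕ} (h : lam p m = lam p m') (hne : m ≠ m') : m + m' + p = 2 := by
  have h1 : ((m : ℝ) - m') * (m + m' + p - 2) = 0 := by
    simp only [lam] at h
    linear_combination h
  rcases mul_eq_zero.1 h1 with h2 | h2
  · exact absurd (by exact_mod_cast sub_eq_zero.1 h2) hne
  · have : (m : ℝ) + m' + p = 2 := by linarith
    exact_mod_cast this

/-- The antipodal map separates degrees 0 and 1 on 𝕊⁰, the one case in which the Laplacian does not.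
-/
theorem act_neg_left {f : S p q a} (hf : f ∈ kType p q a m n) :
    act (kElt (LinearIsometryEquiv.neg ℝ) (LinearIsometryEquiv.refl ℝ _)) f =
      ((-1) ^ m : ℂ) • f := by
  refine kType_map_eq (T' := ((-1) ^ m : ℂ) • LinearMap.id) (fun h₁ h₂ H₁ H₂ => ?_) hf
  refine S.ext fun w => ?_
  have h := polyVal_smul H₁.1 (-1) (w : Amb p q).1
  simp only [neg_smul, one_smul, Complex.ofReal_neg, Complex.ofReal_one] at h
  simp only [act_apply, jS_apply, coneAct_coe, kElt_apply, LinearMap.smul_apply, S.smul_apply,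
    LinearMap.id_apply, LinearIsometryEquiv.coe_neg, LinearIsometryEquiv.coe_refl, id, norm_neg, h]
  ring

theorem act_neg_right {f : S p q a} (hf : f ∈ kType p q a m n) :
    act (kElt (LinearIsometryEquiv.refl ℝ _) (LinearIsometryEquiv.neg ℝ)) f =
      ((-1) ^ n : ℂ) • f := by
  refine kType_map_eq (T' := ((-1) ^ n : ℂ) • LinearMap.id) (fun h₁ h₂ H₁ H₂ => ?_) hf
  refine S.ext fun w => ?_
  have h := polyVal_smul H₂.1 (-1) (w : Amb p q).2
  simp only [neg_smul, one_smul, Complex.ofReal_neg, Complex.ofReal_one] at h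
  simp only [act_apply, jS_apply, coneAct_coe, kElt_apply, LinearMap.smul_apply, S.smul_apply,
    LinearMap.id_apply, LinearIsometryEquiv.coe_neg, LinearIsometryEquiv.coe_refl, id, h]
  ring

theorem parity_of_lam_eq (hp : 1 ≤ p) {m m' : ℕ} (h : lam p m = lam p m') (hne : m ≠ m') :
    ((-1) ^ m : ℂ) * conj ((-1) ^ m' : ℂ) = -1 := by
  have h1 := lam_injOn h hne
  have h2 : (m = 0 ∧ m' = 1) ∨ (m = 1 ∧ m' = 0) := by omega
  rcases h2 with ⟨rfl, rfl⟩ | ⟨rfl, rfl⟩ <;> simp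

/-- Distinct `K`-types are orthogonal. -/
theorem stdInner_kType_ne {f h : S p q a} (hf : f ∈ kType p q a m n) (hh : h ∈ kType p q a m' n')
    (hne : (m, n) ≠ (m', n')) : stdInner f h = 0 := by
  have hp : 1 ≤ p := NeZero.one_le
  have hq : 1 ≤ q := NeZero.one_le
  by_cases hm : m = m'
  · have hn : n ≠ n' := fun hn => hne (by rw [hm, hn])
    by_cases hl : lam q n = lam q n'
    · have e := stdInner_act_kElt (LinearIsometryEquiv.refl ℝ _) (LinearIsometryEquiv.neg ℝ) f h
      rw [act_neg_right hf, act_neg_right hh, stdInner_smul_left, stdInner_smul_right, ← mul_assoc,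
        parity_of_lam_eq hq hl hn] at e
      linear_combination (-1 / 2 : ℂ) * e
    · have e := stdInner_casR f h
      rw [casR_kType hf, casR_kType hh, stdInner_smul_left, stdInner_smul_right] at e
      simp only [map_neg, Complex.conj_ofReal] at e
      have e2 : ((lam q n : ℂ) - lam q n') * stdInner f h = 0 := by linear_combination -e
      exact (mul_eq_zero.1 e2).resolve_left
        (sub_ne_zero.2 fun h => hl (Complex.ofReal_injective h))
  · by_cases hl : lam p m = lam p m'
    · have e := stdInner_act_kElt (LinearIsometryEquiv.neg ℝ) (LinearIsometryEquiv.refl ℝ _) f h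
      rw [act_neg_left hf, act_neg_left hh, stdInner_smul_left, stdInner_smul_right, ← mul_assoc,
        parity_of_lam_eq hp hl hm] at e
      linear_combination (-1 / 2 : ℂ) * e
    · have e := stdInner_casL f h
      rw [casL_kType hf, casL_kType hh, stdInner_smul_left, stdInner_smul_right] at e
      simp only [map_neg, Complex.conj_ofReal] at e
      have e2 : ((lam p m : ℂ) - lam p m') * stdInner f h = 0 := by linear_combination -e
      exact (mul_eq_zero.1 e2).resolve_left
        (sub_ne_zero.2 fun h => hl (Complex.ofReal_injective h))

theorem integ_cas (f : S p q a) : integ (cas f) = 0 := by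
  rw [cas_apply, map_smul, map_sum]
  simp [integ_D_rot]

theorem integ_mulOp_cas (u : S p q 0) (f : S p q a) :
    integ (mulOp u (cas f)) = integ (mulOp (cas u) f) := by
  have h1 := integ_cas (mulOp u f)
  have h2 : integ (Gam u f) + integ (mulOp u (cas f)) = 0 := by
    have h3 : Gam u f + mulOp u (cas f) =
        (1 / 2 : ℂ) • ∑ i, D (rot i) (mulOp u (D (rot i) f)) := by
      simp only [Gam, cas_apply, D_mulOp, Finset.sum_add_distrib, smul_add, map_smul, map_sum]
    rw [← map_add, h3, map_smul, map_sum]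
    simp [integ_D_rot]
  rw [cas_mulOp, map_add, map_add, map_smul, smul_eq_mul] at h1
  linear_combination 2 * h2 - h1

/-- By Green's formula a boost in degree a integrates to (a + p + q - 2) ∫ u f, which is why the
degree 2 - p - q is singled out. -/
theorem integ_D_boost (j : Fin p) (k : Fin q) (f : S p q (2 - p - q)) :
    integ (D (boost j k) f) = 0 := by
  rw [D_boost_eq, map_add, map_smul, map_smul, map_sub, integ_cas, integ_mulOp_cas, cas_uLR]
  have : mulOp ((-(p + q - 2) : ℂ) • uLR j k) f = (-(p + q - 2) : ℂ) • mulOp (uLR j k) f :=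
    S.ext fun w => by simp only [mulOp_apply, S.smul_apply]; ring
  rw [this, map_smul]
  simp only [smul_eq_mul]
  ring

theorem integ_act_boost (j : Fin p) (k : Fin q) (t : ℝ) (f : S p q (2 - p - q)) :
    integ (act (boostFlow j k t) f) = integ f := by
  have hF := isFlow_boost j k
  have h : ∀ t, HasDerivAt (fun t => integ (act (boostFlow j k t) f)) 0 t := fun t => by
    have h1 := hF.hasDerivAt_integ (act (boostFlow j k t) f) 0
    rw [hF.zero, act_one, integ_D_boost] at h1
    rw [← sub_self t] at h1
    refine (h1.comp_sub_const t t).congr_of_eventuallyEq (Filter.Eventually.of_forall fun s => ?_)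
    change integ (act (boostFlow j k s) f) =
      integ (act (boostFlow j k (s - t)) (act (boostFlow j k t) f))
    rw [← act_mul, ← hF.add, add_sub_cancel]
  have h2 := is_const_of_deriv_eq_zero (fun t => (h t).differentiableAt) (fun t => (h t).deriv) t 0
  rw [h2, hF.zero, act_one]

end Inner

/-! ### O(p,q) is generated by rotations and boosts -/

section Generation

variable {p q : ℕ}

/-- The reflection in the hyperplane orthogonal to u - v. The last clause keeps vectors already
dealt with in place; the exchange of u and v is what Schur's lemma uses. -/
theorem exists_reflection {E : Type*} [NormedAddCommGroup E] [InnerProductSpace ℝ E]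
    [FiniteDimensional ℝ E] (u v : E) (h : ‖u‖ = ‖v‖) :
    ∃ A : E ≃ₗᵢ[ℝ] E, A u = v ∧ A v = u ∧ ∀ x, inner ℝ x u = inner ℝ x v → A x = x := by
  refine ⟨(ℝ ∙ (u - v))ᗮ.reflection, Submodule.reflection_sub h, ?_, fun x hx => ?_⟩
  · have h1 := congrArg (ℝ ∙ (u - v))ᗮ.reflection (Submodule.reflection_sub h)
    rwa [Submodule.reflection_reflection, eq_comm] at h1
  · rw [Submodule.reflection_eq_self_iff, Submodule.mem_orthogonal_singleton_iff_inner_left,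
      inner_sub_right, hx, sub_self]

theorem eq_expEquiv {E : Type*} [NormedAddCommGroup E] [NormedSpace ℝ E] [CompleteSpace E]
    (J : E →L[ℝ] E) {γ : ℝ → E} (h : ∀ t, HasDerivAt γ (J (γ t)) t) (t : ℝ) :
    γ t = expEquiv J t (γ 0) := by
  have h1 := ODE_solution_unique_univ (v := fun _ => J) (s := fun _ => Set.univ) (t₀ := 0)
    (f := γ) (g := fun t => expEquiv J t (γ 0)) (K := ‖J‖₊) (fun _ => J.lipschitz.lipschitzOnWith)
    (fun t => ⟨h t, Set.mem_univ _⟩) (fun t => ⟨hasDerivAt_expEquiv J _ t, Set.mem_univ _⟩)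
    (expEquiv_zero J _).symm
  exact congrFun h1 t

theorem boostFlow_fixes (j : Fin p) (k : Fin q) {w : Amb p q} (h : boost j k w = 0) (t : ℝ) :
    (boostFlow j k t).1 w = w :=
  (eq_expEquiv (boost j k) (γ := fun _ => w) (fun t => by
    rw [h]; exact hasDerivAt_const t w) t).symm

theorem boostFlow_single (j : Fin p) (k : Fin q) (t : ℝ) :
    (boostFlow j k t).1 (EuclideanSpace.single j 1, 0) =
      (Real.cosh t • EuclideanSpace.single j 1, Real.sinh t • EuclideanSpace.single k 1) := by
  have h := eq_expEquiv (boost j k) (γ := fun t => ((Real.cosh t • EuclideanSpace.single j 1,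
    Real.sinh t • EuclideanSpace.single k 1) : Amb p q)) (fun t => by
      have e : boost j k (Real.cosh t • EuclideanSpace.single j 1,
          Real.sinh t • EuclideanSpace.single k 1) = (Real.sinh t • EuclideanSpace.single j 1,
            Real.cosh t • EuclideanSpace.single k 1) := by
        rw [boost_apply]
        simp
      rw [e]
      exact ((Real.hasDerivAt_cosh t).smul_const (EuclideanSpace.single j (1 : ℝ))).prodMk
        ((Real.hasDerivAt_sinh t).smul_const (EuclideanSpace.single k (1 : ℝ)))) t
  simp only [Real.cosh_zero, Real.sinh_zero, one_smul, zero_smul] at h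
  exact h.symm

/-- If g fixes ℝ^p pointwise, it preserves the orthogonal complement ℝ^q, where the form is negative
definite, so g is an isometry there. -/
theorem eq_kElt_of_fixes {g : indefOrthogonal p q}
    (h : ∀ j : Fin p, g.1 (EuclideanSpace.single j 1, 0) = (EuclideanSpace.single j 1, 0)) :
    ∃ B, g = kElt (LinearIsometryEquiv.refl ℝ _) B := by
  have h1 : ∀ x, g.1 (x, 0) = (x, 0) := by
    have e : g.1.toContinuousLinearMap.comp (ContinuousLinearMap.inl ℝ _ _) =
        ContinuousLinearMap.inl ℝ _ _ := by
      refine ContinuousLinearMap.coe_injective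
        ((EuclideanSpace.basisFun (Fin p) ℝ).toBasis.ext fun j => ?_)
      simpa using h j
    exact fun x => congrArg (fun L => L x) e
  have h2 : ∀ y, (g.1 (0, y)).1 = 0 := fun y => by
    have e := g.2 (0, y) ((g.1 (0, y)).1, 0)
    rw [h1] at e
    simpa [bil] using e
  have h3 : ∀ y, ‖(g.1 (0, y)).2‖ = ‖y‖ := fun y => by
    have e := g.2 (0, y) (0, y)
    simp only [bil, h2, inner_zero_left, zero_sub, real_inner_self_eq_norm_sq, neg_inj] at e
    exact (sq_eq_sq₀ (norm_nonneg _) (norm_nonneg _)).1 e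
  let L : EuclideanSpace ℝ (Fin q) →ₗᵢ[ℝ] EuclideanSpace ℝ (Fin q) :=
    ⟨LinearMap.snd ℝ _ _ ∘ₗ g.1.toLinearMap ∘ₗ LinearMap.inr ℝ _ _, h3⟩
  refine ⟨L.toLinearIsometryEquiv rfl, Subtype.ext (ContinuousLinearEquiv.ext (funext fun w => ?_))⟩
  have e : w = (w.1, 0) + (0, w.2) := by simp
  rw [kElt_apply]
  conv_lhs => rw [e, map_add, h1]
  refine Prod.ext ?_ ?_
  · simp [h2]
  · simp
    rfl

/-- `O(p,q)` is generated by `O(p) × O(q)` and the boosts. -/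
theorem mem_of_generators [NeZero q] (H : Subgroup (indefOrthogonal p q))
    (hK : ∀ A B, kElt A B ∈ H) (hX : ∀ j k t, boostFlow j k t ∈ H) (g : indefOrthogonal p q) :
    g ∈ H := by
  -- Induction on the number d of vectors of the standard basis of ℝ^p not yet known to be fixed.
  suffices h : ∀ d i : ℕ, i + d = p → ∀ g : indefOrthogonal p q, (∀ j : Fin p, (j : ℕ) < i →
      g.1 (EuclideanSpace.single j 1, 0) = (EuclideanSpace.single j 1, 0)) → g ∈ H from
    h p 0 (zero_add p) g fun j hj => absurd hj (Nat.not_lt_zero _)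
  intro d
  induction d with
  | zero =>
    intro i hi g hg
    obtain ⟨B, rfl⟩ := eq_kElt_of_fixes fun j => hg j (by omega)
    exact hK _ _
  | succ d ih =>
    intro i hi g hg
    let i' : Fin p := ⟨i, by omega⟩
    obtain ⟨u, v, huv⟩ : ∃ u v, g.1 (EuclideanSpace.single i' 1, 0) = (u, v) := ⟨_, _, rfl⟩
    have hn : ‖u‖ ^ 2 - ‖v‖ ^ 2 = 1 := by
      have e := g.2 (EuclideanSpace.single i' 1, 0) (EuclideanSpace.single i' 1, 0)
      rw [huv] at e
      simpa [bil] using e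
    have ho : ∀ j : Fin p, (j : ℕ) < i → inner ℝ (EuclideanSpace.single j (1 : ℝ)) u = 0 :=
      fun j hj => by
        have e := g.2 (EuclideanSpace.single j 1, 0) (EuclideanSpace.single i' 1, 0)
        rw [huv, hg j hj] at e
        have hne : i' ≠ j := fun h => by
          have := congrArg Fin.val h
          simp only [i'] at this
          omega
        simpa [bil, EuclideanSpace.inner_single_left, hne] using e
    obtain ⟨A, hA, -, hA'⟩ := exists_reflection u (‖u‖ • EuclideanSpace.single i' (1 : ℝ))
      (by simp [norm_smul])
    obtain ⟨B, hB, -, -⟩ := exists_reflection v (‖v‖ • EuclideanSpace.single (0 : Fin q) (1 : ℝ))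
      (by simp [norm_smul])
    -- Reflections align (u, v) with the coordinate vectors. Since |u|² - |v|² = 1, the result is
    -- the boost of the i-th basis vector with parameter t, and the inverse boost restores that
    -- vector.
    let t := Real.arsinh ‖v‖
    have ht : Real.sinh t = ‖v‖ := Real.sinh_arsinh _
    have ht' : Real.cosh t = ‖u‖ := by
      have := Real.cosh_sq t
      rw [ht] at this
      exact (sq_eq_sq₀ (Real.cosh_pos t).le (norm_nonneg _)).1 (by linarith)
    have hb := boostFlow_single i' (0 : Fin q) t
    rw [ht, ht'] at hb
    have hmem : (boostFlow i' 0 t)⁻¹ * (kElt A B * g) ∈ H := by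
      refine ih (i + 1) (by omega) _ fun j hj => ?_
      have hmul : ((boostFlow i' (0 : Fin q) t)⁻¹ * (kElt A B * g)).1
          (EuclideanSpace.single j 1, 0) = (boostFlow i' (0 : Fin q) t).1.symm
            ((kElt A B).1 (g.1 (EuclideanSpace.single j 1, 0))) := rfl
      rw [hmul, ContinuousLinearEquiv.symm_apply_eq]
      by_cases hji : (j : ℕ) < i
      · have hne : i' ≠ j := fun h => by
          have := congrArg Fin.val h
          simp only [i'] at this
          omega
        rw [hg j hji, kElt_apply, boostFlow_fixes]
        · refine Prod.ext (hA' _ ?_) (map_zero _)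
          rw [ho j hji, inner_smul_right]
          simp [EuclideanSpace.inner_single_left, hne]
        · simp [boost_apply, hne]
      · have hji' : j = i' := Fin.ext (by simp only [i']; omega)
        rw [hji', huv, kElt_apply, hb, hA, hB]
    have h1 := H.mul_mem (H.inv_mem (hK A B)) (H.mul_mem (hX i' 0 t) hmem)
    rwa [mul_inv_cancel_left, inv_mul_cancel_left] at h1

end Generation

/-! ### Invariance of the integral in degree 2 - p - q and L² bounds for the action -/

section Invariance

variable {p q : ℕ} [NeZero p] [NeZero q] {a : ℂ}

/-- Rotations preserve the measure and boosts were treated infinitesimally; the invariant elements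
form a subgroup containing the generators. -/
theorem integ_act (g : indefOrthogonal p q) (f : S p q (2 - p - q)) : integ (act g f) = integ f := by
  let H : Subgroup (indefOrthogonal p q) :=
    { carrier := {g | ∀ f : S p q (2 - p - q), integ (act g f) = integ f}
      one_mem' := fun f => by rw [act_one]
      mul_mem' := fun {g h} hg hh f => by rw [act_mul, hh, hg]
      inv_mem' := fun {g} hg f => by rw [← hg (act g⁻¹ f), act_act_inv] }
  exact mem_of_generators H (fun A B f => integ_act_kElt A B f)
    (fun j k t f => integ_act_boost j k t f) g f

theorem integ_act_of_eq {b : ℂ} (hb : b = 2 - p - q) (g : indefOrthogonal p q) (f : S p q b) :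
    integ (act g f) = integ f := by
  subst hb
  exact integ_act g f

/-- The product f · conj h is homogeneous of degree a + conj a, so the invariant integral applies to
it. -/
theorem stdInner_act (ha : a + conj a = 2 - p - q) (g : indefOrthogonal p q) (f h : S p q a) :
    stdInner (act g f) (act g h) = stdInner f h := by
  rw [stdInner_eq_integ, stdInner_eq_integ, ← act_conj, ← act_S_mul, integ_act_of_eq ha]

/-- A power of |x| brings |f|² to the degree 2 - p - q. By invariance the group element can be moved
onto that power, which becomes a bounded weight. -/
theorem norm_iota_act_sq (g : indefOrthogonal p q) (f : S p q a) {C : ℝ}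
    (hC : ∀ z, ‖act g⁻¹ (radial (2 - p - q - (a + conj a))) (sphereIncl z)‖ ≤ C) :
    ‖iota (act g f)‖ ^ 2 ≤ C * ‖iota f‖ ^ 2 := by
  set e : ℂ := 2 - p - q - (a + conj a)
  have he : a + conj a + e = 2 - p - q := by simp only [e]; ring
  have hi : ∀ F : S p q a, ∀ r : S p q e, ∀ z, S.mul he (S.mul rfl F (S.conj F)) r (sphereIncl z) =
      ((‖F (sphereIncl z)‖ ^ 2 : ℝ) : ℂ) * r (sphereIncl z) := fun F r z => by
    simp only [S.mul_apply, S.conj_apply, Complex.mul_conj, Complex.normSq_eq_norm_sq]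
  have h1 := integ_act g (S.mul he (S.mul rfl f (S.conj f)) (act g⁻¹ (radial e)))
  have h2 : act g (S.mul he (S.mul rfl f (S.conj f)) (act g⁻¹ (radial e))) =
      S.mul he (S.mul rfl (act g f) (S.conj (act g f))) (radial e) := by
    rw [act_S_mul, act_S_mul, act_conj, act_act_inv]
  rw [h2, integ_apply, integ_apply] at h1
  simp only [hi, radial_apply, norm_fst_sphereIncl, Complex.ofReal_one, Complex.one_cpow,
    mul_one] at h1
  have h3 : ((‖iota (act g f)‖ ^ 2 : ℝ) : ℂ) = ∫ z, ((‖f (sphereIncl z)‖ ^ 2 : ℝ) : ℂ) *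
      act g⁻¹ (radial e) (sphereIncl z) ∂(mu p q) := by
    rw [← h1, norm_iota_sq]
    exact integral_ofReal.symm
  have h4 : ‖iota (act g f)‖ ^ 2 = ‖((‖iota (act g f)‖ ^ 2 : ℝ) : ℂ)‖ := by
    rw [Complex.norm_real, Real.norm_of_nonneg (sq_nonneg _)]
  rw [h4, h3, norm_iota_sq, ← integral_const_mul]
  refine (norm_integral_le_integral_norm _).trans (integral_mono_of_nonneg
    (Filter.Eventually.of_forall fun z => norm_nonneg _) ?_
    (Filter.Eventually.of_forall fun z => ?_))
  · exact (integrable_cont (E := ℝ)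
      ((((continuous_S f).comp continuous_sphereIncl).norm.pow 2))).const_mul C
  · simp only [norm_mul, Complex.norm_real, Real.norm_of_nonneg (sq_nonneg ‖f (sphereIncl z)‖)]
    rw [mul_comm]
    exact mul_le_mul_of_nonneg_right (hC z) (sq_nonneg _)

/-- The boosts act boundedly in `L²`, locally uniformly. -/
theorem exists_norm_iota_act_boost (j : Fin p) (k : Fin q) (T : ℝ) :
    ∃ C, 0 ≤ C ∧ ∀ t, |t| ≤ T → ∀ f : S p q a, ‖iota (act (boostFlow j k t) f)‖ ≤ C * ‖iota f‖ := by
  have hc : Continuous fun x : ℝ × Spheres p q =>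
      radial (2 - p - q - (a + conj a)) (coneAct (boostFlow j k (-x.1)) (sphereIncl x.2)) :=
    (continuous_S _).comp ((isFlow_boost j k).continuous_coneAct.comp
      (continuous_fst.neg.prodMk (continuous_sphereIncl.comp continuous_snd)))
  obtain ⟨C, hC⟩ := ((isCompact_Icc (a := -T) (b := T)).prod
    (isCompact_univ (X := Spheres p q))).exists_bound_of_continuousOn hc.continuousOn
  refine ⟨√|C|, Real.sqrt_nonneg _, fun t ht f => ?_⟩
  have h1 := norm_iota_act_sq (boostFlow j k t) f (C := |C|) fun z =>
    ((hC (t, z) ⟨abs_le.1 ht, Set.mem_univ _⟩).trans (le_abs_self C) |> fun h => by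
      rwa [(isFlow_boost j k).neg] at h)
  refine abs_le_of_sq_le_sq' ?_ (by positivity) |>.2
  rwa [mul_pow, Real.sq_sqrt (abs_nonneg C)]

end Invariance

end

section

open MeasureTheory
open MvPolynomial (X C pderiv)

/-! ### Polynomial bounds for the dimension of K-types -/

section FiniteDimension

variable {p q : ℕ} {a : ℂ} {m n : ℕ}

/-- The function `(x, y) ↦ P(x) Q(y)` on `𝕊^{p-1} × 𝕊^{q-1}`. -/
def polyRes (P : MvPolynomial (Fin p) ℂ) (Q : MvPolynomial (Fin q) ℂ) : C(Spheres p q, ℂ) where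
  toFun z := polyVal P z.1 * polyVal Q z.2
  continuous_toFun := ((contDiff_polyVal P).continuous.comp
    (continuous_subtype_val.comp continuous_fst)).mul ((contDiff_polyVal Q).continuous.comp
    (continuous_subtype_val.comp continuous_snd))

/-- The exponent with values `d`. -/
def expo {p m : ℕ} (d : Fin p → Fin (m + 1)) : Fin p →₀ ℕ :=
  Finsupp.equivFunOnFinite.symm fun i => (d i : ℕ)

theorem exists_expo {P : MvPolynomial (Fin p) ℂ} (hP : P.IsHomogeneous m) {d : Fin p →₀ ℕ}
    (hd : d ∈ P.support) : ∃ e : Fin p → Fin (m + 1), expo e = d := by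
  have hdeg : ∑ i, d i = m := by
    have := hP (MvPolynomial.mem_support_iff.1 hd)
    simpa [Finsupp.weight_apply, Finsupp.sum_fintype] using this
  refine ⟨fun i => ⟨d i, Nat.lt_succ_of_le (hdeg ▸ Finset.single_le_sum
    (f := fun i => d i) (fun _ _ => Nat.zero_le _) (Finset.mem_univ i))⟩, ?_⟩
  ext i
  simp [expo]

/-- A space of functions of dimension at most `(m+1)^p (n+1)^q` containing the `K`-type. -/
def monoSpan (p q m n : ℕ) : Submodule ℂ C(Spheres p q, ℂ) :=
  Submodule.span ℂ (Set.range fun d : (Fin p → Fin (m + 1)) × (Fin q → Fin (n + 1)) =>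
    polyRes (MvPolynomial.monomial (expo d.1) (1 : ℂ)) (MvPolynomial.monomial (expo d.2) 1))

instance : FiniteDimensional ℂ (monoSpan p q m n) :=
  FiniteDimensional.span_of_finite ℂ (Set.finite_range _)

theorem finrank_monoSpan_le :
    Module.finrank ℂ (monoSpan p q m n) ≤ (m + 1) ^ p * (n + 1) ^ q := by
  refine (finrank_range_le_card _).trans ?_
  simp

theorem res_mem_monoSpan {f : S p q a} (hf : f ∈ kType p q a m n) : res f ∈ monoSpan p q m n := by
  have key : kType p q a m n ≤ (monoSpan p q m n).comap res := by
    refine kType_le fun h₁ h₂ H₁ H₂ => ?_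
    have e : res (jS a H₁ H₂) = ∑ d ∈ h₁.support, ∑ d' ∈ h₂.support,
        (h₁.coeff d * h₂.coeff d') • polyRes (MvPolynomial.monomial d (1 : ℂ))
          (MvPolynomial.monomial d' 1) := by
      ext z
      have hs : ∀ {r : ℕ} (P : MvPolynomial (Fin r) ℂ) (x : EuclideanSpace ℝ (Fin r)),
          polyVal P x = ∑ d ∈ P.support,
            P.coeff d * polyVal (MvPolynomial.monomial d (1 : ℂ)) x := fun P x => by
        conv_lhs => rw [P.as_sum, polyVal_sum]
        refine Finset.sum_congr rfl fun d _ => ?_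
        rw [← polyVal_smul_const, MvPolynomial.smul_monomial, smul_eq_mul, mul_one]
      simp only [res_apply, jS_sphere, ContinuousMap.coe_sum, Finset.sum_apply,
        ContinuousMap.coe_smul, Pi.smul_apply, smul_eq_mul]
      rw [hs h₁, hs h₂, Finset.sum_mul_sum]
      refine Finset.sum_congr rfl fun d _ => Finset.sum_congr rfl fun d' _ => ?_
      simp only [polyRes, ContinuousMap.coe_mk]
      ring
    change res (jS a H₁ H₂) ∈ monoSpan p q m n
    rw [e]
    refine Submodule.sum_mem _ fun d hd => Submodule.sum_mem _ fun d' hd' =>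
      Submodule.smul_mem _ _ ?_
    obtain ⟨e, rfl⟩ := exists_expo H₁.1 hd
    obtain ⟨e', rfl⟩ := exists_expo H₂.1 hd'
    exact Submodule.subset_span ⟨(e, e'), rfl⟩
  exact key hf

/-- Restriction to the spheres embeds a `K`-type in a space of bounded dimension. -/
def kTypeRes (p q : ℕ) (a : ℂ) (m n : ℕ) : kType p q a m n →ₗ[ℂ] monoSpan p q m n :=
  (res.domRestrict (kType p q a m n)).codRestrict (monoSpan p q m n)
    fun f => res_mem_monoSpan f.2

theorem kTypeRes_injective (p q : ℕ) (a : ℂ) (m n : ℕ) :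
    Function.Injective (kTypeRes p q a m n) := fun f g h =>
  Subtype.ext (res_injective (congrArg Subtype.val h))

instance : FiniteDimensional ℂ (kType p q a m n) :=
  FiniteDimensional.of_injective (V₂ := monoSpan p q m n) (kTypeRes p q a m n)
    (kTypeRes_injective p q a m n)

theorem finrank_kType_le : Module.finrank ℂ (kType p q a m n) ≤ (m + 1) ^ p * (n + 1) ^ q :=
  (LinearMap.finrank_le_finrank_of_injective (kTypeRes_injective p q a m n)).trans finrank_monoSpan_le

end FiniteDimension

/-! ### L² as the Hilbert sum of the K-types -/

section HilbertSum

variable {p q : ℕ} [NeZero p] [NeZero q] {a : ℂ} {m n m' n' : ℕ}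

/-- The `K`-type inside `L²`. -/
def kL2 (p q : ℕ) [NeZero p] [NeZero q] (a : ℂ) (σ : ℕ × ℕ) : Submodule ℂ (L2 p q) :=
  (kType p q a σ.1 σ.2).map iota

instance (σ : ℕ × ℕ) : FiniteDimensional ℂ (kL2 p q a σ) := by
  unfold kL2
  infer_instance

theorem iota_mem_kL2 {σ : ℕ × ℕ} {f : S p q a} (hf : f ∈ kType p q a σ.1 σ.2) :
    iota f ∈ kL2 p q a σ := Submodule.mem_map_of_mem hf

theorem orthogonalFamily_kL2 :
    OrthogonalFamily ℂ (fun σ => kL2 p q a σ) fun σ => (kL2 p q a σ).subtypeₗᵢ := by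
  refine OrthogonalFamily.of_pairwise fun σ τ hne => ?_
  rw [Function.onFun, Submodule.isOrtho_iff_inner_eq]
  rintro _ ⟨f, hf, rfl⟩ _ ⟨g, hg, rfl⟩
  rw [← stdInner_eq_inner]
  exact stdInner_kType_ne hg hf hne.symm

/-- The span of the `K`-types. -/
def allTypes (p q : ℕ) (a : ℂ) : Submodule ℂ (S p q a) := ⨆ σ : ℕ × ℕ, kType p q a σ.1 σ.2

theorem kType_le_allTypes : kType p q a m n ≤ allTypes p q a :=
  le_iSup (fun σ : ℕ × ℕ => kType p q a σ.1 σ.2) (m, n)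

theorem allTypes_induction {W : Submodule ℂ (S p q a)}
    (h : ∀ m n, kType p q a m n ≤ W) : allTypes p q a ≤ W :=
  iSup_le fun σ => h σ.1 σ.2

theorem mulOp_uL_allTypes (j : Fin p) {f : S p q a} (hf : f ∈ allTypes p q a) :
    mulOp (uL j) f ∈ allTypes p q a :=
  allTypes_induction (W := (allTypes p q a).comap (mulOp (uL j))) (fun _ _ _ hg =>
    (iSup₂_le fun _ _ => kType_le_allTypes : (⨆ _, ⨆ _, _) ≤ _) (mulOp_uL_mem hg j)) hf

theorem mulOp_uR_allTypes (k : Fin q) {f : S p q a} (hf : f ∈ allTypes p q a) :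
    mulOp (uR k) f ∈ allTypes p q a :=
  allTypes_induction (W := (allTypes p q a).comap (mulOp (uR k))) (fun _ _ _ hg =>
    (iSup₂_le fun _ _ => kType_le_allTypes : (⨆ _, ⨆ _, _) ≤ _) (mulOp_uR_mem hg k)) hf

theorem res_mulOp (u : S p q 0) (f : S p q a) : res (mulOp u f) = res u * res f := by
  ext z
  simp

/-- Stone–Weierstrass: the coordinates generate a point-separating star algebra, and the span of the
K-types contains 1 and is stable under multiplication by coordinates. -/
theorem dense_res_allTypes : ((allTypes p q a).map res).topologicalClosure = ⊤ := by
  let gens : Set C(Spheres p q, ℂ) :=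
    (Set.range fun j : Fin p => res (uL j)) ∪ Set.range fun k : Fin q => res (uR k)
  have hstar : star gens = gens := by
    have h1 : ∀ f ∈ gens, star f = f := by
      rintro _ (⟨j, rfl⟩ | ⟨k, rfl⟩) <;> ext z
      · simp [uL_sphere]
      · simp [uR_sphere]
    ext f
    rw [Set.mem_star]
    exact ⟨fun h => by have := h1 _ h; rw [star_star] at this; rwa [this],
      fun h => by rwa [h1 f h]⟩
  let A : StarSubalgebra ℂ C(Spheres p q, ℂ) := StarAlgebra.adjoin ℂ gens
  have hsep : A.SeparatesPoints := by
    intro z w hzw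
    by_contra hcon
    push Not at hcon
    have h1 : ∀ f ∈ gens, f z = f w := fun f hf =>
      hcon f ⟨f, StarAlgebra.subset_adjoin ℂ gens hf, rfl⟩
    refine hzw (Prod.ext (Subtype.ext ?_) (Subtype.ext ?_))
    · ext j
      have := h1 _ (Or.inl ⟨j, rfl⟩)
      simpa [uL_sphere] using this
    · ext k
      have := h1 _ (Or.inr ⟨k, rfl⟩)
      simpa [uR_sphere] using this
  have hA := ContinuousMap.starSubalgebra_topologicalClosure_eq_top_of_separatesPoints A hsep
  have hmul : ∀ f ∈ Algebra.adjoin ℂ gens, ∀ g ∈ (allTypes p q a).map res,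
      f * g ∈ (allTypes p q a).map res := by
    intro f hf
    induction hf using Algebra.adjoin_induction with
    | mem f hf =>
      rintro _ ⟨g, hg, rfl⟩
      rcases hf with ⟨j, rfl⟩ | ⟨k, rfl⟩
      · exact ⟨_, mulOp_uL_allTypes j hg, res_mulOp _ _⟩
      · exact ⟨_, mulOp_uR_allTypes k hg, res_mulOp _ _⟩
    | algebraMap r =>
      intro g hg
      rw [← Algebra.smul_def]
      exact Submodule.smul_mem _ _ hg
    | add f g _ _ h1 h2 =>
      intro x hx
      rw [add_mul]
      exact Submodule.add_mem _ (h1 x hx) (h2 x hx)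
    | mul f g _ _ h1 h2 =>
      intro x hx
      rw [mul_assoc]
      exact h1 _ (h2 x hx)
  have hone : (1 : C(Spheres p q, ℂ)) ∈ (allTypes p q a).map res :=
    ⟨jS a isHarmonic_one isHarmonic_one, kType_le_allTypes (jS_mem _ _), by ext z; simp [jS_sphere]⟩
  rw [eq_top_iff]
  intro f _
  have hf : f ∈ A.topologicalClosure := hA ▸ StarSubalgebra.mem_top
  refine closure_mono (fun g hg => ?_) hf
  have hg' : g ∈ A.toSubalgebra := hg
  rw [StarAlgebra.adjoin_toSubalgebra, hstar, Set.union_self] at hg'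
  have := hmul g hg' 1 hone
  rwa [mul_one] at this

theorem dense_kL2 : (⨆ σ, kL2 p q a σ).topologicalClosure = ⊤ := by
  have h1 : (⨆ σ, kL2 p q a σ) =
      ((allTypes p q a).map res).map (ContinuousMap.toLp 2 (mu p q) ℂ).toLinearMap := by
    rw [allTypes, Submodule.map_iSup, Submodule.map_iSup]
    refine iSup_congr fun σ => ?_
    rw [kL2, iota, Submodule.map_comp]
  rw [h1]
  exact (ContinuousMap.toLp_denseRange ℂ (mu p q) ℂ
    (by norm_num)).topologicalClosure_map_submodule dense_res_allTypes

theorem isHilbertSum_kL2 :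
    IsHilbertSum ℂ (fun σ => kL2 p q a σ) fun σ => (kL2 p q a σ).subtypeₗᵢ :=
  IsHilbertSum.mkInternal _ orthogonalFamily_kL2 dense_kL2.ge

theorem hasSum_starProjection (v : L2 p q) :
    HasSum (fun σ => (kL2 p q a σ).starProjection v) v := by
  have h := (isHilbertSum_kL2 (p := p) (q := q) (a := a)).hasSum_linearIsometryEquiv_symm
    (isHilbertSum_kL2.linearIsometryEquiv v)
  rw [LinearIsometryEquiv.symm_apply_apply] at h
  convert h using 2 with σ
  have h2 := (h.mapL (kL2 p q a σ).starProjection).unique (hasSum_single σ fun τ hne => ?_)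
  · rw [h2]
    exact Submodule.starProjection_eq_self_iff.2 (Subtype.mem _)
  · rw [Submodule.starProjection_apply_eq_zero_iff]
    have ho := (orthogonalFamily_kL2 (p := p) (q := q) (a := a)).isOrtho hne
    exact ho (Subtype.mem _)

theorem hasSum_norm_starProjection (v : L2 p q) :
    HasSum (fun σ => ‖(kL2 p q a σ).starProjection v‖ ^ 2) (‖v‖ ^ 2) := by
  have h := ((hasSum_starProjection (a := a) v).mapL (innerSL ℂ v)).mapL Complex.reCLM
  convert h using 1
  · funext σ
    simp only [innerSL_apply_apply, Complex.reCLM_apply]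
    rw [← inner_self_eq_norm_sq (𝕜 := ℂ), Submodule.inner_starProjection_left_eq_right,
      Submodule.starProjection_eq_self_iff.2 (Submodule.starProjection_apply_mem _ _)]
    rfl
  · simp only [innerSL_apply_apply, Complex.reCLM_apply]
    rw [← inner_self_eq_norm_sq (𝕜 := ℂ)]
    rfl

/-- The `K`-type as a subspace of `L²`. -/
def kEquiv (p q : ℕ) [NeZero p] [NeZero q] (a : ℂ) (σ : ℕ × ℕ) :
    kType p q a σ.1 σ.2 ≃ₗ[ℂ] kL2 p q a σ :=
  Submodule.equivMapOfInjective iota iota_injective _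

theorem kEquiv_apply {σ : ℕ × ℕ} (f : kType p q a σ.1 σ.2) : (kEquiv p q a σ f : L2 p q) = iota f.1 :=
  rfl

/-- The component of a function in a `K`-type. -/
def comp (σ : ℕ × ℕ) : S p q a →ₗ[ℂ] S p q a :=
  (kType p q a σ.1 σ.2).subtype ∘ₗ (kEquiv p q a σ).symm.toLinearMap ∘ₗ
    (kL2 p q a σ).orthogonalProjection.toLinearMap ∘ₗ iota

theorem comp_mem (σ : ℕ × ℕ) (f : S p q a) : comp σ f ∈ kType p q a σ.1 σ.2 :=
  Subtype.mem _

theorem iota_comp (σ : ℕ × ℕ) (f : S p q a) :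
    iota (comp σ f) = (kL2 p q a σ).starProjection (iota f) := by
  have h := kEquiv_apply ((kEquiv p q a σ).symm ((kL2 p q a σ).orthogonalProjection (iota f)))
  rw [LinearEquiv.apply_symm_apply] at h
  exact h.symm

theorem stdInner_comp_left {σ : ℕ × ℕ} {h : S p q a} (hh : h ∈ kType p q a σ.1 σ.2) (f : S p q a) :
    stdInner (comp σ f) h = stdInner f h := by
  rw [stdInner_eq_inner, stdInner_eq_inner, iota_comp,
    ← Submodule.inner_starProjection_left_eq_right,
    Submodule.starProjection_eq_self_iff.2 (iota_mem_kL2 hh)]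

theorem stdInner_comp_right {σ : ℕ × ℕ} {h : S p q a} (hh : h ∈ kType p q a σ.1 σ.2)
    (f : S p q a) : stdInner h (comp σ f) = stdInner h f := by
  rw [← stdInner_conj, stdInner_comp_left hh, stdInner_conj]

/-- An orthogonal projection is pinned down by inner products with its range. Commutation of `comp`
with symmetric, skew and unitary operators preserving the K-types follows by moving them across the
product. -/
theorem comp_eq_of {σ : ℕ × ℕ} {f g : S p q a} (hg : g ∈ kType p q a σ.1 σ.2)
    (h : ∀ u ∈ kType p q a σ.1 σ.2, stdInner f u = stdInner g u) : comp σ f = g := by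
  have h1 : comp σ f - g ∈ kType p q a σ.1 σ.2 := Submodule.sub_mem _ (comp_mem σ f) hg
  refine sub_eq_zero.1 (stdInner_self_eq_zero.1 ?_)
  rw [stdInner_sub_left, stdInner_comp_left h1, h _ h1, sub_self]

theorem comp_of_mem {σ : ℕ × ℕ} {f : S p q a} (hf : f ∈ kType p q a σ.1 σ.2) : comp σ f = f :=
  comp_eq_of hf fun _ _ => rfl

theorem comp_of_mem_ne {σ τ : ℕ × ℕ} {f : S p q a} (hf : f ∈ kType p q a τ.1 τ.2) (hne : σ ≠ τ) :
    comp σ f = 0 :=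
  comp_eq_of (Submodule.zero_mem _) fun u hu => by
    rw [stdInner_zero_left]
    exact stdInner_kType_ne hf hu hne.symm

theorem hasSum_iota_comp (f : S p q a) : HasSum (fun σ => iota (comp σ f)) (iota f) := by
  simp only [iota_comp]
  exact hasSum_starProjection _

theorem hasSum_norm_comp (f : S p q a) :
    HasSum (fun σ => ‖iota (comp σ f)‖ ^ 2) (‖iota f‖ ^ 2) := by
  simp only [iota_comp]
  exact hasSum_norm_starProjection _

theorem norm_iota_comp_le (σ : ℕ × ℕ) (f : S p q a) : ‖iota (comp σ f)‖ ≤ ‖iota f‖ := by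
  rw [iota_comp]
  exact Submodule.norm_starProjection_apply_le _ _

theorem eq_zero_of_comp {f : S p q a} (h : ∀ σ, comp σ f = 0) : f = 0 := by
  have h1 := hasSum_iota_comp f
  simp only [h, map_zero] at h1
  exact iota_injective (by rw [map_zero]; exact h1.unique hasSum_zero)

/-- The inner product with an element of a `K`-type, seen by an `L²` limit. -/
theorem hasSum_stdInner (f h : S p q a) :
    HasSum (fun σ => stdInner (comp σ f) h) (stdInner f h) := by
  have h1 := (hasSum_iota_comp f).mapL (innerSL ℂ (iota h))
  simpa only [innerSL_apply_apply, ← stdInner_eq_inner] using h1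

theorem comp_cas (σ : ℕ × ℕ) (f : S p q a) :
    comp σ (cas f) = (-(lam p σ.1 + lam q σ.2) : ℂ) • comp σ f :=
  comp_eq_of (Submodule.smul_mem _ _ (comp_mem σ f)) fun u hu => by
    rw [stdInner_cas, cas_kType hu, stdInner_smul_right, stdInner_smul_left, stdInner_comp_left hu]
    simp

theorem comp_D_rot (σ : ℕ × ℕ) (i : RotIdx p q) (f : S p q a) :
    comp σ (D (rot i) f) = D (rot i) (comp σ f) :=
  comp_eq_of (D_rot_mem (comp_mem σ f) i) fun u hu => by
    rw [stdInner_D_rot, stdInner_D_rot, stdInner_comp_left (D_rot_mem hu i)]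

theorem comp_act_kElt (σ : ℕ × ℕ)
    (A : EuclideanSpace ℝ (Fin p) ≃ₗᵢ[ℝ] EuclideanSpace ℝ (Fin p))
    (B : EuclideanSpace ℝ (Fin q) ≃ₗᵢ[ℝ] EuclideanSpace ℝ (Fin q)) (f : S p q a) :
    comp σ (act (kElt A B) f) = act (kElt A B) (comp σ f) :=
  comp_eq_of (act_kElt_mem (comp_mem σ f) A B) fun u hu => by
    have h := act_kElt_mem hu A.symm B.symm
    rw [← kElt_inv] at h
    have e : u = act (kElt A B) (act (kElt A B)⁻¹ u) := (act_act_inv _ _).symm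
    rw [e, stdInner_act_kElt, stdInner_act_kElt, stdInner_comp_left h]

end HilbertSum

end

section

open MeasureTheory
open MvPolynomial (X C pderiv)

/-! ### Uniqueness of zonal harmonics -/

section Zonal

variable {r m : ℕ}

theorem IsHarmonic.sum {ι : Type*} (s : Finset ι) {P : ι → MvPolynomial (Fin r) ℂ}
    (h : ∀ i ∈ s, IsHarmonic r m (P i)) : IsHarmonic r m (∑ i ∈ s, P i) :=
  Finset.sum_induction P (IsHarmonic r m) (fun _ _ => IsHarmonic.add) isHarmonic_zero h

theorem differentiable_polyVal (P : MvPolynomial (Fin r) ℂ) : Differentiable ℝ (polyVal P) :=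
  (contDiff_polyVal P).differentiable (by simp)

/-- Linear isometries of Euclidean space. -/
abbrev Iso (r : ℕ) : Type := EuclideanSpace ℝ (Fin r) ≃ₗᵢ[ℝ] EuclideanSpace ℝ (Fin r)

theorem hasDerivAt_polyVal_line (P : MvPolynomial (Fin r) ℂ) (x v : EuclideanSpace ℝ (Fin r))
    (t : ℝ) : HasDerivAt (fun t : ℝ => polyVal P (x + t • v)) (fderiv ℝ (polyVal P) (x + t • v) v)
      t := by
  have h1 : HasDerivAt (fun t : ℝ => x + t • v) v t := by
    simpa using ((hasDerivAt_id t).smul_const v).const_add x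
  exact (differentiable_polyVal P _).hasFDerivAt.comp_hasDerivAt t h1

/-- A harmonic polynomial of positive degree has mean zero on the sphere. -/
theorem integral_harmonic [NeZero r] {P : MvPolynomial (Fin r) ℂ} (H : IsHarmonic r (m + 1) P) :
    ∫ z : Spheres r 1, polyVal P (z.1 : EuclideanSpace ℝ (Fin r)) ∂(mu r 1) = 0 := by
  -- Orthogonality to the constants, with 𝕊⁰ as a dummy second factor and a = 0 as an arbitrary
  -- degree.
  have h := stdInner_kType_ne (a := 0) (jS_mem H (isHarmonic_one (p := 1)))
    (jS_mem (isHarmonic_one (p := r)) (isHarmonic_one (p := 1))) (by simp)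
  rw [← h]
  refine integral_congr_ae (Filter.Eventually.of_forall fun z => ?_)
  have h1 := jS_sphere (a := 0) H (isHarmonic_one (p := 1)) z
  have h2 := jS_sphere (a := 0) (isHarmonic_one (p := r)) (isHarmonic_one (p := 1)) z
  simp only [h1, h2, polyVal_one, map_one, mul_one]

/-- A zonal harmonic polynomial that vanishes at the pole is zero. -/
theorem zonal_eq_zero [NeZero r] {u : EuclideanSpace ℝ (Fin r)} (hu : ‖u‖ = 1)
    {P : MvPolynomial (Fin r) ℂ} (H : IsHarmonic r m P)
    (hinv : ∀ A : Iso r, A u = u →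
      ∀ x, polyVal P (A x) = polyVal P x)
    (h0 : polyVal P u = 0) (x : EuclideanSpace ℝ (Fin r)) : polyVal P x = 0 := by
  induction m generalizing P x with
  | zero =>
    have h : ∀ x, polyVal P 0 = polyVal P x := fun x => by
      have := polyVal_smul H.1 0 x
      rwa [zero_smul, pow_zero, one_mul] at this
    rw [← h x, h u, h0]
  | succ m ih =>
    -- The derivative of P along u is again harmonic, fixed by the stabilizer of u, and zero at u
    -- because P vanishes on the line ℝu. By induction it is zero, so P is constant along u.
    let Q : MvPolynomial (Fin r) ℂ := ∑ i, (u i : ℂ) • pderiv i P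
    have hQ : ∀ x, polyVal Q x = fderiv ℝ (polyVal P) x u := fun x => by
      simp only [Q, polyVal_sum, polyVal_smul_const, fderiv_polyVal]
    have hline : ∀ x (t : ℝ), polyVal P (x + t • u) = polyVal P x := by
      have hd : ∀ x, fderiv ℝ (polyVal P) x u = 0 := by
        intro x
        rw [← hQ]
        refine ih (IsHarmonic.sum _ fun i _ => (H.pderiv_succ i).smul _) (fun A hA x => ?_) ?_ x
        · have h1 : HasFDerivAt (polyVal P ∘ A)
              ((fderiv ℝ (polyVal P) (A x)).comp (A : EuclideanSpace ℝ (Fin r) →L[ℝ] _)) x :=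
            (differentiable_polyVal P (A x)).hasFDerivAt.comp x
              A.toContinuousLinearEquiv.hasFDerivAt
          have h2 : polyVal P ∘ A = polyVal P := funext (hinv A hA)
          rw [h2] at h1
          rw [hQ, hQ, h1.fderiv]
          change _ = fderiv ℝ (polyVal P) (A x) (A u)
          rw [hA]
        · rw [hQ]
          have h1 := hasDerivAt_polyVal_line P 0 u 1
          simp only [zero_add, one_smul] at h1
          have h2 : (fun t : ℝ => polyVal P (t • u)) = fun _ => 0 := funext fun t => by
            rw [polyVal_smul H.1, h0, mul_zero]
          rw [h2] at h1
          exact h1.unique (hasDerivAt_const _ _)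
      intro x t
      have h1 : ∀ t, HasDerivAt (fun t : ℝ => polyVal P (x + t • u)) 0 t := fun t => by
        have := hasDerivAt_polyVal_line P x u t
        rwa [hd] at this
      have h2 := is_const_of_deriv_eq_zero (fun t => (h1 t).differentiableAt)
        (fun t => (h1 t).deriv) t 0
      simpa using h2
    let w : EuclideanSpace ℝ (Fin r) → EuclideanSpace ℝ (Fin r) := fun x => x + (-inner ℝ u x) • u
    have hw : ∀ x, inner ℝ (w x) u = 0 := fun x => by
      simp only [w, inner_add_left, inner_smul_left, real_inner_self_eq_norm_sq, hu]
      rw [real_inner_comm]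
      simp
    have hwP : ∀ x, polyVal P (w x) = polyVal P x := fun x => hline x _
    by_contra hx
    have hP0 : polyVal P 0 = 0 := by
      have := polyVal_smul H.1 0 x
      simpa using this
    have hwx : w x ≠ 0 := fun h => hx (by rw [← hwP, h, hP0])
    have hN : ‖w x‖ ≠ 0 := norm_ne_zero_iff.2 hwx
    -- The stabilizer of u is transitive on spheres of the orthogonal complement of u, so P is a
    -- multiple of the power m + 1 of the distance w to the axis.
    obtain ⟨c, hc, hform⟩ : ∃ c : ℂ, c ≠ 0 ∧
        ∀ y, polyVal P y = ((‖w y‖ ^ (m + 1) : ℝ) : ℂ) * c := by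
      refine ⟨polyVal P x / ((‖w x‖ ^ (m + 1) : ℝ) : ℂ),
        div_ne_zero hx (by exact_mod_cast pow_ne_zero _ hN), fun y => ?_⟩
      obtain ⟨A, hA, -, hA'⟩ := exists_reflection (w y) ((‖w y‖ / ‖w x‖) • w x) (by
        rw [norm_smul, Real.norm_of_nonneg (by positivity)]
        field_simp)
      have h1 := hinv A (hA' u (by
        rw [inner_smul_right, real_inner_comm, hw, real_inner_comm, hw, mul_zero])) (w y)
      rw [hA, polyVal_smul H.1, hwP, hwP] at h1
      rw [← h1]
      push_cast
      rw [div_pow]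
      ring
    have hcont : Continuous fun z : Spheres r 1 =>
        ‖w (z.1 : EuclideanSpace ℝ (Fin r))‖ ^ (m + 1) := by
      fun_prop
    -- Mean zero forces the nonnegative function |w|^{m+1} to vanish on the whole sphere,
    -- contradicting w x ≠ 0.
    have hint := integral_harmonic H
    simp only [hform] at hint
    rw [integral_mul_const] at hint
    have hint2 : ∫ z : Spheres r 1, ‖w (z.1 : EuclideanSpace ℝ (Fin r))‖ ^ (m + 1) ∂(mu r 1) = 0 := by
      have h1 := (mul_eq_zero.1 hint).resolve_right hc
      have h2 := (integral_ofReal (𝕜 := ℂ) (μ := mu r 1)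
        (f := fun z : Spheres r 1 => ‖w (z.1 : EuclideanSpace ℝ (Fin r))‖ ^ (m + 1))).symm.trans h1
      exact Complex.ofReal_eq_zero.1 h2
    rw [integral_eq_zero_iff_of_nonneg (fun z => by positivity) (integrable_cont hcont)] at hint2
    have hall := (hcont.ae_eq_iff_eq (mu r 1) continuous_zero).1 hint2
    have hx0 : x ≠ 0 := fun h => hx (by rw [h, hP0])
    let z₁ : Sph r := ⟨(‖x‖⁻¹) • x, by
      rw [mem_sphere_zero_iff_norm, norm_smul, norm_inv, norm_norm,
        inv_mul_cancel₀ (norm_ne_zero_iff.2 hx0)]⟩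
    have h1 := congrFun hall (z₁, ⟨EuclideanSpace.single 0 1, by simp⟩)
    have h2 : w (‖x‖⁻¹ • x) = ‖x‖⁻¹ • w x := by
      simp only [w, inner_smul_right, smul_add, smul_smul]
      congr 2
      ring
    simp only [z₁, h2, Pi.zero_apply, norm_smul, norm_inv, norm_norm] at h1
    have h3 := pow_eq_zero_iff (n := m + 1) (by omega) |>.1 h1
    exact (mul_ne_zero (inv_ne_zero (norm_ne_zero_iff.2 hx0)) hN) h3

end Zonal

/-! ### Zonal functions on the product of spheres -/

section Slices

variable {p q : ℕ} {a : ℂ} {m n : ℕ}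

theorem exists_slice_left {f : S p q a} (hf : f ∈ kType p q a m n) (y : Sph q) :
    ∃ P, IsHarmonic p m P ∧ ∀ x : Sph p, f (sphereIncl (x, y)) = polyVal P x := by
  induction hf using Submodule.span_induction with
  | mem f hf =>
    obtain ⟨h₁, h₂, H₁, H₂, rfl⟩ := hf
    exact ⟨polyVal h₂ y • h₁, H₁.smul _, fun x => by
      rw [polyVal_smul_const, mul_comm]; exact jS_sphere H₁ H₂ (x, y)⟩
  | zero => exact ⟨0, isHarmonic_zero, fun x => by simp [polyVal]⟩
  | add f g _ _ hf hg =>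
    obtain ⟨P, hP, h⟩ := hf
    obtain ⟨Q, hQ, h'⟩ := hg
    exact ⟨P + Q, hP.add hQ, fun x => by rw [polyVal_add, S.add_apply, h, h']⟩
  | smul c f _ hf =>
    obtain ⟨P, hP, h⟩ := hf
    exact ⟨c • P, hP.smul c, fun x => by rw [polyVal_smul_const, S.smul_apply, h]⟩

theorem exists_slice_right {f : S p q a} (hf : f ∈ kType p q a m n) (x : Sph p) :
    ∃ P, IsHarmonic q n P ∧ ∀ y : Sph q, f (sphereIncl (x, y)) = polyVal P y := by
  induction hf using Submodule.span_induction with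
  | mem f hf =>
    obtain ⟨h₁, h₂, H₁, H₂, rfl⟩ := hf
    exact ⟨polyVal h₁ x • h₂, H₂.smul _, fun y => by
      rw [polyVal_smul_const]; exact jS_sphere H₁ H₂ (x, y)⟩
  | zero => exact ⟨0, isHarmonic_zero, fun x => by simp [polyVal]⟩
  | add f g _ _ hf hg =>
    obtain ⟨P, hP, h⟩ := hf
    obtain ⟨Q, hQ, h'⟩ := hg
    exact ⟨P + Q, hP.add hQ, fun x => by rw [polyVal_add, S.add_apply, h, h']⟩
  | smul c f _ hf =>
    obtain ⟨P, hP, h⟩ := hf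
    exact ⟨c • P, hP.smul c, fun x => by rw [polyVal_smul_const, S.smul_apply, h]⟩

theorem polyVal_invariant_of_sphere {r m : ℕ} {P : MvPolynomial (Fin r) ℂ}
    (hP : P.IsHomogeneous m)
    (A : Iso r)
    (h : ∀ z : Sph r, polyVal P (A z) = polyVal P z) (x : EuclideanSpace ℝ (Fin r)) :
    polyVal P (A x) = polyVal P x := by
  rcases eq_or_ne x 0 with rfl | hx
  · rw [map_zero]
  · have hx' := norm_ne_zero_iff.2 hx
    have e : x = ‖x‖ • (‖x‖⁻¹ • x) := by rw [smul_smul, mul_inv_cancel₀ hx', one_smul]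
    have h1 := h ⟨‖x‖⁻¹ • x, by
      rw [mem_sphere_zero_iff_norm, norm_smul, norm_inv, norm_norm, inv_mul_cancel₀ hx']⟩
    rw [e, map_smul, polyVal_smul hP, polyVal_smul hP, h1]

variable [NeZero p] [NeZero q]

/-- An element of a `K`-type fixed by the stabilizer of a point where it vanishes is zero. -/
theorem kType_zonal {f : S p q a} (hf : f ∈ kType p q a m n) (z : Spheres p q)
    (hinv : ∀ (A : Iso p) (B : Iso q), A (z.1 : EuclideanSpace ℝ (Fin p)) = z.1 →
      B (z.2 : EuclideanSpace ℝ (Fin q)) = z.2 → act (kElt A B) f = f)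
    (h0 : f (sphereIncl z) = 0) : f = 0 := by
  have hval : ∀ (A : Iso p) (B : Iso q), A (z.1 : EuclideanSpace ℝ (Fin p)) = z.1 →
      B (z.2 : EuclideanSpace ℝ (Fin q)) = z.2 → ∀ w : Spheres p q,
      f (sphereIncl (sphMap A w.1, sphMap B w.2)) = f (sphereIncl w) := fun A B hA hB w => by
    rw [← coneAct_kElt, ← act_apply, hinv A B hA hB]
  -- The one-sphere result is applied first to the slice through z.1, then to every slice in the
  -- other direction.
  have h1 : ∀ y, f (sphereIncl (z.1, y)) = 0 := by
    obtain ⟨P, hP, h⟩ := exists_slice_right hf z.1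
    intro y
    rw [h]
    refine zonal_eq_zero (u := z.2) (by simp) hP (fun B hB => polyVal_invariant_of_sphere hP.1 B
      fun y => ?_) (by rw [← h]; exact h0) y
    have h2 := hval (LinearIsometryEquiv.refl ℝ _) B rfl hB (z.1, y)
    have h3 : sphMap (LinearIsometryEquiv.refl ℝ _) z.1 = z.1 := Subtype.ext rfl
    rw [h3, h, h] at h2
    exact h2
  refine S.ext_sphere fun w => ?_
  rw [S.zero_apply]
  obtain ⟨P, hP, h⟩ := exists_slice_left hf w.2
  have : w = (w.1, w.2) := rfl
  rw [this, h]
  refine zonal_eq_zero (u := z.1) (by simp) hP (fun A hA => polyVal_invariant_of_sphere hP.1 A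
    fun x => ?_) (by rw [← h]; exact h1 w.2) w.1
  have h2 := hval A (LinearIsometryEquiv.refl ℝ _) hA rfl (x, w.2)
  have h3 : sphMap (LinearIsometryEquiv.refl ℝ _) w.2 = w.2 := Subtype.ext rfl
  rw [h3, h, h] at h2
  exact h2

end Slices

/-! ### Reproducing vectors and sup-norm bounds -/

section Riesz

variable {p q : ℕ} [NeZero p] [NeZero q] {a : ℂ} {m n : ℕ} {σ τ : ℕ × ℕ}

theorem exists_riesz (φ : kType p q a σ.1 σ.2 →ₗ[ℂ] ℂ) :
    ∃ h : kType p q a σ.1 σ.2, ∀ f : kType p q a σ.1 σ.2, φ f = stdInner (f : S p q a) h := by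
  let ψ : kL2 p q a σ →L[ℂ] ℂ :=
    LinearMap.toContinuousLinearMap (φ ∘ₗ (kEquiv p q a σ).symm.toLinearMap)
  refine ⟨(kEquiv p q a σ).symm ((InnerProductSpace.toDual ℂ (kL2 p q a σ)).symm ψ), fun f => ?_⟩
  rw [stdInner_eq_inner, ← kEquiv_apply, ← kEquiv_apply, LinearEquiv.apply_symm_apply,
    ← Submodule.coe_inner, InnerProductSpace.toDual_symm_apply]
  simp [ψ]

/-- Evaluation at a point of the spheres. -/
def evalAt (σ : ℕ × ℕ) (z : Spheres p q) : kType p q a σ.1 σ.2 →ₗ[ℂ] ℂ where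
  toFun f := f.1 (sphereIncl z)
  map_add' f g := S.add_apply f.1 g.1 _
  map_smul' c f := S.smul_apply c f.1 _

/-- The reproducing vector of a `K`-type. -/
def zonal (σ : ℕ × ℕ) (z : Spheres p q) : kType p q a σ.1 σ.2 :=
  (exists_riesz (evalAt σ z)).choose

theorem stdInner_zonal {f : S p q a} (hf : f ∈ kType p q a σ.1 σ.2) (z : Spheres p q) :
    stdInner f (zonal σ z : kType p q a σ.1 σ.2) = f (sphereIncl z) :=
  ((exists_riesz (a := a) (evalAt σ z)).choose_spec ⟨f, hf⟩).symm

theorem eq_of_stdInner {f g : S p q a} (hf : f ∈ kType p q a σ.1 σ.2)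
    (hg : g ∈ kType p q a σ.1 σ.2)
    (h : ∀ u ∈ kType p q a σ.1 σ.2, stdInner u f = stdInner u g) : f = g := by
  have h1 := Submodule.sub_mem _ hf hg
  refine sub_eq_zero.1 (stdInner_self_eq_zero.1 ?_)
  rw [stdInner_sub_right, h _ h1, sub_self]

theorem act_kElt_inv_mem {f : S p q a} (hf : f ∈ kType p q a m n)
    (A : Iso p)
    (B : Iso q) :
    act (kElt A B)⁻¹ f ∈ kType p q a m n := by
  rw [kElt_inv]
  exact act_kElt_mem hf _ _

theorem stdInner_act_kElt_right (A : Iso p)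
    (B : Iso q) (f h : S p q a) :
    stdInner f (act (kElt A B) h) = stdInner (act (kElt A B)⁻¹ f) h := by
  conv_lhs => rw [← act_act_inv (kElt A B) f]
  rw [stdInner_act_kElt]

/-- The reproducing vector of a point is unique, so rotations permute these vectors along with their
points. -/
theorem act_zonal (σ : ℕ × ℕ) (A : Iso p)
    (B : Iso q) (z : Spheres p q) :
    act (kElt A B) (zonal σ (sphMap A z.1, sphMap B z.2) : kType p q a σ.1 σ.2).1 =
      (zonal σ z : kType p q a σ.1 σ.2).1 := by
  refine eq_of_stdInner (act_kElt_mem (zonal σ _).2 A B) (zonal σ z).2 fun u hu => ?_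
  rw [stdInner_act_kElt_right, stdInner_zonal (act_kElt_inv_mem hu A B), stdInner_zonal hu,
    ← coneAct_kElt, ← act_apply, act_act_inv]

theorem exists_kElt_swap (z w : Spheres p q) :
    ∃ A B, sphMap A z.1 = w.1 ∧ sphMap A w.1 = z.1 ∧ sphMap B z.2 = w.2 ∧ sphMap B w.2 = z.2 := by
  obtain ⟨A, h1, h2, -⟩ := exists_reflection (z.1 : EuclideanSpace ℝ (Fin p)) w.1 (by simp)
  obtain ⟨B, h3, h4, -⟩ := exists_reflection (z.2 : EuclideanSpace ℝ (Fin q)) w.2 (by simp)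
  exact ⟨A, B, Subtype.ext h1, Subtype.ext h2, Subtype.ext h3, Subtype.ext h4⟩

theorem norm_iota_act_kElt (A : Iso p)
    (B : Iso q) (f : S p q a) :
    ‖iota (act (kElt A B) f)‖ = ‖iota f‖ := by
  have h := stdInner_act_kElt A B f f
  rw [stdInner_self, stdInner_self, Complex.ofReal_inj] at h
  exact (sq_eq_sq₀ (norm_nonneg _) (norm_nonneg _)).1 h

/-- By transitivity of K the norm does not depend on the point. Parseval writes its square as Σ
|b_i(w)|² for an orthonormal basis, and integration over w counts the basis. -/
theorem norm_zonal_sq (σ : ℕ × ℕ) (z : Spheres p q) :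
    ‖iota (zonal σ z : kType p q a σ.1 σ.2).1‖ ^ 2 =
      Module.finrank ℂ (kType p q a σ.1 σ.2) := by
  have hconst : ∀ w : Spheres p q, ‖iota (zonal σ w : kType p q a σ.1 σ.2).1‖ =
      ‖iota (zonal σ z : kType p q a σ.1 σ.2).1‖ := fun w => by
    obtain ⟨A, B, h1, -, h2, -⟩ := exists_kElt_swap w z
    have h := act_zonal (a := a) σ A B w
    rw [h1, h2] at h
    rw [← h, norm_iota_act_kElt]
  let b := stdOrthonormalBasis ℂ (kL2 p q a σ)
  have hpar : ∀ w : Spheres p q, ‖iota (zonal σ w : kType p q a σ.1 σ.2).1‖ ^ 2 =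
      ∑ i, ‖((kEquiv p q a σ).symm (b i)).1 (sphereIncl w)‖ ^ 2 := fun w => by
    have h := b.sum_sq_norm_inner_right (kEquiv p q a σ (zonal σ w))
    rw [← kEquiv_apply, ← Submodule.coe_norm, ← h]
    refine Finset.sum_congr rfl fun i _ => ?_
    rw [← stdInner_zonal (Subtype.mem _), stdInner_eq_inner, ← kEquiv_apply, ← kEquiv_apply,
      LinearEquiv.apply_symm_apply, ← Submodule.coe_inner, ← inner_conj_symm, RCLike.norm_conj]
  have h1 : ∫ w, ‖iota (zonal σ w : kType p q a σ.1 σ.2).1‖ ^ 2 ∂(mu p q) =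
      ‖iota (zonal σ z : kType p q a σ.1 σ.2).1‖ ^ 2 := by
    simp only [hconst]
    simp
  rw [← h1]
  simp only [hpar]
  rw [integral_finset_sum _ fun i _ => integrable_cont (u := fun w =>
    ‖((kEquiv p q a σ).symm (b i)).1 (sphereIncl w)‖ ^ 2)
    (((continuous_S ((kEquiv p q a σ).symm (b i)).1).comp continuous_sphereIncl).norm.pow 2)]
  simp only [← norm_iota_sq, ← kEquiv_apply, LinearEquiv.apply_symm_apply]
  have h2 : ∀ i, ‖(b i : L2 p q)‖ = 1 := fun i => by
    rw [← Submodule.coe_norm]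
    exact b.norm_eq_one i
  simp only [h2, one_pow, Finset.sum_const, Finset.card_univ, Fintype.card_fin, nsmul_eq_mul,
    mul_one]
  rw [(kEquiv p q a σ).finrank_eq]

theorem norm_apply_le {f : S p q a} (hf : f ∈ kType p q a σ.1 σ.2) (z : Spheres p q) :
    ‖f (sphereIncl z)‖ ≤ √((σ.1 + 1) ^ p * (σ.2 + 1) ^ q) * ‖iota f‖ := by
  rw [← stdInner_zonal hf z, mul_comm]
  refine (norm_stdInner_le _ _).trans (mul_le_mul_of_nonneg_left ?_ (norm_nonneg _))
  refine Real.le_sqrt_of_sq_le ?_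
  rw [norm_zonal_sq]
  exact_mod_cast finrank_kType_le

end Riesz

/-! ### Schur's lemma for sesquilinear pairings of K-types -/

section Schur

variable {p q : ℕ} [NeZero p] [NeZero q] {a : ℂ} {m n : ℕ} {σ τ : ℕ × ℕ}

theorem polyVal_map_conj {r : ℕ} (P : MvPolynomial (Fin r) ℂ) (x : EuclideanSpace ℝ (Fin r)) :
    polyVal (MvPolynomial.map (starRingEnd ℂ) P) x = conj (polyVal P x) := by
  induction P using MvPolynomial.induction_on with
  | C c => simp
  | add P Q hP hQ => simp only [map_add, polyVal_add, hP, hQ]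
  | mul_X P i hP => simp only [map_mul, polyVal_mul, hP, MvPolynomial.map_X, polyVal_X,
      Complex.conj_ofReal]

theorem IsHarmonic.map_conj {r m : ℕ} {P : MvPolynomial (Fin r) ℂ} (H : IsHarmonic r m P) :
    IsHarmonic r m (MvPolynomial.map (starRingEnd ℂ) P) :=
  ⟨H.1.map _, by simp only [MvPolynomial.pderiv_map, ← map_sum, H.2, map_zero]⟩

/-- The conjugation of `S^a(X⁰)` that restricts to pointwise conjugation on the spheres. -/
def sconj (f : S p q a) : S p q a :=
  S.mul (add_sub_cancel (conj a) a) (S.conj f) (radial (a - conj a))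

theorem sconj_sphere (f : S p q a) (z : Spheres p q) :
    sconj f (sphereIncl z) = conj (f (sphereIncl z)) := by
  simp [sconj, S.mul_apply, S.conj_apply, radial_apply, norm_fst_sphereIncl]

theorem sconj_mem {f : S p q a} (hf : f ∈ kType p q a m n) : sconj f ∈ kType p q a m n := by
  induction hf using Submodule.span_induction with
  | mem f hf =>
    obtain ⟨h₁, h₂, H₁, H₂, rfl⟩ := hf
    have e : sconj (jS a H₁ H₂) = jS a H₁.map_conj H₂.map_conj := S.ext_sphere fun z => by
      rw [sconj_sphere, jS_sphere, jS_sphere, polyVal_map_conj, polyVal_map_conj, map_mul]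
    exact e ▸ jS_mem _ _
  | zero =>
    have e : sconj (0 : S p q a) = 0 := S.ext_sphere fun z => by simp [sconj_sphere]
    rw [e]
    exact Submodule.zero_mem _
  | add f g _ _ hf hg =>
    have e : sconj (f + g) = sconj f + sconj g := S.ext_sphere fun z => by simp [sconj_sphere]
    rw [e]
    exact Submodule.add_mem _ hf hg
  | smul c f _ hf =>
    have e : sconj (c • f) = conj c • sconj f := S.ext_sphere fun z => by simp [sconj_sphere]
    rw [e]
    exact Submodule.smul_mem _ _ hf

/-- Invariance of a sesquilinear pairing of two `K`-types under `O(p) × O(q)`. -/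
def KInvariant (b : kType p q a σ.1 σ.2 →ₗ[ℂ] kType p q a τ.1 τ.2 →ₗ⋆[ℂ] ℂ) : Prop :=
  ∀ (A : Iso p) (B : Iso q) (f f' : kType p q a σ.1 σ.2) (h h' : kType p q a τ.1 τ.2),
    f'.1 = act (kElt A B) f.1 → h'.1 = act (kElt A B) h.1 → b f' h' = b f h

theorem exists_riesz_conj (φ : kType p q a σ.1 σ.2 →ₗ⋆[ℂ] ℂ) :
    ∃ g : kType p q a σ.1 σ.2, ∀ f : kType p q a σ.1 σ.2, φ f = stdInner (g : S p q a) f := by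
  obtain ⟨g, hg⟩ := exists_riesz (σ := σ) (a := a)
    { toFun := fun f => conj (φ f)
      map_add' := fun f g => by simp
      map_smul' := fun c f => by simp : kType p q a σ.1 σ.2 →ₗ[ℂ] ℂ }
  refine ⟨g, fun f => ?_⟩
  have h := congrArg conj (hg f)
  rw [stdInner_conj] at h
  simpa using h

/-- The Riesz vector of the pairing with the reproducing vector at w inherits equivariance in w. As
reproducing vectors determine a K-type, it carries all information about b. -/
theorem exists_schur_vector {b : kType p q a σ.1 σ.2 →ₗ[ℂ] kType p q a τ.1 τ.2 →ₗ⋆[ℂ] ℂ}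
    (hb : KInvariant b) : ∃ v : Spheres p q → kType p q a σ.1 σ.2,
      (∀ f w, b f (zonal τ w) = stdInner (f : S p q a) (v w)) ∧
      ∀ A B (w : Spheres p q), act (kElt A B) (v (sphMap A w.1, sphMap B w.2)).1 = (v w).1 := by
  choose v hv using fun w => exists_riesz (b.flip (zonal τ w))
  refine ⟨v, fun f w => hv w f, fun A B w => ?_⟩
  refine eq_of_stdInner (act_kElt_mem (v _).2 A B) (v w).2 fun u hu => ?_
  have h1 := hv (sphMap A w.1, sphMap B w.2) ⟨_, act_kElt_inv_mem hu A B⟩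
  have h2 := hv w ⟨u, hu⟩
  rw [stdInner_act_kElt_right, ← h1, ← h2]
  exact (hb A B _ _ _ _ (by simp) (act_zonal τ A B w).symm).symm

/-- Schur's lemma for a single `K`-type. -/
theorem schur_same {b : kType p q a σ.1 σ.2 →ₗ[ℂ] kType p q a σ.1 σ.2 →ₗ⋆[ℂ] ℂ}
    (hb : KInvariant b) : ∃ c : ℂ, ∀ f h, b f h = c * stdInner (f : S p q a) h := by
  obtain ⟨v, hv, hact⟩ := exists_schur_vector hb
  obtain ⟨w₀⟩ : Nonempty (Spheres p q) := ⟨(⟨EuclideanSpace.single 0 1, by simp⟩,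
    ⟨EuclideanSpace.single 0 1, by simp⟩)⟩
  let Z : Spheres p q → S p q a := fun w => (zonal σ w : kType p q a σ.1 σ.2).1
  let d : ℂ := (v w₀).1 (sphereIncl w₀) / Z w₀ (sphereIncl w₀)
  -- Both vectors are fixed by the stabilizer of w₀, and d is chosen so that the difference vanishes
  -- at w₀; `kType_zonal` makes the difference zero.
  have hd : (v w₀).1 = d • Z w₀ := by
    have hmem : (v w₀).1 - d • Z w₀ ∈ kType p q a σ.1 σ.2 :=
      Submodule.sub_mem _ (v w₀).2 (Submodule.smul_mem _ _ (zonal σ w₀).2)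
    refine sub_eq_zero.1 (kType_zonal hmem w₀ (fun A B hA hB => ?_) ?_)
    · have e1 : sphMap A w₀.1 = w₀.1 := Subtype.ext hA
      have e2 : sphMap B w₀.2 = w₀.2 := Subtype.ext hB
      have h1 := hact A B w₀
      have h2 := act_zonal (a := a) σ A B w₀
      rw [e1, e2] at h1 h2
      rw [map_sub, map_smul, h1, h2]
    · change (v w₀).1 (sphereIncl w₀) - d * Z w₀ (sphereIncl w₀) = 0
      -- The value of Z at w₀ is its squared norm. If it vanishes, evaluation at w₀ is zero on the
      -- K-type, and the value d = 0 from division by zero is harmless.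
      by_cases hz : Z w₀ (sphereIncl w₀) = 0
      · have hZ : Z w₀ = 0 := by
          rw [← stdInner_zonal (zonal σ w₀).2 w₀] at hz
          exact stdInner_self_eq_zero.1 hz
        have h3 := stdInner_zonal (v w₀).2 w₀
        have h4 : (zonal σ w₀ : kType p q a σ.1 σ.2).1 = 0 := hZ
        rw [h4, stdInner_zero_right] at h3
        rw [← h3, hz, mul_zero, sub_zero]
      · simp only [d]
        rw [div_mul_cancel₀ _ hz, sub_self]
  have hdw : ∀ w, (v w).1 = d • Z w := fun w => by
    obtain ⟨A, B, h1, -, h2, -⟩ := exists_kElt_swap w w₀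
    have h3 := hact A B w
    have h4 := act_zonal (a := a) σ A B w
    rw [h1, h2] at h3 h4
    rw [← h3, hd, map_smul]
    exact congrArg (d • ·) h4
  refine ⟨conj d, fun f h => ?_⟩
  obtain ⟨g, hg⟩ := exists_riesz_conj (b f)
  have hgf : g.1 = conj d • f.1 := S.ext_sphere fun w => by
    rw [← stdInner_zonal g.2 w, ← hg, hv, hdw, stdInner_smul_right, S.smul_apply,
      ← stdInner_zonal f.2 w]
  rw [hg, hgf, stdInner_smul_left]

/-- Schur's lemma for distinct `K`-types. -/
theorem schur_ne (hne : σ ≠ τ) {b : kType p q a σ.1 σ.2 →ₗ[ℂ] kType p q a τ.1 τ.2 →ₗ⋆[ℂ] ℂ}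
    (hb : KInvariant b) (f : kType p q a σ.1 σ.2) (h : kType p q a τ.1 τ.2) : b f h = 0 := by
  obtain ⟨v, hv, hact⟩ := exists_schur_vector hb
  have hv0 : ∀ w, (v w).1 = 0 := fun w => by
    obtain ⟨g, hg⟩ := exists_riesz_conj (b (zonal σ w))
    -- An element of K exchanging z and w equates b at (z, w) with b at (w, z). So the conjugate of
    -- v w belongs to both K-types and is orthogonal to itself.
    have e : sconj (v w).1 = g.1 := S.ext_sphere fun z => by
      obtain ⟨A, B, h1, h2, h3, h4⟩ := exists_kElt_swap z w
      have e1 := act_zonal (a := a) σ A B w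
      have e2 := act_zonal (a := a) τ A B z
      rw [h2, h4] at e1
      rw [h1, h3] at e2
      have h5 := hb A B (zonal σ z) (zonal σ w) (zonal τ w) (zonal τ z) (by rw [← e1]) (by rw [← e2])
      rw [sconj_sphere, ← stdInner_zonal (v w).2 z, stdInner_conj, ← hv, ← h5, hg,
        stdInner_zonal g.2 z]
    have h0 : sconj (v w).1 = 0 := by
      refine stdInner_self_eq_zero.1 ?_
      refine stdInner_kType_ne (sconj_mem (v w).2) (m' := τ.1) (n' := τ.2) ?_ hne
      rw [e]
      exact g.2
    refine S.ext_sphere fun z => ?_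
    have h1 := congrArg (fun f : S p q a => conj (f (sphereIncl z))) h0
    simpa [sconj_sphere] using h1
  obtain ⟨g, hg⟩ := exists_riesz_conj (b f)
  have hgf : g.1 = 0 := S.ext_sphere fun w => by
    rw [← stdInner_zonal g.2 w, ← hg, hv, hv0, stdInner_zero_right, S.zero_apply]
  rw [hg, hgf, stdInner_zero_left]

end Schur

end

section

open MeasureTheory Filter Topology

/-! ### The C^∞ topology through seminorms, and the elliptic operator 1 - C -/

section Jets

variable {p q : ℕ} {a : ℂ}

theorem norm_multilinear_add_le {E F : Type*} [NormedAddCommGroup E] [NormedSpace ℝ E]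
    [NormedAddCommGroup F] [NormedSpace ℝ F] {k : ℕ} (x y : E [×k]→L[ℝ] F) :
    ‖x + y‖ ≤ ‖x‖ + ‖y‖ := norm_add_le x y

theorem norm_multilinear_sum_le {E F : Type*} [NormedAddCommGroup E] [NormedSpace ℝ E]
    [NormedAddCommGroup F] [NormedSpace ℝ F] {k : ℕ} {ι : Type*} (s : Finset ι)
    (x : ι → E [×k]→L[ℝ] F) : ‖∑ i ∈ s, x i‖ ≤ ∑ i ∈ s, ‖x i‖ := norm_sum_le s x

theorem norm_multilinear_smul_le {E : Type*} [NormedAddCommGroup E] [NormedSpace ℝ E] {k : ℕ}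
    (c : ℂ) (x : E [×k]→L[ℝ] ℂ) : ‖c • x‖ ≤ ‖c‖ * ‖x‖ := norm_smul_le c x

/-- The derivative of order `k` of the pullback of `f`, along `𝕊^{p-1} × 𝕊^{q-1}`. -/
def jetAt (k : ℕ) (f : S p q a) (z : Spheres p q) : Amb p q [×k]→L[ℝ] ℂ :=
  iteratedFDeriv ℝ k (pullback f.toFun) (sphereIncl z : Amb p q)

theorem continuous_jetAt (k : ℕ) (f : S p q a) : Continuous (jetAt k f) :=
  continuous_iff_continuousAt.2 fun z =>
    ContinuousAt.comp (f := fun z : Spheres p q => (sphereIncl z : Amb p q))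
      (((contDiffOn_pullback f).contDiffAt
      (isOpen_dom.mem_nhds (mem_dom (sphereIncl z)))).continuousAt_iteratedFDeriv
      (by exact_mod_cast le_top))
      (continuous_subtype_val.comp continuous_sphereIncl).continuousAt

theorem contDiffAt_pullback (k : ℕ) (f : S p q a) (z : Spheres p q) :
    ContDiffAt ℝ k (pullback f.toFun) (sphereIncl z : Amb p q) :=
  ((contDiffOn_pullback f).contDiffAt
    (isOpen_dom.mem_nhds (mem_dom (sphereIncl z)))).of_le (by exact_mod_cast le_top)

theorem jetAt_add (k : ℕ) (f g : S p q a) (z : Spheres p q) :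
    jetAt k (f + g) z = jetAt k f z + jetAt k g z := by
  rw [jetAt, pullback_add, iteratedFDeriv_add_apply (contDiffAt_pullback k f z)
    (contDiffAt_pullback k g z)]
  rfl

theorem jetAt_sub (k : ℕ) (f g : S p q a) (z : Spheres p q) :
    jetAt k (f - g) z = jetAt k f z - jetAt k g z := by
  rw [eq_sub_iff_add_eq, ← jetAt_add, sub_add_cancel]

theorem jetAt_smul (k : ℕ) (c : ℂ) (f : S p q a) (z : Spheres p q) :
    jetAt k (c • f) z = c • jetAt k f z := by
  rw [jetAt, pullback_smul_const, iteratedFDeriv_const_smul_apply (contDiffAt_pullback k f z)]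
  rfl

/-- The supremum of the derivative of order `k`. -/
def jetSup (k : ℕ) (f : S p q a) : ℝ :=
  ‖(⟨fun z => ‖jetAt k f z‖, (continuous_jetAt k f).norm⟩ : C(Spheres p q, ℝ))‖

theorem jetSup_nonneg (k : ℕ) (f : S p q a) : 0 ≤ jetSup k f := norm_nonneg _

theorem norm_jetAt_le (k : ℕ) (f : S p q a) (z : Spheres p q) : ‖jetAt k f z‖ ≤ jetSup k f := by
  have h := ContinuousMap.norm_coe_le_norm
    (⟨fun z => ‖jetAt k f z‖, (continuous_jetAt k f).norm⟩ : C(Spheres p q, ℝ)) z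
  rwa [ContinuousMap.coe_mk, norm_norm] at h

theorem jetSup_le {k : ℕ} {f : S p q a} {C : ℝ} (hC : 0 ≤ C) (h : ∀ z, ‖jetAt k f z‖ ≤ C) :
    jetSup k f ≤ C :=
  (ContinuousMap.norm_le _ hC).2 fun z => by
    rw [ContinuousMap.coe_mk, norm_norm]
    exact h z

theorem jetSup_add_le (k : ℕ) (f g : S p q a) : jetSup k (f + g) ≤ jetSup k f + jetSup k g :=
  jetSup_le (add_nonneg (jetSup_nonneg _ _) (jetSup_nonneg _ _)) fun z => by
    rw [jetAt_add]
    exact (norm_multilinear_add_le (jetAt k f z) (jetAt k g z)).trans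
      (add_le_add (norm_jetAt_le k f z) (norm_jetAt_le k g z))

theorem jetSup_smul_le (k : ℕ) (c : ℂ) (f : S p q a) : jetSup k (c • f) ≤ ‖c‖ * jetSup k f :=
  jetSup_le (mul_nonneg (norm_nonneg _) (jetSup_nonneg _ _)) fun z => by
    rw [jetAt_smul]
    exact (norm_multilinear_smul_le c (jetAt k f z)).trans
      (mul_le_mul_of_nonneg_left (norm_jetAt_le k f z) (norm_nonneg c))

theorem tendsto_S_iff {ι : Type*} {l : Filter ι} {v : ι → S p q a} {f : S p q a} :
    Tendsto v l (𝓝 f) ↔ ∀ k, Tendsto (fun i => jetSup k (v i - f)) l (𝓝 0) := by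
  have hind : IsInducing (fun (f : S p q a) (k : ℕ) => UniformFun.ofFun (fun z : Spheres p q =>
      iteratedFDeriv ℝ k (pullback f.toFun) (sphereIncl z : Amb p q))) := ⟨rfl⟩
  rw [hind.tendsto_nhds_iff, tendsto_pi_nhds]
  refine forall_congr' fun k => ?_
  refine UniformFun.tendsto_iff_tendstoUniformly.trans ?_
  rw [Metric.tendstoUniformly_iff, Metric.tendsto_nhds]
  have hd : ∀ i z, dist (jetAt k f z) (jetAt k (v i) z) = ‖jetAt k (v i - f) z‖ := fun i z => by
    rw [dist_comm, dist_eq_norm, jetAt_sub]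
  constructor
  · intro h ε hε
    filter_upwards [h (ε / 2) (half_pos hε)] with i hi
    rw [dist_zero_right, Real.norm_of_nonneg (jetSup_nonneg _ _)]
    refine lt_of_le_of_lt (jetSup_le (half_pos hε).le fun z => ?_) (half_lt_self hε)
    rw [← hd]
    exact (hi z).le
  · intro h ε hε
    filter_upwards [h ε hε] with i hi z
    rw [dist_zero_right, Real.norm_of_nonneg (jetSup_nonneg _ _)] at hi
    exact (hd i z).trans_lt ((norm_jetAt_le _ _ _).trans_lt hi)

/-- The seminorm controlling the derivatives of order less than `K`. -/
def jetNorm (K : ℕ) (f : S p q a) : ℝ := ∑ k ∈ Finset.range K, jetSup k f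

theorem jetNorm_nonneg (K : ℕ) (f : S p q a) : 0 ≤ jetNorm K f :=
  Finset.sum_nonneg fun _ _ => jetSup_nonneg _ _

theorem norm_jet_le {k K : ℕ} (h : k < K) (f : S p q a) : jetSup k f ≤ jetNorm K f :=
  Finset.single_le_sum (f := fun k => jetSup k f) (fun _ _ => jetSup_nonneg _ _) (Finset.mem_range.2 h)

theorem jetNorm_mono {K K' : ℕ} (h : K ≤ K') (f : S p q a) : jetNorm K f ≤ jetNorm K' f :=
  Finset.sum_le_sum_of_subset_of_nonneg (Finset.range_mono h) fun _ _ _ => jetSup_nonneg _ _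

theorem tendsto_jetNorm (K : ℕ) (f : S p q a) :
    Tendsto (fun g => jetNorm K (g - f)) (𝓝 f) (𝓝 0) := by
  have := tendsto_finset_sum (Finset.range K) fun k _ =>
    tendsto_S_iff.1 (tendsto_id (x := 𝓝 f)) k
  simpa [jetNorm] using this

theorem continuous_of_jetNorm {E : Type*} [NormedAddCommGroup E] [NormedSpace ℂ E]
    (T : S p q a →ₗ[ℂ] E) {C : ℝ} {K : ℕ} (h : ∀ f, ‖T f‖ ≤ C * jetNorm K f) : Continuous T := by
  refine continuous_iff_continuousAt.2 fun f => ?_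
  refine tendsto_iff_norm_sub_tendsto_zero.2 (squeeze_zero (fun _ => norm_nonneg _)
    (fun g => ?_) (by simpa using (tendsto_jetNorm K f).const_mul C))
  rw [← map_sub]
  exact h _

/-- An operator bounded in the `C^∞` topology. -/
def JetBounded (T : S p q a →ₗ[ℂ] S p q a) : Prop :=
  ∀ k, ∃ C K, 0 ≤ C ∧ ∀ f, jetSup k (T f) ≤ C * jetNorm K f

theorem JetBounded.jetNorm_le {T : S p q a →ₗ[ℂ] S p q a} (h : JetBounded T) (K : ℕ) :
    ∃ C K', 0 ≤ C ∧ ∀ f, jetNorm K (T f) ≤ C * jetNorm K' f := by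
  induction K with
  | zero => exact ⟨0, 0, le_rfl, fun f => by simp [jetNorm]⟩
  | succ K ih =>
    obtain ⟨C₁, K₁, h₁, h₁'⟩ := ih
    obtain ⟨C₂, K₂, h₂, h₂'⟩ := h K
    refine ⟨C₁ + C₂, max K₁ K₂, add_nonneg h₁ h₂, fun f => ?_⟩
    have e : jetNorm (K + 1) (T f) = jetNorm K (T f) + jetSup K (T f) := Finset.sum_range_succ _ _
    rw [e, add_mul]
    exact add_le_add
      ((h₁' f).trans (mul_le_mul_of_nonneg_left (jetNorm_mono (le_max_left _ _) f) h₁))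
      ((h₂' f).trans (mul_le_mul_of_nonneg_left (jetNorm_mono (le_max_right _ _) f) h₂))

theorem JetBounded.comp {T T' : S p q a →ₗ[ℂ] S p q a} (h : JetBounded T) (h' : JetBounded T') :
    JetBounded (T ∘ₗ T') := fun k => by
  obtain ⟨C, K, hC, h1⟩ := h k
  obtain ⟨C', K', hC', h2⟩ := h'.jetNorm_le K
  exact ⟨C * C', K', mul_nonneg hC hC', fun f => (h1 _).trans (by
    rw [mul_assoc]
    exact mul_le_mul_of_nonneg_left (h2 f) hC)⟩

theorem JetBounded.add {T T' : S p q a →ₗ[ℂ] S p q a} (h : JetBounded T) (h' : JetBounded T') :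
    JetBounded (T + T') := fun k => by
  obtain ⟨C₁, K₁, h₁, h₁'⟩ := h k
  obtain ⟨C₂, K₂, h₂, h₂'⟩ := h' k
  refine ⟨C₁ + C₂, max K₁ K₂, add_nonneg h₁ h₂, fun f => ?_⟩
  rw [LinearMap.add_apply, add_mul]
  exact (jetSup_add_le _ _ _).trans (add_le_add
    ((h₁' f).trans (mul_le_mul_of_nonneg_left (jetNorm_mono (le_max_left _ _) f) h₁))
    ((h₂' f).trans (mul_le_mul_of_nonneg_left (jetNorm_mono (le_max_right _ _) f) h₂)))

theorem JetBounded.smul {T : S p q a →ₗ[ℂ] S p q a} (h : JetBounded T) (c : ℂ) :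
    JetBounded (c • T) := fun k => by
  obtain ⟨C, K, hC, h1⟩ := h k
  refine ⟨‖c‖ * C, K, mul_nonneg (norm_nonneg _) hC, fun f => ?_⟩
  rw [LinearMap.smul_apply, mul_assoc]
  exact (jetSup_smul_le _ _ _).trans (mul_le_mul_of_nonneg_left (h1 f) (norm_nonneg _))

theorem jetBounded_id : JetBounded (LinearMap.id : S p q a →ₗ[ℂ] S p q a) := fun k =>
  ⟨1, k + 1, zero_le_one, fun f => by
    rw [one_mul]
    exact norm_jet_le (Nat.lt_succ_self k) f⟩

theorem JetBounded.sum {ι : Type*} (s : Finset ι) {T : ι → S p q a →ₗ[ℂ] S p q a}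
    (h : ∀ i ∈ s, JetBounded (T i)) : JetBounded (∑ i ∈ s, T i) :=
  Finset.sum_induction T JetBounded (fun _ _ => JetBounded.add)
    (by simpa using (jetBounded_id (p := p) (q := q) (a := a)).smul 0) h

theorem JetBounded.pow {T : S p q a →ₗ[ℂ] S p q a} (h : JetBounded T) (N : ℕ) :
    JetBounded (T ^ N) := by
  induction N with
  | zero => exact jetBounded_id
  | succ N ih => exact ih.comp h

theorem iteratedFDerivWithin_dom {E : Type*} [NormedAddCommGroup E] [NormedSpace ℝ E]
    (F : Amb p q → E) (k : ℕ) (z : Spheres p q) :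
    iteratedFDerivWithin ℝ k F (dom p q) (sphereIncl z : Amb p q) =
      iteratedFDeriv ℝ k F (sphereIncl z : Amb p q) :=
  iteratedFDerivWithin_of_isOpen k isOpen_dom (mem_dom _)

theorem exists_bound_iteratedFDerivWithin {E : Type*} [NormedAddCommGroup E] [NormedSpace ℝ E]
    {F : Amb p q → E} (hF : ContDiffOn ℝ ∞ F (dom p q)) (k : ℕ) :
    ∃ C, 0 ≤ C ∧ ∀ z : Spheres p q,
      ‖iteratedFDerivWithin ℝ k F (dom p q) (sphereIncl z : Amb p q)‖ ≤ C := by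
  have hc : Continuous fun z : Spheres p q =>
      iteratedFDerivWithin ℝ k F (dom p q) (sphereIncl z : Amb p q) :=
    (hF.continuousOn_iteratedFDerivWithin (by exact_mod_cast le_top)
      isOpen_dom.uniqueDiffOn).comp_continuous
      (continuous_subtype_val.comp continuous_sphereIncl) fun z => mem_dom _
  obtain ⟨C, hC⟩ := (isCompact_univ (X := Spheres p q)).exists_bound_of_continuousOn hc.continuousOn
  exact ⟨max C 0, le_max_right _ _, fun z => (hC z (Set.mem_univ _)).trans (le_max_left _ _)⟩

theorem norm_iteratedFDerivWithin_fderiv_le (f : S p q a) (k : ℕ) (z : Spheres p q) :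
    ‖iteratedFDerivWithin ℝ k (fderiv ℝ (pullback f.toFun)) (dom p q) (sphereIncl z : Amb p q)‖ ≤
      jetSup (k + 1) f := by
  rw [iteratedFDerivWithin_dom, norm_iteratedFDeriv_fderiv]
  exact norm_jetAt_le _ _ _

/-- Rotations commute with the retraction, so the formula holds on an open set and not only on the
cone. Derivatives in all directions may then be taken. -/
theorem pullback_D_rot (i : RotIdx p q) (f : S p q a) {w : Amb p q} (hw : w ∈ dom p q) :
    pullback (D (rot i) f).toFun w = fderiv ℝ (pullback f.toFun) w (rot i w) := by
  have h1 : 0 < ‖w.1‖ / ‖w.2‖ := div_pos (norm_pos_iff.2 hw.1) (norm_pos_iff.2 hw.2)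
  have h := fderiv_pullback_smul f one_pos h1 hw (rot i w)
  rw [Complex.ofReal_one, Complex.one_cpow, one_mul, one_smul, one_smul] at h
  rw [pullback_apply _ hw, ← h]
  change fderiv ℝ (pullback f.toFun) (retraction w) (rot i (retraction w)) = _
  congr 1
  rcases i with i | i
  · simp [rot, retraction]
  · simp [rot, retraction]

theorem jetBounded_D_rot (i : RotIdx p q) : JetBounded (D (a := a) (rot i)) := by
  intro k
  choose M hM0 hM using fun j => exists_bound_iteratedFDerivWithin (p := p) (q := q)
    (rot i).contDiff.contDiffOn j
  refine ⟨∑ j ∈ Finset.range (k + 1), (k.choose j : ℝ) * M (k - j), k + 2,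
    Finset.sum_nonneg fun j _ => mul_nonneg (Nat.cast_nonneg _) (hM0 _), fun f => ?_⟩
  refine jetSup_le (mul_nonneg (Finset.sum_nonneg fun j _ =>
    mul_nonneg (Nat.cast_nonneg _) (hM0 _)) (jetNorm_nonneg _ _)) fun z => ?_
  rw [jetAt, ← iteratedFDerivWithin_dom,
    iteratedFDerivWithin_congr (fun w hw => pullback_D_rot i f hw) (mem_dom _)]
  refine (norm_iteratedFDerivWithin_clm_apply (N := ∞)
    ((contDiffOn_pullback f).fderiv_of_isOpen isOpen_dom (m := ∞) (by simp))
    (rot i).contDiff.contDiffOn isOpen_dom.uniqueDiffOn (mem_dom _)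
    (by exact_mod_cast le_top)).trans ?_
  rw [Finset.sum_mul]
  refine Finset.sum_le_sum fun j hj => ?_
  have hj' := Finset.mem_range.1 hj
  have h1 := (norm_iteratedFDerivWithin_fderiv_le f j z).trans
    (norm_jet_le (K := k + 2) (by omega) f)
  have h2 := hM (k - j) z
  calc _ ≤ (k.choose j : ℝ) * jetNorm (k + 2) f * M (k - j) := by
        gcongr
        exact mul_nonneg (Nat.cast_nonneg _) (jetNorm_nonneg _ _)
    _ = _ := by ring

theorem lam_ge {r : ℕ} (hr : 1 ≤ r) (m : ℕ) : (m : ℝ) * (m - 1) ≤ lam r m := by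
  have : (1 : ℝ) ≤ r := by exact_mod_cast hr
  rw [lam]
  exact mul_le_mul_of_nonneg_left (by linarith) (Nat.cast_nonneg m)

theorem lam_nonneg {r : ℕ} (hr : 1 ≤ r) (m : ℕ) : 0 ≤ lam r m := by
  refine le_trans ?_ (lam_ge hr m)
  rcases m with _ | m
  · simp
  · push_cast
    have : (0 : ℝ) ≤ m := Nat.cast_nonneg m
    nlinarith

/-- The elliptic operator `1 - C`, where `C` is the Casimir operator of `O(p) × O(q)`. -/
def Lam : S p q a →ₗ[ℂ] S p q a := LinearMap.id - cas

theorem Lam_apply (f : S p q a) : Lam f = f - cas f := rfl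

theorem jetBounded_Lam : JetBounded (Lam : S p q a →ₗ[ℂ] S p q a) := by
  have e : (Lam : S p q a →ₗ[ℂ] S p q a) =
      LinearMap.id + (-(1 / 2) : ℂ) • ∑ i, (D (rot i)) ∘ₗ (D (rot i)) := by
    ext1 f
    simp only [Lam_apply, cas_apply, LinearMap.add_apply, LinearMap.smul_apply, LinearMap.id_apply,
      LinearMap.sum_apply, LinearMap.comp_apply, LinearMap.neg_apply, neg_smul, sub_eq_add_neg]
  rw [e]
  exact jetBounded_id.add ((JetBounded.sum _ fun i _ =>
    (jetBounded_D_rot i).comp (jetBounded_D_rot i)).smul _)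

variable [NeZero p] [NeZero q]

theorem norm_iota_le (f : S p q a) {C : ℝ} (hC : 0 ≤ C) (h : ∀ z, ‖f (sphereIncl z)‖ ≤ C) :
    ‖iota f‖ ≤ C := by
  refine abs_le_of_sq_le_sq' ?_ hC |>.2
  rw [norm_iota_sq]
  have h1 : ∫ z, ‖f (sphereIncl z)‖ ^ 2 ∂(mu p q) ≤ ∫ _, C ^ 2 ∂(mu p q) :=
    integral_mono (integrable_cont (((continuous_S f).comp continuous_sphereIncl).norm.pow 2))
      (integrable_const _) fun z => pow_le_pow_left₀ (norm_nonneg _) (h z) 2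
  simpa using h1

theorem norm_iota_le_jet (f : S p q a) : ‖iota f‖ ≤ jetSup 0 f :=
  norm_iota_le f (jetSup_nonneg _ _) fun z => by
    rw [← pullback_coe f.toFun, ← norm_iteratedFDeriv_zero (𝕜 := ℝ)]
    exact norm_jetAt_le _ _ _

/-- The `L²` Sobolev seminorms are continuous. -/
theorem continuous_iota_Lam_pow (N : ℕ) :
    Continuous fun f : S p q a => iota ((Lam ^ N) f) := by
  obtain ⟨C, K, hC, h⟩ := (jetBounded_Lam.pow N : JetBounded (Lam ^ N : S p q a →ₗ[ℂ] _)) 0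
  exact continuous_of_jetNorm (iota ∘ₗ (Lam ^ N)) fun f => (norm_iota_le_jet _).trans (h f)

theorem continuous_iota : Continuous (iota : S p q a →ₗ[ℂ] L2 p q) := continuous_iota_Lam_pow 0

/-- The eigenvalue of `Lam` on a `K`-type. -/
def ell (p q : ℕ) (σ : ℕ × ℕ) : ℝ := 1 + lam p σ.1 + lam q σ.2

theorem Lam_kType {σ : ℕ × ℕ} {f : S p q a} (hf : f ∈ kType p q a σ.1 σ.2) :
    Lam f = (ell p q σ : ℂ) • f := by
  rw [Lam_apply, cas_kType hf, ell]
  push_cast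
  module

theorem Lam_pow_kType {σ : ℕ × ℕ} {f : S p q a} (hf : f ∈ kType p q a σ.1 σ.2) (N : ℕ) :
    (Lam ^ N) f = (ell p q σ : ℂ) ^ N • f := by
  induction N with
  | zero => simp
  | succ N ih =>
    rw [pow_succ, Module.End.mul_apply, Lam_kType hf, map_smul, ih, smul_smul, pow_succ']

theorem comp_Lam (σ : ℕ × ℕ) (f : S p q a) : comp σ (Lam f) = (ell p q σ : ℂ) • comp σ f := by
  rw [Lam_apply, map_sub, comp_cas, ell]
  push_cast
  module

theorem comp_Lam_pow (σ : ℕ × ℕ) (N : ℕ) (f : S p q a) :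
    comp σ ((Lam ^ N) f) = (ell p q σ : ℂ) ^ N • comp σ f := by
  induction N generalizing f with
  | zero => simp
  | succ N ih => rw [pow_succ, Module.End.mul_apply, ih, comp_Lam, smul_smul, pow_succ]

theorem eq_of_comp {f g : S p q a} (h : ∀ σ, comp σ f = comp σ g) : f = g :=
  sub_eq_zero.1 (eq_zero_of_comp fun σ => by rw [map_sub, h, sub_self])

theorem Lam_pow_D_rot (N : ℕ) (i : RotIdx p q) (f : S p q a) :
    (Lam ^ N) (D (rot i) f) = D (rot i) ((Lam ^ N) f) :=
  eq_of_comp fun σ => by rw [comp_Lam_pow, comp_D_rot, comp_D_rot, comp_Lam_pow, map_smul]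

theorem Lam_pow_act_kElt (N : ℕ) (A : Iso p) (B : Iso q) (f : S p q a) :
    (Lam ^ N) (act (kElt A B) f) = act (kElt A B) ((Lam ^ N) f) :=
  eq_of_comp fun σ => by rw [comp_Lam_pow, comp_act_kElt, comp_act_kElt, comp_Lam_pow, map_smul]

theorem one_le_ell (σ : ℕ × ℕ) : 1 ≤ ell p q σ := by
  have h1 := lam_nonneg (r := p) NeZero.one_le σ.1
  have h2 := lam_nonneg (r := q) NeZero.one_le σ.2
  rw [ell]
  linarith

theorem mul_le_ell (σ : ℕ × ℕ) : ((σ.1 : ℝ) + 1) * (σ.2 + 1) ≤ 4 * ell p q σ := by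
  have h1 := lam_ge (r := p) NeZero.one_le σ.1
  have h2 := lam_ge (r := q) NeZero.one_le σ.2
  have h3 := one_le_ell (p := p) (q := q) σ
  rw [ell] at h3 ⊢
  nlinarith [sq_nonneg ((σ.1 : ℝ) - 1), sq_nonneg ((σ.2 : ℝ) - 1), sq_nonneg ((σ.1 : ℝ) - σ.2)]

theorem stdInner_Lam_self (f : S p q a) :
    stdInner (Lam f) f = ((‖iota f‖ ^ 2 + 1 / 2 * ∑ i, ‖iota (D (rot i) f)‖ ^ 2 : ℝ) : ℂ) := by
  rw [Lam_apply, stdInner_sub_left, cas_apply, stdInner_smul_left, stdInner_sum_left]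
  simp only [stdInner_D_rot, stdInner_self]
  push_cast
  rw [Finset.sum_neg_distrib]
  ring

/-- Pairing (1 - C) f with f gives ‖f‖² plus half the sum of the squared norms of the rotation
derivatives. Thus one power of `Lam` controls one rotation derivative in L². -/
theorem energy_le (f : S p q a) :
    ‖iota f‖ ^ 2 + 1 / 2 * ∑ i, ‖iota (D (rot i) f)‖ ^ 2 ≤ ‖iota (Lam f)‖ * ‖iota f‖ := by
  have h := norm_stdInner_le (Lam f) f
  rw [stdInner_Lam_self, Complex.norm_real] at h
  exact (le_abs_self _).trans h

theorem norm_iota_le_Lam (f : S p q a) : ‖iota f‖ ≤ ‖iota (Lam f)‖ := by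
  have h := energy_le f
  have h2 : 0 ≤ ∑ i, ‖iota (D (rot i) f)‖ ^ 2 := Finset.sum_nonneg fun _ _ => sq_nonneg _
  by_contra hlt
  push Not at hlt
  nlinarith [norm_nonneg (iota f), norm_nonneg (iota (Lam f))]

theorem norm_iota_D_rot_le (i : RotIdx p q) (f : S p q a) :
    ‖iota (D (rot i) f)‖ ≤ 2 * ‖iota (Lam f)‖ := by
  have h := energy_le f
  have h1 := norm_iota_le_Lam f
  have h2 := Finset.single_le_sum (f := fun i => ‖iota (D (rot i) f)‖ ^ 2)
    (fun _ _ => sq_nonneg _) (Finset.mem_univ i)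
  refine abs_le_of_sq_le_sq' ?_ (by positivity) |>.2
  nlinarith [norm_nonneg (iota f), norm_nonneg (iota (Lam f)), sq_nonneg (‖iota f‖)]

theorem norm_iota_Lam_pow_mono {N N' : ℕ} (h : N ≤ N') (f : S p q a) :
    ‖iota ((Lam ^ N) f)‖ ≤ ‖iota ((Lam ^ N') f)‖ := by
  induction h with
  | refl => exact le_rfl
  | step _ ih =>
    refine ih.trans ?_
    rw [pow_succ', Module.End.mul_apply]
    exact norm_iota_le_Lam _

end Jets

/-! ### Sobolev estimates: L² norms of powers of 1 - C define the topology -/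

section Sobolev

variable {p q : ℕ} [NeZero p] [NeZero q] {a : ℂ}

/-- `Lam` multiplies the component in σ by its eigenvalue, so components of a smooth function decay
faster than any power of that eigenvalue. -/
theorem norm_comp_le (N : ℕ) (σ : ℕ × ℕ) (f : S p q a) :
    ‖iota (comp σ f)‖ ≤ (ell p q σ ^ N)⁻¹ * ‖iota ((Lam ^ N) f)‖ := by
  have h := norm_iota_comp_le σ ((Lam ^ N) f)
  have h0 : 0 < ell p q σ ^ N := pow_pos (one_pos.trans_le (one_le_ell σ)) N
  rw [comp_Lam_pow, map_smul, norm_smul, norm_pow, Complex.norm_real,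
    Real.norm_of_nonneg (zero_le_one.trans (one_le_ell σ))] at h
  rwa [inv_mul_eq_div, le_div_iff₀' h0]

/-- The exponent of summability. -/
def sobExp (p q : ℕ) : ℕ := p + q + 2

theorem ell_inv_le (σ : ℕ × ℕ) (N : ℕ) :
    (ell p q σ ^ N)⁻¹ ≤ 4 ^ N * (((σ.1 : ℝ) + 1) * (σ.2 + 1))⁻¹ ^ N := by
  have h0 : 0 < ell p q σ := one_pos.trans_le (one_le_ell σ)
  have h1 : (0 : ℝ) < ((σ.1 : ℝ) + 1) * (σ.2 + 1) := by positivity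
  rw [← inv_pow, ← mul_pow]
  refine pow_le_pow_left₀ (inv_nonneg.2 h0.le) ?_ N
  rw [← div_eq_mul_inv, inv_eq_one_div, div_le_div_iff₀ h0 h1, one_mul]
  exact mul_le_ell σ

theorem summable_types : Summable fun σ : ℕ × ℕ => (((σ.1 : ℝ) + 1) * (σ.2 + 1))⁻¹ ^ 2 := by
  have h : Summable fun n : ℕ => (((n : ℝ) + 1)⁻¹) ^ 2 := by
    have := (summable_nat_add_iff 1).2 (Real.summable_nat_pow_inv.2 one_lt_two)
    simpa [inv_pow] using this
  have := h.mul_of_nonneg h (fun _ => by positivity) (fun _ => by positivity)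
  refine this.congr fun σ => ?_
  rw [mul_inv, mul_pow]

/-- In the exponent p + q + 2, the part p + q absorbs the sup-norm constants of the K-types and the
2 makes the double series converge. -/
theorem summable_ell : Summable fun σ : ℕ × ℕ =>
    √((σ.1 + 1) ^ p * (σ.2 + 1) ^ q) * (ell p q σ ^ sobExp p q)⁻¹ := by
  refine Summable.of_nonneg_of_le (fun σ => ?_) (fun σ => ?_)
    (summable_types.mul_left (4 ^ sobExp p q))
  · have := one_pos.trans_le (one_le_ell (p := p) (q := q) σ)
    positivity
  · have h1 : (1 : ℝ) ≤ σ.1 + 1 := by simp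
    have h2 : (1 : ℝ) ≤ σ.2 + 1 := by simp
    have h3 : (1 : ℝ) ≤ (σ.1 + 1) ^ p * (σ.2 + 1) ^ q :=
      one_le_mul_of_one_le_of_one_le (one_le_pow₀ h1) (one_le_pow₀ h2)
    have h4 : √(((σ.1 : ℝ) + 1) ^ p * (σ.2 + 1) ^ q) ≤ (((σ.1 : ℝ) + 1) * (σ.2 + 1)) ^ (p + q) := by
      refine (Real.sqrt_le_iff.2 ⟨zero_le_one.trans h3, le_self_pow₀ h3 two_ne_zero⟩).trans ?_
      rw [mul_pow]
      exact mul_le_mul (pow_le_pow_right₀ h1 (by omega)) (pow_le_pow_right₀ h2 (by omega))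
        (by positivity) (by positivity)
    have h5 := ell_inv_le (p := p) (q := q) σ (sobExp p q)
    have h6 : (0 : ℝ) < ((σ.1 : ℝ) + 1) * (σ.2 + 1) := by positivity
    have h7 : 0 ≤ (ell p q σ ^ sobExp p q)⁻¹ :=
      inv_nonneg.2 (pow_nonneg (zero_le_one.trans (one_le_ell σ)) _)
    refine (mul_le_mul h4 h5 h7 (by positivity)).trans_eq ?_
    have h8 : (((σ.1 : ℝ) + 1) * (σ.2 + 1)) ^ (p + q) *
        (((σ.1 : ℝ) + 1) * (σ.2 + 1))⁻¹ ^ (p + q) = 1 := by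
      rw [← mul_pow, mul_inv_cancel₀ h6.ne', one_pow]
    rw [sobExp, pow_add _ (p + q) 2, pow_add _ (p + q) 2]
    linear_combination (4 ^ (p + q) * 4 ^ 2 * (((σ.1 : ℝ) + 1) * (σ.2 + 1))⁻¹ ^ 2) * h8

/-- The expansion into K-types converges uniformly: the decay of the components beats the constants
of `norm_apply_le`. The uniform limit is f because it agrees with the L² limit. -/
theorem exists_sup_le : ∃ C, 0 ≤ C ∧ ∀ (f : S p q a) (z : Spheres p q),
    ‖f (sphereIncl z)‖ ≤ C * ‖iota ((Lam ^ sobExp p q) f)‖ := by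
  refine ⟨∑' σ : ℕ × ℕ, √((σ.1 + 1) ^ p * (σ.2 + 1) ^ q) * (ell p q σ ^ sobExp p q)⁻¹,
    tsum_nonneg fun σ => ?_, fun f z => ?_⟩
  · have := one_pos.trans_le (one_le_ell (p := p) (q := q) σ)
    positivity
  have hb : ∀ σ : ℕ × ℕ, ‖res (comp σ f)‖ ≤ √((σ.1 + 1) ^ p * (σ.2 + 1) ^ q) *
      (ell p q σ ^ sobExp p q)⁻¹ * ‖iota ((Lam ^ sobExp p q) f)‖ := fun σ => by
    have h0 := one_pos.trans_le (one_le_ell (p := p) (q := q) σ)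
    refine (ContinuousMap.norm_le _ (by positivity)).2 fun z => ?_
    rw [res_apply, mul_assoc]
    exact (norm_apply_le (comp_mem σ f) z).trans
      (mul_le_mul_of_nonneg_left (norm_comp_le _ σ f) (Real.sqrt_nonneg _))
  have hs := summable_ell (p := p) (q := q) |>.mul_right ‖iota ((Lam ^ sobExp p q) f)‖
  have hsum : Summable fun σ => res (comp σ f) := Summable.of_norm_bounded hs hb
  have heq : ∑' σ, res (comp σ f) = res f := by
    refine ContinuousMap.toLp_injective (mu p q) (p := 2) (𝕜 := ℂ) ?_
    have h1 := hsum.hasSum.mapL (ContinuousMap.toLp 2 (mu p q) ℂ)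
    exact h1.unique (hasSum_iota_comp f)
  rw [← tsum_mul_right, ← res_apply, ← heq]
  exact (ContinuousMap.norm_coe_le_norm _ z).trans (tsum_of_norm_bounded hs.hasSum hb)

/-- The coordinate form `dx_l`. -/
def dfst (l : Fin p) : Amb p q →L[ℝ] ℂ :=
  Complex.ofRealCLM.comp ((EuclideanSpace.proj (𝕜 := ℝ) l).comp (ContinuousLinearMap.fst ℝ _ _))

/-- The coordinate form `dy_l`. -/
def dsnd (l : Fin q) : Amb p q →L[ℝ] ℂ :=
  Complex.ofRealCLM.comp ((EuclideanSpace.proj (𝕜 := ℝ) l).comp (ContinuousLinearMap.snd ℝ _ _))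

/-- The coefficients expressing the gradient through the rotations. -/
def gradCoeff : RotIdx p q → Amb p q → Amb p q →L[ℝ] ℂ
  | Sum.inl i, w => ((w.1 i.1 / ‖w.1‖ ^ 2 : ℝ) : ℂ) • dfst i.2
  | Sum.inr i, w => ((w.2 i.1 / ‖w.2‖ ^ 2 : ℝ) : ℂ) • dsnd i.2

/-- The zeroth-order coefficient in the gradient. -/
def gradCoeffZero (a : ℂ) (w : Amb p q) : Amb p q →L[ℝ] ℂ :=
  ∑ l, (((w.1 l / ‖w.1‖ ^ 2 : ℝ) : ℂ) * a) • dfst l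

theorem contDiffOn_coord_fst (i : Fin p) :
    ContDiffOn ℝ ∞ (fun w : Amb p q => ((w.1 i / ‖w.1‖ ^ 2 : ℝ) : ℂ)) (dom p q) :=
  Complex.ofRealCLM.contDiff.comp_contDiffOn ((((EuclideanSpace.proj (𝕜 := ℝ) i).contDiff.comp
    contDiff_fst).contDiffOn).div (contDiff_fst.norm_sq ℝ).contDiffOn
    fun w hw => pow_ne_zero 2 (norm_ne_zero_iff.2 hw.1))

theorem contDiffOn_coord_snd (i : Fin q) :
    ContDiffOn ℝ ∞ (fun w : Amb p q => ((w.2 i / ‖w.2‖ ^ 2 : ℝ) : ℂ)) (dom p q) :=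
  Complex.ofRealCLM.contDiff.comp_contDiffOn ((((EuclideanSpace.proj (𝕜 := ℝ) i).contDiff.comp
    contDiff_snd).contDiffOn).div (contDiff_snd.norm_sq ℝ).contDiffOn
    fun w hw => pow_ne_zero 2 (norm_ne_zero_iff.2 hw.2))

theorem contDiffOn_gradCoeff (i : RotIdx p q) : ContDiffOn ℝ ∞ (gradCoeff i) (dom p q) := by
  rcases i with i | i
  · exact (contDiffOn_coord_fst i.1).smul contDiffOn_const
  · exact (contDiffOn_coord_snd i.1).smul contDiffOn_const

theorem contDiffOn_gradCoeffZero (a : ℂ) :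
    ContDiffOn ℝ ∞ (gradCoeffZero (p := p) (q := q) a) (dom p q) :=
  ContDiffOn.sum fun l _ => ((contDiffOn_coord_fst l).mul contDiffOn_const).smul contDiffOn_const

/-- Rotations give the tangential derivatives and homogeneity the two radial ones. The whole
differential is therefore a combination of f and its rotation derivatives, with coefficients smooth
off the zero vectors. -/
theorem fderiv_pullback_eq (f : S p q a) {w : Amb p q} (hw : w ∈ dom p q) :
    fderiv ℝ (pullback f.toFun) w =
      ∑ i, pullback (D (rot i) f).toFun w • gradCoeff i w +
        pullback f.toFun w • gradCoeffZero a w := by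
  have hx : ((‖w.1‖ ^ 2 : ℝ) : ℂ) ≠ 0 := by
    exact_mod_cast pow_ne_zero 2 (norm_ne_zero_iff.2 hw.1)
  have hy : ((‖w.2‖ ^ 2 : ℝ) : ℂ) ≠ 0 := by
    exact_mod_cast pow_ne_zero 2 (norm_ne_zero_iff.2 hw.2)
  refine ContinuousLinearMap.ext fun v => ?_
  have hv : v = ∑ l, v.1 l • ((EuclideanSpace.single l (1 : ℝ), 0) : Amb p q) +
      ∑ l, v.2 l • ((0, EuclideanSpace.single l (1 : ℝ)) : Amb p q) := by
    refine Prod.ext ?_ ?_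
    · rw [Prod.fst_add, Prod.fst_sum, Prod.fst_sum]
      ext i
      simp [Pi.single_apply]
    · rw [Prod.snd_add, Prod.snd_sum, Prod.snd_sum]
      ext i
      simp [Pi.single_apply]
  have h1 : ∀ l, fderiv ℝ (pullback f.toFun) w (EuclideanSpace.single l (1 : ℝ), 0) =
      ∑ i, ((w.1 i / ‖w.1‖ ^ 2 : ℝ) : ℂ) * pullback (D (rot (Sum.inl (i, l))) f).toFun w +
        ((w.1 l / ‖w.1‖ ^ 2 : ℝ) : ℂ) * a * pullback f.toFun w := fun l => by
    have h := grad_fst f hw l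
    have e : ∀ i, ((w.1 i / ‖w.1‖ ^ 2 : ℝ) : ℂ) * pullback (D (rot (Sum.inl (i, l))) f).toFun w =
        ((‖w.1‖ ^ 2 : ℝ) : ℂ)⁻¹ * ((w.1 i : ℂ) *
          fderiv ℝ (pullback f.toFun) w (rot (Sum.inl (i, l)) w)) := fun i => by
      rw [pullback_D_rot _ f hw, Complex.ofReal_div]
      ring
    simp only [e]
    rw [← Finset.mul_sum, h, Complex.ofReal_div]
    field_simp
    ring
  have h2 : ∀ l, fderiv ℝ (pullback f.toFun) w (0, EuclideanSpace.single l (1 : ℝ)) =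
      ∑ i, ((w.2 i / ‖w.2‖ ^ 2 : ℝ) : ℂ) * pullback (D (rot (Sum.inr (i, l))) f).toFun w :=
    fun l => by
    have h := grad_snd f hw l
    have e : ∀ i, ((w.2 i / ‖w.2‖ ^ 2 : ℝ) : ℂ) * pullback (D (rot (Sum.inr (i, l))) f).toFun w =
        ((‖w.2‖ ^ 2 : ℝ) : ℂ)⁻¹ * ((w.2 i : ℂ) *
          fderiv ℝ (pullback f.toFun) w (rot (Sum.inr (i, l)) w)) := fun i => by
      rw [pullback_D_rot _ f hw, Complex.ofReal_div]
      ring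
    simp only [e]
    rw [← Finset.mul_sum, h]
    field_simp
  have hproj : ∀ {r : ℕ} (l : Fin r) (x : EuclideanSpace ℝ (Fin r)),
      (EuclideanSpace.proj l : _ →L[ℝ] ℝ) x = x l := fun _ _ => rfl
  conv_lhs => rw [hv, map_add, map_sum, map_sum]
  simp only [map_smul, h1, h2]
  simp only [add_apply, sum_apply, smul_apply, Fintype.sum_sum_type, Fintype.sum_prod_type,
    gradCoeff, gradCoeffZero, dfst, dsnd, ContinuousLinearMap.comp_apply, smul_eq_mul,
    Complex.real_smul, Complex.ofRealCLM_apply, ContinuousLinearMap.coe_fst',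
    ContinuousLinearMap.coe_snd', hproj]
  rw [Finset.sum_comm (s := (Finset.univ : Finset (Fin p))),
    Finset.sum_comm (s := (Finset.univ : Finset (Fin q)))]
  simp only [mul_add, Finset.mul_sum, Finset.sum_add_distrib]
  rw [add_right_comm]
  congr 1
  · congr 1
    · refine Finset.sum_congr rfl fun l _ => Finset.sum_congr rfl fun i _ => ?_
      ring
    · refine Finset.sum_congr rfl fun l _ => Finset.sum_congr rfl fun i _ => ?_
      ring
  · refine Finset.sum_congr rfl fun l _ => ?_
    ring

theorem norm_iteratedFDerivWithin_smul_jet_le {G : Amb p q → Amb p q →L[ℝ] ℂ}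
    (hG : ContDiffOn ℝ ∞ G (dom p q)) (k : ℕ) : ∃ C, 0 ≤ C ∧ ∀ (f : S p q a) (z : Spheres p q),
      ‖iteratedFDerivWithin ℝ k (fun w => pullback f.toFun w • G w) (dom p q)
        (sphereIncl z : Amb p q)‖ ≤ C * jetNorm (k + 1) f := by
  choose M hM0 hM using fun j => exists_bound_iteratedFDerivWithin hG j
  refine ⟨∑ j ∈ Finset.range (k + 1), (k.choose j : ℝ) * M (k - j),
    Finset.sum_nonneg fun j _ => mul_nonneg (Nat.cast_nonneg _) (hM0 _), fun f z => ?_⟩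
  refine (norm_iteratedFDerivWithin_smul_le (N := ∞) (contDiffOn_pullback f) hG
    isOpen_dom.uniqueDiffOn (mem_dom _) (by exact_mod_cast le_top)).trans ?_
  rw [Finset.sum_mul]
  refine Finset.sum_le_sum fun j hj => ?_
  have hj' := Finset.mem_range.1 hj
  have h1 : ‖iteratedFDerivWithin ℝ j (pullback f.toFun) (dom p q) (sphereIncl z : Amb p q)‖ ≤
      jetNorm (k + 1) f := by
    rw [iteratedFDerivWithin_dom]
    exact (norm_jetAt_le _ _ _).trans (norm_jet_le hj' f)
  have h2 := hM (k - j) z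
  calc _ ≤ (k.choose j : ℝ) * jetNorm (k + 1) f * M (k - j) := by
        gcongr
        exact mul_nonneg (Nat.cast_nonneg _) (jetNorm_nonneg _ _)
    _ = _ := by ring

/-- Leibniz in `fderiv_pullback_eq`: one order of differentiation is traded for one rotation
derivative. -/
theorem exists_jet_succ_le (k : ℕ) : ∃ C, 0 ≤ C ∧ ∀ f : S p q a,
    jetSup (k + 1) f ≤ C * (∑ i, jetNorm (k + 1) (D (rot i) f) + jetNorm (k + 1) f) := by
  choose C hC0 hC using fun i => norm_iteratedFDerivWithin_smul_jet_le (a := a)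
    (contDiffOn_gradCoeff (p := p) (q := q) i) k
  obtain ⟨C', hC0', hC'⟩ := norm_iteratedFDerivWithin_smul_jet_le (a := a)
    (contDiffOn_gradCoeffZero (p := p) (q := q) a) k
  have hsum : 0 ≤ ∑ i, C i := Finset.sum_nonneg fun i _ => hC0 i
  refine ⟨∑ i, C i + C', add_nonneg hsum hC0', fun f => ?_⟩
  have hJ : 0 ≤ ∑ i, jetNorm (k + 1) (D (rot i) f) :=
    Finset.sum_nonneg fun i _ => jetNorm_nonneg _ _
  have hJ' := jetNorm_nonneg (k + 1) f
  refine jetSup_le (mul_nonneg (add_nonneg hsum hC0') (add_nonneg hJ hJ')) fun z => ?_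
  have hd : ∀ i, ContDiffOn ℝ ∞ (fun w => pullback (D (rot i) f).toFun w • gradCoeff i w)
      (dom p q) := fun i => (contDiffOn_pullback _).smul (contDiffOn_gradCoeff i)
  have hd' : ContDiffOn ℝ ∞ (fun w => pullback f.toFun w • gradCoeffZero a w) (dom p q) :=
    (contDiffOn_pullback _).smul (contDiffOn_gradCoeffZero a)
  have hle : ((k : ℕ) : WithTop ℕ∞) ≤ ∞ := by exact_mod_cast le_top
  have h1 : ‖∑ i, iteratedFDerivWithin ℝ k (fun w => pullback (D (rot i) f).toFun w •
      gradCoeff i w) (dom p q) (sphereIncl z : Amb p q)‖ ≤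
      (∑ i, C i) * ∑ i, jetNorm (k + 1) (D (rot i) f) := by
    refine (norm_multilinear_sum_le Finset.univ fun i => iteratedFDerivWithin ℝ k
      (fun w => pullback (D (rot i) f).toFun w • gradCoeff i w) (dom p q)
        (sphereIncl z : Amb p q)).trans ?_
    rw [Finset.sum_mul]
    refine Finset.sum_le_sum fun i _ => (hC i _ z).trans ?_
    exact mul_le_mul_of_nonneg_left (Finset.single_le_sum
      (f := fun i => jetNorm (k + 1) (D (rot i) f)) (fun _ _ => jetNorm_nonneg _ _)
      (Finset.mem_univ i)) (hC0 i)
  have h3 : iteratedFDerivWithin ℝ k (fderiv ℝ (pullback f.toFun)) (dom p q)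
      (sphereIncl z : Amb p q) = ∑ i, iteratedFDerivWithin ℝ k
        (fun w => pullback (D (rot i) f).toFun w • gradCoeff i w) (dom p q)
          (sphereIncl z : Amb p q) + iteratedFDerivWithin ℝ k
            (fun w => pullback f.toFun w • gradCoeffZero a w) (dom p q)
              (sphereIncl z : Amb p q) := by
    rw [iteratedFDerivWithin_congr (fun w hw => fderiv_pullback_eq f hw) (mem_dom _),
      fun_iteratedFDerivWithin_add_apply
        ((ContDiffOn.sum fun i _ => hd i).of_le hle _ (mem_dom _)) (hd'.of_le hle _ (mem_dom _))
        isOpen_dom.uniqueDiffOn (mem_dom _),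
      show (fun w => ∑ i, pullback (D (rot i) f).toFun w • gradCoeff i w) =
        ∑ i, fun w => pullback (D (rot i) f).toFun w • gradCoeff i w from
          (by funext w; simp only [Finset.sum_apply]),
      iteratedFDerivWithin_sum_apply isOpen_dom.uniqueDiffOn (mem_dom _)
        (fun i _ => (hd i).of_le hle _ (mem_dom _))]
  have h4 : ‖jetAt (k + 1) f z‖ = ‖iteratedFDerivWithin ℝ k (fderiv ℝ (pullback f.toFun))
      (dom p q) (sphereIncl z : Amb p q)‖ := by
    rw [iteratedFDerivWithin_dom, norm_iteratedFDeriv_fderiv]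
    rfl
  rw [h4, h3]
  refine (norm_multilinear_add_le (∑ i, iteratedFDerivWithin ℝ k
        (fun w => pullback (D (rot i) f).toFun w • gradCoeff i w) (dom p q)
          (sphereIncl z : Amb p q)) _).trans ?_
  have h2 := hC' f z
  nlinarith [mul_nonneg hC0' hJ, mul_nonneg hsum hJ']

/-- The `L²` Sobolev seminorms control the `C^∞` topology. -/
theorem exists_jetNorm_le (K : ℕ) : ∃ C N, 0 ≤ C ∧ ∀ f : S p q a,
    jetNorm K f ≤ C * ‖iota ((Lam ^ N) f)‖ := by
  induction K with
  | zero => exact ⟨0, 0, le_rfl, fun f => by simp [jetNorm]⟩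
  | succ K ih =>
    obtain ⟨C, N, hC, h⟩ := ih
    -- Order zero is the Sobolev embedding. A higher order is traded for a rotation, which commutes
    -- with `Lam` and costs one more power of it.
    have hlast : ∃ C' N', 0 ≤ C' ∧ ∀ f : S p q a, jetSup K f ≤ C' * ‖iota ((Lam ^ N') f)‖ := by
      rcases K with _ | k
      · obtain ⟨C', hC', h'⟩ := exists_sup_le (p := p) (q := q) (a := a)
        refine ⟨C', sobExp p q, hC', fun f => ?_⟩
        refine jetSup_le (by positivity) fun z => ?_
        rw [jetAt, norm_iteratedFDeriv_zero, pullback_coe]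
        exact h' f z
      · obtain ⟨C', hC', h'⟩ := exists_jet_succ_le (p := p) (q := q) (a := a) k
        refine ⟨C' * (∑ _i : RotIdx p q, C * 2 + C), N + 1, by positivity, fun f => ?_⟩
        refine (h' f).trans ?_
        rw [mul_assoc]
        refine mul_le_mul_of_nonneg_left ?_ hC'
        rw [add_mul, Finset.sum_mul]
        refine add_le_add (Finset.sum_le_sum fun i _ => (h _).trans ?_) ((h f).trans ?_)
        · rw [Lam_pow_D_rot, mul_assoc, pow_succ', Module.End.mul_apply]
          exact mul_le_mul_of_nonneg_left (norm_iota_D_rot_le i _) hC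
        · exact mul_le_mul_of_nonneg_left (norm_iota_Lam_pow_mono (Nat.le_succ N) f) hC
    obtain ⟨C', N', hC', h'⟩ := hlast
    refine ⟨C + C', max N N', add_nonneg hC hC', fun f => ?_⟩
    have e : jetNorm (K + 1) f = jetNorm K f + jetSup K f := Finset.sum_range_succ _ _
    rw [e, add_mul]
    exact add_le_add
      ((h f).trans (mul_le_mul_of_nonneg_left (norm_iota_Lam_pow_mono (le_max_left _ _) f) hC))
      ((h' f).trans (mul_le_mul_of_nonneg_left (norm_iota_Lam_pow_mono (le_max_right _ _) f) hC'))

/-- A closed subspace contains a function that it approximates in all Sobolev seminorms. -/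
theorem mem_of_approx {V : Submodule ℂ (S p q a)} (hV : IsClosed (V : Set (S p q a))) {f : S p q a}
    (h : ∀ N, ∀ ε > 0, ∃ v ∈ V, ‖iota ((Lam ^ N) (v - f))‖ < ε) : f ∈ V := by
  -- Diagonal choice: the n-th approximant is within 1/(n+1) in the n-th Sobolev norm, hence
  -- eventually close in every fixed one.
  choose v hvV hv using fun n : ℕ => h n (1 / ((n : ℝ) + 1)) (by positivity)
  refine hV.mem_of_tendsto (b := atTop) (f := v) (tendsto_S_iff.2 fun k => ?_)
    (Eventually.of_forall hvV)
  obtain ⟨C, N, hC, hCN⟩ := exists_jetNorm_le (p := p) (q := q) (a := a) (k + 1)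
  have h0 : Tendsto (fun n : ℕ => C * (1 / ((n : ℝ) + 1))) atTop (𝓝 0) := by
    simpa using tendsto_one_div_add_atTop_nhds_zero_nat.const_mul C
  refine squeeze_zero' (Eventually.of_forall fun _ => jetSup_nonneg _ _) ?_ h0
  filter_upwards [eventually_ge_atTop N] with n hn
  refine (norm_jet_le (Nat.lt_succ_self k) _).trans ((hCN _).trans ?_)
  exact mul_le_mul_of_nonneg_left ((norm_iota_Lam_pow_mono hn _).trans (hv n).le) hC

end Sobolev

end

section

open MeasureTheory Filter Topology

variable {p q : ℕ} [NeZero p] [NeZero q] {a : ℂ}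

/-! ### Closed K-stable subspaces are determined by their K-types -/

section ClosedSubmodules

/-- The unitary action of `O(p) × O(q)` on `L²`. -/
def unitaryK (A : Iso p) (B : Iso q) : L2 p q →ₗᵢ[ℂ] L2 p q :=
  Lp.compMeasurePreservingₗᵢ ℂ (fun z : Spheres p q => (sphMap A z.1, sphMap B z.2))
    ((measurePreserving_sphMap A).prod (measurePreserving_sphMap B))

theorem unitaryK_iota (A : Iso p) (B : Iso q) (f : S p q a) :
    unitaryK A B (iota f) = iota (act (kElt A B) f) := by
  have hm := (measurePreserving_sphMap A).prod (measurePreserving_sphMap B)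
  refine Lp.ext ?_
  refine (Lp.coeFn_compMeasurePreserving (iota f) hm).trans ?_
  have h1 := ContinuousMap.coeFn_toLp (p := 2) (𝕜 := ℂ) (mu p q) (res f)
  have h2 := ContinuousMap.coeFn_toLp (p := 2) (𝕜 := ℂ) (mu p q) (res (act (kElt A B) f))
  refine (hm.quasiMeasurePreserving.ae_eq_comp h1).trans (EventuallyEq.trans ?_ h2.symm)
  refine Eventually.of_forall fun z => ?_
  simp only [Function.comp, res_apply, act_apply, coneAct_kElt]
  rfl

/-- A subspace stable under `O(p) × O(q)`. -/
def KStable (V : Submodule ℂ (S p q a)) : Prop :=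
  ∀ (A : Iso p) (B : Iso q), ∀ f ∈ V, act (kElt A B) f ∈ V

theorem KStable.inv {V : Submodule ℂ (S p q a)} (hV : KStable V) (A : Iso p) (B : Iso q)
    {f : S p q a} (hf : f ∈ V) : act (kElt A B)⁻¹ f ∈ V := by
  rw [kElt_inv]
  exact hV _ _ f hf

/-- The closure in `L²` of the image of a subspace under a power of `Lam`. -/
def sobClosure (V : Submodule ℂ (S p q a)) (N : ℕ) : Submodule ℂ (L2 p q) :=
  (V.map (iota ∘ₗ (Lam ^ N))).topologicalClosure

instance (V : Submodule ℂ (S p q a)) (N : ℕ) : CompleteSpace (sobClosure V N) :=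
  (Submodule.isClosed_topologicalClosure _).completeSpace_coe

theorem iota_Lam_mem_sobClosure {V : Submodule ℂ (S p q a)} (N : ℕ) {v : S p q a} (hv : v ∈ V) :
    iota ((Lam ^ N) v) ∈ sobClosure V N :=
  Submodule.le_topologicalClosure _ (Submodule.mem_map_of_mem (f := iota ∘ₗ (Lam ^ N)) hv)

/-- The closure is stable under the unitary action of K and so is its orthogonal complement. Schur's
lemma then applies to the projection. -/
theorem starProjection_unitaryK {V : Submodule ℂ (S p q a)} (hV : KStable V) (N : ℕ) (A : Iso p)
    (B : Iso q) (x : L2 p q) : (sobClosure V N).starProjection (unitaryK A B x) =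
      unitaryK A B ((sobClosure V N).starProjection x) := by
  refine Submodule.eq_starProjection_of_mem_orthogonal ?_ ?_
  · have h1 : ∀ w ∈ sobClosure V N, unitaryK A B w ∈ sobClosure V N := fun w hw =>
      map_mem_closure (unitaryK A B).continuous hw (by
        rintro _ ⟨v, hv, rfl⟩
        refine ⟨act (kElt A B) v, hV A B v hv, ?_⟩
        change iota ((Lam ^ N) (act (kElt A B) v)) = unitaryK A B (iota ((Lam ^ N) v))
        rw [unitaryK_iota, Lam_pow_act_kElt])
    exact h1 _ (Submodule.starProjection_apply_mem _ _)
  · change _ ∈ (V.map (iota ∘ₗ (Lam ^ N))).topologicalClosureᗮ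
    rw [Submodule.orthogonal_closure, Submodule.mem_orthogonal]
    rintro _ ⟨v, hv, rfl⟩
    have e : (iota ∘ₗ (Lam ^ N)) v = unitaryK A B (iota ((Lam ^ N) (act (kElt A B)⁻¹ v))) := by
      rw [unitaryK_iota, ← Lam_pow_act_kElt, act_act_inv]
      rfl
    rw [e, ← map_sub, LinearIsometry.inner_map_map]
    exact Submodule.sub_starProjection_mem_orthogonal x _
      (iota_Lam_mem_sobClosure N (hV.inv A B hv))

theorem eq_zero_of_inner_iota {v : L2 p q}
    (h : ∀ σ : ℕ × ℕ, ∀ f ∈ kType p q a σ.1 σ.2, inner ℂ (iota f) v = 0) : v = 0 := by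
  have h1 := hasSum_starProjection (a := a) v
  have h2 : ∀ σ, (kL2 p q a σ).starProjection v = 0 := fun σ => by
    rw [Submodule.starProjection_apply_eq_zero_iff, Submodule.mem_orthogonal]
    rintro _ ⟨f, hf, rfl⟩
    exact h σ f hf
  simp only [h2] at h1
  exact h1.unique hasSum_zero

/-- The sesquilinear form on two `K`-types of an operator of `L²`. -/
def opForm (P : L2 p q →L[ℂ] L2 p q) (σ τ : ℕ × ℕ) :
    kType p q a σ.1 σ.2 →ₗ[ℂ] kType p q a τ.1 τ.2 →ₗ⋆[ℂ] ℂ :=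
  LinearMap.mk₂'ₛₗ (RingHom.id ℂ) (starRingEnd ℂ) (fun f h => inner ℂ (iota h.1) (P (iota f.1)))
    (fun f f' h => by simp [inner_add_right])
    (fun c f h => by simp [inner_smul_right])
    (fun f h h' => by simp [inner_add_left])
    (fun c f h => by simp [inner_smul_left])

/-- An operator commuting with `O(p) × O(q)` acts by scalars on the `K`-types. -/
theorem exists_scalar {P : L2 p q →L[ℂ] L2 p q}
    (hP : ∀ (A : Iso p) (B : Iso q) x, P (unitaryK A B x) = unitaryK A B (P x)) (σ : ℕ × ℕ) :
    ∃ c : ℂ, ∀ f ∈ kType p q a σ.1 σ.2, P (iota f) = c • iota f := by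
  have hK : ∀ τ, KInvariant (opForm (a := a) P σ τ) := fun τ A B f f' h h' hf hh => by
    change inner ℂ (iota h'.1) (P (iota f'.1)) = inner ℂ (iota h.1) (P (iota f.1))
    rw [hf, hh, ← unitaryK_iota, ← unitaryK_iota, hP, LinearIsometry.inner_map_map]
  obtain ⟨c, hc⟩ := schur_same (hK σ)
  refine ⟨c, fun f hf => sub_eq_zero.1 (eq_zero_of_inner_iota (a := a) fun τ h hh => ?_)⟩
  rw [inner_sub_right, inner_smul_right, ← stdInner_eq_inner]
  by_cases hne : σ = τ
  · subst hne
    exact sub_eq_zero.2 (hc ⟨f, hf⟩ ⟨h, hh⟩)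
  · rw [stdInner_kType_ne hf hh hne, mul_zero, sub_zero]
    exact schur_ne hne (hK τ) ⟨f, hf⟩ ⟨h, hh⟩

/-- A closed `O(p) × O(q)`-stable subspace contains every `K`-type on which it has a nonzero
component. -/
theorem kType_le_of_comp_ne {V : Submodule ℂ (S p q a)} (hV : KStable V)
    (hcl : IsClosed (V : Set (S p q a))) {f : S p q a} (hf : f ∈ V) {σ : ℕ × ℕ}
    (hne : comp σ f ≠ 0) : kType p q a σ.1 σ.2 ≤ V := by
  intro h hh
  refine mem_of_approx hcl fun N ε hε => ?_
  -- On the K-type σ the projection onto the N-th Sobolev closure of V is a scalar c. Once c = 1,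
  -- every element of the K-type is approximated from V in the N-th norm.
  obtain ⟨c, hc⟩ := exists_scalar (a := a) (starProjection_unitaryK hV N) σ
  have hell : (ell p q σ : ℂ) ^ N ≠ 0 :=
    pow_ne_zero _ (by exact_mod_cast (one_pos.trans_le (one_le_ell σ)).ne')
  -- Idempotence leaves c = 0 or c = 1. The former would make `comp σ f` orthogonal to (Lam^N) f,
  -- although that pairing is a nonzero multiple of the squared norm of `comp σ f`.
  have hc1 : c = 1 := by
    have hg := comp_mem σ f
    have hg0 : iota (comp σ f) ≠ 0 := fun h0 => hne (iota_injective (by rw [h0, map_zero]))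
    have h1 := hc _ hg
    have h2 : (sobClosure V N).starProjection (c • iota (comp σ f)) = c • iota (comp σ f) := by
      rw [← h1]
      exact Submodule.starProjection_eq_self_iff.2 (Submodule.starProjection_apply_mem _ _)
    rw [map_smul, h1] at h2
    by_cases hc0 : c = 0
    · exfalso
      rw [hc0, zero_smul, Submodule.starProjection_apply_eq_zero_iff] at h1
      have h3 := h1 _ (iota_Lam_mem_sobClosure N hf)
      rw [← stdInner_eq_inner, ← stdInner_comp_right hg, comp_Lam_pow, stdInner_smul_right] at h3
      rcases mul_eq_zero.1 h3 with h3 | h3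
      · exact hell ((map_eq_zero _).1 h3)
      · exact hne (stdInner_self_eq_zero.1 h3)
    · exact smul_left_injective ℂ hg0 (by simpa using smul_right_injective _ hc0 h2)
  have h1 := hc _ ((kType p q a σ.1 σ.2).smul_mem ((ell p q σ : ℂ) ^ N) hh)
  rw [hc1, one_smul, Submodule.starProjection_eq_self_iff] at h1
  obtain ⟨_, ⟨v, hv, rfl⟩, hd⟩ := Metric.mem_closure_iff.1 h1 ε hε
  refine ⟨v, hv, ?_⟩
  rw [map_sub, map_sub, Lam_pow_kType hh, ← dist_eq_norm, dist_comm]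
  exact hd

/-- A function belongs to a closed subspace if its components do. -/
theorem mem_of_forall_comp {V : Submodule ℂ (S p q a)} (hcl : IsClosed (V : Set (S p q a)))
    {f : S p q a} (h : ∀ σ, comp σ f ∈ V) : f ∈ V := by
  refine mem_of_approx hcl fun N ε hε => ?_
  obtain ⟨s, hs⟩ := Metric.tendsto_atTop.1 (hasSum_iota_comp ((Lam ^ N) f)) ε hε
  refine ⟨∑ σ ∈ s, comp σ f, Submodule.sum_mem _ fun σ _ => h σ, ?_⟩
  have := hs s le_rfl
  rw [dist_eq_norm, ← map_sum, ← map_sub] at this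
  refine lt_of_eq_of_lt (congrArg (fun u => ‖iota u‖) ?_) this
  rw [map_sub, map_sum]
  congr 1
  exact Finset.sum_congr rfl fun σ _ => by rw [Lam_pow_kType (comp_mem σ f), comp_Lam_pow]

/-- The functions whose components lie in the `K`-types in `T`. -/
def typeSpan (p q : ℕ) [NeZero p] [NeZero q] (a : ℂ) (T : Set (ℕ × ℕ)) : Submodule ℂ (S p q a) :=
  ⨅ σ, ⨅ _ : σ ∉ T, LinearMap.ker (comp σ)

theorem mem_typeSpan {T : Set (ℕ × ℕ)} {f : S p q a} :
    f ∈ typeSpan p q a T ↔ ∀ σ, σ ∉ T → comp σ f = 0 := by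
  simp only [typeSpan, Submodule.mem_iInf, LinearMap.mem_ker]

theorem comp_eq_zero_iff {σ : ℕ × ℕ} {f : S p q a} :
    comp σ f = 0 ↔ ∀ h ∈ kType p q a σ.1 σ.2, stdInner f h = 0 := by
  refine ⟨fun h0 h hh => by rw [← stdInner_comp_left hh, h0, stdInner_zero_left], fun h0 => ?_⟩
  rw [← stdInner_self_eq_zero, stdInner_comp_left (comp_mem σ f)]
  exact h0 _ (comp_mem σ f)

theorem continuous_stdInner_left (h : S p q a) : Continuous fun f : S p q a => stdInner f h := by
  simp only [stdInner_eq_inner]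
  exact continuous_const.inner continuous_iota

theorem isClosed_typeSpan (T : Set (ℕ × ℕ)) :
    IsClosed (typeSpan p q a T : Set (S p q a)) := by
  have e : (typeSpan p q a T : Set (S p q a)) = ⋂ σ, ⋂ _ : σ ∉ T, ⋂ h, ⋂ _ : h ∈ kType p q a σ.1 σ.2,
      {f | stdInner f h = 0} := by
    ext f
    simp only [SetLike.mem_coe, mem_typeSpan, comp_eq_zero_iff, Set.mem_iInter, Set.mem_ofPred_eq]
  rw [e]
  exact isClosed_iInter fun σ => isClosed_iInter fun _ => isClosed_iInter fun h =>
    isClosed_iInter fun _ => isClosed_eq (continuous_stdInner_left h) continuous_const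

theorem kType_le_typeSpan {T : Set (ℕ × ℕ)} {σ : ℕ × ℕ} (hσ : σ ∈ T) :
    kType p q a σ.1 σ.2 ≤ typeSpan p q a T := fun _ hf =>
  mem_typeSpan.2 fun _ hτ => comp_of_mem_ne hf fun h => hτ (h ▸ hσ)

theorem typeSpan_kStable (T : Set (ℕ × ℕ)) : KStable (typeSpan p q a T) := fun A B f hf =>
  mem_typeSpan.2 fun σ hσ => by rw [comp_act_kElt, mem_typeSpan.1 hf σ hσ, map_zero]

/-- The `K`-types contained in a subspace. -/
def typesOf (V : Submodule ℂ (S p q a)) : Set (ℕ × ℕ) := {σ | kType p q a σ.1 σ.2 ≤ V}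

/-- One inclusion approximates a function by its components, the other uses that a nonzero component
drags in its whole K-type. Closed invariant subspaces become sets of lattice points. -/
theorem typeSpan_typesOf {V : Submodule ℂ (S p q a)} (hV : KStable V)
    (hcl : IsClosed (V : Set (S p q a))) : typeSpan p q a (typesOf V) = V := by
  refine le_antisymm (fun f hf => mem_of_forall_comp hcl fun σ => ?_)
    fun f hf => mem_typeSpan.2 fun σ hσ => ?_
  · by_cases hσ : σ ∈ typesOf V
    · exact hσ (comp_mem σ f)
    · rw [mem_typeSpan.1 hf σ hσ]
      exact V.zero_mem
  · by_contra hne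
    exact hσ (kType_le_of_comp_ne hV hcl hf hne)

theorem kStable_of_isClosedInvariant {V : Submodule ℂ (S p q a)} (hV : IsClosedInvariant V) :
    KStable V := fun A B f hf => by
  have := hV.2 (kElt A B)⁻¹ f hf
  rwa [rho_eq_act, inv_inv] at this

theorem IsClosedInvariant.act_mem {V : Submodule ℂ (S p q a)} (hV : IsClosedInvariant V)
    (g : indefOrthogonal p q) {f : S p q a} (hf : f ∈ V) : act g f ∈ V := hV.2 g⁻¹ f hf

end ClosedSubmodules

end

section

open MeasureTheory Filter Topology

variable {p q : ℕ} [NeZero p] [NeZero q] {a : ℂ}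

/-! ### Boosts between K-types and analytic vectors -/

section Boost

theorem IsFlow.hasDerivAt_stdInner {J : Amb p q →L[ℝ] Amb p q} {g : ℝ → indefOrthogonal p q}
    (hg : IsFlow J g) (f h : S p q a) (t : ℝ) :
    HasDerivAt (fun t => stdInner (act (g t) f) h) (stdInner (act (g t) (D J f)) h) t := by
  have hh : Continuous fun z : Spheres p q => conj (h (sphereIncl z)) :=
    Complex.continuous_conj.comp (res h).continuous
  have hc : ∀ f : S p q a, Continuous fun x : ℝ × Spheres p q =>
      act (g x.1) f (sphereIncl x.2) * conj (h (sphereIncl x.2)) := fun f => by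
    have h1 : Continuous fun x : ℝ × Spheres p q => act (g x.1) f (sphereIncl x.2) := by
      simp only [act_apply]
      exact (continuous_S f).comp (hg.continuous_coneAct.comp
        (continuous_fst.prodMk (continuous_sphereIncl.comp continuous_snd)))
    exact h1.mul (hh.comp continuous_snd)
  have hz : ∀ (f : S p q a) t, Continuous fun z : Spheres p q =>
      act (g t) f (sphereIncl z) * conj (h (sphereIncl z)) := fun f t =>
    (res (act (g t) f)).continuous.mul hh
  obtain ⟨C, hC⟩ := (isCompact_Icc.prod isCompact_univ :
    IsCompact (Set.Icc (t - 1) (t + 1) ×ˢ (Set.univ : Set (Spheres p q)))).exists_bound_of_continuousOn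
      (hc (D J f)).continuousOn
  have key := hasDerivAt_integral_of_dominated_loc_of_deriv_le (𝕜 := ℝ) (x₀ := t)
    (F := fun t z => act (g t) f (sphereIncl z) * conj (h (sphereIncl z)))
    (F' := fun t z => act (g t) (D J f) (sphereIncl z) * conj (h (sphereIncl z))) (μ := mu p q)
    (bound := fun _ => C)
    (s := Set.Icc (t - 1) (t + 1)) (Icc_mem_nhds (by linarith) (by linarith))
    (Eventually.of_forall fun s => (hz f s).aestronglyMeasurable) (integrable_cont (hz f t))
    (hz (D J f) t).aestronglyMeasurable
    (Eventually.of_forall fun z s hs => hC (s, z) ⟨hs, trivial⟩) (integrable_const _)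
    (Eventually.of_forall fun z s _ => by
      simp only [act_apply]
      exact (hg.hasDerivAt f _ s).mul_const _)
  exact key.2

/-- The adjoint of a boost. -/
def boostAdj (j : Fin p) (k : Fin q) : S p q a →ₗ[ℂ] S p q a :=
  (a + conj a + (p + q - 2)) • mulOp (uLR j k) - D (boost j k)

/-- In `D_boost_eq` the commutator of two symmetric operators is skew and multiplication by the real
function u is symmetric, so only the scalar in front of u matters. -/
theorem stdInner_D_boost (j : Fin p) (k : Fin q) (f h : S p q a) :
    stdInner (D (boost j k) f) h = stdInner f (boostAdj j k h) := by
  rw [boostAdj, LinearMap.sub_apply, LinearMap.smul_apply, D_boost_eq, D_boost_eq]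
  simp only [stdInner_add_left, stdInner_smul_left, stdInner_sub_left, stdInner_cas,
    stdInner_mulOp_uLR, stdInner_sub_right, stdInner_add_right, stdInner_smul_right]
  simp only [map_add, map_sub, map_div₀, map_one, Complex.conj_conj, Complex.conj_ofNat,
    map_natCast]
  ring

/-- The coefficient of a boost from one `K`-type to another. -/
def trans (p q : ℕ) (a : ℂ) (σ τ : ℕ × ℕ) : ℂ :=
  a + (p + q - 2) / 2 + ((ell p q σ : ℂ) - ell p q τ) / 2

/-- The Laplacian acts by scalars on both sides, so its commutator with u contributes half the
difference of eigenvalues. All dependence on a is thereby in a number. -/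
theorem stdInner_boost_kType {σ τ : ℕ × ℕ} {f h : S p q a} (hf : f ∈ kType p q a σ.1 σ.2)
    (hh : h ∈ kType p q a τ.1 τ.2) (j : Fin p) (k : Fin q) :
    stdInner (D (boost j k) f) h = trans p q a σ τ * stdInner (mulOp (uLR j k) f) h := by
  rw [D_boost_eq, stdInner_add_left, stdInner_smul_left, stdInner_smul_left, stdInner_sub_left,
    stdInner_cas, cas_kType hf, cas_kType hh, stdInner_smul_right, map_smul, stdInner_smul_left,
    trans, ell, ell]
  simp only [map_neg, map_add, Complex.conj_ofReal]
  push_cast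
  ring

/-- Neighbouring `K`-types. -/
def Nbr (σ τ : ℕ × ℕ) : Prop := nbr σ.1 τ.1 ∧ nbr σ.2 τ.2

theorem Nbr.symm {σ τ : ℕ × ℕ} (h : Nbr σ τ) : Nbr τ σ := ⟨nbr.symm h.1, nbr.symm h.2⟩

theorem comp_mulOp_uLR {σ τ : ℕ × ℕ} {f : S p q a} (hf : f ∈ kType p q a σ.1 σ.2)
    (hn : ¬ Nbr σ τ) (j : Fin p) (k : Fin q) : comp τ (mulOp (uLR j k) f) = 0 := by
  have h : nbrSum p q a σ.1 σ.2 ≤ LinearMap.ker (comp τ : S p q a →ₗ[ℂ] S p q a) :=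
    iSup₂_le fun ρ hρ g hg => comp_of_mem_ne hg fun e => hn (e ▸ hρ)
  exact h (mulOp_uLR_mem hf j k)

theorem stdInner_mulOp_of_not {σ τ : ℕ × ℕ} {f h : S p q a} (hf : f ∈ kType p q a σ.1 σ.2)
    (hh : h ∈ kType p q a τ.1 τ.2) (hn : ¬ Nbr σ τ) (j : Fin p) (k : Fin q) :
    stdInner (mulOp (uLR j k) f) h = 0 := by
  rw [← stdInner_comp_left hh, comp_mulOp_uLR hf hn, stdInner_zero_left]

/-- No boost leads from the `K`-types in `T` to a `K`-type outside `T'`. -/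
def Stays (p q : ℕ) [NeZero p] [NeZero q] (a : ℂ) (T T' : Set (ℕ × ℕ)) : Prop :=
  ∀ σ ∈ T, ∀ τ, τ ∉ T' → ∀ (j : Fin p) (k : Fin q), ∀ f ∈ kType p q a σ.1 σ.2,
    comp τ (D (boost j k) f) = 0

theorem stays_of_trans {T T' : Set (ℕ × ℕ)}
    (hT : ∀ σ ∈ T, ∀ τ, τ ∉ T' → Nbr σ τ → trans p q a σ τ = 0) : Stays p q a T T' :=
  fun σ hσ τ hτ j k f hf => comp_eq_zero_iff.2 fun h hh => by
    rw [stdInner_boost_kType hf hh]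
    by_cases hn : Nbr σ τ
    · rw [hT σ hσ τ hτ hn, zero_mul]
    · rw [stdInner_mulOp_of_not hf hh hn, mul_zero]

/-- A boost is unbounded in L² and cannot be applied to an L² expansion termwise. Moving it to the
fixed function h by the adjoint avoids this. -/
theorem D_boost_mem_typeSpan {T T' : Set (ℕ × ℕ)} (hT : Stays p q a T T') (j : Fin p) (k : Fin q)
    {f : S p q a} (hf : f ∈ typeSpan p q a T) : D (boost j k) f ∈ typeSpan p q a T' := by
  refine mem_typeSpan.2 fun τ hτ => comp_eq_zero_iff.2 fun h hh => ?_
  rw [stdInner_D_boost]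
  refine (hasSum_stdInner f (boostAdj j k h)).unique ?_
  have e : (fun σ => stdInner (comp σ f) (boostAdj j k h)) = fun _ => (0 : ℂ) := by
    funext σ
    rw [← stdInner_D_boost]
    by_cases hσ : σ ∈ T
    · exact comp_eq_zero_iff.1 (hT σ hσ τ hτ j k _ (comp_mem σ f)) h hh
    · rw [mem_typeSpan.1 hf σ hσ, map_zero, stdInner_zero_left]
  rw [e]
  exact hasSum_zero

/-- The `K`-types of degrees at most `d`. -/
def box (d : ℕ) : Set (ℕ × ℕ) := {σ | σ.1 ≤ d ∧ σ.2 ≤ d}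

theorem D_boost_mem_box {d : ℕ} (j : Fin p) (k : Fin q) {f : S p q a}
    (hf : f ∈ typeSpan p q a (box d)) : D (boost j k) f ∈ typeSpan p q a (box (d + 1)) := by
  refine D_boost_mem_typeSpan (stays_of_trans fun σ hσ τ hτ hn => absurd ?_ hτ) j k hf
  obtain ⟨h1, h2⟩ := hσ
  obtain ⟨h3, h4⟩ := hn
  simp only [nbr] at h3 h4
  exact ⟨by omega, by omega⟩

theorem ell_le {d : ℕ} {σ : ℕ × ℕ} (hσ : σ ∈ box d) :
    ell p q σ ≤ (3 + p + q) * (d + 1) ^ 2 := by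
  obtain ⟨h1, h2⟩ := hσ
  have h1' : (σ.1 : ℝ) ≤ d := by exact_mod_cast h1
  have h2' : (σ.2 : ℝ) ≤ d := by exact_mod_cast h2
  have key : ∀ (r : ℕ) (m : ℕ), (m : ℝ) ≤ d → lam r m ≤ (1 + r) * (d + 1) ^ 2 := fun r m hm => by
    have h0 : (0 : ℝ) ≤ m := Nat.cast_nonneg m
    have hr : (0 : ℝ) ≤ r := Nat.cast_nonneg r
    have hd : (0 : ℝ) ≤ d := Nat.cast_nonneg d
    rw [lam]
    have h3 : (m : ℝ) * (m + r - 2) ≤ m * (m + r) := by nlinarith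
    have h4 : (m : ℝ) * (m + r) ≤ d * (d + r) := mul_le_mul hm (by linarith) (by positivity) hd
    nlinarith [mul_nonneg hr hd, mul_nonneg hr (mul_nonneg hd hd)]
  have := key p _ h1'
  have := key q _ h2'
  rw [ell]
  nlinarith [Nat.cast_nonneg (α := ℝ) d]

theorem norm_iota_Lam_le {d : ℕ} {f : S p q a} (hf : f ∈ typeSpan p q a (box d)) :
    ‖iota (Lam f)‖ ≤ (3 + p + q) * (d + 1) ^ 2 * ‖iota f‖ := by
  refine abs_le_of_sq_le_sq' ?_ (by positivity) |>.2
  rw [mul_pow]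
  refine hasSum_le (fun σ => ?_) (hasSum_norm_comp (Lam f)) ((hasSum_norm_comp f).mul_left _)
  by_cases hσ : σ ∈ box d
  · rw [comp_Lam, map_smul, norm_smul, mul_pow]
    refine mul_le_mul_of_nonneg_right ?_ (sq_nonneg _)
    have h0 := one_pos.trans_le (one_le_ell (p := p) (q := q) σ)
    rw [Complex.norm_real, Real.norm_of_nonneg h0.le]
    exact pow_le_pow_left₀ h0.le (ell_le hσ) 2
  · rw [comp_Lam, mem_typeSpan.1 hf σ hσ]
    simp

theorem exists_norm_mulOp_le (u : S p q 0) :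
    ∃ C, 0 ≤ C ∧ ∀ f : S p q a, ‖iota (mulOp u f)‖ ≤ C * ‖iota f‖ := by
  refine ⟨‖res u‖, norm_nonneg _, fun f => ?_⟩
  refine abs_le_of_sq_le_sq' ?_ (by positivity) |>.2
  rw [mul_pow, norm_iota_sq, norm_iota_sq, ← integral_const_mul]
  have hc : ∀ f : S p q a, Integrable (fun z => ‖f (sphereIncl z)‖ ^ 2) (mu p q) := fun f =>
    integrable_cont (((continuous_S f).comp continuous_sphereIncl).norm.pow 2)
  refine integral_mono (hc _) ((hc f).const_mul _) fun z => ?_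
  change ‖mulOp u f (sphereIncl z)‖ ^ 2 ≤ ‖res u‖ ^ 2 * ‖f (sphereIncl z)‖ ^ 2
  rw [mulOp_apply, norm_mul, mul_pow]
  exact mul_le_mul_of_nonneg_right (pow_le_pow_left₀ (norm_nonneg _)
    (ContinuousMap.norm_coe_le_norm (res u) z) 2) (sq_nonneg _)

/-- By the energy estimate a rotation derivative costs a factor linear in the degree. This linear
rate is what makes K-finite functions analytic vectors. -/
theorem exists_norm_D_boost_le (j : Fin p) (k : Fin q) :
    ∃ C, 0 ≤ C ∧ ∀ (d : ℕ) (f : S p q a), f ∈ typeSpan p q a (box d) →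
      ‖iota (D (boost j k) f)‖ ≤ C * (d + 1) * ‖iota f‖ := by
  choose M hM0 hM using fun i => exists_norm_mulOp_le (a := a) (D (rot i) (uLR j k))
  obtain ⟨M', hM0', hM'⟩ := exists_norm_mulOp_le (a := a) (uLR (p := p) (q := q) j k)
  let L : ℝ := 2 * (3 + p + q)
  have hL : 0 ≤ L := by positivity
  refine ⟨1 / 2 * (∑ i, M i * √L) + ‖a‖ * M', add_nonneg (mul_nonneg (by norm_num)
    (Finset.sum_nonneg fun i _ => mul_nonneg (hM0 i) (Real.sqrt_nonneg _)))
    (mul_nonneg (norm_nonneg _) hM0'), fun d f hf => ?_⟩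
  have hrot : ∀ i, ‖iota (D (rot i) f)‖ ≤ √L * (d + 1) * ‖iota f‖ := fun i => by
    have hnn : 0 ≤ √L * (d + 1) * ‖iota f‖ :=
      mul_nonneg (mul_nonneg (Real.sqrt_nonneg _) (by positivity)) (norm_nonneg _)
    refine abs_le_of_sq_le_sq' ?_ hnn |>.2
    have h1 := energy_le f
    have h2 := Finset.single_le_sum (f := fun i => ‖iota (D (rot i) f)‖ ^ 2)
      (fun _ _ => sq_nonneg _) (Finset.mem_univ i)
    have h3 := mul_le_mul_of_nonneg_right (norm_iota_Lam_le hf) (norm_nonneg (iota f))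
    rw [mul_pow, mul_pow, Real.sq_sqrt hL]
    have h4 := sq_nonneg ‖iota f‖
    have h5 : L * (d + 1) ^ 2 * ‖iota f‖ ^ 2 =
      2 * ((3 + p + q) * (d + 1) ^ 2 * ‖iota f‖ * ‖iota f‖) := by
      simp only [L]
      ring
    rw [h5]
    linarith
  have hd : (1 : ℝ) ≤ d + 1 := by linarith [Nat.cast_nonneg (α := ℝ) d]
  rw [D_boost_eq_Gam, Gam, map_add, map_smul, map_smul, map_sum]
  refine (norm_add_le _ _).trans ?_
  rw [norm_smul, norm_smul]
  have h1 : ‖∑ i, iota (mulOp (D (rot i) (uLR j k)) (D (rot i) f))‖ ≤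
      (∑ i, M i * √L) * (d + 1) * ‖iota f‖ := by
    rw [Finset.sum_mul, Finset.sum_mul]
    refine norm_sum_le_of_le _ fun i _ => (hM i _).trans ?_
    have := mul_le_mul_of_nonneg_left (hrot i) (hM0 i)
    linarith
  have h2 : ‖a‖ * ‖iota (mulOp (uLR j k) f)‖ ≤ ‖a‖ * (M' * ((d + 1) * ‖iota f‖)) := by
    refine mul_le_mul_of_nonneg_left ((hM' f).trans (mul_le_mul_of_nonneg_left ?_ hM0'))
      (norm_nonneg a)
    exact le_mul_of_one_le_left (norm_nonneg _) hd
  have h3 : ‖(1 / 2 : ℂ)‖ = 1 / 2 := by simp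
  rw [h3]
  linarith

/-- The `K`-finite functions are analytic vectors for the boosts. -/
theorem exists_norm_pow_D_boost_le (j : Fin p) (k : Fin q) {d : ℕ} {f : S p q a}
    (hf : f ∈ typeSpan p q a (box d)) :
    ∃ A K : ℝ, 0 ≤ A ∧ 0 ≤ K ∧ ∀ n : ℕ,
      ‖iota ((D (boost j k) ^ n) f)‖ ≤ A * K ^ n * n.factorial := by
  obtain ⟨C, hC, h⟩ := exists_norm_D_boost_le (a := a) j k
  -- Each boost enlarges the box by one, so the n-th power costs C^n (d+1)⋯(d+n).
  have key : ∀ (n d : ℕ) (f : S p q a), f ∈ typeSpan p q a (box d) →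
      ‖iota ((D (boost j k) ^ n) f)‖ * d.factorial ≤ C ^ n * (d + n).factorial * ‖iota f‖ := by
    intro n
    induction n with
    | zero =>
      intro d f _
      simp [mul_comm]
    | succ n ih =>
      intro d f hf
      have h1 := ih (d + 1) _ (D_boost_mem_box j k hf)
      have h2 := h d f hf
      rw [Nat.factorial_succ, Nat.cast_mul, Nat.cast_succ] at h1
      rw [pow_succ, Module.End.mul_apply]
      have hd : (0 : ℝ) < d + 1 := by positivity
      have h3 : C ^ n * ((d + 1 + n).factorial : ℝ) * ‖iota (D (boost j k) f)‖ ≤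
          C ^ n * ((d + 1 + n).factorial : ℝ) * (C * (d + 1) * ‖iota f‖) :=
        mul_le_mul_of_nonneg_left h2 (by positivity)
      rw [show d + (n + 1) = d + 1 + n by omega]
      refine le_of_mul_le_mul_right ?_ hd
      calc _ = ‖iota ((D (boost j k) ^ n) (D (boost j k) f))‖ * ((d + 1) * d.factorial) := by ring
        _ ≤ _ := h1.trans h3
        _ = _ := by ring
  refine ⟨2 ^ d * ‖iota f‖, 2 * C, by positivity, by positivity, fun n => ?_⟩
  have h1 := key n d f hf
  -- A binomial coefficient is at most a power of two; this trades (d+n)! for d! n! and doubles the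
  -- constant C.
  have h2 : ((d + n).factorial : ℝ) ≤ 2 ^ (d + n) * d.factorial * n.factorial := by
    have h3 : (d + n).choose n * d.factorial * n.factorial = (d + n).factorial :=
      Nat.add_choose_mul_factorial_mul_factorial d n
    have h4 : (d + n).choose n ≤ 2 ^ (d + n) := Nat.choose_le_two_pow _ _
    rw [← h3]
    have h5 : (((d + n).choose n : ℕ) : ℝ) ≤ 2 ^ (d + n) := by exact_mod_cast h4
    push_cast
    gcongr
  have hd : (0 : ℝ) < d.factorial := by exact_mod_cast Nat.factorial_pos d
  refine le_of_mul_le_mul_right (h1.trans ?_) hd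
  calc C ^ n * ((d + n).factorial : ℝ) * ‖iota f‖
      ≤ C ^ n * (2 ^ (d + n) * d.factorial * n.factorial) * ‖iota f‖ := by gcongr
    _ = _ := by
      rw [pow_add, mul_pow]
      ring

/-- The action of a boost as a limit over the components. -/
theorem hasSum_iota_act_boost (j : Fin p) (k : Fin q) (t : ℝ) (f : S p q a) :
    HasSum (fun σ => iota (act (boostFlow j k t) (comp σ f))) (iota (act (boostFlow j k t) f)) := by
  obtain ⟨C, hC, h⟩ := exists_norm_iota_act_boost (a := a) j k |t|
  refine tendsto_iff_norm_sub_tendsto_zero.2 (squeeze_zero (fun _ => norm_nonneg _) (fun s => ?_)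
    (by simpa using (tendsto_iff_norm_sub_tendsto_zero.1 (hasSum_iota_comp f)).const_mul C))
  have := h t le_rfl (∑ σ ∈ s, comp σ f - f)
  simpa only [map_sub, map_sum] using this

end Boost

end

section

open MeasureTheory Filter Topology

/-! ### Uniqueness for functions with factorially bounded derivatives -/

section Analytic

/-- Integrating n times from the common zero s gives the Taylor remainder estimate for all
derivatives at once. -/
theorem jets_bound {θ : ℕ → ℝ → ℂ} (hd : ∀ n t, HasDerivAt (θ n) (θ (n + 1) t) t) {s T A K : ℝ}
    (hb : ∀ n, ∀ t ∈ Set.Icc s T, ‖θ n t‖ ≤ A * K ^ n * n.factorial) (hs : ∀ n, θ n s = 0) (n : ℕ) :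
    ∀ m, ∀ t ∈ Set.Icc s T,
      ‖θ m t‖ ≤ A * K ^ (m + n) * (m + n).factorial * ((t - s) ^ n / n.factorial) := by
  induction n with
  | zero =>
    intro m t ht
    simpa using hb m t ht
  | succ n ih =>
    intro m t ht
    have hB : ∀ t : ℝ, HasDerivAt (fun t : ℝ => A * K ^ (m + (n + 1)) * (m + (n + 1)).factorial *
        ((t - s) ^ (n + 1) / (n + 1).factorial)) (A * K ^ (m + 1 + n) * (m + 1 + n).factorial *
          ((t - s) ^ n / n.factorial)) t := fun t => by
      have h1 := ((((hasDerivAt_id t).sub_const s).pow (n + 1)).div_const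
        ((n + 1).factorial : ℝ)).const_mul (A * K ^ (m + (n + 1)) * (m + (n + 1)).factorial)
      refine h1.congr_deriv ?_
      rw [show m + 1 + n = m + (n + 1) by omega]
      have hn : (n.factorial : ℝ) ≠ 0 := by exact_mod_cast Nat.factorial_ne_zero n
      have hn1 : (n : ℝ) + 1 ≠ 0 := by positivity
      rw [Nat.factorial_succ n]
      push_cast
      field_simp
      simp
    refine image_norm_le_of_norm_deriv_right_le_deriv_boundary
      (fun t _ => (hd m t).continuousAt.continuousWithinAt) (fun t _ => (hd m t).hasDerivWithinAt)
      (by simp [hs]) hB (fun t ht => ih (m + 1) t ⟨ht.1, ht.2.le⟩) ht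

/-- The factorial in the bound cancels the one in the remainder up to powers of two, leaving a
geometric sequence of ratio 2K(t - s) < 1. -/
theorem eq_zero_of_jets_local {θ : ℕ → ℝ → ℂ} (hd : ∀ n t, HasDerivAt (θ n) (θ (n + 1) t) t)
    {s T A K : ℝ} (hA : 0 ≤ A) (hK : 0 ≤ K)
    (hb : ∀ n, ∀ t ∈ Set.Icc s T, ‖θ n t‖ ≤ A * K ^ n * n.factorial) (hs : ∀ n, θ n s = 0)
    {t : ℝ} (ht : t ∈ Set.Icc s T) (hlt : 2 * K * (t - s) < 1) (m : ℕ) : θ m t = 0 := by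
  have h0 : 0 ≤ t - s := sub_nonneg.2 ht.1
  have h1 : ∀ n : ℕ, ‖θ m t‖ ≤ A * (2 * K) ^ m * m.factorial * (2 * K * (t - s)) ^ n := fun n => by
    refine (jets_bound hd hb hs n m t ht).trans ?_
    have h3 : (m + n).choose n * m.factorial * n.factorial = (m + n).factorial :=
      Nat.add_choose_mul_factorial_mul_factorial m n
    have h4 : (((m + n).choose n : ℕ) : ℝ) ≤ 2 ^ (m + n) := by
      exact_mod_cast Nat.choose_le_two_pow _ _
    have hn : (n.factorial : ℝ) ≠ 0 := by exact_mod_cast Nat.factorial_ne_zero n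
    rw [← h3]
    push_cast
    calc A * K ^ (m + n) * (((m + n).choose n : ℕ) * m.factorial * n.factorial) *
          ((t - s) ^ n / n.factorial)
        = A * K ^ (m + n) * ((((m + n).choose n : ℕ) : ℝ) * m.factorial) * (t - s) ^ n := by
          field_simp
      _ ≤ A * K ^ (m + n) * (2 ^ (m + n) * m.factorial) * (t - s) ^ n := by gcongr
      _ = _ := by
        rw [mul_pow, mul_pow, mul_pow]
        ring
  have h2 : Tendsto (fun n : ℕ => A * (2 * K) ^ m * m.factorial * (2 * K * (t - s)) ^ n) atTop
      (𝓝 (A * (2 * K) ^ m * m.factorial * 0)) :=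
    (tendsto_pow_atTop_nhds_zero_of_lt_one (by positivity) hlt).const_mul _
  rw [mul_zero] at h2
  exact norm_le_zero_iff.1 (ge_of_tendsto' h2 h1)

theorem eq_zero_of_jets_right {θ : ℕ → ℝ → ℂ} (hd : ∀ n t, HasDerivAt (θ n) (θ (n + 1) t) t)
    (h0 : ∀ n, θ n 0 = 0) {K : ℝ} (hK : 0 ≤ K)
    (hb : ∀ T, ∃ A, ∀ n t, |t| ≤ T → ‖θ n t‖ ≤ A * K ^ n * n.factorial) {t : ℝ} (ht : 0 ≤ t)
    (n : ℕ) : θ n t = 0 := by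
  -- The step length depends on K only. Since just A varies with T, finitely many steps reach any
  -- point.
  let δ : ℝ := (2 * K + 1)⁻¹
  have hδ : 0 < δ := by positivity
  have key : ∀ (N : ℕ) (t : ℝ), t ∈ Set.Icc 0 (N * δ) → ∀ n, θ n t = 0 := by
    intro N
    induction N with
    | zero =>
      intro t ht n
      have : t = 0 := by
        have := ht.2
        simp only [Nat.cast_zero, zero_mul] at this
        exact le_antisymm this ht.1
      rw [this, h0]
    | succ N ih =>
      intro t ht n
      rcases le_total t (N * δ) with h | h
      · exact ih t ⟨ht.1, h⟩ n
      · obtain ⟨A, hA⟩ := hb ((N + 1 : ℕ) * δ)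
        have hA0 : 0 ≤ A := by
          have := (norm_nonneg _).trans (hA 0 0 (by rw [abs_zero]; positivity))
          simpa using this
        have hN : 0 ≤ N * δ := by positivity
        refine eq_zero_of_jets_local hd hA0 hK (s := N * δ) (T := (N + 1 : ℕ) * δ)
          (fun n t ht => hA n t ?_) (ih (N * δ) ⟨hN, le_rfl⟩) ⟨h, ht.2⟩ ?_ n
        · rw [abs_of_nonneg (hN.trans ht.1)]
          exact ht.2
        · have h3 : t - N * δ ≤ δ := by
            have := ht.2
            push_cast at this
            linarith
          have h4 : 2 * K * (t - N * δ) ≤ 2 * K * δ := by gcongr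
          refine h4.trans_lt ?_
          rw [← div_eq_mul_inv, div_lt_one (by positivity)]
          linarith
  obtain ⟨N, hN⟩ := exists_nat_ge (t / δ)
  exact key N t ⟨ht, (div_le_iff₀ hδ).1 hN⟩ n

/-- Uniqueness for a sequence of successive derivatives of analytic growth. -/
theorem eq_zero_of_jets {θ : ℕ → ℝ → ℂ} (hd : ∀ n t, HasDerivAt (θ n) (θ (n + 1) t) t)
    (h0 : ∀ n, θ n 0 = 0) {K : ℝ} (hK : 0 ≤ K)
    (hb : ∀ T, ∃ A, ∀ n t, |t| ≤ T → ‖θ n t‖ ≤ A * K ^ n * n.factorial) (t : ℝ) : θ 0 t = 0 := by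
  rcases le_total 0 t with ht | ht
  · exact eq_zero_of_jets_right hd h0 hK hb ht 0
  · have h := eq_zero_of_jets_right (θ := fun n t => (-1) ^ n * θ n (-t)) (fun n t => ?_)
      (fun n => by simp [h0]) hK (fun T => ?_) (neg_nonneg.2 ht) 0
    · simpa using h
    · have h1 : HasDerivAt (fun t => θ n (-t)) (-θ (n + 1) (-t)) t := by
        have := (hd n (-t)).scomp t (hasDerivAt_neg t)
        rw [neg_one_smul] at this
        exact this
      refine (h1.const_mul ((-1) ^ n)).congr_deriv ?_
      ring
    · obtain ⟨A, hA⟩ := hb T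
      refine ⟨A, fun n t ht => ?_⟩
      simpa using hA n (-t) (by rwa [abs_neg])

end Analytic

variable {p q : ℕ} [NeZero p] [NeZero q] {a : ℂ}

/-! ### From infinitesimal to global invariance -/

section Invariance

/-- To prove a statement for all of `O(p,q)` it suffices to treat generators. -/
theorem generators_induction {P : indefOrthogonal p q → Prop} (hone : P 1)
    (hmul : ∀ g h, P g → P h → P (g * h)) (hK : ∀ A B, P (kElt A B))
    (hX : ∀ j k t, P (boostFlow j k t)) (g : indefOrthogonal p q) : P g := by
  let H : Subgroup (indefOrthogonal p q) :=
    { carrier := {g | P g ∧ P g⁻¹}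
      one_mem' := ⟨hone, by rwa [inv_one]⟩
      mul_mem' := fun {g h} hg hh => ⟨hmul g h hg.1 hh.1, by
        rw [mul_inv_rev]
        exact hmul _ _ hh.2 hg.2⟩
      inv_mem' := fun {g} hg => ⟨hg.2, by
        rw [inv_inv]
        exact hg.1⟩ }
  exact (mem_of_generators H (fun A B => ⟨hK A B, by rw [kElt_inv]; exact hK _ _⟩)
    (fun j k t => ⟨hX j k t, by rw [← (isFlow_boost j k).neg]; exact hX _ _ _⟩) g).1

theorem D_boost_pow_mem_typeSpan {T : Set (ℕ × ℕ)}
    (hT : Stays p q a T T) (j : Fin p) (k : Fin q)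
    {f : S p q a} (hf : f ∈ typeSpan p q a T) (n : ℕ) :
    (D (boost j k) ^ n) f ∈ typeSpan p q a T := by
  induction n with
  | zero => exact hf
  | succ n ih =>
    rw [pow_succ', Module.End.mul_apply]
    exact D_boost_mem_typeSpan hT j k ih

theorem kType_le_box (σ : ℕ × ℕ) :
    kType p q a σ.1 σ.2 ≤ typeSpan p q a (box (max σ.1 σ.2)) :=
  kType_le_typeSpan ⟨le_max_left _ _, le_max_right _ _⟩

/-- For h outside T, the matrix coefficient of each component along the flow has all derivatives
zero at time 0 and analytic growth, so it vanishes identically; then sum over the components in L².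
-/
theorem act_boost_mem_typeSpan {T : Set (ℕ × ℕ)}
    (hT : Stays p q a T T) (j : Fin p) (k : Fin q) (t : ℝ)
    {f : S p q a} (hf : f ∈ typeSpan p q a T) : act (boostFlow j k t) f ∈ typeSpan p q a T := by
  refine mem_typeSpan.2 fun τ hτ => comp_eq_zero_iff.2 fun h hh => ?_
  have h1 := (hasSum_iota_act_boost j k t f).mapL (innerSL ℂ (iota h))
  simp only [innerSL_apply_apply, ← stdInner_eq_inner] at h1
  have e : (fun σ => stdInner (act (boostFlow j k t) (comp σ f)) h) = fun _ => (0 : ℂ) := by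
    funext σ
    have hm : comp σ f ∈ typeSpan p q a T := by
      by_cases hσ : σ ∈ T
      · exact kType_le_typeSpan hσ (comp_mem σ f)
      · rw [mem_typeSpan.1 hf σ hσ]
        exact Submodule.zero_mem _
    obtain ⟨A, K, hA, hK, hAK⟩ := exists_norm_pow_D_boost_le j k (kType_le_box σ (comp_mem σ f))
    refine eq_zero_of_jets
      (θ := fun n t => stdInner (act (boostFlow j k t) ((D (boost j k) ^ n) (comp σ f))) h)
      (fun n t => ?_) (fun n => ?_) hK (fun T' => ?_) t
    · rw [pow_succ', Module.End.mul_apply]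
      exact (isFlow_boost j k).hasDerivAt_stdInner _ h t
    · simp only [(isFlow_boost j k).zero, act_one]
      exact comp_eq_zero_iff.1 (mem_typeSpan.1 (D_boost_pow_mem_typeSpan hT j k hm n) τ hτ) h hh
    · obtain ⟨C, hC, hCT⟩ := exists_norm_iota_act_boost (a := a) j k T'
      refine ⟨C * A * ‖iota h‖, fun n t ht => (norm_stdInner_le _ _).trans ?_⟩
      calc ‖iota (act (boostFlow j k t) ((D (boost j k) ^ n) (comp σ f)))‖ * ‖iota h‖
          ≤ C * (A * K ^ n * n.factorial) * ‖iota h‖ :=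
            mul_le_mul_of_nonneg_right ((hCT t ht _).trans
              (mul_le_mul_of_nonneg_left (hAK n) hC)) (norm_nonneg _)
        _ = _ := by ring
  rw [e] at h1
  exact h1.unique hasSum_zero

/-- A set of `K`-types that the boosts do not leave spans a closed invariant subspace. -/
theorem isClosedInvariant_typeSpan {T : Set (ℕ × ℕ)}
    (hT : Stays p q a T T) :
    IsClosedInvariant (typeSpan p q a T) := by
  refine ⟨isClosed_typeSpan T, fun g f hf => ?_⟩
  rw [rho_eq_act]
  exact generators_induction (P := fun g => ∀ f ∈ typeSpan p q a T, act g f ∈ typeSpan p q a T)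
    (fun f hf => by rwa [act_one]) (fun g h hg hh f hf => by
      rw [act_mul]
      exact hh _ (hg _ hf)) (typeSpan_kStable T) (fun j k t f hf =>
      act_boost_mem_typeSpan hT j k t hf) g⁻¹ f hf

theorem isClosedInvariant_inf {V W : Submodule ℂ (S p q a)} (hV : IsClosedInvariant V)
    (hW : IsClosedInvariant W) : IsClosedInvariant (V ⊓ W) :=
  ⟨hV.1.inter hW.1, fun g f hf => ⟨hV.2 g f hf.1, hW.2 g f hf.2⟩⟩

/-- A closed invariant subspace is stable under the boosts. -/
theorem comp_D_boost_mem {V : Submodule ℂ (S p q a)} (hV : IsClosedInvariant V) {f : S p q a}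
    (hf : f ∈ V) (j : Fin p) (k : Fin q) {τ : ℕ × ℕ} (hτ : τ ∉ typesOf V) :
    comp τ (D (boost j k) f) = 0 := by
  have hK := kStable_of_isClosedInvariant hV
  refine comp_eq_zero_iff.2 fun h hh => ?_
  have h1 := (isFlow_boost j k).hasDerivAt_stdInner f h 0
  -- The flow keeps f in V, and V has no component in τ, so the matrix coefficient is zero at all
  -- times and so is its derivative.
  have e : (fun t => stdInner (act (boostFlow j k t) f) h) = fun _ => (0 : ℂ) := by
    funext t
    refine comp_eq_zero_iff.1 ?_ h hh
    by_contra hne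
    exact hτ (kType_le_of_comp_ne hK hV.1 (hV.act_mem _ hf) hne)
  rw [e, (isFlow_boost j k).zero, act_one] at h1
  exact h1.unique (hasDerivAt_const _ _)

theorem stays_typesOf {V : Submodule ℂ (S p q a)} (hV : IsClosedInvariant V) :
    Stays p q a (typesOf V) (typesOf V) := fun _ hσ _ hτ j k _ hf =>
  comp_D_boost_mem hV (hσ hf) j k hτ

end Invariance

end

section

/-! ### Vanishing transition coefficients are walls -/

section Barrier

variable {p q : ℕ} {a : ℂ}

theorem trans_pp (m n : ℕ) : trans p q a (m, n) (m + 1, n + 1) = App a m n := by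
  simp only [trans, ell, lam, App]
  push_cast
  ring

theorem trans_mm (m n : ℕ) : trans p q a (m + 1, n + 1) (m, n) = Amm p q a (m + 1) (n + 1) := by
  simp only [trans, ell, lam, Amm]
  push_cast
  ring

theorem trans_pm (m n : ℕ) : trans p q a (m, n + 1) (m + 1, n) = Apm q a m (n + 1) := by
  simp only [trans, ell, lam, Apm]
  push_cast
  ring

theorem trans_mp (m n : ℕ) : trans p q a (m + 1, n) (m, n + 1) = Amp p a (m + 1) n := by
  simp only [trans, ell, lam, Amp]
  push_cast
  ring

/-- A functional on `K`-types which grows in one of the four directions of transition. -/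
structure IsDirection (p q : ℕ) (a : ℂ) (φ : ℕ × ℕ → ℤ) : Prop where
  step : ∀ ρ ρ', Nbr ρ ρ' → φ ρ' = φ ρ + 2 ∨ φ ρ' = φ ρ ∨ φ ρ' = φ ρ - 2
  trans_eq : ∀ ρ ρ' σ τ, Nbr ρ ρ' → Nbr σ τ → φ ρ = φ σ → φ ρ' = φ ρ + 2 → φ τ = φ σ + 2 →
    trans p q a ρ ρ' = trans p q a σ τ

theorem Nbr.cases {ρ ρ' : ℕ × ℕ} (h : Nbr ρ ρ') :
    (∃ m n, ρ = (m, n) ∧ ρ' = (m + 1, n + 1)) ∨ (∃ m n, ρ = (m + 1, n + 1) ∧ ρ' = (m, n)) ∨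
      (∃ m n, ρ = (m, n + 1) ∧ ρ' = (m + 1, n)) ∨ ∃ m n, ρ = (m + 1, n) ∧ ρ' = (m, n + 1) := by
  obtain ⟨m, n⟩ := ρ
  obtain ⟨m', n'⟩ := ρ'
  obtain ⟨h1, h2⟩ := h
  simp only [nbr] at h1 h2
  rcases h1 with rfl | rfl <;> rcases h2 with rfl | rfl
  · exact Or.inl ⟨_, _, rfl, rfl⟩
  · exact Or.inr (Or.inr (Or.inl ⟨_, _, rfl, rfl⟩))
  · exact Or.inr (Or.inr (Or.inr ⟨_, _, rfl, rfl⟩))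
  · exact Or.inr (Or.inl ⟨_, _, rfl, rfl⟩)

theorem isDirection_pp : IsDirection p q a fun σ => (σ.1 : ℤ) + σ.2 where
  step ρ ρ' h := by
    rcases h.cases with ⟨m, n, rfl, rfl⟩ | ⟨m, n, rfl, rfl⟩ | ⟨m, n, rfl, rfl⟩ | ⟨m, n, rfl, rfl⟩ <;>
      (push_cast; omega)
  trans_eq ρ ρ' σ τ h h' h1 h2 h3 := by
    rcases h.cases with ⟨m, n, rfl, rfl⟩ | ⟨m, n, rfl, rfl⟩ | ⟨m, n, rfl, rfl⟩ | ⟨m, n, rfl, rfl⟩ <;>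
    rcases h'.cases with ⟨s, t, rfl, rfl⟩ | ⟨s, t, rfl, rfl⟩ | ⟨s, t, rfl, rfl⟩ | ⟨s, t, rfl, rfl⟩ <;>
    push_cast at h1 h2 h3 <;> try omega
    rw [trans_pp, trans_pp, App, App]
    have h1' : (m : ℂ) + n = s + t := by exact_mod_cast h1
    linear_combination -h1'

theorem isDirection_mm : IsDirection p q a fun σ => -((σ.1 : ℤ) + σ.2) where
  step ρ ρ' h := by
    rcases h.cases with ⟨m, n, rfl, rfl⟩ | ⟨m, n, rfl, rfl⟩ | ⟨m, n, rfl, rfl⟩ | ⟨m, n, rfl, rfl⟩ <;>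
      (push_cast; omega)
  trans_eq ρ ρ' σ τ h h' h1 h2 h3 := by
    rcases h.cases with ⟨m, n, rfl, rfl⟩ | ⟨m, n, rfl, rfl⟩ | ⟨m, n, rfl, rfl⟩ | ⟨m, n, rfl, rfl⟩ <;>
    rcases h'.cases with ⟨s, t, rfl, rfl⟩ | ⟨s, t, rfl, rfl⟩ | ⟨s, t, rfl, rfl⟩ | ⟨s, t, rfl, rfl⟩ <;>
    push_cast at h1 h2 h3 <;> try omega
    rw [trans_mm, trans_mm, Amm, Amm]
    have h1' : (m : ℂ) + n = s + t := by
      have : (m : ℤ) + n = s + t := by omega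
      exact_mod_cast this
    push_cast
    linear_combination h1'

theorem isDirection_pm : IsDirection p q a fun σ => (σ.1 : ℤ) - σ.2 where
  step ρ ρ' h := by
    rcases h.cases with ⟨m, n, rfl, rfl⟩ | ⟨m, n, rfl, rfl⟩ | ⟨m, n, rfl, rfl⟩ | ⟨m, n, rfl, rfl⟩ <;>
      (push_cast; omega)
  trans_eq ρ ρ' σ τ h h' h1 h2 h3 := by
    rcases h.cases with ⟨m, n, rfl, rfl⟩ | ⟨m, n, rfl, rfl⟩ | ⟨m, n, rfl, rfl⟩ | ⟨m, n, rfl, rfl⟩ <;>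
    rcases h'.cases with ⟨s, t, rfl, rfl⟩ | ⟨s, t, rfl, rfl⟩ | ⟨s, t, rfl, rfl⟩ | ⟨s, t, rfl, rfl⟩ <;>
    push_cast at h1 h2 h3 <;> try omega
    rw [trans_pm, trans_pm, Apm, Apm]
    have h1' : (m : ℂ) - n = s - t := by
      have : (m : ℤ) - n = s - t := by omega
      exact_mod_cast this
    push_cast
    linear_combination -h1'

theorem isDirection_mp : IsDirection p q a fun σ => (σ.2 : ℤ) - σ.1 where
  step ρ ρ' h := by
    rcases h.cases with ⟨m, n, rfl, rfl⟩ | ⟨m, n, rfl, rfl⟩ | ⟨m, n, rfl, rfl⟩ | ⟨m, n, rfl, rfl⟩ <;>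
      (push_cast; omega)
  trans_eq ρ ρ' σ τ h h' h1 h2 h3 := by
    rcases h.cases with ⟨m, n, rfl, rfl⟩ | ⟨m, n, rfl, rfl⟩ | ⟨m, n, rfl, rfl⟩ | ⟨m, n, rfl, rfl⟩ <;>
    rcases h'.cases with ⟨s, t, rfl, rfl⟩ | ⟨s, t, rfl, rfl⟩ | ⟨s, t, rfl, rfl⟩ | ⟨s, t, rfl, rfl⟩ <;>
    push_cast at h1 h2 h3 <;> try omega
    rw [trans_mp, trans_mp, Amp, Amp]
    have h1' : (m : ℂ) - n = s - t := by
      have : (m : ℤ) - n = s - t := by omega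
      exact_mod_cast this
    push_cast
    linear_combination h1'

theorem Nbr.exists_direction {σ τ : ℕ × ℕ} (h : Nbr σ τ) (p q : ℕ) (a : ℂ) :
    ∃ φ, IsDirection p q a φ ∧ φ τ = φ σ + 2 := by
  rcases h.cases with ⟨m, n, rfl, rfl⟩ | ⟨m, n, rfl, rfl⟩ | ⟨m, n, rfl, rfl⟩ | ⟨m, n, rfl, rfl⟩
  · exact ⟨_, isDirection_pp, by push_cast; ring⟩
  · exact ⟨_, isDirection_mm, by push_cast; ring⟩
  · exact ⟨_, isDirection_pm, by push_cast; ring⟩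
  · exact ⟨_, isDirection_mp, by push_cast; ring⟩

variable [NeZero p] [NeZero q]

/-- Transition coefficients between neighbouring `K`-types of a constituent do not vanish. -/
theorem trans_ne_zero {V₀ V₁ : Submodule ℂ (S p q a)} (hV : IsConstituent V₀ V₁) {σ τ : ℕ × ℕ}
    (hσ : HasKType V₀ V₁ σ.1 σ.2) (hτ : HasKType V₀ V₁ τ.1 τ.2) (hn : Nbr σ τ) :
    trans p q a σ τ ≠ 0 := by
  intro h0
  obtain ⟨hV₀, hV₁, hlt, hirr⟩ := hV
  obtain ⟨φ, hφ, hστ⟩ := hn.exists_direction p q a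
  -- The K-types not beyond the level of σ, together with the other parity class of φ, which boosts
  -- never reach. Leaving R means a step from the level of σ, where the coefficient is `trans p q a
  -- σ τ` = 0.
  let R : Set (ℕ × ℕ) := {ρ | φ ρ ≤ φ σ ∨ φ ρ % 2 ≠ φ σ % 2}
  have hR : Stays p q a R R := stays_of_trans fun ρ hρ ρ' hρ' hn' => by
    simp only [R, Set.mem_ofPred_eq] at hρ hρ'
    have h1 : φ ρ = φ σ ∧ φ ρ' = φ ρ + 2 := by
      have := hφ.step ρ ρ' hn'
      omega
    rw [hφ.trans_eq ρ ρ' σ τ hn' hn h1.1 h1.2 hστ, h0]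
  -- The K-types of V₀ are added so that the subspace compared with V₁ contains V₀.
  have hRT : Stays p q a (R ∪ typesOf V₀) (R ∪ typesOf V₀) := by
    rintro ρ (hρ | hρ) ρ' hρ' j k f hf
    · exact hR ρ hρ ρ' (fun h => hρ' (Or.inl h)) j k f hf
    · exact stays_typesOf hV₀ ρ hρ ρ' (fun h => hρ' (Or.inr h)) j k f hf
  have hW := isClosedInvariant_inf hV₁ (isClosedInvariant_typeSpan hRT)
  have h1 : V₀ ≤ typeSpan p q a (R ∪ typesOf V₀) := by
    intro f hf
    rw [← typeSpan_typesOf (kStable_of_isClosedInvariant hV₀) hV₀.1, mem_typeSpan] at hf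
    exact mem_typeSpan.2 fun ρ hρ => hf ρ fun h => hρ (Or.inr h)
  -- Irreducibility leaves two options: V₀, which lacks σ although the new subspace has it, or V₁,
  -- which has τ although the new subspace lacks it.
  rcases hirr _ hW (le_inf hlt.le h1) inf_le_left with h | h
  · exact hσ.2 (h ▸ le_inf hσ.1 (kType_le_typeSpan (Or.inl (Or.inl le_rfl))))
  · have hτR : τ ∉ R ∪ typesOf V₀ := by
      rintro (h2 | h2)
      · simp only [R, Set.mem_ofPred_eq] at h2
        omega
      · exact hτ.2 h2
    refine hτ.2 fun f hf => ?_
    have h2 : f ∈ typeSpan p q a (R ∪ typesOf V₀) := by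
      have h3 := hτ.1 hf
      rw [← h] at h3
      exact h3.2
    rw [← comp_of_mem (σ := τ) hf, mem_typeSpan.1 h2 τ hτR]
    exact V₀.zero_mem

end Barrier

end

section

/-! ### One-variable recursions with polynomially bounded solutions -/

section Recursions

/-- The solution of `χ (j + 1) = χ j * ρ j` with `χ 0 = 1`. -/
def zprod (ρ : ℤ → ℝ) : ℤ → ℝ
  | Int.ofNat n => ∏ i ∈ Finset.range n, ρ i
  | Int.negSucc n => ∏ i ∈ Finset.range (n + 1), (ρ (-(i : ℤ) - 1))⁻¹

theorem zprod_natCast (ρ : ℤ → ℝ) (n : ℕ) : zprod ρ n = ∏ i ∈ Finset.range n, ρ i := rfl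

theorem zprod_neg (ρ : ℤ → ℝ) (n : ℕ) :
    zprod ρ (-n) = ∏ i ∈ Finset.range n, (ρ (-(i : ℤ) - 1))⁻¹ := by
  rcases n with _ | n
  · rfl
  · rfl

theorem zprod_ne_zero {ρ : ℤ → ℝ} (hρ : ∀ j, ρ j ≠ 0) (j : ℤ) : zprod ρ j ≠ 0 := by
  rcases Int.eq_nat_or_neg j with ⟨n, rfl | rfl⟩
  · rw [zprod_natCast]
    exact Finset.prod_ne_zero_iff.2 fun i _ => hρ _
  · rw [zprod_neg]
    exact Finset.prod_ne_zero_iff.2 fun i _ => inv_ne_zero (hρ _)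

theorem zprod_succ {ρ : ℤ → ℝ} (hρ : ∀ j, ρ j ≠ 0) (j : ℤ) :
    zprod ρ (j + 1) = zprod ρ j * ρ j := by
  rcases Int.eq_nat_or_neg j with ⟨n, rfl | rfl⟩
  · rw [zprod_natCast, ← Nat.cast_succ, zprod_natCast, Finset.prod_range_succ]
  · rcases n with _ | n
    · have h0 : zprod ρ 0 = 1 := rfl
      simpa [h0] using zprod_natCast ρ 1
    · rw [show (-((n + 1 : ℕ) : ℤ)) + 1 = -(n : ℤ) by push_cast; ring, zprod_neg, zprod_neg,
        Finset.prod_range_succ, mul_assoc,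
        show (-((n + 1 : ℕ) : ℤ)) = -(n : ℤ) - 1 by push_cast; ring, inv_mul_cancel₀ (hρ _), mul_one]

/-- Bernoulli's inequality bounds each factor by ((i+2)/(i+1))^M, and these telescope. -/
theorem abs_prod_le {θ : ℕ → ℝ} {M : ℕ} (h : ∀ i, |θ i| ≤ 1 + M / ((i : ℝ) + 1)) (n : ℕ) :
    |∏ i ∈ Finset.range n, θ i| ≤ ((n : ℝ) + 1) ^ M := by
  induction n with
  | zero => simp
  | succ n ih =>
    rw [Finset.prod_range_succ, abs_mul]
    have hn : (0 : ℝ) < n + 1 := by positivity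
    have h1 : 1 + (M : ℝ) * ((n : ℝ) + 1)⁻¹ ≤ (1 + ((n : ℝ) + 1)⁻¹) ^ M :=
      one_add_mul_le_pow (by have := inv_pos.2 hn; linarith) M
    have h2 : |θ n| ≤ (1 + ((n : ℝ) + 1)⁻¹) ^ M := by
      refine (h n).trans ?_
      rwa [div_eq_mul_inv]
    refine (mul_le_mul ih h2 (abs_nonneg _) (by positivity)).trans (le_of_eq ?_)
    rw [← mul_pow, mul_add, mul_one, mul_inv_cancel₀ hn.ne']
    push_cast
    rfl

theorem abs_zprod_le {ρ : ℤ → ℝ} {M : ℕ} (h : ∀ j : ℤ, |ρ j| ≤ 1 + M / (|(j : ℝ)| + 1))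
    (h' : ∀ j : ℤ, |(ρ j)⁻¹| ≤ 1 + M / (|(j : ℝ)| + 1)) (j : ℤ) :
    |zprod ρ j| ≤ (|(j : ℝ)| + 1) ^ M := by
  rcases Int.eq_nat_or_neg j with ⟨n, rfl | rfl⟩
  · rw [zprod_natCast]
    have h1 := abs_prod_le (θ := fun i : ℕ => ρ i) (M := M) (fun i => by simpa using h i) n
    simpa using h1
  · rw [zprod_neg]
    have h1 := abs_prod_le (θ := fun i : ℕ => (ρ (-(i : ℤ) - 1))⁻¹) (M := M) (fun i => by
      refine (h' _).trans ?_
      have hi : (0 : ℝ) ≤ i := Nat.cast_nonneg i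
      have : |((-(i : ℤ) - 1 : ℤ) : ℝ)| = i + 1 := by
        push_cast
        rw [show -(i : ℝ) - 1 = -(i + 1) by ring, abs_neg, abs_of_nonneg (by positivity)]
      rw [this]
      gcongr
      linarith) n
    simpa using h1

/-- Near γ the integers are discrete, far away the triangle inequality suffices. Hence (d - β)/(d -
γ) differs from 1 by O(1/(|d|+1)), as polynomial growth of the product requires. -/
theorem exists_dist_pos (γ : ℝ) :
    ∃ δ : ℝ, 0 < δ ∧ ∀ d : ℤ, (d : ℝ) - γ ≠ 0 → δ * (|(d : ℝ)| + 1) ≤ |(d : ℝ) - γ| := by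
  obtain ⟨δ, hδ, h⟩ : ∃ δ : ℝ, 0 < δ ∧ ∀ d : ℤ, (d : ℝ) - γ ≠ 0 → δ ≤ |(d : ℝ) - γ| := by
    by_cases h0 : γ = round γ
    · refine ⟨1, one_pos, fun d hd => ?_⟩
      rw [h0] at hd ⊢
      have : d - round γ ≠ 0 := fun h => hd (by exact_mod_cast h)
      exact_mod_cast Int.one_le_abs this
    · refine ⟨|γ - round γ|, abs_pos.2 (sub_ne_zero.2 h0), fun d _ => ?_⟩
      rw [abs_sub_comm (d : ℝ)]
      exact round_le γ d
  refine ⟨min (1 / 2) (δ / (2 * |γ| + 2)), by positivity, fun d hd => ?_⟩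
  have hd0 := abs_nonneg (d : ℝ)
  have hg0 := abs_nonneg γ
  by_cases hl : 2 * |γ| + 1 ≤ |(d : ℝ)|
  · have h1 : |(d : ℝ)| - |γ| ≤ |(d : ℝ) - γ| := abs_sub_abs_le_abs_sub _ _
    have h2 : min (1 / 2) (δ / (2 * |γ| + 2)) * (|(d : ℝ)| + 1) ≤ 1 / 2 * (|(d : ℝ)| + 1) := by
      gcongr
      exact min_le_left _ _
    linarith
  · push Not at hl
    have h2 : min (1 / 2) (δ / (2 * |γ| + 2)) * (|(d : ℝ)| + 1) ≤
        δ / (2 * |γ| + 2) * (2 * |γ| + 2) :=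
      mul_le_mul (min_le_right _ _) (by linarith) (by positivity) (by positivity)
    rw [div_mul_cancel₀ _ (by positivity)] at h2
    exact h2.trans (h d hd)

/-- A rational function of degree zero, with the value `1` at its zeros and poles. -/
def ratio (β γ : ℝ) (d : ℤ) : ℝ :=
  if (d : ℝ) - β = 0 ∨ (d : ℝ) - γ = 0 then 1 else (d - β) / (d - γ)

theorem ratio_ne_zero (β γ : ℝ) (d : ℤ) : ratio β γ d ≠ 0 := by
  rw [ratio]
  split_ifs with h
  · exact one_ne_zero
  · push Not at h
    exact div_ne_zero h.1 h.2

theorem ratio_of_ne {β γ : ℝ} {d : ℤ} (h : (d : ℝ) - β ≠ 0) (h' : (d : ℝ) - γ ≠ 0) :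
    ratio β γ d = (d - β) / (d - γ) := if_neg (not_or.2 ⟨h, h'⟩)

theorem ratio_inv (β γ : ℝ) (d : ℤ) : (ratio β γ d)⁻¹ = ratio γ β d := by
  rw [ratio, ratio]
  split_ifs with h h' h'
  · exact inv_one
  · exact absurd h.symm h'
  · exact absurd h'.symm h
  · exact inv_div _ _

theorem exists_abs_ratio_le (β γ : ℝ) :
    ∃ M : ℕ, ∀ d : ℤ, |ratio β γ d| ≤ 1 + M / (|(d : ℝ)| + 1) := by
  obtain ⟨δ, hδ, h⟩ := exists_dist_pos γ
  obtain ⟨M, hM⟩ := exists_nat_ge (|γ - β| / δ)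
  refine ⟨M, fun d => ?_⟩
  have hd : 0 < |(d : ℝ)| + 1 := by positivity
  rw [ratio]
  split_ifs with h0
  · rw [abs_one]
    have : (0 : ℝ) ≤ M / (|(d : ℝ)| + 1) := by positivity
    linarith
  · push Not at h0
    have h1 := h d h0.2
    have h2 : 0 < |(d : ℝ) - γ| := abs_pos.2 h0.2
    rw [show ((d : ℝ) - β) = (d - γ) + (γ - β) by ring, add_div, div_self h0.2]
    refine (abs_add_le _ _).trans ?_
    rw [abs_one, abs_div]
    refine add_le_add le_rfl ?_
    calc |γ - β| / |(d : ℝ) - γ| ≤ |γ - β| / (δ * (|(d : ℝ)| + 1)) := by gcongr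
      _ = |γ - β| / δ / (|(d : ℝ)| + 1) := by rw [div_div]
      _ ≤ M / (|(d : ℝ)| + 1) := by gcongr

/-- A nowhere vanishing solution of polynomial growth of the recursion
`ψ (d + 2) (d - γ) = ψ d (d - β)`. -/
theorem exists_recursion (β γ : ℝ) : ∃ (ψ : ℤ → ℝ) (M : ℕ), (∀ d, ψ d ≠ 0) ∧
    (∀ d, |ψ d| ≤ (|(d : ℝ)| + 1) ^ M) ∧
    ∀ d : ℤ, (d : ℝ) - β ≠ 0 → (d : ℝ) - γ ≠ 0 → ψ (d + 2) * (d - γ) = ψ d * (d - β) := by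
  obtain ⟨M₁, h₁⟩ := exists_abs_ratio_le β γ
  obtain ⟨M₂, h₂⟩ := exists_abs_ratio_le γ β
  -- The recursion steps by two, so even and odd arguments are treated separately, with d = 2j + e.
  let ρ : ℤ → ℤ → ℝ := fun e j => ratio β γ (2 * j + e)
  have hρ : ∀ e j, ρ e j ≠ 0 := fun e j => ratio_ne_zero _ _ _
  have key : ∀ (e j : ℤ), 0 ≤ e → e < 2 → |(j : ℝ)| ≤ |((2 * j + e : ℤ) : ℝ)| := fun e j h0 h1 => by
    have : |j| ≤ |2 * j + e| := by
      rcases abs_cases j with h | h <;> rcases abs_cases (2 * j + e) with h' | h' <;> omega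
    exact_mod_cast this
  refine ⟨fun d => zprod (ρ (d % 2)) (d / 2), max M₁ M₂, fun d => zprod_ne_zero (hρ _) _,
    fun d => ?_, fun d hb hc => ?_⟩
  · have h0 : 0 ≤ d % 2 := Int.emod_nonneg _ (by norm_num)
    have h1 : d % 2 < 2 := Int.emod_lt_of_pos _ (by norm_num)
    have hbd : ∀ (M : ℕ), M ≤ max M₁ M₂ → ∀ j : ℤ, 1 + M / (|((2 * j + d % 2 : ℤ) : ℝ)| + 1) ≤
        1 + ((max M₁ M₂ : ℕ) : ℝ) / (|(j : ℝ)| + 1) := fun M hM j => by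
      have hM' : (M : ℝ) ≤ ((max M₁ M₂ : ℕ) : ℝ) := by exact_mod_cast hM
      have := key (d % 2) j h0 h1
      gcongr
    refine (abs_zprod_le (fun j => (h₁ _).trans (hbd M₁ (le_max_left _ _) j)) (fun j => ?_)
      (d / 2)).trans ?_
    · rw [ratio_inv]
      exact (h₂ _).trans (hbd M₂ (le_max_right _ _) j)
    · have h3 := key (d % 2) (d / 2) h0 h1
      rw [Int.mul_ediv_add_emod] at h3
      gcongr
  · have h1 : (d + 2) % 2 = d % 2 := by omega
    have h2 : (d + 2) / 2 = d / 2 + 1 := by omega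
    beta_reduce
    rw [h1, h2, zprod_succ (hρ _), mul_assoc]
    congr 1
    change ratio β γ (2 * (d / 2) + d % 2) * _ = _
    rw [Int.mul_ediv_add_emod, ratio_of_ne hb hc, div_mul_cancel₀ _ hc]

end Recursions

/-! ### Constants on the lattice of K-types -/

section Constants

variable {p q : ℕ} {a : ℂ}

/-- Nonzero real constants of polynomial growth with the ratios prescribed by the transition
coefficients. -/
theorem exists_constants (ha : a.im = 0) : ∃ (c : ℕ × ℕ → ℝ) (M : ℕ), (∀ σ, c σ ≠ 0) ∧
    (∀ σ, |c σ| ≤ (((σ.1 : ℝ) + 1) * (σ.2 + 1)) ^ M) ∧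
    ∀ σ τ, Nbr σ τ → trans p q a σ τ ≠ 0 → trans p q a τ σ ≠ 0 →
      trans p q a σ τ * c τ + trans p q a τ σ * c σ = 0 := by
  obtain ⟨α, rfl⟩ : ∃ α : ℝ, a = α := ⟨a.re, Complex.ext rfl (by simpa using ha)⟩
  -- With d = m + n the coefficients are A^{++}(m,n) = -(d - α) and A^{--}(m+1,n+1) = d + (α+p+q-2).
  -- With d = m - (n+1) the other two are -(d - (α+q-2)) and d + (α+p). The product φ(m+n) ψ(m-n)
  -- then solves both recursions.
  obtain ⟨φ, M₁, hφ0, hφ, hφr⟩ := exists_recursion (-(α + p + q - 2)) α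
  obtain ⟨ψ, M₂, hψ0, hψ, hψr⟩ := exists_recursion (-(α + p)) (α + q - 2)
  have h12 : ∀ m n, trans p q α (m, n) (m + 1, n + 1) ≠ 0 →
      trans p q α (m + 1, n + 1) (m, n) ≠ 0 →
      trans p q α (m, n) (m + 1, n + 1) * (φ ((m + 1 : ℕ) + (n + 1 : ℕ)) : ℂ) +
        trans p q α (m + 1, n + 1) (m, n) * φ (m + n) = 0 := fun m n h1 h2 => by
    rw [trans_pp, App] at h1 ⊢
    rw [trans_mm, Amm] at h2 ⊢
    have e := hφr (m + n) (fun h => h2 ?_) (fun h => h1 ?_)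
    · rw [show (((m + 1 : ℕ) : ℤ) + ((n + 1 : ℕ) : ℤ)) = m + n + 2 by push_cast; ring]
      have e' := congrArg (fun x : ℝ => (x : ℂ)) e
      push_cast at e' ⊢
      linear_combination -e'
    · have e' := congrArg (fun x : ℝ => (x : ℂ)) h
      push_cast at e' ⊢
      linear_combination e'
    · have e' := congrArg (fun x : ℝ => (x : ℂ)) h
      push_cast at e' ⊢
      linear_combination -e'
  have h34 : ∀ m n, trans p q α (m, n + 1) (m + 1, n) ≠ 0 →
      trans p q α (m + 1, n) (m, n + 1) ≠ 0 →
      trans p q α (m, n + 1) (m + 1, n) * (ψ ((m + 1 : ℕ) - (n : ℕ)) : ℂ) +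
        trans p q α (m + 1, n) (m, n + 1) * ψ (m - (n + 1 : ℕ)) = 0 := fun m n h1 h2 => by
    rw [trans_pm, Apm] at h1 ⊢
    rw [trans_mp, Amp] at h2 ⊢
    have e := hψr (m - (n + 1 : ℕ)) (fun h => h2 ?_) (fun h => h1 ?_)
    · rw [show (((m + 1 : ℕ) : ℤ) - (n : ℤ)) = m - (n + 1 : ℕ) + 2 by push_cast; ring]
      have e' := congrArg (fun x : ℝ => (x : ℂ)) e
      push_cast at e' ⊢
      linear_combination -e'
    · have e' := congrArg (fun x : ℝ => (x : ℂ)) h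
      push_cast at e' ⊢
      linear_combination e'
    · have e' := congrArg (fun x : ℝ => (x : ℂ)) h
      push_cast at e' ⊢
      linear_combination -e'
  refine ⟨fun σ => φ (σ.1 + σ.2) * ψ (σ.1 - σ.2), M₁ + M₂, fun σ => mul_ne_zero (hφ0 _) (hψ0 _),
    fun σ => ?_, fun σ τ hn h1 h2 => ?_⟩
  · have h1 : (0 : ℝ) ≤ σ.1 := Nat.cast_nonneg _
    have h2 : (0 : ℝ) ≤ σ.2 := Nat.cast_nonneg _
    have h3 : |(((σ.1 : ℤ) + σ.2 : ℤ) : ℝ)| + 1 ≤ ((σ.1 : ℝ) + 1) * (σ.2 + 1) := by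
      push_cast
      rw [abs_of_nonneg (by positivity)]
      nlinarith
    have h4 : |(((σ.1 : ℤ) - σ.2 : ℤ) : ℝ)| + 1 ≤ ((σ.1 : ℝ) + 1) * (σ.2 + 1) := by
      push_cast
      have : |(σ.1 : ℝ) - σ.2| ≤ σ.1 + σ.2 := abs_le.2 ⟨by linarith, by linarith⟩
      nlinarith
    rw [abs_mul, pow_add]
    exact mul_le_mul ((hφ _).trans (pow_le_pow_left₀ (by positivity) h3 _))
      ((hψ _).trans (pow_le_pow_left₀ (by positivity) h4 _)) (abs_nonneg _) (by positivity)
  · rcases hn.cases with ⟨m, n, rfl, rfl⟩ | ⟨m, n, rfl, rfl⟩ | ⟨m, n, rfl, rfl⟩ | ⟨m, n, rfl, rfl⟩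
    · have e : ((m + 1 : ℕ) : ℤ) - (n + 1 : ℕ) = m - n := by push_cast; ring
      have h := h12 m n h1 h2
      simp only [e]
      push_cast at h ⊢
      linear_combination (ψ (m - n) : ℂ) * h
    · have e : ((m + 1 : ℕ) : ℤ) - (n + 1 : ℕ) = m - n := by push_cast; ring
      have h := h12 m n h2 h1
      simp only [e]
      push_cast at h ⊢
      linear_combination (ψ (m - n) : ℂ) * h
    · have e : ((m + 1 : ℕ) : ℤ) + (n : ℕ) = m + (n + 1 : ℕ) := by push_cast; ring
      have h := h34 m n h1 h2
      simp only [e]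
      push_cast at h ⊢
      linear_combination (φ (m + (n + 1)) : ℂ) * h
    · have e : ((m + 1 : ℕ) : ℤ) + (n : ℕ) = m + (n + 1 : ℕ) := by push_cast; ring
      have h := h34 m n h2 h1
      simp only [e]
      push_cast at h ⊢
      linear_combination (φ (m + (n + 1)) : ℂ) * h

end Constants

end

section

open MeasureTheory Filter Topology

variable {p q : ℕ} [NeZero p] [NeZero q] {a : ℂ}

theorem hasSum_of_eq {ι E : Type*} [AddCommMonoid E] [TopologicalSpace E] {f g : ι → E} {x : E}
    (hg : HasSum g x) (h : ∀ i, f i = g i) : HasSum f x := by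
  rwa [show f = g from funext h]

/-! ### Forms that are scalar on K-types -/

section SpectralForm

/-- Polynomial growth of constants indexed by `K`-types. -/
def PolyGrowth (c : ℕ × ℕ → ℝ) (M : ℕ) : Prop :=
  ∀ σ, |c σ| ≤ (((σ.1 : ℝ) + 1) * (σ.2 + 1)) ^ M

theorem norm_iota_comp_le_Lam (N : ℕ) (σ : ℕ × ℕ) (f : S p q a) :
    ‖iota (comp σ f)‖ ≤ (ell p q σ ^ N)⁻¹ * ‖iota ((Lam ^ N) f)‖ := by
  have h0 := one_pos.trans_le (one_le_ell (p := p) (q := q) σ)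
  have h1 := norm_iota_comp_le σ ((Lam ^ N) f)
  rw [comp_Lam_pow, map_smul, norm_smul, norm_pow, Complex.norm_real, Real.norm_of_nonneg h0.le] at h1
  rwa [← div_eq_inv_mul, le_div_iff₀ (pow_pos h0 N), mul_comm]

/-- M powers of `Lam` on f absorb the growth of c, and two more make the series over the lattice
converge. -/
theorem norm_term_le {c : ℕ × ℕ → ℝ} {M : ℕ} (hc : PolyGrowth c M) (f h : S p q a) (σ : ℕ × ℕ) :
    ‖(c σ : ℂ) * stdInner (comp σ f) h‖ ≤
      (((σ.1 : ℝ) + 1) * (σ.2 + 1))⁻¹ ^ 2 *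
        (4 ^ (M + 2) * ‖iota ((Lam ^ (M + 2)) f)‖ * ‖iota h‖) := by
  have hP : (0 : ℝ) < ((σ.1 : ℝ) + 1) * (σ.2 + 1) := by positivity
  set P := ((σ.1 : ℝ) + 1) * (σ.2 + 1) with hPdef
  have h1 := norm_stdInner_le (comp σ f) h
  have h2 := norm_iota_comp_le_Lam (M + 2) σ f
  have h3 := ell_inv_le (p := p) (q := q) σ (M + 2)
  rw [← hPdef] at h3
  have h4 := hc σ
  rw [← hPdef] at h4
  rw [norm_mul, Complex.norm_real, Real.norm_eq_abs]
  have h5 : ‖iota (comp σ f)‖ ≤ 4 ^ (M + 2) * P⁻¹ ^ (M + 2) * ‖iota ((Lam ^ (M + 2)) f)‖ :=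
    h2.trans (mul_le_mul_of_nonneg_right h3 (norm_nonneg _))
  have h6 : P ^ M * P⁻¹ ^ (M + 2) = P⁻¹ ^ 2 := by
    rw [pow_add, ← mul_assoc, ← mul_pow, mul_inv_cancel₀ hP.ne', one_pow, one_mul]
  calc |c σ| * ‖stdInner (comp σ f) h‖
      ≤ P ^ M * (4 ^ (M + 2) * P⁻¹ ^ (M + 2) * ‖iota ((Lam ^ (M + 2)) f)‖ * ‖iota h‖) :=
        mul_le_mul h4 (h1.trans (mul_le_mul_of_nonneg_right h5 (norm_nonneg _)))
          (norm_nonneg _) (by positivity)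
    _ = (P ^ M * P⁻¹ ^ (M + 2)) * (4 ^ (M + 2) * ‖iota ((Lam ^ (M + 2)) f)‖ * ‖iota h‖) := by ring
    _ = _ := by rw [h6]

theorem summable_term {c : ℕ × ℕ → ℝ} {M : ℕ} (hc : PolyGrowth c M) (f h : S p q a) :
    Summable fun σ => (c σ : ℂ) * stdInner (comp σ f) h :=
  Summable.of_norm_bounded (summable_types.mul_right _) fun σ => norm_term_le hc f h σ

/-- The form which is `c σ` times the inner product on the `K`-type `σ`. -/
def specForm {c : ℕ × ℕ → ℝ} {M : ℕ} (hc : PolyGrowth c M) :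
    S p q a →ₗ[ℂ] S p q a →ₗ⋆[ℂ] ℂ :=
  LinearMap.mk₂'ₛₗ (RingHom.id ℂ) (starRingEnd ℂ)
    (fun f h => ∑' σ, (c σ : ℂ) * stdInner (comp σ f) h)
    (fun f f' h => by
      rw [← (summable_term hc f h).tsum_add (summable_term hc f' h)]
      simp only [map_add, stdInner_add_left, mul_add])
    (fun z f h => by
      rw [RingHom.id_apply, smul_eq_mul, ← tsum_mul_left]
      refine tsum_congr fun σ => ?_
      rw [map_smul, stdInner_smul_left]
      ring)
    (fun f h h' => by
      rw [← (summable_term hc f h).tsum_add (summable_term hc f h')]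
      simp only [stdInner_add_right, mul_add])
    (fun z f h => by
      rw [smul_eq_mul, ← tsum_mul_left]
      refine tsum_congr fun σ => ?_
      rw [stdInner_smul_right]
      ring)

variable {c : ℕ × ℕ → ℝ} {M : ℕ} (hc : PolyGrowth c M)

theorem hasSum_specForm (f h : S p q a) :
    HasSum (fun σ => (c σ : ℂ) * stdInner (comp σ f) h) (specForm hc f h) :=
  (summable_term hc f h).hasSum

/-- Only f pays with derivatives; in h the bound is a plain L² norm. Limits in h may therefore be
taken in L², where the boosts act boundedly. -/
theorem exists_norm_specForm_le : ∃ C, ∀ f h : S p q a,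
    ‖specForm hc f h‖ ≤ C * ‖iota ((Lam ^ (M + 2)) f)‖ * ‖iota h‖ := by
  refine ⟨(∑' σ : ℕ × ℕ, (((σ.1 : ℝ) + 1) * (σ.2 + 1))⁻¹ ^ 2) * 4 ^ (M + 2), fun f h => ?_⟩
  refine (tsum_of_norm_bounded (summable_types.mul_right _).hasSum
    fun σ => norm_term_le hc f h σ).trans (le_of_eq ?_)
  rw [tsum_mul_right]
  ring

theorem specForm_conj (f h : S p q a) : specForm hc h f = conj (specForm hc f h) := by
  refine (hasSum_specForm hc h f).unique ?_
  refine hasSum_of_eq (Complex.hasSum_conj'.2 (hasSum_specForm hc f h)) fun σ => ?_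
  rw [map_mul, Complex.conj_ofReal, stdInner_conj, ← stdInner_comp_right (comp_mem σ h),
    stdInner_comp_left (comp_mem σ f)]

theorem specForm_left {σ : ℕ × ℕ} {f : S p q a} (hf : f ∈ kType p q a σ.1 σ.2) (h : S p q a) :
    specForm hc f h = c σ * stdInner f h := by
  refine (hasSum_specForm hc f h).unique ?_
  have := hasSum_single (f := fun τ => (c τ : ℂ) * stdInner (comp τ f) h) σ fun τ hne => by
    rw [comp_of_mem_ne hf hne, stdInner_zero_left, mul_zero]
  rwa [comp_of_mem hf] at this

theorem specForm_right {σ : ℕ × ℕ} {h : S p q a} (hh : h ∈ kType p q a σ.1 σ.2) (f : S p q a) :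
    specForm hc f h = c σ * stdInner f h := by
  rw [specForm_conj, specForm_left hc hh, map_mul, Complex.conj_ofReal, stdInner_conj]

theorem continuous_specForm : Continuous fun x : S p q a × S p q a => specForm hc x.1 x.2 := by
  obtain ⟨C, hC⟩ := exists_norm_specForm_le (p := p) (q := q) (a := a) hc
  refine continuous_iff_continuousAt.2 fun ⟨f₀, h₀⟩ => ?_
  refine tendsto_iff_norm_sub_tendsto_zero.2 ?_
  have h1 : Tendsto (fun x : S p q a × S p q a => ‖iota ((Lam ^ (M + 2)) (x.1 - f₀))‖) (𝓝 (f₀, h₀))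
      (𝓝 0) := by
    have := tendsto_iff_norm_sub_tendsto_zero.1
      (((continuous_iota_Lam_pow (p := p) (q := q) (a := a) (M + 2)).comp
        continuous_fst).tendsto (f₀, h₀))
    simpa only [Function.comp, ← map_sub] using this
  have h2 : Tendsto (fun x : S p q a × S p q a => ‖iota (x.2 - h₀)‖) (𝓝 (f₀, h₀)) (𝓝 0) := by
    have := tendsto_iff_norm_sub_tendsto_zero.1
      (((continuous_iota (p := p) (q := q) (a := a)).comp continuous_snd).tendsto (f₀, h₀))
    simpa only [Function.comp, ← map_sub] using this
  have h3 : Tendsto (fun x : S p q a × S p q a => ‖iota x.2‖) (𝓝 (f₀, h₀)) (𝓝 ‖iota h₀‖) :=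
    (((continuous_iota (p := p) (q := q) (a := a)).comp continuous_snd).norm).tendsto (f₀, h₀)
  refine squeeze_zero (fun _ => norm_nonneg _) (fun x => ?_)
    (g := fun x : S p q a × S p q a => C * ‖iota ((Lam ^ (M + 2)) (x.1 - f₀))‖ * ‖iota x.2‖ +
      C * ‖iota ((Lam ^ (M + 2)) f₀)‖ * ‖iota (x.2 - h₀)‖) ?_
  · have e : specForm hc x.1 x.2 - specForm hc f₀ h₀ =
        specForm hc (x.1 - f₀) x.2 + specForm hc f₀ (x.2 - h₀) := by
      rw [map_sub, map_sub, LinearMap.sub_apply]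
      ring
    rw [e]
    exact (norm_add_le _ _).trans (add_le_add (hC _ _) (hC _ _))
  · simpa using ((h1.const_mul C).mul h3).add (h2.const_mul (C * ‖iota ((Lam ^ (M + 2)) f₀)‖))

theorem specForm_act_kElt (A : Iso p) (B : Iso q) (f h : S p q a) :
    specForm hc (act (kElt A B) f) (act (kElt A B) h) = specForm hc f h := by
  refine (hasSum_specForm hc _ _).unique ?_
  simp only [comp_act_kElt, stdInner_act_kElt]
  exact hasSum_specForm hc f h

theorem eq_sum_comp {s : Finset (ℕ × ℕ)} {f : S p q a} (hf : f ∈ typeSpan p q a s) :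
    f = ∑ σ ∈ s, comp σ f := by
  refine eq_of_comp fun τ => ?_
  rw [map_sum]
  by_cases hτ : τ ∈ s
  · rw [Finset.sum_eq_single τ (fun σ _ hne => comp_of_mem_ne (comp_mem σ f) hne.symm)
      (fun h => absurd hτ h), comp_of_mem (comp_mem τ f)]
  · rw [mem_typeSpan.1 hf τ hτ, Finset.sum_eq_zero fun σ hσ =>
      comp_of_mem_ne (comp_mem σ f) (ne_of_mem_of_not_mem hσ hτ).symm]

theorem coe_box (d : ℕ) :
    ((Finset.range (d + 1) ×ˢ Finset.range (d + 1) : Finset (ℕ × ℕ)) : Set (ℕ × ℕ)) = box d := by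
  ext σ
  simp [box, Nat.lt_succ_iff]

end SpectralForm

/-! ### Invariance of such forms under O(p,q) -/

section InvariantForm

variable {c : ℕ × ℕ → ℝ} {M : ℕ} (hc : PolyGrowth c M) {V : Submodule ℂ (S p q a)}

/-- Constants for which the form is infinitesimally invariant on the `K`-types of `V`. -/
def SkewOn (V : Submodule ℂ (S p q a)) (c : ℕ × ℕ → ℝ) : Prop :=
  ∀ σ ∈ typesOf V, ∀ τ ∈ typesOf V, ∀ (j : Fin p) (k : Fin q), ∀ f ∈ kType p q a σ.1 σ.2,
    ∀ h ∈ kType p q a τ.1 τ.2,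
      (c τ : ℂ) * stdInner (D (boost j k) f) h = -(c σ * stdInner f (D (boost j k) h))

theorem comp_eq_zero_or {f : S p q a} (hV : IsClosedInvariant V) (hf : f ∈ V) (σ : ℕ × ℕ) :
    comp σ f = 0 ∨ σ ∈ typesOf V := by
  by_cases h : comp σ f = 0
  · exact Or.inl h
  · exact Or.inr (kType_le_of_comp_ne (kStable_of_isClosedInvariant hV) hV.1 hf h)

theorem D_boost_mem (hV : IsClosedInvariant V) {f : S p q a} (hf : f ∈ V) (j : Fin p) (k : Fin q) :
    D (boost j k) f ∈ V := by
  have e := typeSpan_typesOf (kStable_of_isClosedInvariant hV) hV.1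
  rw [← e]
  rw [← e] at hf
  exact D_boost_mem_typeSpan (stays_typesOf hV) j k hf

theorem specForm_D_boost_kType (hV : IsClosedInvariant V) (hs : SkewOn V c) {f h : S p q a}
    {τ : ℕ × ℕ} (hf : f ∈ V) (hτ : τ ∈ typesOf V) (hh : h ∈ kType p q a τ.1 τ.2) (j : Fin p)
    (k : Fin q) : specForm hc (D (boost j k) f) h = -specForm hc f (D (boost j k) h) := by
  rw [specForm_right hc hh, stdInner_D_boost]
  refine ((hasSum_stdInner f (boostAdj j k h)).mul_left (c τ : ℂ)).unique
    (hasSum_of_eq (hasSum_specForm hc f (D (boost j k) h)).neg fun σ => ?_)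
  rw [← stdInner_D_boost]
  rcases comp_eq_zero_or hV hf σ with h0 | hσ
  · rw [h0, map_zero, stdInner_zero_left, stdInner_zero_left, mul_zero, mul_zero, neg_zero]
  · exact hs σ hσ τ hτ j k _ (comp_mem σ f) h hh

theorem specForm_D_boost (hV : IsClosedInvariant V) (hs : SkewOn V c) {f h : S p q a} {d : ℕ}
    (hf : f ∈ V) (hh : h ∈ V) (hd : h ∈ typeSpan p q a (box d)) (j : Fin p) (k : Fin q) :
    specForm hc (D (boost j k) f) h = -specForm hc f (D (boost j k) h) := by
  rw [← coe_box] at hd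
  rw [eq_sum_comp hd, map_sum, map_sum, map_sum, ← Finset.sum_neg_distrib]
  refine Finset.sum_congr rfl fun τ _ => ?_
  rcases comp_eq_zero_or hV hh τ with h0 | hτ
  · rw [h0, map_zero, map_zero, map_zero, neg_zero]
  · exact specForm_D_boost_kType hc hV hs hf hτ (comp_mem τ h) j k

theorem D_boost_pow_mem (hV : IsClosedInvariant V) {f : S p q a} (hf : f ∈ V) (j : Fin p)
    (k : Fin q) (n : ℕ) : (D (boost j k) ^ n) f ∈ V := by
  induction n with
  | zero => exact hf
  | succ n ih =>
    rw [pow_succ', Module.End.mul_apply]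
    exact D_boost_mem hV ih j k

theorem specForm_D_boost_pow (hV : IsClosedInvariant V) (hs : SkewOn V c) (j : Fin p) (k : Fin q)
    (n : ℕ) {f h : S p q a} {d : ℕ} (hf : f ∈ V) (hh : h ∈ V) (hd : h ∈ typeSpan p q a (box d)) :
    specForm hc ((D (boost j k) ^ n) f) h = (-1) ^ n * specForm hc f ((D (boost j k) ^ n) h) := by
  induction n generalizing h d with
  | zero => simp
  | succ n ih =>
    rw [pow_succ', Module.End.mul_apply,
      specForm_D_boost hc hV hs (D_boost_pow_mem hV hf j k n) hh hd,
      ih (D_boost_mem hV hh j k) (D_boost_mem_box j k hd), ← pow_succ', pow_succ (D (boost j k)),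
      Module.End.mul_apply]
    ring

/-- On K-finite functions the two sides have the same derivatives at t = 0, by iterating the
skewness, and both have analytic growth. -/
theorem specForm_act_boost_kType (hV : IsClosedInvariant V) (hs : SkewOn V c) {σ τ : ℕ × ℕ}
    (hσ : σ ∈ typesOf V) (hτ : τ ∈ typesOf V) {f h : S p q a} (hf : f ∈ kType p q a σ.1 σ.2)
    (hh : h ∈ kType p q a τ.1 τ.2) (j : Fin p) (k : Fin q) (t : ℝ) :
    specForm hc (act (boostFlow j k t) f) h = specForm hc f (act (boostFlow j k (-t)) h) := by
  rw [specForm_right hc hh, specForm_left hc hf]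
  obtain ⟨A₁, K₁, hA₁, hK₁, h₁⟩ := exists_norm_pow_D_boost_le j k (kType_le_box σ hf)
  obtain ⟨A₂, K₂, hA₂, hK₂, h₂⟩ := exists_norm_pow_D_boost_le j k (kType_le_box τ hh)
  have key := eq_zero_of_jets (K := max K₁ K₂) (θ := fun n t =>
    c τ * stdInner (act (boostFlow j k t) ((D (boost j k) ^ n) f)) h -
      (-1) ^ n * (c σ * stdInner f (act (boostFlow j k (-t)) ((D (boost j k) ^ n) h))))
    (fun n t => ?_) (fun n => ?_) (hK₁.trans (le_max_left _ _)) (fun T => ?_) t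
  · simpa [sub_eq_zero] using key
  · have e1 := (isFlow_boost j k).hasDerivAt_stdInner ((D (boost j k) ^ n) f) h t
    have e2 := ((isFlow_boost j k).hasDerivAt_stdInner ((D (boost j k) ^ n) h) f (-t)).scomp t
      (hasDerivAt_neg t)
    have e3 := Complex.conjCLE.toContinuousLinearMap.hasFDerivAt.comp_hasDerivAt t e2
    have e4 : HasDerivAt (fun t => stdInner f (act (boostFlow j k (-t)) ((D (boost j k) ^ n) h)))
        (-stdInner f (act (boostFlow j k (-t)) (D (boost j k) ((D (boost j k) ^ n) h)))) t := by
      refine (e3.congr_deriv ?_).congr_of_eventuallyEq (Eventually.of_forall fun s => ?_)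
      · rw [neg_one_smul]
        change conj (-_) = _
        rw [map_neg, stdInner_conj]
      · exact (stdInner_conj _ _).symm
    refine ((e1.const_mul (c τ : ℂ)).sub ((e4.const_mul (c σ : ℂ)).const_mul ((-1) ^ n))).congr_deriv ?_
    rw [pow_succ' (D (boost j k)), Module.End.mul_apply, Module.End.mul_apply]
    ring
  · simp only [neg_zero, (isFlow_boost j k).zero, act_one]
    have := specForm_D_boost_pow hc hV hs j k n (hσ hf) (hτ hh) (kType_le_box τ hh)
    rw [specForm_right hc hh, specForm_left hc hf] at this
    rw [this, sub_self]
  · obtain ⟨C, hC, hCT⟩ := exists_norm_iota_act_boost (a := a) j k T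
    refine ⟨C * (|c τ| * A₁ * ‖iota h‖ + |c σ| * A₂ * ‖iota f‖), fun n t ht => ?_⟩
    have b1 : ‖stdInner (act (boostFlow j k t) ((D (boost j k) ^ n) f)) h‖ ≤
        C * (A₁ * max K₁ K₂ ^ n * n.factorial) * ‖iota h‖ :=
      (norm_stdInner_le _ _).trans (mul_le_mul_of_nonneg_right ((hCT t ht _).trans
        (mul_le_mul_of_nonneg_left ((h₁ n).trans (by gcongr; exact le_max_left _ _)) hC))
          (norm_nonneg _))
    have b2 : ‖stdInner f (act (boostFlow j k (-t)) ((D (boost j k) ^ n) h))‖ ≤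
        ‖iota f‖ * (C * (A₂ * max K₁ K₂ ^ n * n.factorial)) :=
      (norm_stdInner_le _ _).trans (mul_le_mul_of_nonneg_left ((hCT (-t) (by rwa [abs_neg]) _).trans
        (mul_le_mul_of_nonneg_left ((h₂ n).trans (by gcongr; exact le_max_right _ _)) hC))
          (norm_nonneg _))
    refine (norm_sub_le _ _).trans ?_
    rw [norm_mul, norm_mul, norm_mul, norm_pow, norm_neg, norm_one, one_pow, one_mul,
      Complex.norm_real, Complex.norm_real, Real.norm_eq_abs, Real.norm_eq_abs]
    have b3 := mul_le_mul_of_nonneg_left b1 (abs_nonneg (c τ))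
    have b4 := mul_le_mul_of_nonneg_left b2 (abs_nonneg (c σ))
    linarith

/-- For h in a K-type the left side is a multiple of an L² product, hence continuous in f for the L²
norm, so f may be expanded into components. -/
theorem specForm_act_boost_left (hV : IsClosedInvariant V) (hs : SkewOn V c) {τ : ℕ × ℕ}
    (hτ : τ ∈ typesOf V) {f h : S p q a} (hf : f ∈ V) (hh : h ∈ kType p q a τ.1 τ.2) (j : Fin p)
    (k : Fin q) (t : ℝ) :
    specForm hc (act (boostFlow j k t) f) h = specForm hc f (act (boostFlow j k (-t)) h) := by
  rw [specForm_right hc hh]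
  have h1 := ((hasSum_iota_act_boost j k t f).mapL (innerSL ℂ (iota h))).mul_left (c τ : ℂ)
  simp only [innerSL_apply_apply, ← stdInner_eq_inner] at h1
  refine h1.unique (hasSum_of_eq (hasSum_specForm hc f (act (boostFlow j k (-t)) h))
    fun σ => ?_)
  rcases comp_eq_zero_or hV hf σ with h0 | hσ
  · rw [h0, map_zero, stdInner_zero_left, stdInner_zero_left, mul_zero, mul_zero]
  · rw [← specForm_right hc hh, ← specForm_left hc (comp_mem σ f)]
    exact specForm_act_boost_kType hc hV hs hσ hτ (comp_mem σ f) hh j k t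

/-- Now h is expanded: its partial sums converge after the boost in L², which suffices by the
asymmetric bound on the form. -/
theorem specForm_act_boost (hV : IsClosedInvariant V) (hs : SkewOn V c) {f h : S p q a}
    (hf : f ∈ V) (hh : h ∈ V) (j : Fin p) (k : Fin q) (t : ℝ) :
    specForm hc (act (boostFlow j k t) f) h = specForm hc f (act (boostFlow j k (-t)) h) := by
  obtain ⟨C, hC⟩ := exists_norm_specForm_le (p := p) (q := q) (a := a) hc
  refine (hasSum_specForm hc (act (boostFlow j k t) f) h).unique ?_
  have e : (fun τ => (c τ : ℂ) * stdInner (comp τ (act (boostFlow j k t) f)) h) =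
      fun τ => specForm hc f (act (boostFlow j k (-t)) (comp τ h)) := by
    funext τ
    rw [← stdInner_comp_right (comp_mem τ _), stdInner_comp_left (comp_mem τ h)]
    rcases comp_eq_zero_or hV hh τ with h0 | hτ
    · rw [h0, map_zero, map_zero, stdInner_zero_right, mul_zero]
    · rw [← specForm_right hc (comp_mem τ h)]
      exact specForm_act_boost_left hc hV hs hτ hf (comp_mem τ h) j k t
  rw [e]
  refine tendsto_iff_norm_sub_tendsto_zero.2 (squeeze_zero (fun _ => norm_nonneg _) (fun s => ?_)
    (by simpa using (tendsto_iff_norm_sub_tendsto_zero.1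
      (hasSum_iota_act_boost j k (-t) h)).const_mul (C * ‖iota ((Lam ^ (M + 2)) f)‖)))
  have := hC f (act (boostFlow j k (-t)) (∑ τ ∈ s, comp τ h - h))
  simpa only [map_sub, map_sum] using this

/-- The form is invariant under `O(p,q)`. -/
theorem specForm_act (hV : IsClosedInvariant V) (hs : SkewOn V c) (g : indefOrthogonal p q) :
    ∀ f ∈ V, ∀ h ∈ V, specForm hc (act g f) (act g h) = specForm hc f h := by
  refine generators_induction (P := fun g => ∀ f ∈ V, ∀ h ∈ V,
    specForm hc (act g f) (act g h) = specForm hc f h) (fun f _ h _ => by rw [act_one, act_one])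
    (fun g g' hg hg' f hf h hh => ?_) (fun A B f _ h _ => specForm_act_kElt hc A B f h)
    (fun j k t f hf h hh => ?_) g
  · rw [act_mul, act_mul, hg' _ (hV.act_mem g hf) _ (hV.act_mem g hh), hg f hf h hh]
  · rw [specForm_act_boost hc hV hs hf (hV.act_mem _ hh), (isFlow_boost j k).neg, act_inv_act]

end InvariantForm

end

section

open MeasureTheory Filter Topology

variable {p q : ℕ} [NeZero p] [NeZero q] {a : ℂ}

/-! ### Constituents for real a -/

section RealAxis

theorem conj_trans (ha : conj a = a) (σ τ : ℕ × ℕ) :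
    conj (trans p q a σ τ) = trans p q a σ τ := by
  simp only [trans, map_add, map_sub, map_div₀, ha, Complex.conj_ofReal, map_natCast,
    Complex.conj_ofNat]

theorem stdInner_boost_right {σ τ : ℕ × ℕ} {f h : S p q a} (hf : f ∈ kType p q a σ.1 σ.2)
    (hh : h ∈ kType p q a τ.1 τ.2) (j : Fin p) (k : Fin q) :
    stdInner f (D (boost j k) h) = conj (trans p q a τ σ) * stdInner (mulOp (uLR j k) f) h := by
  rw [← stdInner_conj, stdInner_boost_kType hh hf, map_mul, stdInner_conj, stdInner_mulOp_uLR]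

/-- The restriction of the form with constants `c` to a subspace. -/
def subForm {c : ℕ × ℕ → ℝ} {M : ℕ} (hc : PolyGrowth c M) (V : Submodule ℂ (S p q a)) :
    V →ₗ[ℂ] V →ₗ⋆[ℂ] ℂ := (specForm hc).domRestrict₁₂ V V

theorem subForm_apply {c : ℕ × ℕ → ℝ} {M : ℕ} (hc : PolyGrowth c M) (V : Submodule ℂ (S p q a))
    (f h : V) : subForm hc V f h = specForm hc (f : S p q a) h := rfl

theorem isInvariantHermitianForm_subForm {c : ℕ × ℕ → ℝ} {M : ℕ} (hc : PolyGrowth c M)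
    {V₀ V₁ : Submodule ℂ (S p q a)}
    (h0 : ∀ f ∈ V₀, ∀ h, specForm hc f h = 0)
    (hinv : ∀ g, ∀ f ∈ V₁, ∀ h ∈ V₁, specForm hc (act g f) (act g h) = specForm hc f h) :
    IsInvariantHermitianForm V₀ V₁ (subForm hc V₁) where
  descends f h hf := by
    rw [subForm_apply]
    exact h0 f.1 hf h.1
  hermitian f h := by
    rw [subForm_apply, subForm_apply]
    exact specForm_conj hc f.1 h.1
  continuous := by
    have h1 : Continuous fun x : V₁ × V₁ => ((x.1 : S p q a), (x.2 : S p q a)) :=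
      (continuous_subtype_val.comp continuous_fst).prodMk
        (continuous_subtype_val.comp continuous_snd)
    have h2 := (continuous_specForm (p := p) (q := q) (a := a) hc).comp h1
    simp only [subForm_apply]
    exact h2
  invariant g f h f' h' hf hh := by
    rw [subForm_apply, subForm_apply, hf, hh, rho_eq_act]
    exact hinv _ _ f.2 _ h.2

variable {V₀ V₁ : Submodule ℂ (S p q a)}

open Classical in
/-- The constants on the `K`-types which occur in a subquotient, extended by zero. -/
def occConst (V₀ V₁ : Submodule ℂ (S p q a)) (c : ℕ × ℕ → ℝ) (σ : ℕ × ℕ) : ℝ :=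
  if HasKType V₀ V₁ σ.1 σ.2 then c σ else 0

theorem occConst_pos {σ : ℕ × ℕ} (h : HasKType V₀ V₁ σ.1 σ.2) (c : ℕ × ℕ → ℝ) :
    occConst V₀ V₁ c σ = c σ := if_pos h

theorem occConst_neg {σ : ℕ × ℕ} (h : ¬ HasKType V₀ V₁ σ.1 σ.2) (c : ℕ × ℕ → ℝ) :
    occConst V₀ V₁ c σ = 0 := if_neg h

theorem PolyGrowth.occConst {c : ℕ × ℕ → ℝ} {M : ℕ} (hc : PolyGrowth c M)
    (V₀ V₁ : Submodule ℂ (S p q a)) : PolyGrowth (occConst V₀ V₁ c) M := fun σ => by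
  by_cases h : HasKType V₀ V₁ σ.1 σ.2
  · rw [occConst_pos h]
    exact hc σ
  · rw [occConst_neg h, abs_zero]
    positivity

theorem stdInner_D_boost_eq_zero {V : Submodule ℂ (S p q a)} (hV : IsClosedInvariant V)
    {σ τ : ℕ × ℕ} (hσ : σ ∈ typesOf V) (hτ : τ ∉ typesOf V) {f h : S p q a}
    (hf : f ∈ kType p q a σ.1 σ.2) (hh : h ∈ kType p q a τ.1 τ.2) (j : Fin p) (k : Fin q) :
    stdInner (D (boost j k) f) h = 0 :=
  comp_eq_zero_iff.1 (stays_typesOf hV σ hσ τ hτ j k f hf) h hh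

/-- Between two K-types that occur this is the recursion, valid because no coefficient vanishes
there. Between one that occurs and one in V₀, the boost from V₀ has no component outside V₀, and the
other term carries the constant 0. -/
theorem skewOn_occConst (ha : conj a = a) (hV : IsConstituent V₀ V₁) {c : ℕ × ℕ → ℝ}
    (hrec : ∀ σ τ, Nbr σ τ → trans p q a σ τ ≠ 0 → trans p q a τ σ ≠ 0 →
      trans p q a σ τ * c τ + trans p q a τ σ * c σ = 0) :
    SkewOn V₁ (occConst V₀ V₁ c) := by
  intro σ hσ τ hτ j k f hf h hh
  by_cases oσ : HasKType V₀ V₁ σ.1 σ.2 <;> by_cases oτ : HasKType V₀ V₁ τ.1 τ.2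
  · rw [occConst_pos oσ, occConst_pos oτ, stdInner_boost_kType hf hh, stdInner_boost_right hf hh,
      conj_trans ha]
    by_cases hn : Nbr σ τ
    · have := hrec σ τ hn (trans_ne_zero hV oσ oτ hn) (trans_ne_zero hV oτ oσ hn.symm)
      linear_combination stdInner (mulOp (uLR j k) f) h * this
    · rw [stdInner_mulOp_of_not hf hh hn]
      ring
  · have h1 : τ ∈ typesOf V₀ := by
      by_contra h2
      exact oτ ⟨hτ, h2⟩
    rw [occConst_neg oτ, ← stdInner_conj (D (boost j k) h) f, stdInner_D_boost_eq_zero hV.1 h1 oσ.2 hh hf]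
    simp
  · have h1 : σ ∈ typesOf V₀ := by
      by_contra h2
      exact oσ ⟨hσ, h2⟩
    rw [occConst_neg oσ, stdInner_D_boost_eq_zero hV.1 h1 oτ.2 hf hh]
    simp
  · rw [occConst_neg oσ, occConst_neg oτ]
    simp

theorem specForm_occConst_eq_zero (hV₀ : IsClosedInvariant V₀) {c : ℕ × ℕ → ℝ} {M : ℕ}
    (hc : PolyGrowth c M) {f : S p q a} (hf : f ∈ V₀) (h : S p q a) :
    specForm (hc.occConst V₀ V₁) f h = 0 := by
  refine (hasSum_specForm (hc.occConst V₀ V₁) f h).unique (hasSum_of_eq hasSum_zero fun σ => ?_)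
  rcases comp_eq_zero_or hV₀ hf σ with h0 | hσ
  · rw [h0, stdInner_zero_left, mul_zero]
  · rw [occConst_neg fun h => h.2 hσ, Complex.ofReal_zero, zero_mul]

/-- Testing f against its own component in an occurring K-type, where the constant is nonzero, shows
that this component vanishes. All others already lie in V₀. -/
theorem mem_of_specForm_eq_zero (hV₀ : IsClosedInvariant V₀) (hV₁ : IsClosedInvariant V₁)
    {c : ℕ × ℕ → ℝ} {M : ℕ} (hc : PolyGrowth c M) (hc0 : ∀ σ, c σ ≠ 0) {f : S p q a} (hf : f ∈ V₁)
    (h : ∀ h ∈ V₁, specForm (hc.occConst V₀ V₁) f h = 0) : f ∈ V₀ := by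
  refine mem_of_forall_comp hV₀.1 fun σ => ?_
  rcases comp_eq_zero_or hV₁ hf σ with h0 | hσ
  · rw [h0]
    exact V₀.zero_mem
  · by_cases oσ : kType p q a σ.1 σ.2 ≤ V₀
    · exact oσ (comp_mem σ f)
    · have h1 := h _ (hσ (comp_mem σ f))
      rw [specForm_right _ (comp_mem σ f), occConst_pos ⟨hσ, oσ⟩, ← stdInner_comp_left (comp_mem σ f),
        mul_eq_zero] at h1
      rcases h1 with h1 | h1
      · exact absurd (by exact_mod_cast h1) (hc0 σ)
      · rw [stdInner_self_eq_zero.1 h1]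
        exact V₀.zero_mem

/-- Every constituent is Hermitian for real `a`. -/
theorem exists_form_of_real (ha : a.im = 0) (hV : IsConstituent V₀ V₁) :
    ∃ (B : V₁ →ₗ[ℂ] V₁ →ₗ⋆[ℂ] ℂ) (c : ℕ → ℕ → ℝ),
      IsInvariantHermitianForm V₀ V₁ B ∧
      (∀ f : V₁, (∀ h : V₁, B f h = 0) → (f : S p q a) ∈ V₀) ∧
      IsBuiltFrom V₀ V₁ B c ∧
      (∀ m n, HasKType V₀ V₁ m n → c m n ≠ 0) ∧
      SolvesRecursion V₀ V₁ c := by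
  have ha' : conj a = a := Complex.conj_eq_iff_im.2 ha
  obtain ⟨c, M, hc0, hc, hrec⟩ := exists_constants (p := p) (q := q) ha
  have hc : PolyGrowth c M := hc
  have hs := skewOn_occConst ha' hV hrec
  refine ⟨subForm (hc.occConst V₀ V₁) V₁, fun m n => c (m, n),
    isInvariantHermitianForm_subForm _ (fun f hf h => specForm_occConst_eq_zero hV.1 hc hf h)
      (specForm_act _ hV.2.1 hs),
    fun f hf => mem_of_specForm_eq_zero hV.1 hV.2.1 hc hc0 f.2 fun h hh => hf ⟨h, hh⟩,
    ⟨fun m n m' n' hne f h hf hh => ?_, fun m n o f h hf hh => ?_⟩, fun m n _ => hc0 _,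
    ⟨fun m n o o' => ?_, fun m n o o' => ?_⟩⟩
  · rw [subForm_apply, specForm_left (σ := (m, n)) _ hf, stdInner_kType_ne hf hh hne, mul_zero]
  · rw [subForm_apply, specForm_left (σ := (m, n)) _ hf, occConst_pos (σ := (m, n)) o]
  · have hn : Nbr (m, n) (m + 1, n + 1) := ⟨Or.inl rfl, Or.inl rfl⟩
    have h := hrec _ _ hn (trans_ne_zero hV o o' hn) (trans_ne_zero hV o' o hn.symm)
    rwa [← conj_trans ha' (m + 1, n + 1), trans_pp, trans_mm] at h
  · have hn : Nbr (m, n + 1) (m + 1, n) := ⟨Or.inl rfl, Or.inr rfl⟩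
    have h := hrec _ _ hn (trans_ne_zero hV o o' hn) (trans_ne_zero hV o' o hn.symm)
    rwa [← conj_trans ha' (m + 1, n), trans_pm, trans_mp] at h

theorem ne_zero_of_nondegenerate (hV : IsConstituent V₀ V₁) {B : V₁ →ₗ[ℂ] V₁ →ₗ⋆[ℂ] ℂ}
    (hB : ∀ f : V₁, (∀ h : V₁, B f h = 0) → (f : S p q a) ∈ V₀) : B ≠ 0 := by
  rintro rfl
  exact hV.2.2.1.not_ge fun f hf => hB ⟨f, hf⟩ fun _ => rfl

end RealAxis

/-! ### The unitary axis -/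

section UnitaryAxis

theorem polyGrowth_one : PolyGrowth (fun _ => 1) 0 := fun σ => by simp

theorem specForm_one (f h : S p q a) : specForm polyGrowth_one f h = stdInner f h := by
  refine (hasSum_specForm polyGrowth_one f h).unique (hasSum_of_eq (hasSum_stdInner f h) fun σ => ?_)
  rw [Complex.ofReal_one, one_mul]

/-- The degenerate series is unitary on the unitary axis. -/
theorem isUnitary_of_onUnitaryAxis (ha : OnUnitaryAxis p q a) :
    IsUnitary (⊥ : Submodule ℂ (S p q a)) ⊤ := by
  have ha' : a + conj a = 2 - p - q := by
    rw [Complex.add_conj, ha]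
    push_cast
    ring
  refine ⟨subForm polyGrowth_one ⊤, isInvariantHermitianForm_subForm _ (fun f hf h => ?_)
    (fun g f _ h _ => ?_), fun f hf => ?_⟩
  · rw [(Submodule.mem_bot ℂ).1 hf, map_zero, LinearMap.zero_apply]
  · rw [specForm_one, specForm_one, stdInner_act ha']
  · rw [subForm_apply, specForm_one, stdInner_self, Complex.ofReal_re]
    have : iota (f : S p q a) ≠ 0 := fun h => hf ((Submodule.mem_bot ℂ).2
      (iota_injective (by rw [h, map_zero])))
    positivity

end UnitaryAxis

/-! ### Invariant Hermitian forms restricted to K-types -/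

section HermitianConstituents

variable {V₀ V₁ : Submodule ℂ (S p q a)}

/-- A continuous functional on a closed invariant subspace vanishes if it vanishes on the
components. -/
theorem functional_eq_zero (hV : IsClosedInvariant V₁) {φ : V₁ →ₗ[ℂ] ℂ} (hφ : Continuous φ)
    (h : ∀ σ ∈ typesOf V₁, ∀ f : V₁, (f : S p q a) ∈ kType p q a σ.1 σ.2 → φ f = 0) : φ = 0 := by
  -- The kernel is closed in V₁, hence in S^a, so membership can be tested on components.
  have hcl : IsClosed ((LinearMap.ker φ).map V₁.subtype : Set (S p q a)) := by
    have h1 : IsClosed {f : V₁ | φ f = 0} := isClosed_eq hφ continuous_const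
    exact (hV.1.isClosedEmbedding_subtypeVal.isClosedMap _ h1)
  ext f
  have hf : (f : S p q a) ∈ (LinearMap.ker φ).map V₁.subtype := by
    refine mem_of_forall_comp hcl fun σ => ?_
    rcases comp_eq_zero_or hV f.2 σ with h0 | hσ
    · rw [h0]
      exact Submodule.zero_mem _
    · exact ⟨⟨comp σ f.1, hσ (comp_mem σ _)⟩, h σ hσ _ (comp_mem σ _), rfl⟩
  obtain ⟨f', hf', e⟩ := hf
  rw [← Subtype.ext e]
  exact hf'

variable {B : V₁ →ₗ[ℂ] V₁ →ₗ⋆[ℂ] ℂ}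

/-- The restriction of a form to two `K`-types. -/
def kForm (B : V₁ →ₗ[ℂ] V₁ →ₗ⋆[ℂ] ℂ) {σ τ : ℕ × ℕ} (hσ : σ ∈ typesOf V₁) (hτ : τ ∈ typesOf V₁) :
    kType p q a σ.1 σ.2 →ₗ[ℂ] kType p q a τ.1 τ.2 →ₗ⋆[ℂ] ℂ :=
  LinearMap.mk₂'ₛₗ (RingHom.id ℂ) (starRingEnd ℂ)
    (fun f h => B (Submodule.inclusion hσ f) (Submodule.inclusion hτ h))
    (fun f f' h => by simp) (fun c f h => by simp) (fun f h h' => by simp) (fun c f h => by simp)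

theorem kInvariant_kForm (hB : IsInvariantHermitianForm V₀ V₁ B) {σ τ : ℕ × ℕ}
    (hσ : σ ∈ typesOf V₁) (hτ : τ ∈ typesOf V₁) :
    KInvariant (kForm B hσ hτ) := fun A C f f' h h' hf hh =>
  hB.invariant (kElt A C)⁻¹ _ _ _ _ (by rw [rho_eq_act, inv_inv]; exact hf)
    (by rw [rho_eq_act, inv_inv]; exact hh)

theorem form_ne (hB : IsInvariantHermitianForm V₀ V₁ B) {σ τ : ℕ × ℕ} (hσ : σ ∈ typesOf V₁)
    (hτ : τ ∈ typesOf V₁) (hne : σ ≠ τ) {f h : V₁} (hf : (f : S p q a) ∈ kType p q a σ.1 σ.2)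
    (hh : (h : S p q a) ∈ kType p q a τ.1 τ.2) : B f h = 0 :=
  schur_ne hne (kInvariant_kForm hB hσ hτ) ⟨f, hf⟩ ⟨h, hh⟩

theorem exists_form_const (hB : IsInvariantHermitianForm V₀ V₁ B)
    {σ : ℕ × ℕ} (hσ : σ ∈ typesOf V₁) :
    ∃ c : ℝ, ∀ f h : V₁, (f : S p q a) ∈ kType p q a σ.1 σ.2 →
      (h : S p q a) ∈ kType p q a σ.1 σ.2 → B f h = c * stdInner (f : S p q a) h := by
  obtain ⟨c, hc⟩ := schur_same (kInvariant_kForm hB hσ hσ)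
  have hc' : ∀ f h : V₁, (f : S p q a) ∈ kType p q a σ.1 σ.2 →
      (h : S p q a) ∈ kType p q a σ.1 σ.2 → B f h = c * stdInner (f : S p q a) h :=
    fun f h hf hh => hc ⟨f, hf⟩ ⟨h, hh⟩
  refine ⟨c.re, fun f h hf hh => ?_⟩
  -- Hermitian symmetry on a nonzero vector makes the Schur constant real; a zero vector satisfies
  -- the formula with any constant.
  by_cases hf0 : f = 0
  · rw [hf0, map_zero, LinearMap.zero_apply, Submodule.coe_zero, stdInner_zero_left, mul_zero]
  · have h1 := hB.hermitian f f
    rw [hc' f f hf hf, map_mul, stdInner_conj] at h1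
    have h2 : stdInner (f : S p q a) f ≠ 0 := fun h => hf0 (Subtype.ext (stdInner_self_eq_zero.1 h))
    have h3 := mul_right_cancel₀ h2 h1
    rw [hc' f h hf hh, Complex.conj_eq_iff_re.1 h3.symm]

/-- Both sides are continuous in f and agree on every K-type of V₁, so they agree on V₁. -/
theorem form_right (hB : IsInvariantHermitianForm V₀ V₁ B) (hV : IsClosedInvariant V₁)
    {τ : ℕ × ℕ} (hτ : τ ∈ typesOf V₁) {c : ℝ}
    (hc : ∀ f h : V₁, (f : S p q a) ∈ kType p q a τ.1 τ.2 →
      (h : S p q a) ∈ kType p q a τ.1 τ.2 → B f h = c * stdInner (f : S p q a) h) (f : V₁) {h : V₁}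
    (hh : (h : S p q a) ∈ kType p q a τ.1 τ.2) : B f h = c * stdInner (f : S p q a) h := by
  let φ : V₁ →ₗ[ℂ] ℂ := B.flip h - (c : ℂ) • (stdL (h : S p q a) ∘ₗ V₁.subtype)
  have hφ : ∀ f, φ f = B f h - c * stdInner (f : S p q a) h := fun f => rfl
  have hcont : Continuous φ :=
    (hB.continuous.comp (continuous_id.prodMk continuous_const)).sub
      (continuous_const.mul ((continuous_stdInner_left (h : S p q a)).comp continuous_subtype_val))
  have h0 : φ = 0 := functional_eq_zero hV hcont fun σ hσ f hf => by
    rw [hφ]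
    by_cases hne : σ = τ
    · subst hne
      rw [hc f h hf hh, sub_self]
    · rw [form_ne hB hσ hτ hne hf hh, stdInner_kType_ne hf hh hne, mul_zero, sub_zero]
  rw [← sub_eq_zero, ← hφ, h0, LinearMap.zero_apply]

/-- If all constants vanished, the form would be zero on K-types in one variable, then everywhere by
continuity. -/
theorem exists_form_ne_zero (hB : IsInvariantHermitianForm V₀ V₁ B)
    (hV : IsClosedInvariant V₁) (hne : B ≠ 0) :
    ∃ σ ∈ typesOf V₁, ∃ c : ℝ, c ≠ 0 ∧ (∃ f ∈ kType p q a σ.1 σ.2, f ≠ 0) ∧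
      ∀ f h : V₁, (f : S p q a) ∈ kType p q a σ.1 σ.2 →
        (h : S p q a) ∈ kType p q a σ.1 σ.2 → B f h = c * stdInner (f : S p q a) h := by
  by_contra hcon
  push Not at hcon
  refine hne ?_
  have h1 : ∀ τ ∈ typesOf V₁, ∀ h : V₁, (h : S p q a) ∈ kType p q a τ.1 τ.2 → ∀ f, B f h = 0 := by
    intro τ hτ h hh f
    obtain ⟨c, hc⟩ := exists_form_const hB hτ
    rw [form_right hB hV hτ hc f hh]
    by_cases h0 : (h : S p q a) = 0
    · rw [h0, stdInner_zero_right, mul_zero]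
    · by_cases hc0 : c = 0
      · rw [hc0, Complex.ofReal_zero, zero_mul]
      · obtain ⟨f', h', hf', hh', hne'⟩ := hcon τ hτ c hc0 ⟨h, hh, h0⟩
        exact absurd (hc f' h' hf' hh') hne'
  ext h f
  rw [LinearMap.zero_apply, LinearMap.zero_apply, hB.hermitian, map_eq_zero]
  have hcont : Continuous (B.flip h) := hB.continuous.comp (continuous_id.prodMk continuous_const)
  have h2 := functional_eq_zero hV hcont fun σ hσ f hf => by
    rw [LinearMap.flip_apply, hB.hermitian, h1 σ hσ f hf h, map_zero]
  exact congrArg (fun φ : V₁ →ₗ[ℂ] ℂ => φ f) h2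

end HermitianConstituents

end

section

open MeasureTheory Filter Topology

/-! ### A Hermitian form forces the unitary or the real axis -/

section AxisCriterion

variable {p q : ℕ} [NeZero p] [NeZero q] {a : ℂ}

theorem eq_zero_of_mulOp {f : S p q a} (h : ∀ j k, mulOp (uLR j k) f = 0) : f = 0 := by
  refine S.ext_sphere fun z => ?_
  have hx : ∃ j, (z.1 : EuclideanSpace ℝ (Fin p)) j ≠ 0 := by
    by_contra! hcon
    have h1 : ‖(z.1 : EuclideanSpace ℝ (Fin p))‖ = 1 := by simp
    rw [show (z.1 : EuclideanSpace ℝ (Fin p)) = 0 from PiLp.ext hcon, norm_zero] at h1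
    exact zero_ne_one h1
  have hy : ∃ k, (z.2 : EuclideanSpace ℝ (Fin q)) k ≠ 0 := by
    by_contra! hcon
    have h1 : ‖(z.2 : EuclideanSpace ℝ (Fin q))‖ = 1 := by simp
    rw [show (z.2 : EuclideanSpace ℝ (Fin q)) = 0 from PiLp.ext hcon, norm_zero] at h1
    exact zero_ne_one h1
  obtain ⟨j, hj⟩ := hx
  obtain ⟨k, hk⟩ := hy
  have h1 := congrArg (fun g : S p q a => g (sphereIncl z)) (h j k)
  simp only [mulOp_apply, uLR_sphere, S.zero_apply, mul_eq_zero, Complex.ofReal_eq_zero] at h1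
  rw [S.zero_apply]
  tauto

/-- At every point of the spheres some x_j y_k is nonzero, so these multiplications have no common
kernel and at least one leads from f to some K-type. -/
theorem exists_mulOp_ne_zero {f : S p q a} (hf : f ≠ 0) :
    ∃ (j : Fin p) (k : Fin q) (τ : ℕ × ℕ), ∃ h ∈ kType p q a τ.1 τ.2,
      stdInner (mulOp (uLR j k) f) h ≠ 0 := by
  by_contra! hcon
  exact hf (eq_zero_of_mulOp fun j k => eq_zero_of_comp fun τ =>
    comp_eq_zero_iff.2 fun h hh => hcon j k τ h hh)

/-- Imaginary parts give (c' - c) Im a = 0. If Im a ≠ 0, then c' = c and the real parts sum to 2 Re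
a + p + q - 2 = 0, the eigenvalue differences cancelling. -/
theorem onUnitaryAxis_or_real {x y c c' : ℝ} (hc : c ≠ 0)
    (h : (c' : ℂ) * (a + (p + q - 2) / 2 + ((x : ℂ) - y) / 2) =
      -(c * conj (a + (p + q - 2) / 2 + ((y : ℂ) - x) / 2))) :
    OnUnitaryAxis p q a ∨ a.im = 0 := by
  have hre := congrArg Complex.re h
  have him := congrArg Complex.im h
  have e : ∀ x y : ℝ, a + (p + q - 2) / 2 + ((x : ℂ) - y) / 2 =
      a + (((p + q - 2) / 2 + (x - y) / 2 : ℝ) : ℂ) := fun x y => by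
    push_cast
    ring
  rw [e, e] at hre him
  simp only [map_add, Complex.conj_ofReal, Complex.mul_re, Complex.mul_im, Complex.add_re,
    Complex.add_im, Complex.ofReal_re, Complex.ofReal_im, Complex.neg_re, Complex.neg_im,
    Complex.conj_re, Complex.conj_im, zero_mul, sub_zero, add_zero] at hre him
  by_cases hi : a.im = 0
  · exact Or.inr hi
  · left
    have h1 : c' = c := mul_right_cancel₀ hi (by linarith)
    rw [h1] at hre
    have h2 : a.re + ((p + q - 2) / 2 + (x - y) / 2) =
        -(a.re + ((p + q - 2) / 2 + (y - x) / 2)) := mul_left_cancel₀ hc (by linarith)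
    rw [OnUnitaryAxis]
    linarith

/-- A subquotient with a nonzero invariant Hermitian form lies over the unitary axis or the real
axis. -/
theorem onUnitaryAxis_or_real_of_form {V₀ V₁ : Submodule ℂ (S p q a)} (hV : IsClosedInvariant V₁)
    {B : V₁ →ₗ[ℂ] V₁ →ₗ⋆[ℂ] ℂ} (hB : IsInvariantHermitianForm V₀ V₁ B) (hne : B ≠ 0) :
    OnUnitaryAxis p q a ∨ a.im = 0 := by
  obtain ⟨σ, hσ, c, hc0, ⟨f, hf, hf0⟩, hc⟩ := exists_form_ne_zero hB hV hne
  obtain ⟨j, k, τ, h, hh, hM⟩ := exists_mulOp_ne_zero hf0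
  by_cases hτ : τ ∈ typesOf V₁
  · obtain ⟨c', hc'⟩ := exists_form_const hB hτ
    have hg := isFlow_boost (p := p) (q := q) j k
    -- Invariance moves the boost to the other argument; `form_right` and Hermitian symmetry express
    -- both sides through the constants of τ and σ. The derivative at t = 0 compares the two
    -- transition coefficients.
    have key : ∀ t, (c' : ℂ) * stdInner (act (boostFlow j k t) f) h =
        c * stdInner f (act (boostFlow j k (-t)) h) := fun t => by
      let f₁ : V₁ := ⟨f, hσ hf⟩
      let h₁ : V₁ := ⟨h, hτ hh⟩
      let F : V₁ := ⟨act (boostFlow j k t) f, hV.act_mem _ (hσ hf)⟩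
      let H : V₁ := ⟨act (boostFlow j k (-t)) h, hV.act_mem _ (hτ hh)⟩
      have e1 : B F h₁ = c' * stdInner (act (boostFlow j k t) f) h :=
        form_right hB hV hτ hc' F hh
      have e2 : B f₁ H = c * stdInner f (act (boostFlow j k (-t)) h) := by
        rw [hB.hermitian, form_right hB hV hσ hc H hf, map_mul, Complex.conj_ofReal, stdInner_conj]
      rw [← e1, ← e2]
      refine hB.invariant (boostFlow j k t)⁻¹ f₁ H F h₁ ?_ ?_
      · rw [rho_eq_act, inv_inv]
      · change h = rho p q a (boostFlow j k t)⁻¹ (act (boostFlow j k (-t)) h)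
        rw [rho_eq_act, inv_inv, hg.neg, act_act_inv]
    have e1 := (hg.hasDerivAt_stdInner f h 0).const_mul (c' : ℂ)
    have e2 := ((hg.hasDerivAt_stdInner h f (-0)).scomp (0 : ℝ) (hasDerivAt_neg 0))
    have e3 := (Complex.conjCLE.toContinuousLinearMap.hasFDerivAt.comp_hasDerivAt 0 e2).const_mul
      (c : ℂ)
    have e4 := e1.unique (e3.congr_of_eventuallyEq (Eventually.of_forall fun s =>
      (key s).trans (congrArg ((c : ℂ) * ·) (stdInner_conj _ _).symm)))
    rw [neg_one_smul, neg_zero, hg.zero, act_one, act_one] at e4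
    have e5 : (c' : ℂ) * stdInner (D (boost j k) f) h = c * conj (-stdInner (D (boost j k) h) f) := e4
    rw [map_neg, stdInner_conj, stdInner_boost_kType hf hh, stdInner_boost_right hf hh] at e5
    refine onUnitaryAxis_or_real (x := ell p q σ) (y := ell p q τ) hc0 (c' := c') ?_
    refine mul_right_cancel₀ hM ?_
    change (c' : ℂ) * trans p q a σ τ * _ = -(c * conj (trans p q a τ σ)) * _
    linear_combination e5
  · right
    -- If τ is not in V₁, the boost cannot reach it, so the transition coefficient is zero; its
    -- imaginary part is Im a.
    have h1 := stdInner_D_boost_eq_zero hV hσ hτ hf hh j k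
    rw [stdInner_boost_kType hf hh, mul_eq_zero, or_iff_left hM, trans] at h1
    have h2 := congrArg Complex.im h1
    rw [show a + (p + q - 2) / 2 + ((ell p q σ : ℂ) - ell p q τ) / 2 =
      a + (((p + q - 2) / 2 + (ell p q σ - ell p q τ) / 2 : ℝ) : ℂ) by push_cast; ring] at h2
    simpa using h2

end AxisCriterion

end

end LightCone

end

theorem lemma3p2 (p q : ℕ) (hq : 1 ≤ q) (hpq : q ≤ p) (a : ℂ) :
    -- a Hermitian constituent forces the unitary axis or the real axis
    ((∃ V₀ V₁ : Submodule ℂ (LightCone.S p q a),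
        LightCone.IsConstituent V₀ V₁ ∧ LightCone.IsHermitian V₀ V₁) →
      LightCone.OnUnitaryAxis p q a ∨ a.im = 0) ∧
    -- on the unitary axis the whole module is unitary
    (LightCone.OnUnitaryAxis p q a →
      LightCone.IsUnitary (⊥ : Submodule ℂ (LightCone.S p q a)) ⊤) ∧
    -- on the real axis every constituent is Hermitian, through a nondegenerate form whose
    -- constants on the K-types are nonzero and solve the recursion
    (a.im = 0 → ∀ V₀ V₁ : Submodule ℂ (LightCone.S p q a), LightCone.IsConstituent V₀ V₁ →
      LightCone.IsHermitian V₀ V₁ ∧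
      ∃ (B : V₁ →ₗ[ℂ] V₁ →ₗ⋆[ℂ] ℂ) (c : ℕ → ℕ → ℝ),
        LightCone.IsInvariantHermitianForm V₀ V₁ B ∧
        (∀ f : V₁, (∀ h : V₁, B f h = 0) → (f : LightCone.S p q a) ∈ V₀) ∧
        LightCone.IsBuiltFrom V₀ V₁ B c ∧
        (∀ m n, LightCone.HasKType V₀ V₁ m n → c m n ≠ 0) ∧
        LightCone.SolvesRecursion V₀ V₁ c) := by
  have : NeZero p := ⟨by omega⟩
  have : NeZero q := ⟨by omega⟩
  refine ⟨?_, LightCone.isUnitary_of_onUnitaryAxis, fun ha V₀ V₁ hV => ?_⟩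
  · rintro ⟨V₀, V₁, hV, B, hB, hne⟩
    exact LightCone.onUnitaryAxis_or_real_of_form hV.2.1 hB hne
  · obtain ⟨B, c, hB, hnd, h⟩ := LightCone.exists_form_of_real ha hV
    exact ⟨⟨B, hB, LightCone.ne_zero_of_nondegenerate hV hnd⟩, B, c, hB, hnd, h⟩
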